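/- Work over $\mathbb Q$. For a regular cell complex $X$ let $A(X)$ be the complete free graded Lie algebra (completed with respect to the number of brackets, in each degree) on one generator of degree $\dim c-1$ for each cell $c$. A \emph{DGLA model} of $X$ is a differential $\partial$ of degree $-1$ on $A(X)$, compatible with the bracket filtration and making $A(X)$ a DGLA, such that every vertex $a$ is a point ($\partial a+\frac12[a,a]=0$), the bracket-free part of $\partial c$ is the geometric boundary $\partial_0c$, and $\partial c$ lies in the Lie algebra generated by the cells of $\bar c$. For a point $x$ put $\partial_x=\partial+\mathrm{ad}_x$; a cell $c$ of dimension $>1$ is \emph{localised at} $x$ if $\partial_xc$ lies in the Lie algebra generated by the closure of $\partial_0c$. For $e$ of degree $0$ put $u_e(a)=e^{-\mathrm{ad}_e}a+\sum_{k\ge0}\frac{(-1)^k}{(k+1)!}\mathrm{ad}_e^k(\partial e)$. For an edge $e$ from $p$ to $q$ "the standard differential" is $\partial e=[e,q]+\sum_{k\ge0}\frac{B_k}{k!}\mathrm{ad}_e^k(q-p)$, where $\frac{x}{e^x-1}=\sum B_k\frac{x^k}{k!}$. $\mathrm{BCH}(\gamma)$ of an edge path is the iterated BCH of its edges, with a minus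 sign on edges traversed backwards; $\exp(e)g$ means $e^{\mathrm{ad}_e}g$. For $n\ge2$ call noncommutative formal power series $P_1,\dots,P_n$ over $\mathbb Q$ in $n-1$ variables \emph{admissible} if they have initial term $1$ and, in the complete free Lie algebra on $x_1,\dots,x_{n-1}$, $$\sum_{i=1}^{n-1}P_i(\mathrm{ad}_{x_1},\dots,\mathrm{ad}_{x_{n-1}})\,x_i=P_n(\mathrm{ad}_{x_1},\dots,\mathrm{ad}_{x_{n-1}})\,\mathrm{BCH}(x_1,\dots,x_{n-1}),$$ and \emph{dihedral} if, with indices mod $n$, $P_{i+1}(x_1,\dots,x_{n-1})=P_i(x_2,\dots,x_{n-1},-\mathrm{BCH}(x_1,\dots,x_{n-1}))$ and $P_{n-i}(x_1,\dots,x_{n-1})=P_i(-x_{n-1},\dots,-x_1)$. Let $X_n$ be the $n$-faceted banana, with vertices $a,b$, edges $e_1,\dots,e_n$ from $a$ to $b$, faces $f'_i$ with $\partial_0f'_i=e_i-e_{i+1}$ (cyclic indices) and a 3-cell $h'$ with $\partial_0h'=\sum f'_i$. \textbf{(1) Polyhedral 3-cells.} Let $X$ be a polyhedral 3-cell with $n$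 faces (a 3-ball whose boundary sphere is a finite regular cell complex), with faces oriented outwards. Let $a,b$ be vertices and let a shelling of the boundary be chosen: $n$ non-self-intersecting edge paths $\gamma_i$ from $a$ to $b$, with $\gamma_i=\alpha_i\cup\delta_i\cup\beta_i$ and $\gamma_{i+1}=\alpha_i\cup\delta_i'\cup\beta_i$ (cyclic indices), such that $\delta_i\cup-\delta_i'$ is the oriented boundary of the $i$-th face $g_i$, each face occurring once. Let $p_i$ be the end of $\alpha_i$. Then admissible $P_1,\dots,P_n$ exist, and for every admissible $P$: (a) There is a unique DGLA model of $X_n$ with the standard differential on edges, $\partial_af'_i=\mathrm{BCH}(e_i,-e_{i+1})$ and $\partial_ah'=\sum_{i=1}^nP_i(\mathrm{ad}_{y_1},\dots,\mathrm{ad}_{y_{n-1}})f'_i$, $y_j=\mathrm{BCH}(e_j,-e_{j+1})$. (b) There is a unique DGLA model of $X$ with the standard differential on edges (so $u_e(p)=q$ for an edge $e$ from $p$ to $q$), $\partial_{p_i}g_i=\mathrm{BCH}(\delta_i,-\delta'_i)$, $g_i$ localised at $p_i$, the 3-cell $h$ localised at $a$, and $$\partial_ah=\sum_{i=1}^nP_i(\mathrm{ad}_{y_1},\dots,\mathrm{ad}_{y_{n-1}})\exp(\mathrm{BCH}(\alpha_i))g_i,\qquad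 y_j=\mathrm{BCH}(\mathrm{BCH}(\gamma_j),-\mathrm{BCH}(\gamma_{j+1})).$$ (c) There is a unique (filtration-preserving) DGLA map from the model (a) to the model (b) with $a\mapsto a$, $b\mapsto b$, $e_i\mapsto\mathrm{BCH}(\gamma_i)$, $f'_i\mapsto\exp(\mathrm{BCH}(\alpha_i))g_i$, $h'\mapsto h$. \textbf{(2) The cube.} A universal average of $n$ elements is a totally symmetric Lie series $\mu_n(x_1,\dots,x_n)$ such that in every complete free DGLA on finitely many homogeneous generators (with filtration-compatible differential), whenever $a,b$ are points and $u_{x_i}(a)=b$ for all $i$, also $u_{\mu_n(x_1,\dots,x_n)}(a)=b$. Put $\mu_2(x,y)=\mathrm{BCH}(x,\frac12\mathrm{BCH}(-x,y))$. Consider the cube $[0,1]^3$ with $a=(0,0,0)$, $b=(1,1,1)$, and every cell oriented by the increasing order of its directions. For a square with minimal vertex $p$ and directions $j<k$, let $\epsilon_1,\epsilon_2$ be the edges of the path from $p$ to the opposite vertex that runs first in direction $j$, and $\epsilon_4,\epsilon_3$ those of the path that runs first in direction $k$; its diagonal is $v_g=\mu_2(\mathrm{BCH}(\epsilon_1,\epsilon_2),\mathrm{BCH}(\epsilon_4,\epsilon_3))$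 and its centre $u_{v_g/2}(p)$. Let $\gamma_1,\dots,\gamma_6$ be the maximal increasing edge paths from $a$ to $b$, with directions $321,231,213,123,132,312$; let $g_i$ be the square between $\gamma_i$ and $\gamma_{i+1}$, $s_i=\pm1$ its coefficient in $\partial_0h$ (so $s=(-,-,-,+,+,+)$), and $\alpha_i$ the common initial segment of $\gamma_i,\gamma_{i+1}$ up to the minimal vertex of $g_i$. For a universal average $\mu_6$ put $v=\mu_6(\mathrm{BCH}(\gamma_1),\dots,\mathrm{BCH}(\gamma_6))$ and let $x=u_{v/2}(a)$ be the centre of the cube. A universal average $\mu_6$ exists, and admissible dihedral $P_1,\dots,P_6$ exist. For all such $\mu_6$, $P$ there is a unique DGLA model of the cube with the standard differential on edges, each square $g$ localised at its centre $x_g$ with $\partial_{x_g}g=\exp(-\frac12v_g)\,\mathrm{BCH}(\epsilon_1,\epsilon_2,-\epsilon_3,-\epsilon_4)$, and the 3-cell $h$ localised at the centre $x$ with $$\partial_xh=\exp(-\tfrac12v)\sum_{i=1}^6P_i(\mathrm{ad}_{y_1},\dots,\mathrm{ad}_{y_5})\,s_i\exp(\mathrm{BCH}(\alpha_i))\exp(\tfrac12v_{g_i})g_i,\qquad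 y_j=\mathrm{BCH}(\mathrm{BCH}(\gamma_j),-\mathrm{BCH}(\gamma_{j+1})).$$ There is a unique (filtration-preserving) DGLA map to it from the model (a) of $X_6$ with $a\mapsto a$, $b\mapsto b$, $e_i\mapsto\mathrm{BCH}(\gamma_i)$, $f'_i\mapsto s_i\exp(\mathrm{BCH}(\alpha_i))\exp(\frac12v_{g_i})g_i$, $h'\mapsto\exp(\frac12v)h$. The model is symmetric under all symmetries of the cube that fix $a$ and $b$: each permutation of the three coordinates, acting on the generators by permuting cells with the sign of its effect on their orientation, extends uniquely to a filtration-preserving DGLA endomorphism of the model. -/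

import Mathlib

/-!
Graded Lie series over `ℚ`.

A noncommutative formal power series in letters `C` is a function from words (lists of letters) to
`ℚ`.  Each letter `c` has a degree `deg c : ℤ`.  The free graded Lie algebra on `C` is the smallest
subspace of the free associative algebra which contains the letters and is closed under the graded
commutator, and its completion with respect to the number of brackets consists of the series all of
whose word-length components lie in it.  A component of word length `m` has `m - 1` brackets.
-/

/-- Noncommutative formal power series over `ℚ` in the letters `C`. -/
def NCSeries (C : Type) : Type := List C → ℚ

namespace NCSeries

variable {C : Type}

instance : AddCommGroup (NCSeries C) := inferInstanceAs (AddCommGroup (List C → ℚ))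
instance : Module ℚ (NCSeries C) := inferInstanceAs (Module ℚ (List C → ℚ))

theorem add_coeff (f g : NCSeries C) (w : List C) : (f + g) w = f w + g w := rfl
theorem smul_coeff (r : ℚ) (f : NCSeries C) (w : List C) : (r • f) w = r * f w := rfl
theorem zero_coeff (w : List C) : (0 : NCSeries C) w = 0 := rfl

theorem sum_coeff {ι : Type} (s : Finset ι) (F : ι → NCSeries C) (w : List C) :
    (∑ i ∈ s, F i) w = ∑ i ∈ s, F i w :=
  Finset.sum_apply (M := fun _ : List C => ℚ) w s F

/-- The product of series (concatenation of words). -/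
def mul (f g : NCSeries C) : NCSeries C := fun w =>
  ∑ k ∈ Finset.range (w.length + 1), f (w.take k) * g (w.drop k)

open Classical in
/-- The series with the single term `1 · w₀`. -/
noncomputable def mono (w₀ : List C) : NCSeries C := fun w => if w = w₀ then 1 else 0

/-- The unit series. -/
noncomputable def one : NCSeries C := mono []

/-- A letter, as a series. -/
noncomputable def letter (c : C) : NCSeries C := mono [c]

/-- The product of a list of series. -/
noncomputable def prod : List (NCSeries C) → NCSeries C
  | [] => one
  | f :: l => mul f (prod l)

/-- Powers of a series. -/
noncomputable def pow (f : NCSeries C) : ℕ → NCSeries C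
  | 0 => one
  | k + 1 => mul f (pow f k)

/-- `exp f = ∑ fᵏ / k!`, for a series `f` without constant term (so that only the `k` up to the
length of a word contribute to its coefficient). -/
noncomputable def exp (f : NCSeries C) : NCSeries C := fun w =>
  ∑ k ∈ Finset.range (w.length + 1), (1 / (k.factorial : ℚ)) * pow f k w

/-- `log g = ∑_{k ≥ 1} (-1)^(k+1) (g - 1)ᵏ / k`, for a series `g` with constant term `1`. -/
noncomputable def log (g : NCSeries C) : NCSeries C := fun w =>
  ∑ k ∈ Finset.Icc 1 w.length, ((-1 : ℚ) ^ (k + 1) / (k : ℚ)) * pow (g - one) k w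

/-- Baker-Campbell-Hausdorff: `exp (bch x y) = exp x · exp y`, for series without constant term. -/
noncomputable def bch (x y : NCSeries C) : NCSeries C := log (mul (exp x) (exp y))

/-- The iterated Baker-Campbell-Hausdorff series of a list (`0` for the empty list). -/
noncomputable def bchList (l : List (NCSeries C)) : NCSeries C := l.foldr bch 0

/-- The average `μ₂(x, y) = BCH(x, ½ BCH(-x, y))` of two elements. -/
noncomputable def mu2 (x y : NCSeries C) : NCSeries C := bch x ((1 / 2 : ℚ) • bch (-x) y)

/-- Substitution of series `x i` without constant term for the letters `i` of `P`. -/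
noncomputable def subst {ι : Type} [Fintype ι] (P : NCSeries ι) (x : ι → NCSeries C) :
    NCSeries C := fun w =>
  ∑ k ∈ Finset.range (w.length + 1), ∑ u : Fin k → ι,
    P (List.ofFn u) * prod ((List.ofFn u).map x) w

/-- The degree of a word. -/
def wdeg (deg : C → ℤ) (w : List C) : ℤ := (w.map deg).sum

theorem wdeg_take_add_drop (deg : C → ℤ) (w : List C) (k : ℕ) :
    wdeg deg (w.take k) + wdeg deg (w.drop k) = wdeg deg w := by
  unfold wdeg
  rw [← List.sum_append, ← List.map_append, List.take_append_drop]

/-- The graded commutator: `[f, g] = f g - (-1)^(|f||g|) g f` for homogeneous `f`, `g`, extended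
bilinearly. -/
noncomputable def bracket (deg : C → ℤ) (f g : NCSeries C) : NCSeries C := fun w =>
  ∑ k ∈ Finset.range (w.length + 1),
    (f (w.take k) * g (w.drop k)
      - (-1 : ℚ) ^ (wdeg deg (w.take k) * wdeg deg (w.drop k)) * (g (w.take k) * f (w.drop k)))

/-- `exp(ad_e) f = ∑ (ad_e)ᵏ f / k!`, for `e` without constant term. -/
noncomputable def expAd (deg : C → ℤ) (e f : NCSeries C) : NCSeries C := fun w =>
  ∑ k ∈ Finset.range (w.length + 1), (1 / (k.factorial : ℚ)) * ((bracket deg e)^[k] f) w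

/-- `P(ad_{y 1}, ad_{y 2}, …) z` for a noncommutative power series `P` and series `y i` without
constant term. -/
noncomputable def actAd {ι : Type} [Fintype ι] (deg : C → ℤ) (P : NCSeries ι)
    (y : ι → NCSeries C) (z : NCSeries C) : NCSeries C := fun w =>
  ∑ k ∈ Finset.range (w.length + 1), ∑ u : Fin k → ι,
    P (List.ofFn u) * ((List.ofFn u).foldr (fun i g => bracket deg (y i) g) z) w

/-- The differential of an edge `e` from `a` to `b`:
`[e, b] + ∑ (Bₖ / k!) (ad_e)ᵏ (b - a)`, where `x / (eˣ - 1) = ∑ Bₖ xᵏ / k!`. -/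
noncomputable def edgeDiff (deg : C → ℤ) (e a b : NCSeries C) : NCSeries C := fun w =>
  bracket deg e b w + ∑ k ∈ Finset.range (w.length + 1),
    (bernoulli k / (k.factorial : ℚ)) * ((bracket deg e)^[k] (b - a)) w

/-- The part of a series in word length `m`. -/
noncomputable def lenPart (m : ℕ) (f : NCSeries C) : NCSeries C := fun w =>
  if w.length = m then f w else 0

/-- The (uncompleted) free graded Lie algebra on the letters in `S`. -/
noncomputable def freeLie (deg : C → ℤ) (S : Set C) : Submodule ℚ (NCSeries C) :=
  sInf {L | (∀ c ∈ S, letter c ∈ L) ∧ ∀ f ∈ L, ∀ g ∈ L, bracket deg f g ∈ L}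

/-- Membership in the completed free graded Lie algebra on the letters in `S`. -/
def IsLieSeries (deg : C → ℤ) (S : Set C) (f : NCSeries C) : Prop :=
  ∀ m, lenPart m f ∈ freeLie deg S

theorem lenPart_add (m : ℕ) (f g : NCSeries C) :
    lenPart m (f + g) = lenPart m f + lenPart m g := by
  funext w
  simp only [lenPart, add_coeff]
  split_ifs <;> simp

theorem lenPart_smul (m : ℕ) (r : ℚ) (f : NCSeries C) :
    lenPart m (r • f) = r • lenPart m f := by
  funext w
  simp only [lenPart, smul_coeff]
  split_ifs <;> simp

theorem lenPart_zero (m : ℕ) : lenPart m (0 : NCSeries C) = 0 := by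
  funext w
  simp [lenPart, zero_coeff]

theorem letter_mem_freeLie (deg : C → ℤ) {S : Set C} {c : C} (hc : c ∈ S) :
    letter c ∈ freeLie deg S := by
  rw [freeLie, Submodule.mem_sInf]
  exact fun L hL => hL.1 c hc

theorem bracket_mem_freeLie (deg : C → ℤ) {S : Set C} {f g : NCSeries C}
    (hf : f ∈ freeLie deg S) (hg : g ∈ freeLie deg S) : bracket deg f g ∈ freeLie deg S := by
  rw [freeLie, Submodule.mem_sInf] at *
  exact fun L hL => hL.2 f (hf L hL) g (hg L hL)

theorem lenPart_bracket (deg : C → ℤ) (m : ℕ) (f g : NCSeries C) :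
    lenPart m (bracket deg f g)
      = ∑ i ∈ Finset.range (m + 1), bracket deg (lenPart i f) (lenPart (m - i) g) := by
  funext w
  rw [sum_coeff]
  simp only [lenPart, bracket]
  by_cases hw : w.length = m
  · rw [if_pos hw, Finset.sum_comm]
    refine Finset.sum_congr rfl fun k hk => ?_
    have hk' : k ≤ m := by rw [Finset.mem_range] at hk; omega
    have h1 : (w.take k).length = k := by rw [List.length_take]; omega
    have h2 : (w.drop k).length = m - k := by rw [List.length_drop]; omega
    rw [Finset.sum_sub_distrib]
    congr 1
    · rw [Finset.sum_eq_single k]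
      · simp [h1, h2]
      · intro i _ hik
        simp [h1, Ne.symm hik]
      · intro h; exact absurd (Finset.mem_range.2 (by omega)) h
    · rw [Finset.sum_eq_single (m - k)]
      · rw [h1, h2, if_pos (by omega), if_pos rfl]
      · intro i hi hik
        rw [Finset.mem_range] at hi
        rw [h1, h2, if_neg (by omega)]
        simp
      · intro h; exact absurd (Finset.mem_range.2 (by omega)) h
  · rw [if_neg hw]
    symm
    refine Finset.sum_eq_zero fun i hi => Finset.sum_eq_zero fun k hk => ?_
    rw [Finset.mem_range] at hi hk
    have h1 : (w.take k).length = k := by rw [List.length_take]; omega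
    have h2 : (w.drop k).length = w.length - k := by rw [List.length_drop]
    rw [h1, h2]
    split_ifs <;> first | omega | simp

/-- The complete free graded Lie algebra on all letters: the direct sum over the degrees `n ∈ ℤ` of
the spaces of Lie series that are homogeneous of degree `n`. -/
noncomputable def lieAlg (deg : C → ℤ) : Submodule ℚ (NCSeries C) where
  carrier := {f | IsLieSeries deg Set.univ f ∧ ∃ N : ℕ, ∀ w, f w ≠ 0 → |wdeg deg w| ≤ N}
  zero_mem' := by
    refine ⟨fun m => ?_, 0, fun w hw => absurd (zero_coeff w) hw⟩
    rw [lenPart_zero]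
    exact zero_mem _
  add_mem' := by
    rintro f g ⟨hf, N, hN⟩ ⟨hg, M, hM⟩
    refine ⟨fun m => ?_, N + M, fun w hw => ?_⟩
    · rw [lenPart_add]
      exact add_mem (hf m) (hg m)
    · rw [add_coeff] at hw
      push_cast
      by_cases h : f w = 0
      · have h' : g w ≠ 0 := by
          intro h'
          exact hw (by rw [h, h', add_zero])
        have := hM w h'
        omega
      · have := hN w h
        omega
  smul_mem' := by
    rintro r f ⟨hf, N, hN⟩
    refine ⟨fun m => ?_, N, fun w hw => hN w ?_⟩
    · rw [lenPart_smul]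
      exact Submodule.smul_mem _ _ (hf m)
    · intro h
      exact hw (by rw [smul_coeff, h, mul_zero])

theorem bracket_mem_lieAlg (deg : C → ℤ) {f g : NCSeries C}
    (hf : f ∈ lieAlg deg) (hg : g ∈ lieAlg deg) : bracket deg f g ∈ lieAlg deg := by
  obtain ⟨hf, N, hN⟩ := hf
  obtain ⟨hg, M, hM⟩ := hg
  refine ⟨fun m => ?_, N + M, fun w hw => ?_⟩
  · rw [lenPart_bracket]
    exact Submodule.sum_mem _ fun i _ => bracket_mem_freeLie deg (hf i) (hg _)
  · obtain ⟨k, -, hk⟩ := Finset.exists_ne_zero_of_sum_ne_zero hw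
    have hd := wdeg_take_add_drop deg w k
    push_cast
    rw [← hd]
    by_cases h1 : f (w.take k) * g (w.drop k) = 0
    · have h2 : g (w.take k) * f (w.drop k) ≠ 0 := by
        intro h2
        exact hk (by rw [h1, h2, mul_zero, sub_zero])
      have ha := hM _ (left_ne_zero_of_mul h2)
      have hb := hN _ (right_ne_zero_of_mul h2)
      exact (abs_add_le _ _).trans (by omega)
    · have ha := hN _ (left_ne_zero_of_mul h1)
      have hb := hM _ (right_ne_zero_of_mul h1)
      exact (abs_add_le _ _).trans (by omega)

theorem letter_mem_lieAlg (deg : C → ℤ) (c : C) : letter c ∈ lieAlg deg := by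
  refine ⟨fun m => ?_, (deg c).natAbs, fun w hw => ?_⟩
  · by_cases hm : m = 1
    · have : lenPart m (letter c) = letter c := by
        funext w
        simp only [lenPart, letter, mono]
        split_ifs with h1 h2 h2 <;> simp_all
      rw [this]
      exact letter_mem_freeLie deg (Set.mem_univ c)
    · have : lenPart m (letter c) = 0 := by
        funext w
        rw [zero_coeff]
        simp only [lenPart, letter, mono]
        split_ifs with h1 h2
        · rw [h2] at h1
          exact absurd h1.symm (by simpa using hm)
        · rfl
        · rfl
      rw [this]
      exact zero_mem _
  · have h : w = [c] := by
      by_contra h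
      exact hw (by simp [letter, mono, h])
    rw [h]
    simp [wdeg]

/-- The bracket of the complete free graded Lie algebra. -/
noncomputable def lieBr (deg : C → ℤ) :
    lieAlg deg →ₗ[ℚ] lieAlg deg →ₗ[ℚ] lieAlg deg :=
  LinearMap.mk₂ ℚ (fun f g => ⟨bracket deg f g, bracket_mem_lieAlg deg f.2 g.2⟩)
    (by
      intro f f' g
      apply Subtype.ext
      funext w
      simp only [bracket, Submodule.coe_add, add_coeff]
      rw [← Finset.sum_add_distrib]
      exact Finset.sum_congr rfl fun k _ => by ring)
    (by
      intro r f g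
      apply Subtype.ext
      funext w
      simp only [bracket, Submodule.coe_smul, smul_coeff]
      rw [Finset.mul_sum]
      exact Finset.sum_congr rfl fun k _ => by ring)
    (by
      intro f g g'
      apply Subtype.ext
      funext w
      simp only [bracket, Submodule.coe_add, add_coeff]
      rw [← Finset.sum_add_distrib]
      exact Finset.sum_congr rfl fun k _ => by ring)
    (by
      intro r f g
      apply Subtype.ext
      funext w
      simp only [bracket, Submodule.coe_smul, smul_coeff]
      rw [Finset.mul_sum]
      exact Finset.sum_congr rfl fun k _ => by ring)

/-- A letter as a generator of the complete free graded Lie algebra. -/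
noncomputable def gen (deg : C → ℤ) (c : C) : lieAlg deg := ⟨letter c, letter_mem_lieAlg deg c⟩

/-- The homogeneous elements of degree `n`. -/
def gr (deg : C → ℤ) (n : ℤ) : Submodule ℚ (lieAlg deg) where
  carrier := {f | ∀ w, (f : NCSeries C) w ≠ 0 → wdeg deg w = n}
  zero_mem' := fun w hw => absurd (zero_coeff w) hw
  add_mem' := by
    intro f g hf hg w hw
    by_cases h : (f : NCSeries C) w = 0
    · refine hg w fun h' => hw ?_
      rw [Submodule.coe_add, add_coeff, h, h', add_zero]
    · exact hf w h
  smul_mem' := by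
    intro r f hf w hw
    refine hf w fun h => hw ?_
    rw [Submodule.coe_smul, smul_coeff, h, mul_zero]

/-- Elements with no term of word length less than `m`; these form the filtration that defines the
topology. -/
def InFil (deg : C → ℤ) (m : ℕ) (f : lieAlg deg) : Prop :=
  ∀ w : List C, w.length < m → (f : NCSeries C) w = 0

end NCSeries

open NCSeries

/-- Differential graded Lie algebras over `ℚ`, with a differential of degree `-1`. -/
structure IsDGLA {A : Type} [AddCommGroup A] [Module ℚ A] (grade : ℤ → Submodule ℚ A)
    (br : A →ₗ[ℚ] A →ₗ[ℚ] A) (d : A →ₗ[ℚ] A) : Prop where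
  internal : DirectSum.IsInternal grade
  br_mem : ∀ p q x y, x ∈ grade p → y ∈ grade q → br x y ∈ grade (p + q)
  d_mem : ∀ p x, x ∈ grade p → d x ∈ grade (p - 1)
  d_sq : ∀ x, d (d x) = 0
  symm : ∀ p q x y, x ∈ grade p → y ∈ grade q → br y x = -((-1 : ℚ) ^ (p * q) • br x y)
  jacobi : ∀ p q r x y z, x ∈ grade p → y ∈ grade q → z ∈ grade r →
    (-1 : ℚ) ^ (p * q) • br (br y z) x + (-1 : ℚ) ^ (q * r) • br (br z x) y
      + (-1 : ℚ) ^ (r * p) • br (br x y) z = 0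
  leibniz : ∀ p q x y, x ∈ grade p → y ∈ grade q →
    d (br x y) = br (d x) y + (-1 : ℚ) ^ p • br x (d y)

section DGLA

variable {C : Type} {deg : C → ℤ}

/-- A differential on the complete free graded Lie algebra: it makes it a DGLA and is compatible
with the filtration by word length. -/
structure IsDifferential (d : lieAlg deg →ₗ[ℚ] lieAlg deg) : Prop where
  dgla : IsDGLA (gr deg) (lieBr deg) d
  cont : ∀ m f, InFil deg m f → InFil deg m (d f)

/-- A point: a solution in degree `-1` of the Maurer-Cartan equation `∂a + ½[a, a] = 0`. -/
def IsPoint (d : lieAlg deg →ₗ[ℚ] lieAlg deg) (a : lieAlg deg) : Prop :=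
  a ∈ gr deg (-1) ∧ d a + (1 / 2 : ℚ) • lieBr deg a a = 0

/-- The twisted differential `∂ₐ f = ∂f + [a, f]`. -/
noncomputable def twisted (d : lieAlg deg →ₗ[ℚ] lieAlg deg) (a f : lieAlg deg) : lieAlg deg :=
  d f + lieBr deg a f

/-- `u_e(a) = exp(-ad_e) a + ∑ ((-1)ᵏ / (k+1)!) (ad_e)ᵏ (∂e)`, the result of flowing by `e` from `a`
for unit time. -/
noncomputable def flow (d : lieAlg deg →ₗ[ℚ] lieAlg deg) (e a : lieAlg deg) : NCSeries C := fun w =>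
  expAd deg (-(e : NCSeries C)) a w + ∑ k ∈ Finset.range (w.length + 1),
    ((-1 : ℚ) ^ k / ((k + 1).factorial : ℚ)) * ((bracket deg (e : NCSeries C))^[k] (d e)) w

/-- DGLA homomorphisms between complete free DGLAs. -/
structure IsDGLAHom {C' : Type} {deg' : C' → ℤ} (d : lieAlg deg →ₗ[ℚ] lieAlg deg)
    (d' : lieAlg deg' →ₗ[ℚ] lieAlg deg') (φ : lieAlg deg →ₗ[ℚ] lieAlg deg') : Prop where
  map_gr : ∀ n f, f ∈ gr deg n → φ f ∈ gr deg' n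
  map_br : ∀ f g, φ (lieBr deg f g) = lieBr deg' (φ f) (φ g)
  map_d : ∀ f, φ (d f) = d' (φ f)
  cont : ∀ m f, InFil deg m f → InFil deg' m (φ f)

end DGLA

/-- Universal averages of `n` elements: totally symmetric Lie series `μ(x₁, …, xₙ)` such that, in
every complete free DGLA, if all the `xᵢ` flow from the point `a` to the point `b` in unit time,
then so does `μ(x₁, …, xₙ)`. -/
structure IsUniversalAverage (n : ℕ) (μ : NCSeries (Fin n)) : Prop where
  lie : IsLieSeries (fun _ => 0) Set.univ μ
  symm : ∀ (π : Equiv.Perm (Fin n)) (w : List (Fin n)), μ (w.map π) = μ w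
  average : ∀ (C : Type) [Finite C] (deg : C → ℤ) (d : lieAlg deg →ₗ[ℚ] lieAlg deg),
    IsDifferential d → ∀ a b : lieAlg deg, IsPoint d a → IsPoint d b →
    ∀ x : Fin n → lieAlg deg, (∀ i, x i ∈ gr deg 0) → (∀ i, flow d (x i) a = b) →
    ∃ z : lieAlg deg, (z : NCSeries C) = subst μ (fun i => (x i : NCSeries C)) ∧ flow d z a = b

/-! Cell complexes and their models. -/

/-- The combinatorial data of a regular cell complex with oriented cells: the cells, their
dimensions, the incidence numbers `inc c c'` (the coefficient of `c'` in the geometric boundary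
`∂₀ c`), and the set of cells in the closure of a cell. -/
structure CellData where
  Cell : Type
  dim : Cell → ℕ
  inc : Cell → Cell → ℤ
  cl : Cell → Set Cell

namespace CellData

/-- The generator of a cell has degree one less than the dimension of the cell. -/
def deg (X : CellData) (c : X.Cell) : ℤ := (X.dim c : ℤ) - 1

/-- The graded Lie algebra `A(X)`, freely generated by the cells. -/
noncomputable abbrev Alg (X : CellData) : Submodule ℚ (NCSeries X.Cell) := lieAlg X.deg

/-- DGLA models of a cell complex. -/
structure IsModel (X : CellData) (d : X.Alg →ₗ[ℚ] X.Alg) : Prop where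
  differential : IsDifferential d
  flat : ∀ c, X.dim c = 0 → IsPoint d (gen X.deg c)
  linear_part : ∀ c c', (d (gen X.deg c) : NCSeries X.Cell) [c'] = (X.inc c c' : ℚ)
  locality : ∀ c, IsLieSeries X.deg (X.cl c) (d (gen X.deg c) : NCSeries X.Cell)

/-- The cell `c` is localised at the point `x`: `∂ₓ c` lies in the Lie algebra generated by the
closure of the geometric boundary of `c`. -/
def IsLocalisedAt (X : CellData) (d : X.Alg →ₗ[ℚ] X.Alg) (c : X.Cell) (x : X.Alg) : Prop :=
  IsPoint d x ∧ IsLieSeries X.deg {z | ∃ y, X.inc c y ≠ 0 ∧ z ∈ X.cl y}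
    (twisted d x (gen X.deg c) : NCSeries X.Cell)

end CellData

/-! Polyhedral 3-cells. -/

/-- The dart (oriented edge) `(e, true)` is `e` with its orientation, `(e, false)` is `e` reversed.
This is the initial vertex of a dart. -/
def dartStart {V E : Type} (src tgt : E → V) (x : E × Bool) : V :=
  if x.2 then src x.1 else tgt x.1

/-- Reversal of darts. -/
def dartFlip {E : Type} : Equiv.Perm (E × Bool) := Equiv.prodCongr (Equiv.refl E) Equiv.boolNot

/-- A polyhedral 3-cell: a 3-ball whose boundary sphere is a regular cell complex, given as a
combinatorial map of genus zero.  `left x` is the face whose outward-oriented boundary runs through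
the dart `x`, and `next x` is the dart that follows `x` on the boundary of that face. -/
structure PolyhedralCell where
  V : Type
  E : Type
  F : Type
  finV : Finite V
  finE : Finite E
  finF : Finite F
  src : E → V
  tgt : E → V
  next : Equiv.Perm (E × Bool)
  left : E × Bool → F
  src_ne_tgt : ∀ e, src e ≠ tgt e
  start_next : ∀ x, dartStart src tgt (next x) = dartStart src tgt (dartFlip x)
  left_surjective : Function.Surjective left
  left_eq_iff : ∀ x y, left x = left y ↔ next.SameCycle x y
  /-- The boundary of a face is a simple closed curve. -/
  left_simple : ∀ x y, left x = left y → dartStart src tgt x = dartStart src tgt y → x = y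
  left_flip : ∀ x, left (dartFlip x) ≠ left x
  start_surjective : Function.Surjective (dartStart src tgt)
  /-- The faces around a vertex form a single cycle. -/
  star_cycle : ∀ x y, dartStart src tgt x = dartStart src tgt y →
    (next * dartFlip).SameCycle x y
  connected : ∀ u v, Relation.EqvGen (fun x y => ∃ e, src e = x ∧ tgt e = y) u v
  euler : Nat.card V + Nat.card F = Nat.card E + 2

namespace PolyhedralCell

/-- The cells of a polyhedral 3-cell: vertices, edges, faces, and the 3-cell itself. -/
inductive Cell (X : PolyhedralCell) : Type
  | vert : X.V → Cell X
  | edge : X.E → Cell X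
  | face : X.F → Cell X
  | top : Cell X

variable (X : PolyhedralCell)

/-- Initial vertex of a dart. -/
def start (x : X.E × Bool) : X.V := dartStart X.src X.tgt x

/-- Final vertex of a dart. -/
def fin (x : X.E × Bool) : X.V := dartStart X.src X.tgt (dartFlip x)

open Classical in
/-- The cell complex of a polyhedral 3-cell, with all faces oriented outwards. -/
noncomputable def cells : CellData where
  Cell := Cell X
  dim
    | .vert _ => 0
    | .edge _ => 1
    | .face _ => 2
    | .top => 3
  inc
    | .edge e, .vert v => (if X.tgt e = v then 1 else 0) - (if X.src e = v then 1 else 0)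
    | .face f, .edge e =>
      (if X.left (e, true) = f then 1 else 0) - (if X.left (e, false) = f then 1 else 0)
    | .top, .face _ => 1
    | _, _ => 0
  cl
    | .vert v => {.vert v}
    | .edge e => {.edge e, .vert (X.src e), .vert (X.tgt e)}
    | .face f => {c | c = .face f ∨
        ∃ x, X.left x = f ∧ (c = .edge x.1 ∨ c = .vert (X.start x))}
    | .top => Set.univ

/-- `l` is a walk along edges from `u` to `v`. -/
def IsWalk : X.V → List (X.E × Bool) → X.V → Prop
  | u, [], v => u = v
  | u, x :: l, v => X.start x = u ∧ IsWalk (X.fin x) l v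

/-- The walk with the opposite direction. -/
def reverse (l : List (X.E × Bool)) : List (X.E × Bool) := (l.map dartFlip).reverse

/-- A shelling of the boundary of a polyhedral 3-cell with `m + 1` faces: a cyclic sequence of
non-self-intersecting paths `γ i` along edges from `a` to `b`, such that `γ i = α i ∪ δ i ∪ β i`,
`γ (i + 1) = α i ∪ δ' i ∪ β i`, and `δ i` followed by the reverse of `δ' i` is the boundary of the
`i`-th face. Here `p i` is the common initial vertex of `δ i` and `δ' i`. -/
structure Shelling (m : ℕ) (a b : X.V) where
  face : Fin (m + 1) ≃ X.F
  γ : Fin (m + 1) → List (X.E × Bool)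
  α : Fin (m + 1) → List (X.E × Bool)
  δ : Fin (m + 1) → List (X.E × Bool)
  δ' : Fin (m + 1) → List (X.E × Bool)
  β : Fin (m + 1) → List (X.E × Bool)
  p : Fin (m + 1) → X.V
  walk : ∀ i, X.IsWalk a (γ i) b
  simple : ∀ i, (a :: (γ i).map X.fin).Nodup
  γ_eq : ∀ i, γ i = α i ++ δ i ++ β i
  γ_succ_eq : ∀ i, γ (i + 1) = α i ++ δ' i ++ β i
  walk_α : ∀ i, X.IsWalk a (α i) (p i)
  boundary_nodup : ∀ i, (δ i ++ X.reverse (δ' i)).Nodup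
  boundary : ∀ i x, x ∈ δ i ++ X.reverse (δ' i) ↔ X.left x = face i

/-- A cell as a generator of the model. -/
noncomputable def cellGen (c : Cell X) : X.cells.Alg := gen X.cells.deg c

/-- A cell as a series. -/
noncomputable def ser (c : Cell X) : NCSeries X.cells.Cell := letter (C := X.cells.Cell) c

/-- `BCH` of a path: the iterated BCH of its edges, with a sign for edges traversed backwards. -/
noncomputable def pathBCH (l : List (X.E × Bool)) : NCSeries X.cells.Cell :=
  bchList (l.map fun x => if x.2 then X.ser (.edge x.1) else -X.ser (.edge x.1))

end PolyhedralCell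

/-! The banana 3-cell. -/

/-- The cells of the `n`-faceted banana. -/
inductive BananaCell (n : ℕ) : Type
  | a : BananaCell n
  | b : BananaCell n
  | e : Fin n → BananaCell n
  | f : Fin n → BananaCell n
  | h : BananaCell n

/-- The cell complex of the `(m + 1)`-faceted banana: `∂₀ eᵢ = b - a`, `∂₀ fᵢ = eᵢ - eᵢ₊₁` (with
cyclic indices) and `∂₀ h = ∑ fᵢ`. -/
def banana (m : ℕ) : CellData where
  Cell := BananaCell (m + 1)
  dim
    | .a => 0
    | .b => 0
    | .e _ => 1
    | .f _ => 2
    | .h => 3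
  inc
    | .e _, .a => -1
    | .e _, .b => 1
    | .f i, .e j => (if j = i then 1 else 0) - (if j = i + 1 then 1 else 0)
    | .h, .f _ => 1
    | _, _ => 0
  cl
    | .a => {.a}
    | .b => {.b}
    | .e i => {.e i, .a, .b}
    | .f i => {.f i, .e i, .e (i + 1), .a, .b}
    | .h => Set.univ

/-- A cell of the banana as a generator. -/
noncomputable def bGen {m : ℕ} (c : BananaCell (m + 1)) : (banana m).Alg := gen (banana m).deg c

/-- A cell of the banana as a series. -/
noncomputable def bSer {m : ℕ} (c : BananaCell (m + 1)) : NCSeries (banana m).Cell :=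
  letter (C := (banana m).Cell) c

/-- Noncommutative power series `P₁, …, Pₙ` in `n - 1` variables, `n = m + 1`, with initial term `1`
and `∑_{i<n} Pᵢ(ad_{x₁}, …, ad_{xₙ₋₁}) xᵢ = Pₙ(ad_{x₁}, …, ad_{xₙ₋₁}) BCH(x₁, …, xₙ₋₁)` in the
complete free Lie algebra on `x₁, …, xₙ₋₁`. -/
def IsAdmissible (m : ℕ) (P : Fin (m + 1) → NCSeries (Fin m)) : Prop :=
  (∀ i, P i [] = 1) ∧
  ∑ j : Fin m, actAd (fun _ => 0) (P j.castSucc) letter (letter j)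
    = actAd (fun _ => 0) (P (Fin.last m)) letter (bchList (List.ofFn fun j : Fin m => letter j))

/-- The dihedral invariance of a family `P₁, …, Pₙ`, `n = m + 1`, with cyclic indices:
`Pᵢ₊₁(x₁, …, xₙ₋₁) = Pᵢ(x₂, …, xₙ₋₁, -BCH(x₁, …, xₙ₋₁))` and
`Pₙ₋ᵢ(x₁, …, xₙ₋₁) = Pᵢ(-xₙ₋₁, …, -x₁)`.  The index `i : Fin n` stands for `i + 1`. -/
def IsDihedral (m : ℕ) (P : Fin (m + 1) → NCSeries (Fin m)) : Prop :=
  (∀ i, P (i + 1) = subst (P i) fun j : Fin m =>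
    if hj : (j : ℕ) + 1 < m then letter ⟨j + 1, hj⟩
    else -bchList (List.ofFn fun k : Fin m => letter k)) ∧
  (∀ i, P (-(i + 1) - 1) = subst (P i) fun j : Fin m => -letter j.rev)

/-- The model of the banana with generators `a, b, eᵢ, fᵢ, h`, in which all `fᵢ` and `h` are
localised at `a`, that is given by the series `Pᵢ`. -/
structure IsBananaModel (m : ℕ) (P : Fin (m + 1) → NCSeries (Fin m))
    (d : (banana m).Alg →ₗ[ℚ] (banana m).Alg) : Prop where
  model : (banana m).IsModel d
  d_edge : ∀ i, (d (bGen (.e i)) : NCSeries _)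
    = edgeDiff (banana m).deg (bSer (.e i)) (bSer .a) (bSer .b)
  d_face : ∀ i, (twisted d (bGen .a) (bGen (.f i)) : NCSeries _)
    = bch (bSer (.e i)) (-bSer (.e (i + 1)))
  d_top : (twisted d (bGen .a) (bGen .h) : NCSeries _)
    = ∑ i, actAd (banana m).deg (P i)
        (fun j : Fin m => bch (bSer (.e j.castSucc)) (-bSer (.e j.succ))) (bSer (.f i))

namespace PolyhedralCell

variable {X : PolyhedralCell} {m : ℕ} {a b : X.V}

/-- The model of a polyhedral 3-cell induced by a shelling and the series `Pᵢ`: the `i`-th face is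
localised at `p i` and the 3-cell at `a`. -/
structure Shelling.IsInducedModel (S : X.Shelling m a b) (P : Fin (m + 1) → NCSeries (Fin m))
    (d : X.cells.Alg →ₗ[ℚ] X.cells.Alg) : Prop where
  model : X.cells.IsModel d
  d_edge : ∀ e, (d (X.cellGen (.edge e)) : NCSeries _)
    = edgeDiff X.cells.deg (X.ser (.edge e)) (X.ser (.vert (X.src e))) (X.ser (.vert (X.tgt e)))
  flow_edge : ∀ e, flow d (X.cellGen (.edge e)) (X.cellGen (.vert (X.src e)))
    = X.ser (.vert (X.tgt e))
  d_face : ∀ i, (twisted d (X.cellGen (.vert (S.p i))) (X.cellGen (.face (S.face i))) : NCSeries _)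
    = X.pathBCH (S.δ i ++ X.reverse (S.δ' i))
  face_localised : ∀ i, X.cells.IsLocalisedAt d (.face (S.face i)) (X.cellGen (.vert (S.p i)))
  d_top : (twisted d (X.cellGen (.vert a)) (X.cellGen .top) : NCSeries _)
    = ∑ i, actAd X.cells.deg (P i)
        (fun j : Fin m => bch (X.pathBCH (S.γ j.castSucc)) (-X.pathBCH (S.γ j.succ)))
        (expAd X.cells.deg (X.pathBCH (S.α i)) (X.ser (.face (S.face i))))
  top_localised : X.cells.IsLocalisedAt d .top (X.cellGen (.vert a))

/-- The values on generators of the map from the model of the banana. -/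
structure Shelling.IsInducedMap (S : X.Shelling m a b) (φ : (banana m).Alg →ₗ[ℚ] X.cells.Alg) :
    Prop where
  map_a : φ (bGen .a) = X.cellGen (.vert a)
  map_b : φ (bGen .b) = X.cellGen (.vert b)
  map_e : ∀ i, (φ (bGen (.e i)) : NCSeries _) = X.pathBCH (S.γ i)
  map_f : ∀ i, (φ (bGen (.f i)) : NCSeries _)
    = expAd X.cells.deg (X.pathBCH (S.α i)) (X.ser (.face (S.face i)))
  map_h : φ (bGen .h) = X.cellGen .top

end PolyhedralCell

/-! The cube `[0,1]³`. -/

/-- A cell of the cube: in each direction either one of the two ends or the whole interval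
(`none`). -/
abbrev CubeCell : Type := Fin 3 → Option Bool

/-- Restriction of a cell to one end in direction `i`. -/
def CubeCell.set (c : CubeCell) (i : Fin 3) (s : Bool) : CubeCell := Function.update c i (some s)

/-- The cell complex of the cube, each cell oriented by the increasing order of its directions. -/
def cube : CellData where
  Cell := CubeCell
  dim c := (Finset.univ.filter fun i => c i = none).card
  inc c c' := ∑ i : Fin 3, ∑ s : Bool,
    if c i = none ∧ c' = c.set i s then
      (-1) ^ (Finset.univ.filter fun j => j < i ∧ c j = none).card * (if s then 1 else -1)
    else 0
  cl c := {c' | ∀ i, c i = none ∨ c' i = c i}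

namespace Cube

/-- A cell of the cube as a generator. -/
noncomputable def cGen (c : CubeCell) : cube.Alg := gen cube.deg c

/-- A cell of the cube as a series. -/
noncomputable def cSer (c : CubeCell) : NCSeries cube.Cell := letter (C := cube.Cell) c

/-- The vertex `(0,0,0)`, one end `a` of the main diagonal. -/
def vertA : CubeCell := fun _ => some false

/-- The vertex `(1,1,1)`, the other end `b` of the main diagonal. -/
def vertB : CubeCell := fun _ => some true

/-- The 3-cell. -/
def top : CubeCell := fun _ => none

/-- `BCH` of the path on the boundary of the square `g` with directions `j`, `k`, from its minimal
to its maximal vertex, that runs first in direction `j` and then in direction `k`. -/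
noncomputable def squarePath (g : CubeCell) (j k : Fin 3) : NCSeries cube.Cell :=
  bch (cSer (g.set k false)) (cSer (g.set j true))

/-- The centre diagonal of the square `g` with directions `j`, `k`. -/
noncomputable def squareDiag (g : CubeCell) (j k : Fin 3) : NCSeries cube.Cell :=
  mu2 (squarePath g j k) (squarePath g k j)

/-- The minimal vertex of the square `g` with directions `j`, `k`. -/
def squareMin (g : CubeCell) (j k : Fin 3) : CubeCell := (g.set j false).set k false

/-- The directions of the six maximal chains of edges from `a` to `b`, in cyclic order. -/
def chainDir : Fin 6 → Fin 3 → Fin 3 :=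
  ![![2, 1, 0], ![1, 2, 0], ![1, 0, 2], ![0, 1, 2], ![0, 2, 1], ![2, 0, 1]]

/-- The `t`-th edge of the `i`-th chain. -/
def chainEdge (i : Fin 6) (t : Fin 3) : CubeCell := fun r =>
  if r = chainDir i t then none
  else if ∃ s, s < t ∧ chainDir i s = r then some true else some false

/-- `BCH` of the `i`-th chain. -/
noncomputable def chainBCH (i : Fin 6) : NCSeries cube.Cell :=
  bchList [cSer (chainEdge i 0), cSer (chainEdge i 1), cSer (chainEdge i 2)]

/-- The face between the `i`-th and the next chain lies in the plane where the coordinate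
`faceDir i` has the value `faceEnd i`, ... -/
def faceDir : Fin 6 → Fin 3 := ![0, 1, 2, 0, 1, 2]

/-- ... where `true` stands for `1` and `false` for `0`. -/
def faceEnd : Fin 6 → Bool := ![false, true, false, true, false, true]

/-- The face between the `i`-th and the next chain. -/
def chainFace (i : Fin 6) : CubeCell := fun r =>
  if r = faceDir i then some (faceEnd i) else none

/-- The sign of that face in the geometric boundary of the 3-cell. -/
def faceSign : Fin 6 → ℚ := ![-1, -1, -1, 1, 1, 1]

/-- The first direction of that face. -/
def faceFst : Fin 6 → Fin 3 := ![1, 0, 0, 1, 0, 0]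

/-- The second direction of that face. -/
def faceSnd : Fin 6 → Fin 3 := ![2, 2, 1, 2, 2, 1]

/-- `BCH` of the common initial segment of the `i`-th and the next chain, which leads from `a` to
the minimal vertex of the face between them; it is empty if that face contains `a`. -/
noncomputable def initialBCH (i : Fin 6) : NCSeries cube.Cell :=
  if faceEnd i then cSer (chainEdge i 0) else 0

/-- The face between the `i`-th and the next chain, with outward orientation and moved so that it
is localised at `a`. -/
noncomputable def movedFace (i : Fin 6) : NCSeries cube.Cell :=
  faceSign i • expAd cube.deg (initialBCH i)
    (expAd cube.deg ((1 / 2 : ℚ) • squareDiag (chainFace i) (faceFst i) (faceSnd i))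
      (cSer (chainFace i)))

/-- The main diagonal: the average of the six chains. -/
noncomputable def mainDiag (μ : NCSeries (Fin 6)) : NCSeries cube.Cell := subst μ chainBCH

/-- The model of the cube in which each face is localised at its centre, half way along its centre
diagonal, and the 3-cell at its centre, half way along the main diagonal. -/
structure IsCubeModel (μ : NCSeries (Fin 6)) (P : Fin 6 → NCSeries (Fin 5))
    (d : cube.Alg →ₗ[ℚ] cube.Alg) : Prop where
  model : cube.IsModel d
  d_edge : ∀ (c : CubeCell) (i : Fin 3), cube.dim c = 1 → c i = none →
    (d (cGen c) : NCSeries _)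
      = edgeDiff cube.deg (cSer c) (cSer (c.set i false)) (cSer (c.set i true))
  flow_edge : ∀ (c : CubeCell) (i : Fin 3), cube.dim c = 1 → c i = none →
    flow d (cGen c) (cGen (c.set i false)) = cSer (c.set i true)
  d_face : ∀ (g : CubeCell) (j k : Fin 3), cube.dim g = 2 → j < k → g j = none → g k = none →
    ∃ v x : cube.Alg, (v : NCSeries _) = squareDiag g j k ∧
      (x : NCSeries _) = flow d ((1 / 2 : ℚ) • v) (cGen (squareMin g j k)) ∧
      (twisted d x (cGen g) : NCSeries _)
        = expAd cube.deg (-(1 / 2 : ℚ) • squareDiag g j k)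
            (bchList [cSer (g.set k false), cSer (g.set j true),
              -cSer (g.set k true), -cSer (g.set j false)]) ∧
      cube.IsLocalisedAt d g x
  d_top : ∃ v x : cube.Alg, (v : NCSeries _) = mainDiag μ ∧
      (x : NCSeries _) = flow d ((1 / 2 : ℚ) • v) (cGen vertA) ∧
      (twisted d x (cGen top) : NCSeries _)
        = expAd cube.deg (-(1 / 2 : ℚ) • mainDiag μ)
            (∑ i : Fin 6, actAd cube.deg (P i)
              (fun j : Fin 5 => bch (chainBCH j.castSucc) (-chainBCH j.succ)) (movedFace i)) ∧
      cube.IsLocalisedAt d top x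

/-- The values on generators of the map from the model of the 6-faceted banana. -/
structure IsInducedMap (μ : NCSeries (Fin 6)) (φ : (banana 5).Alg →ₗ[ℚ] cube.Alg) : Prop where
  map_a : φ (bGen .a) = cGen vertA
  map_b : φ (bGen .b) = cGen vertB
  map_e : ∀ i, (φ (bGen (.e i)) : NCSeries _) = chainBCH i
  map_f : ∀ i, (φ (bGen (.f i)) : NCSeries _) = movedFace i
  map_h : (φ (bGen .h) : NCSeries _) = expAd cube.deg ((1 / 2 : ℚ) • mainDiag μ) (cSer top)

/-- The action of a permutation of the three directions on cells.  These are the symmetries of the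
cube that fix both ends of the main diagonal. -/
def permCell (π : Equiv.Perm (Fin 3)) (c : CubeCell) : CubeCell := fun i => c (π.symm i)

/-- The sign by which `π` changes the orientation of a cell: that of the induced permutation of the
directions of the cell. -/
def permSign (π : Equiv.Perm (Fin 3)) (c : CubeCell) : ℚ :=
  ∏ i : Fin 3, ∏ j : Fin 3, if i < j ∧ c i = none ∧ c j = none ∧ π j < π i then -1 else 1

end Cube

/-! Everything takes place inside algebras of noncommutative series. A differential on `lieAlg` is
the restriction of a continuous odd derivation `D` of the whole series algebra
(`IsDifferential.exists_isDiff`). Such a `D` is determined by its values on letters, which may be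
prescribed freely apart from their degree and the absence of a constant term. Since `D²` is an
ordinary derivation, it vanishes as soon as it vanishes on letters. A model is therefore a table of
values on cells: the required formulas determine the table, which gives uniqueness, and existence
amounts to checking degree, locality, linear part and `D² = 0` cell by cell (`exists_isModel`).

The check of `D² = 0` is a computation with gauge transformations. A point is a solution of `D a =
-a²`. That `e` flows from `a` to `b` means `D(exp e) = exp e · b - a · exp e` (`Transports`,
`flow_eq_iff`). This condition is multiplicative, so the BCH series of an edge path flows from its
start to its end. The Bernoulli formula for an edge is exactly the solution of this condition for `D
e` (`transports_of_edgeDiff`, `edgeDiff_of_transports`). Write `D_a = D + ad_a`. At a point `a` one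
has `D_a² = D²` (`tw_tw`), transport intertwines `D_a` and `D_b` (`tw_expAd`), and loops at `a` are
`D_a`-closed (`tw_eq_zero_of_transports`). This settles the faces, whose twisted boundaries are
loops.

For the 3-cell, `D_a` commutes with `P_i(ad y)` because the `y_j` are loops, and it sends the `i`-th
face, moved to `a`, to `BCH(γ_i, -γ_{i+1})`. What remains is the admissibility relation, in its
cyclic form `∑ P_i(ad x) x_i = 0` with `x_n = -BCH(x_1, …, x_{n-1})`, with loops substituted for
letters. The loops telescope, so the last one is indeed the image of `x_n` (`substHom_loop_cyc`,
`sum_act_loop`, `tw_sum_act`). Banana, polyhedral cell and cube are instances of this computation;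
in the cube the cells are conjugated to their centres. The same data define a map out of the banana
(`existsUnique_bananaHom`).

Admissible series exist because BCH is a Lie series, which follows from the differential equation
obtained with the Euler derivation (`lengthOp_bch_letter`), and because the Dynkin operator writes
every Lie series as `∑ Q_i(ad x) x_i` (`exists_eq_sum_act`); one takes `P_n = 1`. Dihedral series
arise by averaging over the dihedral group (`exists_isDihedral`). A universal average is the unique
`z` with `∑ BCH(-z, x_i) = 0`, the limit of an iteration that gains one word length per step
(`exists_deviation_eq_zero`, `eq_of_deviation_eq_zero`). Every step keeps the endpoints, because
linear combinations of closed elements are closed (`transports_approxAvg`).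

Permutations of the coordinates act on the six chains of the cube by rotations (even permutations)
and reflections (odd ones), as recorded in `permCell_chain`. Dihedral invariance of `P` makes the
sum over the faces equivariant (`sum_act_rot`, `sum_act_flip`), and the symmetry of the averages
fixes the diagonals. -/

namespace NCSeries

variable {C C' C₂ : Type}

/-! The algebra of series and its filtration by word length. -/

/-- The series with the coefficients of the words that start with the letter `c`. -/
def shift (c : C) (f : NCSeries C) : NCSeries C := fun w => f (c :: w)

theorem mul_nil (f g : NCSeries C) : mul f g [] = f [] * g [] := by
  simp [mul]

theorem mul_cons (f g : NCSeries C) (c : C) (w : List C) :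
    mul f g (c :: w) = f [] * g (c :: w) + mul (shift c f) g w := by
  simp only [mul, List.length_cons]
  rw [Finset.sum_range_succ']
  simp [shift, add_comm]

theorem mul_add' (f g h : NCSeries C) : mul f (g + h) = mul f g + mul f h := by
  funext w
  simp only [mul, add_coeff, mul_add, Finset.sum_add_distrib]

theorem add_mul' (f g h : NCSeries C) : mul (f + g) h = mul f h + mul g h := by
  funext w
  simp only [mul, add_coeff, add_mul, Finset.sum_add_distrib]

theorem smul_mul' (r : ℚ) (f g : NCSeries C) : mul (r • f) g = r • mul f g := by
  funext w
  simp only [mul, smul_coeff, Finset.mul_sum, mul_assoc]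

theorem mul_smul' (r : ℚ) (f g : NCSeries C) : mul f (r • g) = r • mul f g := by
  funext w
  simp only [mul, smul_coeff, Finset.mul_sum]
  exact Finset.sum_congr rfl fun k _ => by ring

theorem shift_mul (c : C) (f g : NCSeries C) :
    shift c (mul f g) = f [] • shift c g + mul (shift c f) g := by
  funext w
  rw [add_coeff, smul_coeff]
  exact mul_cons f g c w

/-- Splitting off the first letter (`mul_cons`, `shift_mul`) reduces a coefficient of either triple
product to a shorter word, with a shifted first factor. -/
theorem mul_assoc' (f g h : NCSeries C) : mul (mul f g) h = mul f (mul g h) := by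
  funext w
  induction w generalizing f g h with
  | nil => simp only [mul_nil, mul_assoc]
  | cons c w ih =>
    rw [mul_cons, mul_cons, shift_mul, add_mul', smul_mul', add_coeff, smul_coeff, ih, mul_nil,
      mul_cons g h]
    ring

theorem one_mul' (f : NCSeries C) : mul one f = f := by
  funext w
  cases w with
  | nil => simp [mul_nil, one, mono]
  | cons c w =>
    have h : shift c (one : NCSeries C) = (0 : ℚ) • one := by
      funext v
      simp [shift, one, mono, smul_coeff]
    rw [mul_cons, h, smul_mul', smul_coeff]
    simp [one, mono]

theorem mul_one' (f : NCSeries C) : mul f one = f := by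
  funext w
  induction w generalizing f with
  | nil => simp [mul_nil, one, mono]
  | cons c w ih =>
    rw [mul_cons, ih]
    simp [one, mono, shift]

/-! ### Series as a `ℚ`-algebra. -/

namespace Ring

noncomputable scoped instance : Ring (NCSeries C) :=
  { (inferInstance : AddCommGroup (NCSeries C)) with
    mul := mul
    one := one
    mul_assoc := mul_assoc'
    one_mul := one_mul'
    mul_one := mul_one'
    left_distrib := mul_add'
    right_distrib := add_mul'
    zero_mul := fun f => by
      have := smul_mul' 0 f f
      rwa [zero_smul, zero_smul] at this
    mul_zero := fun f => by
      have := mul_smul' 0 f f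
      rwa [zero_smul, zero_smul] at this }

noncomputable scoped instance : Algebra ℚ (NCSeries C) :=
  Algebra.ofModule smul_mul' mul_smul'

end Ring

open scoped NCSeries.Ring

theorem mul_eq (f g : NCSeries C) : mul f g = f * g := rfl

theorem one_eq : (one : NCSeries C) = 1 := rfl

theorem pow_eq (f : NCSeries C) (k : ℕ) : pow f k = f ^ k := by
  induction k with
  | zero => rw [pow_zero]; rfl
  | succ k ih => rw [pow_succ', ← ih]; rfl

theorem prod_eq (l : List (NCSeries C)) : prod l = l.prod := by
  induction l with
  | nil => rfl
  | cons f l ih => rw [List.prod_cons, ← ih]; rfl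

theorem mul_coeff (f g : NCSeries C) (w : List C) :
    (f * g) w = ∑ k ∈ Finset.range (w.length + 1), f (w.take k) * g (w.drop k) := rfl

theorem neg_coeff (f : NCSeries C) (w : List C) : (-f) w = -f w := rfl

theorem sub_coeff (f g : NCSeries C) (w : List C) : (f - g) w = f w - g w := rfl

theorem mul_coeff_nil (f g : NCSeries C) : (f * g) [] = f [] * g [] := mul_nil f g

theorem one_coeff_nil : (1 : NCSeries C) [] = 1 := by
  simp [← one_eq, one, mono]

/-- The series without terms of word length less than `m`. -/
def fil (C : Type) (m : ℕ) : Submodule ℚ (NCSeries C) where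
  carrier := {f | ∀ w : List C, w.length < m → f w = 0}
  zero_mem' := fun w _ => zero_coeff w
  add_mem' := fun {f g} hf hg w hw => by rw [add_coeff, hf w hw, hg w hw, add_zero]
  smul_mem' := fun r f hf w hw => by rw [smul_coeff, hf w hw, mul_zero]

theorem fil_zero (f : NCSeries C) : f ∈ fil C 0 := fun _ h => absurd h (Nat.not_lt_zero _)

theorem fil_anti {m n : ℕ} (h : m ≤ n) {f : NCSeries C} (hf : f ∈ fil C n) : f ∈ fil C m :=
  fun w hw => hf w (hw.trans_le h)

theorem mem_fil_one {f : NCSeries C} : f ∈ fil C 1 ↔ f [] = 0 := by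
  refine ⟨fun h => h [] (by simp), fun h w hw => ?_⟩
  have hw' : w = [] := List.length_eq_zero_iff.1 (by omega)
  rw [hw', h]

theorem mul_mem_fil {m n : ℕ} {f g : NCSeries C} (hf : f ∈ fil C m) (hg : g ∈ fil C n) :
    f * g ∈ fil C (m + n) := by
  intro w hw
  rw [mul_coeff]
  refine Finset.sum_eq_zero fun k hk => ?_
  rw [Finset.mem_range] at hk
  by_cases h : k < m
  · rw [hf _ (by rw [List.length_take]; omega), zero_mul]
  · rw [hg _ (by rw [List.length_drop]; omega), mul_zero]

theorem mul_mem_fil_left {m : ℕ} {f : NCSeries C} (hf : f ∈ fil C m) (g : NCSeries C) :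
    f * g ∈ fil C m := mul_mem_fil hf (fil_zero g)

theorem mul_mem_fil_right {m : ℕ} (f : NCSeries C) {g : NCSeries C} (hg : g ∈ fil C m) :
    f * g ∈ fil C m := by
  simpa using mul_mem_fil (fil_zero f) hg

theorem pow_mem_fil {f : NCSeries C} (hf : f ∈ fil C 1) (k : ℕ) : f ^ k ∈ fil C k := by
  induction k with
  | zero => exact fil_zero _
  | succ k ih => rw [pow_succ]; exact mul_mem_fil ih hf

theorem prod_mem_fil {l : List (NCSeries C)} (hl : ∀ f ∈ l, f ∈ fil C 1) :
    l.prod ∈ fil C l.length := by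
  induction l with
  | nil => exact fil_zero _
  | cons f l ih =>
    rw [List.prod_cons, List.length_cons, add_comm]
    exact mul_mem_fil (hl f (by simp)) (ih fun g hg => hl g (by simp [hg]))

theorem eq_of_forall_sub_mem_fil {f g : NCSeries C} (h : ∀ m, f - g ∈ fil C m) : f = g := by
  funext w
  have := h (w.length + 1) w (Nat.lt_succ_self _)
  rwa [sub_coeff, sub_eq_zero] at this

theorem coeff_eq_of_sub_mem_fil {f g : NCSeries C} {m : ℕ} (h : f - g ∈ fil C m) {w : List C}
    (hw : w.length < m) : f w = g w := by
  have := h w hw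
  rwa [sub_coeff, sub_eq_zero] at this

/-- The linear maps that preserve the filtration. -/
def IsFilt (F : NCSeries C →ₗ[ℚ] NCSeries C') : Prop := ∀ m f, f ∈ fil C m → F f ∈ fil C' m

namespace IsFilt

theorem comp {F : NCSeries C →ₗ[ℚ] NCSeries C'} {G : NCSeries C' →ₗ[ℚ] NCSeries C₂}
    (hG : IsFilt G) (hF : IsFilt F) : IsFilt (G.comp F) :=
  fun m f hf => hG m _ (hF m f hf)

theorem add {F G : NCSeries C →ₗ[ℚ] NCSeries C'} (hF : IsFilt F) (hG : IsFilt G) :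
    IsFilt (F + G) := fun m f hf => add_mem (hF m f hf) (hG m f hf)

theorem sub {F G : NCSeries C →ₗ[ℚ] NCSeries C'} (hF : IsFilt F) (hG : IsFilt G) :
    IsFilt (F - G) := fun m f hf => sub_mem (hF m f hf) (hG m f hf)

theorem smul {F : NCSeries C →ₗ[ℚ] NCSeries C'} (hF : IsFilt F) (r : ℚ) :
    IsFilt (r • F) := fun m f hf => Submodule.smul_mem _ _ (hF m f hf)

theorem id : IsFilt (LinearMap.id : NCSeries C →ₗ[ℚ] NCSeries C) := fun _ _ h => h

theorem mulLeft (f : NCSeries C) : IsFilt (LinearMap.mulLeft ℚ f) :=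
  fun _ _ hg => mul_mem_fil_right f hg

theorem mulRight (f : NCSeries C) : IsFilt (LinearMap.mulRight ℚ f) :=
  fun _ _ hg => mul_mem_fil_left hg f

end IsFilt

/-! ### Locally finite sums of series. -/

/-- The sum of a sequence of series, the `k`-th of which has no term of word length less than
`k`. -/
def lsum (F : ℕ → NCSeries C) : NCSeries C :=
  fun w => ∑ k ∈ Finset.range (w.length + 1), F k w

/-- Terms with index beyond the length of the word vanish on it, so any longer truncation gives the
same coefficient. -/
theorem lsum_coeff {F : ℕ → NCSeries C} (hF : ∀ k, F k ∈ fil C k) {w : List C} {N : ℕ}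
    (hN : w.length < N) : lsum F w = ∑ k ∈ Finset.range N, F k w := by
  refine Finset.sum_subset (Finset.range_mono hN) fun k _ hk => ?_
  rw [Finset.mem_range, not_lt] at hk
  exact hF k w hk

theorem lsum_sub_mem_fil {F : ℕ → NCSeries C} (hF : ∀ k, F k ∈ fil C k) (N : ℕ) :
    lsum F - ∑ k ∈ Finset.range N, F k ∈ fil C N := by
  intro w hw
  rw [sub_coeff, lsum_coeff hF hw, sum_coeff, sub_self]

theorem lsum_mem_fil {F : ℕ → NCSeries C} {m : ℕ} (hF : ∀ k, F k ∈ fil C m) :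
    lsum F ∈ fil C m :=
  fun w hw => Finset.sum_eq_zero fun k _ => hF k w hw

theorem lsum_add (F G : ℕ → NCSeries C) : lsum (fun k => F k + G k) = lsum F + lsum G := by
  funext w
  simp only [lsum, add_coeff, Finset.sum_add_distrib]

theorem lsum_sub (F G : ℕ → NCSeries C) : lsum (fun k => F k - G k) = lsum F - lsum G := by
  funext w
  simp only [lsum, sub_coeff, Finset.sum_sub_distrib]

theorem lsum_smul (r : ℚ) (F : ℕ → NCSeries C) : lsum (fun k => r • F k) = r • lsum F := by
  funext w
  simp only [lsum, smul_coeff, Finset.mul_sum]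

theorem lsum_succ {F : ℕ → NCSeries C} (hF : ∀ k, F k ∈ fil C k) :
    lsum F = F 0 + lsum fun k => F (k + 1) := by
  funext w
  rw [add_coeff, lsum_coeff hF (Nat.lt_succ_of_lt (Nat.lt_succ_self w.length)),
    Finset.sum_range_succ', add_comm]
  rfl

theorem lsum_single (f : NCSeries C) : lsum (fun k => if k = 0 then f else 0) = f := by
  funext w
  rw [lsum, Finset.sum_eq_single 0]
  · simp
  · intro k _ hk
    rw [if_neg hk, zero_coeff]
  · simp

/-- Preserving the filtration is a form of continuity: the tail of the sum lies deep in the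
filtration and stays there, and on the finite part linearity applies. -/
theorem IsFilt.map_lsum {Φ : NCSeries C →ₗ[ℚ] NCSeries C'} (hΦ : IsFilt Φ)
    {F : ℕ → NCSeries C} (hF : ∀ k, F k ∈ fil C k) : Φ (lsum F) = lsum fun k => Φ (F k) := by
  funext w
  have h := hΦ _ _ (lsum_sub_mem_fil hF (w.length + 1))
  rw [map_sub, map_sum] at h
  rw [coeff_eq_of_sub_mem_fil h (Nat.lt_succ_self _), sum_coeff]
  rfl

/-- On a given word only pairs with `i + j` at most its length contribute, so the double sum is
finite and can be regrouped along antidiagonals. -/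
theorem lsum_lsum {F : ℕ → ℕ → NCSeries C} (hF : ∀ i j, F i j ∈ fil C (i + j)) :
    lsum (fun i => lsum fun j => F i j)
      = lsum fun n => ∑ p ∈ Finset.HasAntidiagonal.antidiagonal n, F p.1 p.2 := by
  funext w
  simp only [lsum, sum_coeff]
  rw [Finset.sum_sigma', Finset.sum_sigma', ← Finset.sum_subset (s₁ :=
    ((Finset.range (w.length + 1)).sigma fun _ => Finset.range (w.length + 1)).filter
      fun p => p.1 + p.2 ≤ w.length)]
  · refine Finset.sum_bij' (fun p _ => ⟨p.1 + p.2, (p.1, p.2)⟩) (fun p _ => ⟨p.2.1, p.2.2⟩)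
      ?_ ?_ ?_ ?_ ?_
    · rintro ⟨i, j⟩ h
      simp only [Finset.mem_filter, Finset.mem_sigma, Finset.mem_range,
        Finset.HasAntidiagonal.mem_antidiagonal, and_true] at h ⊢
      omega
    · rintro ⟨n, i, j⟩ h
      simp only [Finset.mem_filter, Finset.mem_sigma, Finset.mem_range,
        Finset.HasAntidiagonal.mem_antidiagonal] at h ⊢
      omega
    · rintro ⟨i, j⟩ _
      rfl
    · rintro ⟨n, i, j⟩ h
      simp only [Finset.mem_sigma, Finset.HasAntidiagonal.mem_antidiagonal] at h
      obtain ⟨_, rfl⟩ := h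
      rfl
    · rintro ⟨i, j⟩ _
      rfl
  · exact Finset.filter_subset _ _
  · rintro ⟨i, j⟩ h h'
    simp only [Finset.mem_filter, not_and, not_le] at h'
    exact hF i j w (h' h)

theorem lsum_mul_lsum {F G : ℕ → NCSeries C} (hF : ∀ k, F k ∈ fil C k)
    (hG : ∀ k, G k ∈ fil C k) :
    lsum F * lsum G = lsum fun n => ∑ p ∈ Finset.HasAntidiagonal.antidiagonal n, F p.1 * G p.2 := by
  rw [← lsum_lsum (F := fun i j => F i * G j) fun i j => mul_mem_fil (hF i) (hG j)]
  have := (IsFilt.mulRight (lsum G)).map_lsum hF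
  simp only [LinearMap.mulRight_apply] at this
  rw [this]
  congr 1
  funext i
  exact (IsFilt.mulLeft (F i)).map_lsum hG

/-! Monomials and continuous linear maps. -/

theorem mono_apply [DecidableEq C] (u w : List C) :
    (mono u : NCSeries C) w = if w = u then 1 else 0 := by
  unfold mono
  split_ifs <;> rfl

theorem letter_mul_cons (c : C) (f : NCSeries C) (d : C) (w : List C) :
    (letter c * f) (d :: w) = (letter c) [d] * f w := by
  have h : shift d (letter c) = (letter c [d]) • (1 : NCSeries C) := by
    funext v
    by_cases hd : d = c <;> simp [shift, letter, mono, smul_coeff, ← one_eq, one, hd]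
  have := mul_cons (letter c) f d w
  rw [mul_eq, h, mul_eq, smul_mul_assoc, one_mul, smul_coeff] at this
  rw [this]
  simp [letter, mono]

theorem mono_nil : (mono [] : NCSeries C) = 1 := rfl

theorem mono_cons (c : C) (u : List C) : mono (c :: u) = letter c * mono u := by
  funext w
  cases w with
  | nil => simp [mul_coeff_nil, letter, mono]
  | cons d w =>
    rw [letter_mul_cons]
    by_cases hd : d = c <;> by_cases hw : w = u <;> simp [letter, mono, hd, hw]

theorem mono_mul_mono (u v : List C) : (mono u * mono v : NCSeries C) = mono (u ++ v) := by
  induction u with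
  | nil => rw [mono_nil, one_mul, List.nil_append]
  | cons c u ih => rw [mono_cons, mul_assoc, ih, List.cons_append, mono_cons]

theorem mono_mem_fil (u : List C) : mono u ∈ fil C u.length := by
  intro w hw
  have h : w ≠ u := by
    rintro rfl
    exact lt_irrefl _ hw
  simp [mono, h]

theorem letter_mem_fil (c : C) : letter c ∈ fil C 1 := mono_mem_fil [c]

section Fintype

variable [Fintype C]

/-- The continuous linear map with the value `K u` on the word `u`. -/
noncomputable def lin (K : List C → NCSeries C') : NCSeries C →ₗ[ℚ] NCSeries C' where
  toFun f := lsum fun k => ∑ u : Fin k → C, f (List.ofFn u) • K (List.ofFn u)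
  map_add' f g := by
    simp only [add_coeff, add_smul, Finset.sum_add_distrib, lsum_add]
  map_smul' r f := by
    simp only [smul_coeff, mul_smul, ← Finset.smul_sum, lsum_smul, RingHom.id_apply]

theorem lin_apply (K : List C → NCSeries C') (f : NCSeries C) : lin K f = lsum fun k =>
    ∑ u : Fin k → C, f (List.ofFn u) • K (List.ofFn u) := rfl

theorem lin_coeff (K : List C → NCSeries C') (f : NCSeries C) (w : List C') :
    lin K f w = ∑ k ∈ Finset.range (w.length + 1), ∑ u : Fin k → C,
      f (List.ofFn u) * K (List.ofFn u) w := by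
  rw [lin_apply, lsum]
  simp only [sum_coeff, smul_coeff]

theorem sum_words_mono (f : NCSeries C) (k : ℕ) :
    ∑ u : Fin k → C, f (List.ofFn u) • (mono (List.ofFn u) : NCSeries C) = lenPart k f := by
  classical
  funext w
  rw [sum_coeff, lenPart]
  split_ifs with h
  · subst h
    rw [Finset.sum_eq_single w.get]
    · simp [smul_coeff, mono]
    · intro u _ hu
      have : w ≠ List.ofFn u := by
        intro h'
        apply hu
        apply List.ofFn_injective
        rw [← h']
        simp
      simp [smul_coeff, mono, this]
    · simp
  · refine Finset.sum_eq_zero fun u _ => ?_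
    have : w ≠ List.ofFn u := by
      intro h'
      exact h (by rw [h', List.length_ofFn])
    simp [smul_coeff, mono, this]

theorem lin_isFilt {K : List C → NCSeries C'} (hK : ∀ u, K u ∈ fil C' u.length) :
    IsFilt (lin K) := by
  intro m f hf
  rw [lin_apply]
  refine lsum_mem_fil fun k => sum_mem fun u _ => ?_
  by_cases h : k < m
  · rw [hf _ (by rwa [List.length_ofFn]), zero_smul]
    exact zero_mem _
  · refine Submodule.smul_mem _ _ (fil_anti (not_lt.1 h) ?_)
    simpa using hK (List.ofFn u)

/-- The truncation in `lsum` loses nothing: if the word `w` is shorter than `u`, then `K u` vanishes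
on it anyway. -/
theorem lin_mono {K : List C → NCSeries C'} (hK : ∀ u, K u ∈ fil C' u.length) (u : List C) :
    lin K (mono u) = K u := by
  classical
  funext w
  rw [lin_apply, lsum]
  have key : ∀ k, (∑ v : Fin k → C, (mono u : NCSeries C) (List.ofFn v) • K (List.ofFn v))
      = if k = u.length then K u else 0 := by
    intro k
    split_ifs with h
    · subst h
      rw [Finset.sum_eq_single u.get]
      · simp [mono]
      · intro v _ hv
        have : List.ofFn v ≠ u := by
          intro h'
          apply hv
          apply List.ofFn_injective
          rw [h']
          simp
        simp [mono, this]
      · simp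
    · refine Finset.sum_eq_zero fun v _ => ?_
      have : List.ofFn v ≠ u := by
        intro h'
        exact h (by rw [← h', List.length_ofFn])
      simp [mono, this]
  simp only [key]
  by_cases h : u.length < w.length + 1
  · rw [Finset.sum_eq_single u.length]
    · simp
    · intro k _ hk
      rw [if_neg hk, zero_coeff]
    · intro h'
      exact absurd (Finset.mem_range.2 h) h'
  · rw [Finset.sum_eq_zero, hK u w (by omega)]
    intro k hk
    rw [Finset.mem_range] at hk
    rw [if_neg (by omega), zero_coeff]

end Fintype

theorem lenPart_mem_fil (m : ℕ) (f : NCSeries C) : lenPart m f ∈ fil C m := by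
  intro w hw
  rw [lenPart, if_neg (by omega)]

theorem lsum_lenPart (f : NCSeries C) : lsum (fun k => lenPart k f) = f := by
  funext w
  simp [lsum, lenPart]

/-- Continuous linear maps are determined by their values on words. -/
theorem IsFilt.ext [Finite C] {F G : NCSeries C →ₗ[ℚ] NCSeries C'} (hF : IsFilt F)
    (hG : IsFilt G) (h : ∀ u, F (mono u) = G (mono u)) : F = G := by
  have := Fintype.ofFinite C
  refine LinearMap.ext fun f => ?_
  rw [← lsum_lenPart f, hF.map_lsum fun k => lenPart_mem_fil k f,
    hG.map_lsum fun k => lenPart_mem_fil k f]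
  congr 1
  funext k
  rw [← sum_words_mono, map_sum, map_sum]
  exact Finset.sum_congr rfl fun u _ => by rw [map_smul, map_smul, h]

/-- Two maps in two variables that are linear and continuous in each of them agree if they agree on
words. -/
theorem IsFilt.ext₂ [Finite C] [Finite C'] {L L' : NCSeries C → NCSeries C' →ₗ[ℚ] NCSeries C₂}
    {R R' : NCSeries C' → NCSeries C →ₗ[ℚ] NCSeries C₂}
    (h₁ : ∀ f, IsFilt (L f)) (h₁' : ∀ f, IsFilt (L' f)) (h₂ : ∀ g, IsFilt (R g))
    (h₂' : ∀ g, IsFilt (R' g)) (hLR : ∀ f g, L f g = R g f) (hLR' : ∀ f g, L' f g = R' g f)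
    (h : ∀ u v, L (mono u) (mono v) = L' (mono u) (mono v)) (f : NCSeries C) (g : NCSeries C') :
    L f g = L' f g := by
  rw [hLR, hLR']
  refine LinearMap.congr_fun ((h₂ g).ext (h₂' g) fun u => ?_) f
  rw [← hLR, ← hLR']
  exact LinearMap.congr_fun ((h₁ (mono u)).ext (h₁' (mono u)) fun v => h u v) g

end NCSeries

namespace NCSeries

open scoped NCSeries.Ring

variable {C C' C₂ : Type}

/-! Power series in an operator that raises the word length. -/

/-- The linear maps that raise the filtration by one step. -/
def IsRaise (T : NCSeries C →ₗ[ℚ] NCSeries C) : Prop := ∀ m f, f ∈ fil C m → T f ∈ fil C (m + 1)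

namespace IsRaise

theorem pow_mem {T : NCSeries C →ₗ[ℚ] NCSeries C} (hT : IsRaise T) {m : ℕ} {f : NCSeries C}
    (hf : f ∈ fil C m) (k : ℕ) : (T ^ k) f ∈ fil C (m + k) := by
  induction k with
  | zero => exact hf
  | succ k ih =>
    rw [pow_succ', Module.End.mul_apply, ← add_assoc]
    exact hT _ _ ih

theorem pow_mem' {T : NCSeries C →ₗ[ℚ] NCSeries C} (hT : IsRaise T) (f : NCSeries C) (k : ℕ) :
    (T ^ k) f ∈ fil C k := by
  simpa using hT.pow_mem (fil_zero f) k

theorem isFilt_pow {T : NCSeries C →ₗ[ℚ] NCSeries C} (hT : IsRaise T) (k : ℕ) :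
    IsFilt (T ^ k) := fun m _ hf => fil_anti (Nat.le_add_right m k) (hT.pow_mem hf k)

theorem sub {T U : NCSeries C →ₗ[ℚ] NCSeries C} (hT : IsRaise T) (hU : IsRaise U) :
    IsRaise (T - U) := fun m f hf => sub_mem (hT m f hf) (hU m f hf)

theorem mulLeft {x : NCSeries C} (hx : x ∈ fil C 1) : IsRaise (LinearMap.mulLeft ℚ x) :=
  fun m _ hf => by rw [add_comm]; exact mul_mem_fil hx hf

theorem mulRight {x : NCSeries C} (hx : x ∈ fil C 1) : IsRaise (LinearMap.mulRight ℚ x) :=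
  fun _ _ hf => mul_mem_fil hf hx

end IsRaise

/-- The power series `p` evaluated at the operator `T`. -/
noncomputable def opSeries (p : PowerSeries ℚ) (T : NCSeries C →ₗ[ℚ] NCSeries C) :
    NCSeries C →ₗ[ℚ] NCSeries C where
  toFun f := lsum fun k => PowerSeries.coeff k p • (T ^ k) f
  map_add' f g := by
    simp only [map_add, smul_add, lsum_add]
  map_smul' r f := by
    simp only [map_smul, smul_comm _ r, lsum_smul, RingHom.id_apply]

theorem opSeries_apply (p : PowerSeries ℚ) (T : NCSeries C →ₗ[ℚ] NCSeries C) (f : NCSeries C) :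
    opSeries p T f = lsum fun k => PowerSeries.coeff k p • (T ^ k) f := rfl

section opSeries

variable {T U : NCSeries C →ₗ[ℚ] NCSeries C} {p q : PowerSeries ℚ}

theorem opSeries_term_mem (hT : IsRaise T) (p : PowerSeries ℚ) (f : NCSeries C) (k : ℕ) :
    PowerSeries.coeff k p • (T ^ k) f ∈ fil C k :=
  Submodule.smul_mem _ _ (hT.pow_mem' f k)

theorem opSeries_isFilt (hT : IsRaise T) : IsFilt (opSeries p T) := fun m f hf =>
  lsum_mem_fil fun k => Submodule.smul_mem _ _ (hT.isFilt_pow k m f hf)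

theorem opSeries_sub : opSeries (p - q) T = opSeries p T - opSeries q T := by
  refine LinearMap.ext fun f => ?_
  simp only [LinearMap.sub_apply, opSeries_apply, map_sub, sub_smul, lsum_sub]

theorem opSeries_one : opSeries 1 T = 1 := by
  refine LinearMap.ext fun f => ?_
  rw [opSeries_apply, Module.End.one_apply]
  conv_rhs => rw [← lsum_single f]
  congr 1
  funext k
  rw [PowerSeries.coeff_one]
  split_ifs with h
  · subst h; simp
  · simp

/-- The Cauchy product, as a locally finite double sum regrouped by total degree. -/
theorem opSeries_mul (hT : IsRaise T) (p q : PowerSeries ℚ) (f : NCSeries C) :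
    opSeries (p * q) T f = opSeries p T (opSeries q T f) := by
  have h : opSeries p T (opSeries q T f) = lsum fun i => lsum fun j =>
      (PowerSeries.coeff i p * PowerSeries.coeff j q) • (T ^ (i + j)) f := by
    rw [opSeries_apply]
    congr 1
    funext i
    rw [opSeries_apply, (hT.isFilt_pow i).map_lsum (opSeries_term_mem hT q f), ← lsum_smul]
    congr 1
    funext j
    rw [map_smul, smul_smul, pow_add, Module.End.mul_apply]
  rw [h, lsum_lsum fun i j => Submodule.smul_mem _ _ (hT.pow_mem' f (i + j)), opSeries_apply]
  congr 1
  funext n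
  rw [PowerSeries.coeff_mul, Finset.sum_smul]
  refine Finset.sum_congr rfl fun x hx => ?_
  rw [Finset.HasAntidiagonal.mem_antidiagonal.1 hx]

theorem opSeries_X (hT : IsRaise T) (f : NCSeries C) : opSeries PowerSeries.X T f = T f := by
  rw [opSeries_apply]
  rw [lsum_succ fun k => opSeries_term_mem hT _ f k]
  conv_rhs => rw [← lsum_single (T f)]
  rw [PowerSeries.coeff_zero_X, zero_smul, zero_add]
  congr 1
  funext k
  rw [PowerSeries.coeff_X]
  split_ifs with h h' h' <;> first | omega | skip
  · have : k = 0 := by omega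
    subst this
    simp
  · simp

/-- An intertwiner of two operators intertwines their powers, and continuity extends this to power
series. -/
theorem opSeries_comm {Φ : NCSeries C →ₗ[ℚ] NCSeries C'} (hΦ : IsFilt Φ)
    {T' : NCSeries C' →ₗ[ℚ] NCSeries C'} (hT : IsRaise T) (h : ∀ f, Φ (T f) = T' (Φ f))
    (p : PowerSeries ℚ) (f : NCSeries C) : Φ (opSeries p T f) = opSeries p T' (Φ f) := by
  rw [opSeries_apply, hΦ.map_lsum (opSeries_term_mem hT p f), opSeries_apply]
  congr 1
  funext k
  rw [map_smul]
  congr 1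
  induction k with
  | zero => rfl
  | succ k ih =>
    rw [pow_succ', Module.End.mul_apply, h, ih, pow_succ', Module.End.mul_apply]

/-- The binomial theorem for commuting operators; both sides are sums over pairs `(i, j)` of `Tⁱ Uʲ
/ (i! j!)`. -/
theorem opSeries_exp_add (hT : IsRaise T) (hU : IsRaise U) (h : Commute T U) (f : NCSeries C) :
    opSeries (PowerSeries.exp ℚ) (T + U) f
      = opSeries (PowerSeries.exp ℚ) T (opSeries (PowerSeries.exp ℚ) U f) := by
  have h' : opSeries (PowerSeries.exp ℚ) T (opSeries (PowerSeries.exp ℚ) U f)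
      = lsum fun i => lsum fun j =>
        ((1 / (i.factorial : ℚ)) * (1 / (j.factorial : ℚ))) • (T ^ i) ((U ^ j) f) := by
    rw [opSeries_apply]
    congr 1
    funext i
    rw [opSeries_apply, (hT.isFilt_pow i).map_lsum (opSeries_term_mem hU _ f), ← lsum_smul]
    congr 1
    funext j
    rw [map_smul, smul_smul, PowerSeries.coeff_exp, PowerSeries.coeff_exp]
    rfl
  rw [h', lsum_lsum, opSeries_apply]
  · congr 1
    funext n
    rw [h.add_pow', LinearMap.sum_apply, Finset.smul_sum]
    refine Finset.sum_congr rfl fun x hx => ?_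
    rw [Finset.HasAntidiagonal.mem_antidiagonal] at hx
    rw [LinearMap.smul_apply, ← Nat.cast_smul_eq_nsmul ℚ, smul_smul, Module.End.mul_apply]
    congr 1
    rw [← hx, Nat.choose_symm_add, Nat.add_choose, Nat.cast_div (Nat.factorial_mul_factorial_dvd_factorial_add _ _)
      (by positivity), PowerSeries.coeff_exp]
    have h1 : (((x.1 + x.2).factorial : ℕ) : ℚ) ≠ 0 := by positivity
    have h2 : ((x.1.factorial : ℕ) : ℚ) ≠ 0 := by positivity
    have h3 : ((x.2.factorial : ℕ) : ℚ) ≠ 0 := by positivity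
    simp only [eq_ratCast, Rat.cast_id, Nat.cast_mul]
    field_simp
  · intro i j
    refine Submodule.smul_mem _ _ ?_
    rw [add_comm]
    exact hT.pow_mem (hU.pow_mem' f j) i

end opSeries

/-! Power series in a series without constant term; the exponential and the logarithm. -/

/-- The power series `p` evaluated at the series `x` without constant term. -/
noncomputable def ev (p : PowerSeries ℚ) (x : NCSeries C) : NCSeries C :=
  lsum fun k => PowerSeries.coeff k p • x ^ k

section ev

variable {x y : NCSeries C}

theorem mulLeft_pow_apply (x f : NCSeries C) (k : ℕ) :
    (LinearMap.mulLeft ℚ x ^ k) f = x ^ k * f := by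
  rw [LinearMap.pow_mulLeft, LinearMap.mulLeft_apply]

theorem ev_term_mem (hx : x ∈ fil C 1) (p : PowerSeries ℚ) (k : ℕ) :
    PowerSeries.coeff k p • x ^ k ∈ fil C k :=
  Submodule.smul_mem _ _ (pow_mem_fil hx k)

/-- Evaluation at a series is evaluation at the operator of left multiplication by it, so that the
functional calculus of `ev` is inherited from `opSeries`. -/
theorem opSeries_mulLeft (hx : x ∈ fil C 1) (p : PowerSeries ℚ) (f : NCSeries C) :
    opSeries p (LinearMap.mulLeft ℚ x) f = ev p x * f := by
  have := (IsFilt.mulRight f).map_lsum (ev_term_mem hx p)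
  simp only [LinearMap.mulRight_apply, smul_mul_assoc] at this
  rw [ev, this, opSeries_apply]
  simp only [mulLeft_pow_apply]

theorem opSeries_mulRight (hx : x ∈ fil C 1) (p : PowerSeries ℚ) (f : NCSeries C) :
    opSeries p (LinearMap.mulRight ℚ x) f = f * ev p x := by
  have := (IsFilt.mulLeft f).map_lsum (ev_term_mem hx p)
  simp only [LinearMap.mulLeft_apply, mul_smul_comm] at this
  rw [ev, this, opSeries_apply]
  simp only [LinearMap.pow_mulRight, LinearMap.mulRight_apply]

theorem ev_mul (hx : x ∈ fil C 1) (p q : PowerSeries ℚ) : ev (p * q) x = ev p x * ev q x := by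
  have := opSeries_mul (IsRaise.mulLeft hx) p q 1
  rwa [opSeries_mulLeft hx, opSeries_mulLeft hx, opSeries_mulLeft hx, mul_one, mul_one] at this

theorem ev_one (hx : x ∈ fil C 1) : ev 1 x = 1 := by
  have := opSeries_mulLeft hx 1 1
  rwa [opSeries_one, mul_one, eq_comm] at this

theorem ev_X (hx : x ∈ fil C 1) : ev PowerSeries.X x = x := by
  have := opSeries_mulLeft hx PowerSeries.X 1
  rwa [opSeries_X (IsRaise.mulLeft hx), LinearMap.mulLeft_apply, mul_one, mul_one, eq_comm] at this

theorem ev_add (p q : PowerSeries ℚ) : ev (p + q) x = ev p x + ev q x := by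
  simp only [ev, map_add, add_smul, lsum_add]

theorem ev_sub (p q : PowerSeries ℚ) : ev (p - q) x = ev p x - ev q x := by
  simp only [ev, map_sub, sub_smul, lsum_sub]

theorem ev_pow (hx : x ∈ fil C 1) (p : PowerSeries ℚ) (n : ℕ) : ev (p ^ n) x = ev p x ^ n := by
  induction n with
  | zero => rw [pow_zero, pow_zero, ev_one hx]
  | succ n ih => rw [pow_succ, pow_succ, ev_mul hx, ih]

theorem ev_coeff_nil (p : PowerSeries ℚ) (x : NCSeries C) :
    ev p x [] = PowerSeries.constantCoeff p := by
  simp [ev, lsum, smul_coeff, one_coeff_nil]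

theorem ev_mem_fil (p : PowerSeries ℚ) (hp : PowerSeries.constantCoeff p = 0) :
    ev p x ∈ fil C 1 := mem_fil_one.2 (by rw [ev_coeff_nil, hp])

theorem ev_ev (hx : x ∈ fil C 1) (p q : PowerSeries ℚ) (hq : PowerSeries.constantCoeff q = 0) :
    ev p (ev q x) = ev (p.subst q) x := by
  funext w
  have hq' : PowerSeries.HasSubst q := PowerSeries.HasSubst.of_constantCoeff_zero' hq
  simp only [ev, lsum]
  have h1 : ∀ k, (PowerSeries.coeff k p • (lsum fun j => PowerSeries.coeff j q • x ^ j) ^ k) w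
      = ∑ j ∈ Finset.range (w.length + 1),
        (PowerSeries.coeff k p * PowerSeries.coeff j (q ^ k)) * (x ^ j) w := by
    intro k
    have := ev_pow hx q k
    rw [ev, ev] at this
    rw [← this, smul_coeff, lsum, Finset.mul_sum]
    simp only [smul_coeff, mul_assoc]
  simp only [h1]
  rw [Finset.sum_comm]
  refine Finset.sum_congr rfl fun j hj => ?_
  rw [Finset.mem_range] at hj
  rw [← Finset.sum_mul, smul_coeff]
  congr 1
  -- As `q` has no constant term, `q ^ k` starts in degree `k`; only `k ≤ j` contribute, and these
  -- lie in the range of summation.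
  rw [PowerSeries.coeff_subst' hq', finsum_eq_sum_of_support_subset]
  · rfl
  · intro k hk
    rw [Finset.coe_range, Set.mem_Iio]
    by_contra hk'
    apply hk
    have h2 : PowerSeries.coeff j (q ^ k) = 0 := by
      apply PowerSeries.coeff_of_lt_order
      refine lt_of_lt_of_le ?_ (PowerSeries.le_order_pow_of_constantCoeff_eq_zero k hq)
      exact_mod_cast (by omega : j < k)
    simp only [h2, smul_zero]

theorem map_ev {Φ : NCSeries C →ₗ[ℚ] NCSeries C'} (hΦ : IsFilt Φ) (h1 : Φ 1 = 1)
    (hmul : ∀ f g, Φ (f * g) = Φ f * Φ g) (hx : x ∈ fil C 1) (p : PowerSeries ℚ) :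
    Φ (ev p x) = ev p (Φ x) := by
  rw [ev, hΦ.map_lsum (ev_term_mem hx p), ev]
  congr 1
  funext k
  rw [map_smul]
  congr 1
  induction k with
  | zero => rw [pow_zero, pow_zero, h1]
  | succ k ih => rw [pow_succ, pow_succ, hmul, ih]

end ev

theorem exp_eq_ev (x : NCSeries C) : exp x = ev (PowerSeries.exp ℚ) x := by
  funext w
  simp only [exp, ev, lsum, smul_coeff, pow_eq, PowerSeries.coeff_exp]
  rfl

theorem log_eq_ev (g : NCSeries C) : log g = ev (PowerSeries.log ℚ) (g - 1) := by
  funext w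
  have h : ∀ k ∈ Finset.Icc 1 w.length, ((-1 : ℚ) ^ (k + 1) / (k : ℚ)) * pow (g - one) k w
      = (PowerSeries.coeff k (PowerSeries.log ℚ) • (g - 1) ^ k) w := by
    intro k hk
    rw [Finset.mem_Icc] at hk
    rw [smul_coeff, pow_eq, PowerSeries.coeff_log, if_neg (by omega)]
    rfl
  rw [log, Finset.sum_congr rfl h, ev, lsum]
  refine Finset.sum_subset (fun k hk => ?_) fun k hk hk' => ?_
  · rw [Finset.mem_Icc] at hk
    exact Finset.mem_range.2 (by omega)
  · rw [Finset.mem_range] at hk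
    rw [Finset.mem_Icc] at hk'
    have : k = 0 := by omega
    subst this
    simp [smul_coeff]

theorem geom_mul_one_add_X :
    (PowerSeries.mk fun n => (-1 : ℚ) ^ n) * (1 + PowerSeries.X) = 1 := by
  ext n
  rw [mul_add, mul_one, map_add, PowerSeries.coeff_one]
  cases n with
  | zero => simp
  | succ n =>
    rw [PowerSeries.coeff_succ_mul_X, PowerSeries.coeff_mk, PowerSeries.coeff_mk, pow_succ]
    simp

theorem derivative_log :
    PowerSeries.derivative ℚ (PowerSeries.log ℚ) = PowerSeries.mk fun n => (-1 : ℚ) ^ n := by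
  rw [PowerSeries.deriv_log]
  rfl

theorem eq_of_derivative_eq {f g : PowerSeries ℚ}
    (h : PowerSeries.derivative ℚ f = PowerSeries.derivative ℚ g)
    (h' : PowerSeries.constantCoeff f = PowerSeries.constantCoeff g) : f = g :=
  PowerSeries.derivative.ext h h'

/-- Both sides have constant term `0` and derivative `1`: the derivative `1 / (1 + X)` of the
logarithm, taken at `exp - 1`, cancels the derivative of the exponential. -/
theorem log_subst_exp :
    (PowerSeries.log ℚ).subst (PowerSeries.exp ℚ - 1) = PowerSeries.X := by
  have hs : PowerSeries.HasSubst (PowerSeries.exp ℚ - 1) := PowerSeries.HasSubst.exp_sub_one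
  apply eq_of_derivative_eq
  · rw [PowerSeries.derivative_subst hs, derivative_log, map_sub, PowerSeries.derivative_exp]
    have h := congrArg (PowerSeries.subst (PowerSeries.exp ℚ - 1)) geom_mul_one_add_X
    rw [← PowerSeries.coe_substAlgHom hs, map_mul, map_add, map_one, PowerSeries.substAlgHom_X hs]
      at h
    rw [← PowerSeries.coe_substAlgHom hs]
    have h1 : PowerSeries.derivative ℚ (1 : PowerSeries ℚ) = 0 := Derivation.map_one_eq_zero _
    have h2 : PowerSeries.derivative ℚ (PowerSeries.X : PowerSeries ℚ) = 1 :=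
      PowerSeries.derivative_X
    rw [h1, h2, sub_zero]
    convert h using 2
    ring
  · rw [PowerSeries.constantCoeff_X]
    exact PowerSeries.constantCoeff_subst_eq_zero
      (by rw [← PowerSeries.constantCoeff_eq]; simp) _ PowerSeries.constantCoeff_log

/-- The composite `F` solves `F' = F · G` with `G = 1 / (1 + X)`. As `G' = -G²`, the product `F · G`
has derivative zero, and its constant term is `1`. -/
theorem exp_subst_log :
    (PowerSeries.exp ℚ).subst (PowerSeries.log ℚ) = 1 + PowerSeries.X := by
  have hs : PowerSeries.HasSubst (PowerSeries.log ℚ) := PowerSeries.HasSubst.log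
  set G : PowerSeries ℚ := PowerSeries.mk fun n => (-1 : ℚ) ^ n with hG
  have hG1 : G * (1 + PowerSeries.X) = 1 := geom_mul_one_add_X
  set F := (PowerSeries.exp ℚ).subst (PowerSeries.log ℚ) with hF
  have hF' : PowerSeries.derivative ℚ F = F * G := by
    rw [hF, PowerSeries.derivative_subst hs, derivative_log, PowerSeries.derivative_exp]
  have h2 : PowerSeries.derivative ℚ (PowerSeries.X : PowerSeries ℚ) = 1 :=
    PowerSeries.derivative_X
  have h1 : PowerSeries.derivative ℚ (1 : PowerSeries ℚ) = 0 :=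
    Derivation.map_one_eq_zero _
  have hG' : PowerSeries.derivative ℚ G = -(G * G) := by
    have h := congrArg (PowerSeries.derivative ℚ) hG1
    rw [Derivation.leibniz, map_add, h1, h2, zero_add, smul_eq_mul, smul_eq_mul, mul_one] at h
    calc _ = (G * (1 + PowerSeries.X)) * PowerSeries.derivative ℚ G := by rw [hG1, one_mul]
      _ = G * (G + (1 + PowerSeries.X) * PowerSeries.derivative ℚ G) - G * G := by ring
      _ = _ := by rw [h]; ring
  have hFG : F * G = 1 := by
    apply eq_of_derivative_eq
    · rw [Derivation.leibniz, hF', hG', h1, smul_eq_mul, smul_eq_mul]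
      ring
    · rw [map_mul, map_one]
      have : PowerSeries.constantCoeff F = 1 := by
        have h : F - 1 = (PowerSeries.exp ℚ - 1).subst (PowerSeries.log ℚ) := by
          rw [hF, ← PowerSeries.coe_substAlgHom hs, map_sub, map_one]
        have h' : PowerSeries.constantCoeff (F - 1) = 0 := by
          rw [h]
          exact PowerSeries.constantCoeff_subst_eq_zero
            (by rw [← PowerSeries.constantCoeff_eq]; exact PowerSeries.constantCoeff_log) _
            (by simp)
        rwa [map_sub, map_one, sub_eq_zero] at h'
      rw [this, hG, ← PowerSeries.coeff_zero_eq_constantCoeff_apply, PowerSeries.coeff_mk]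
      simp
  calc F = F * (G * (1 + PowerSeries.X)) := by rw [hG1, mul_one]
    _ = _ := by rw [← mul_assoc, hFG, one_mul]

/-! ### Exponential, logarithm and the Baker-Campbell-Hausdorff series. -/

section exp

variable {x y : NCSeries C}

theorem exp_coeff_nil (x : NCSeries C) : exp x [] = 1 := by
  rw [exp_eq_ev, ev_coeff_nil, PowerSeries.constantCoeff_exp]

theorem log_mem_fil (g : NCSeries C) : log g ∈ fil C 1 := by
  rw [log_eq_ev]
  exact ev_mem_fil _ PowerSeries.constantCoeff_log

theorem sub_one_mem_fil {g : NCSeries C} (hg : g [] = 1) : g - 1 ∈ fil C 1 :=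
  mem_fil_one.2 (by rw [sub_coeff, hg, one_coeff_nil, sub_self])

theorem log_exp (hx : x ∈ fil C 1) : log (exp x) = x := by
  have h : exp x - 1 = ev (PowerSeries.exp ℚ - 1) x := by
    rw [ev_sub, ev_one hx, exp_eq_ev]
  rw [log_eq_ev, h, ev_ev hx, log_subst_exp, ev_X hx]
  simp

theorem exp_log {g : NCSeries C} (hg : g [] = 1) : exp (log g) = g := by
  have h := sub_one_mem_fil hg
  rw [exp_eq_ev, log_eq_ev, ev_ev h _ _ PowerSeries.constantCoeff_log, exp_subst_log, ev_add,
    ev_one h, ev_X h, add_sub_cancel]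

theorem exp_injective (hx : x ∈ fil C 1) (hy : y ∈ fil C 1) (h : exp x = exp y) : x = y := by
  rw [← log_exp hx, h, log_exp hy]

theorem exp_add (hx : x ∈ fil C 1) (hy : y ∈ fil C 1) (h : Commute x y) :
    exp (x + y) = exp x * exp y := by
  have hxy : Commute (LinearMap.mulLeft ℚ x) (LinearMap.mulLeft ℚ y) := by
    refine LinearMap.ext fun f => ?_
    simp only [Module.End.mul_apply, LinearMap.mulLeft_apply, ← mul_assoc, h.eq]
  have := opSeries_exp_add (IsRaise.mulLeft hx) (IsRaise.mulLeft hy) hxy 1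
  have h' : LinearMap.mulLeft ℚ x + LinearMap.mulLeft ℚ y = LinearMap.mulLeft ℚ (x + y) := by
    refine LinearMap.ext fun f => ?_
    simp [add_mul]
  rw [h', opSeries_mulLeft (add_mem hx hy), opSeries_mulLeft hy, opSeries_mulLeft hx, mul_one,
    mul_one] at this
  rw [exp_eq_ev, exp_eq_ev, exp_eq_ev, this]

theorem exp_zero : exp (0 : NCSeries C) = 1 := by
  have h := exp_log (one_coeff_nil (C := C))
  rw [log_eq_ev, sub_self] at h
  have h0 : ev (PowerSeries.log ℚ) (0 : NCSeries C) = 0 := by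
    funext w
    rw [ev, lsum, zero_coeff]
    refine Finset.sum_eq_zero fun k _ => ?_
    rw [smul_coeff]
    cases k with
    | zero => simp
    | succ k => rw [pow_succ, mul_zero, zero_coeff, mul_zero]
  rwa [h0] at h

theorem exp_mul_exp_neg (hx : x ∈ fil C 1) : exp x * exp (-x) = 1 := by
  rw [← exp_add hx (neg_mem hx) (Commute.refl x).neg_right, add_neg_cancel, exp_zero]

theorem exp_neg_mul_exp (hx : x ∈ fil C 1) : exp (-x) * exp x = 1 := by
  have := exp_mul_exp_neg (neg_mem hx)
  rwa [neg_neg] at this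

theorem exp_half_mul_exp_half (hx : x ∈ fil C 1) :
    exp ((1 / 2 : ℚ) • x) * exp ((1 / 2 : ℚ) • x) = exp x := by
  have h : (1 / 2 : ℚ) • x ∈ fil C 1 := Submodule.smul_mem _ _ hx
  rw [← exp_add h h (Commute.refl _), ← add_smul]
  norm_num

theorem bch_mem_fil (x y : NCSeries C) : bch x y ∈ fil C 1 := log_mem_fil _

theorem exp_bch (x y : NCSeries C) : exp (bch x y) = exp x * exp y :=
  exp_log (by rw [mul_eq, mul_coeff_nil, exp_coeff_nil, exp_coeff_nil, one_mul])

theorem bchList_mem_fil (l : List (NCSeries C)) : bchList l ∈ fil C 1 := by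
  cases l with
  | nil => exact zero_mem _
  | cons x l => exact bch_mem_fil _ _

theorem exp_bchList (l : List (NCSeries C)) : exp (bchList l) = (l.map exp).prod := by
  induction l with
  | nil => exact exp_zero
  | cons x l ih => rw [List.map_cons, List.prod_cons, ← ih]; exact exp_bch _ _

theorem neg_bch (hx : x ∈ fil C 1) (hy : y ∈ fil C 1) : -bch x y = bch (-y) (-x) := by
  apply exp_injective (neg_mem (bch_mem_fil _ _)) (bch_mem_fil _ _)
  rw [exp_bch]
  have h1 : exp (bch x y) * (exp (-y) * exp (-x)) = 1 := by
    rw [exp_bch, mul_assoc, ← mul_assoc (exp y), exp_mul_exp_neg hy, one_mul, exp_mul_exp_neg hx]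
  calc _ = exp (-bch x y) * (exp (bch x y) * (exp (-y) * exp (-x))) := by rw [h1, mul_one]
    _ = _ := by rw [← mul_assoc, exp_neg_mul_exp (bch_mem_fil _ _), one_mul]

theorem map_exp {Φ : NCSeries C →ₗ[ℚ] NCSeries C'} (hΦ : IsFilt Φ) (h1 : Φ 1 = 1)
    (hmul : ∀ f g, Φ (f * g) = Φ f * Φ g) (hx : x ∈ fil C 1) : Φ (exp x) = exp (Φ x) := by
  rw [exp_eq_ev, map_ev hΦ h1 hmul hx, exp_eq_ev]

theorem map_log {Φ : NCSeries C →ₗ[ℚ] NCSeries C'} (hΦ : IsFilt Φ) (h1 : Φ 1 = 1)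
    (hmul : ∀ f g, Φ (f * g) = Φ f * Φ g) {g : NCSeries C} (hg : g [] = 1) :
    Φ (log g) = log (Φ g) := by
  rw [log_eq_ev, map_ev hΦ h1 hmul (sub_one_mem_fil hg), log_eq_ev, map_sub, h1]

theorem map_bch {Φ : NCSeries C →ₗ[ℚ] NCSeries C'} (hΦ : IsFilt Φ) (h1 : Φ 1 = 1)
    (hmul : ∀ f g, Φ (f * g) = Φ f * Φ g) (hx : x ∈ fil C 1) (hy : y ∈ fil C 1) :
    Φ (bch x y) = bch (Φ x) (Φ y) := by
  rw [bch, map_log hΦ h1 hmul, mul_eq, hmul, map_exp hΦ h1 hmul hx, map_exp hΦ h1 hmul hy]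
  · rfl
  · rw [mul_eq, mul_coeff_nil, exp_coeff_nil, exp_coeff_nil, one_mul]

theorem map_bchList {Φ : NCSeries C →ₗ[ℚ] NCSeries C'} (hΦ : IsFilt Φ) (h1 : Φ 1 = 1)
    (hmul : ∀ f g, Φ (f * g) = Φ f * Φ g) {l : List (NCSeries C)} (hl : ∀ x ∈ l, x ∈ fil C 1) :
    Φ (bchList l) = bchList (l.map Φ) := by
  induction l with
  | nil => exact map_zero Φ
  | cons x l ih =>
    have ih' := ih fun y hy => hl y (by simp [hy])
    rw [List.map_cons]
    change Φ (bch x (bchList l)) = bch (Φ x) (bchList (l.map Φ))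
    rw [map_bch hΦ h1 hmul (hl x (by simp)) (bchList_mem_fil l), ih']

end exp

/-! Conjugation by exponentials and the derivative of the exponential. -/

/-- The commutator with `x`, as an operator. -/
noncomputable def comm (x : NCSeries C) : NCSeries C →ₗ[ℚ] NCSeries C :=
  LinearMap.mulLeft ℚ x - LinearMap.mulRight ℚ x

theorem comm_apply (x f : NCSeries C) : comm x f = x * f - f * x := rfl

theorem comm_isRaise {x : NCSeries C} (hx : x ∈ fil C 1) : IsRaise (comm x) :=
  (IsRaise.mulLeft hx).sub (IsRaise.mulRight hx)

/-- The operator `ad x` is the sum of left multiplication by `x` and right multiplication by `-x`,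
which commute. -/
theorem opSeries_exp_comm {x : NCSeries C} (hx : x ∈ fil C 1) (f : NCSeries C) :
    opSeries (PowerSeries.exp ℚ) (comm x) f = exp x * f * exp (-x) := by
  have h : comm x = LinearMap.mulLeft ℚ x + LinearMap.mulRight ℚ (-x) := by
    refine LinearMap.ext fun g => ?_
    simp [comm_apply, sub_eq_add_neg]
  have hc : Commute (LinearMap.mulLeft ℚ x) (LinearMap.mulRight ℚ (-x)) :=
    LinearMap.commute_mulLeft_right x (-x)
  rw [h, opSeries_exp_add (IsRaise.mulLeft hx) (IsRaise.mulRight (neg_mem hx)) hc,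
    opSeries_mulRight (neg_mem hx), opSeries_mulLeft hx, exp_eq_ev, exp_eq_ev, mul_assoc]

/-- The power series `(1 - e⁻ˣ) / x`. -/
noncomputable def expQuot : PowerSeries ℚ :=
  PowerSeries.mk fun k => (-1 : ℚ) ^ k / ((k + 1).factorial : ℚ)

/-- The power series `e⁻ˣ`. -/
noncomputable def expNeg : PowerSeries ℚ := PowerSeries.evalNegHom (PowerSeries.exp ℚ)

theorem coeff_expNeg (k : ℕ) :
    PowerSeries.coeff k expNeg = (-1 : ℚ) ^ k * (1 / (k.factorial : ℚ)) := by
  simp [expNeg, PowerSeries.evalNegHom, PowerSeries.coeff_rescale]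

theorem exp_mul_expNeg : PowerSeries.exp ℚ * expNeg = 1 :=
  PowerSeries.exp_mul_exp_neg_eq_one

theorem expQuot_mul_X : expQuot * PowerSeries.X = 1 - expNeg := by
  ext n
  rw [map_sub, coeff_expNeg, PowerSeries.coeff_one]
  cases n with
  | zero => simp
  | succ n =>
    rw [PowerSeries.coeff_succ_mul_X, expQuot, PowerSeries.coeff_mk, if_neg (by omega), pow_succ]
    ring

/-- This is the identity `((1 - e⁻ˣ)/x) · (x/(eˣ - 1)) = e⁻ˣ`, the reason why Bernoulli numbers
occur in the differential of an edge. It is verified after multiplication by `eˣ - 1`. -/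
theorem expQuot_mul_bernoulli : expQuot * bernoulliPowerSeries ℚ = expNeg := by
  have h : PowerSeries.exp ℚ - 1 ≠ 0 := by
    intro h
    have := congrArg (PowerSeries.coeff 1) h
    simp [PowerSeries.coeff_exp, PowerSeries.coeff_one] at this
  apply mul_right_cancel₀ h
  rw [mul_assoc, bernoulliPowerSeries_mul_exp_sub_one, expQuot_mul_X, mul_sub, mul_comm expNeg,
    exp_mul_expNeg, mul_one]

theorem opSeries_expNeg_comm {x : NCSeries C} (hx : x ∈ fil C 1) (f : NCSeries C) :
    opSeries expNeg (comm x) f = exp (-x) * f * exp x := by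
  have h : exp (-x) * (exp x * opSeries expNeg (comm x) f * exp (-x)) * exp x
      = exp (-x) * f * exp x := by
    rw [← opSeries_exp_comm hx, ← opSeries_mul (comm_isRaise hx), exp_mul_expNeg, opSeries_one]
    rfl
  rw [← h]
  simp only [mul_assoc, exp_neg_mul_exp hx, mul_one]
  rw [← mul_assoc, exp_neg_mul_exp hx, one_mul]

theorem opSeries_expQuot_comm_comm {x : NCSeries C} (hx : x ∈ fil C 1) (f : NCSeries C) :
    opSeries expQuot (comm x) (comm x f) = f - exp (-x) * f * exp x := by
  rw [← opSeries_X (comm_isRaise hx) f, ← opSeries_mul (comm_isRaise hx), expQuot_mul_X,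
    opSeries_sub, opSeries_one, LinearMap.sub_apply, opSeries_expNeg_comm hx]
  rfl

theorem comm_pow_mul_right (x y : NCSeries C) (j : ℕ) :
    ((-1 : ℚ) ^ j • (comm x ^ j) y) * x
      = x * ((-1 : ℚ) ^ j • (comm x ^ j) y) + (-1 : ℚ) ^ (j + 1) • (comm x ^ (j + 1)) y := by
  rw [pow_succ', pow_succ' (comm x), Module.End.mul_apply, comm_apply]
  simp only [smul_mul_assoc, mul_smul_comm, smul_sub, mul_smul, neg_smul, one_smul]
  abel

/-- Each new factor `x` is moved to the left past the iterates `(-ad x)ʲ y`, leaving the next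
iterate as a correction (`comm_pow_mul_right`); Pascal's rule collects the coefficients. The Leibniz
rule is needed on powers of `x` only, so odd derivations are covered when `x` has degree `0`. -/
theorem map_pow_of_derivation {Φ : NCSeries C →ₗ[ℚ] NCSeries C} {x y : NCSeries C} (h1 : Φ 1 = 0)
    (h : ∀ k : ℕ, Φ (x ^ k * x) = Φ (x ^ k) * x + x ^ k * y) (n : ℕ) :
    Φ (x ^ n) = ∑ j ∈ Finset.range n,
      (n.choose (j + 1) : ℚ) • (x ^ (n - 1 - j) * ((-1 : ℚ) ^ j • (comm x ^ j) y)) := by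
  induction n with
  | zero => simpa using h1
  | succ n ih =>
    set a : ℕ → NCSeries C := fun j => (-1 : ℚ) ^ j • (comm x ^ j) y with ha
    have hx : ∀ j, a j * x = x * a j + a (j + 1) := comm_pow_mul_right x y
    have h0 : a 0 = y := by simp [ha]
    have hs : ∀ j ∈ Finset.range n, ((n.choose (j + 1) : ℚ) • (x ^ (n - 1 - j) * a j)) * x
        = (n.choose (j + 1) : ℚ) • (x ^ (n - j) * a j)
          + (n.choose (j + 1) : ℚ) • (x ^ (n - (j + 1)) * a (j + 1)) := by
      intro j hj
      rw [Finset.mem_range] at hj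
      have e1 : n - j = (n - 1 - j) + 1 := by omega
      have e2 : n - (j + 1) = n - 1 - j := by omega
      rw [smul_mul_assoc, mul_assoc, hx, mul_add, smul_add, ← mul_assoc, ← pow_succ, e1, e2]
    rw [pow_succ, h, ih, Finset.sum_mul, Finset.sum_congr rfl hs, Finset.sum_add_distrib, add_assoc]
    have h2 : ∑ j ∈ Finset.range n, (n.choose (j + 1) : ℚ) • (x ^ (n - (j + 1)) * a (j + 1))
        + x ^ n * y = ∑ j ∈ Finset.range (n + 1), (n.choose j : ℚ) • (x ^ (n - j) * a j) := by
      rw [Finset.sum_range_succ']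
      simp [h0]
    have h3 : ∑ j ∈ Finset.range n, (n.choose (j + 1) : ℚ) • (x ^ (n - j) * a j)
        = ∑ j ∈ Finset.range (n + 1), (n.choose (j + 1) : ℚ) • (x ^ (n - j) * a j) := by
      rw [Finset.sum_range_succ]
      simp
    rw [h2, h3, ← Finset.sum_add_distrib]
    refine Finset.sum_congr rfl fun j _ => ?_
    rw [← add_smul, Nat.choose_succ_succ, Nat.cast_add, add_comm (n.choose (j + 1) : ℚ),
      Nat.add_sub_cancel]

/-- The derivative of the exponential: `Φ(eˣ) = eˣ · ((1 - e^(-ad x)) / ad x) Φ(x)`. -/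
theorem map_exp_of_derivation {Φ : NCSeries C →ₗ[ℚ] NCSeries C} (hΦ : IsFilt Φ)
    {x y : NCSeries C} (hx : x ∈ fil C 1) (h1 : Φ 1 = 0)
    (h : ∀ k : ℕ, Φ (x ^ k * x) = Φ (x ^ k) * x + x ^ k * y) :
    Φ (exp x) = exp x * opSeries expQuot (comm x) y := by
  have hmem : ∀ k, Φ (PowerSeries.coeff k (PowerSeries.exp ℚ) • x ^ k) ∈ fil C k := fun k =>
    hΦ _ _ (ev_term_mem hx _ k)
  rw [exp_eq_ev, ev, hΦ.map_lsum (ev_term_mem hx _), lsum_succ hmem, pow_zero, map_smul, h1,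
    smul_zero, zero_add, opSeries_apply,
    lsum_mul_lsum (ev_term_mem hx _) (opSeries_term_mem (comm_isRaise hx) _ y)]
  congr 1
  funext n
  -- The reflection of the sum indexes both sides by the number `j` of commutators applied to `y`,
  -- with `x ^ (n - j)` in front.
  rw [map_smul, map_pow_of_derivation h1 h, Finset.Nat.sum_antidiagonal_eq_sum_range_succ_mk,
    ← Finset.sum_range_reflect, Finset.smul_sum]
  refine Finset.sum_congr rfl fun j hj => ?_
  rw [Finset.mem_range] at hj
  have e1 : n + 1 - 1 - j = n - j := by omega
  have e2 : n + 1 - 1 - (n - j) = j := by omega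
  have e3 : ((n + 1).choose (n - j + 1) : ℚ)
      = ((n + 1).factorial : ℚ) / (((n - j + 1).factorial : ℚ) * (j.factorial : ℚ)) := by
    rw [Nat.cast_choose ℚ (by omega)]
    congr 4
    omega
  rw [e1, e2, e3, PowerSeries.coeff_exp, PowerSeries.coeff_exp, expQuot, PowerSeries.coeff_mk]
  simp only [smul_mul_assoc, mul_smul_comm, smul_smul]
  congr 1
  have f1 : ((n + 1).factorial : ℚ) ≠ 0 := by positivity
  have f2 : ((n - j + 1).factorial : ℚ) ≠ 0 := by positivity
  have f3 : (j.factorial : ℚ) ≠ 0 := by positivity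
  simp only [eq_ratCast, Rat.cast_id]
  field_simp

/-- A derivation that kills the powers of `g - 1` kills the logarithm of `g`. -/
theorem map_ev_of_forall_pow {Φ : NCSeries C →ₗ[ℚ] NCSeries C'} (hΦ : IsFilt Φ) {x : NCSeries C}
    (hx : x ∈ fil C 1) (h : ∀ k : ℕ, Φ (x ^ k) = 0) (p : PowerSeries ℚ) : Φ (ev p x) = 0 := by
  rw [ev, hΦ.map_lsum (ev_term_mem hx p)]
  funext w
  rw [lsum, zero_coeff]
  exact Finset.sum_eq_zero fun k _ => by rw [map_smul, h, smul_zero, zero_coeff]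

end NCSeries

namespace NCSeries

open scoped NCSeries.Ring

variable {C C' C₂ : Type}

/-! Gradings. -/

theorem wdeg_nil (deg : C → ℤ) : wdeg deg [] = 0 := rfl

theorem wdeg_cons (deg : C → ℤ) (c : C) (w : List C) : wdeg deg (c :: w) = deg c + wdeg deg w := by
  simp [wdeg]

theorem wdeg_const_one (w : List C) : wdeg (fun _ => 1) w = w.length := by
  induction w with
  | nil => rfl
  | cons c w ih => rw [wdeg_cons, ih, List.length_cons]; push_cast; ring

theorem neg_one_zpow_mul_self (n : ℤ) : (-1 : ℚ) ^ n * (-1 : ℚ) ^ n = 1 := by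
  rcases Int.even_or_odd n with h | h
  · rw [h.neg_one_zpow, one_mul]
  · rw [h.neg_one_zpow]; norm_num

/-- The sign automorphism `f ↦ (-1)^(p |f|) f`. -/
noncomputable def tau (deg : C → ℤ) (p : ℤ) : NCSeries C →ₗ[ℚ] NCSeries C where
  toFun f := fun w => (-1 : ℚ) ^ (p * wdeg deg w) * f w
  map_add' f g := by
    funext w
    exact mul_add _ (f w) (g w)
  map_smul' r f := by
    funext w
    exact mul_left_comm _ r (f w)

/-- The series that are homogeneous of degree `n`. -/
def hom (deg : C → ℤ) (n : ℤ) : Submodule ℚ (NCSeries C) where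
  carrier := {f | ∀ w, f w ≠ 0 → wdeg deg w = n}
  zero_mem' := fun w hw => absurd (zero_coeff w) hw
  add_mem' := by
    intro f g hf hg w hw
    by_cases h : f w = 0
    · refine hg w fun h' => hw ?_
      rw [add_coeff, h, h', add_zero]
    · exact hf w h
  smul_mem' := by
    intro r f hf w hw
    refine hf w fun h => hw ?_
    rw [smul_coeff, h, mul_zero]

variable {deg : C → ℤ}

theorem tau_coeff (p : ℤ) (f : NCSeries C) (w : List C) :
    tau deg p f w = (-1 : ℚ) ^ (p * wdeg deg w) * f w := rfl

theorem tau_isFilt (p : ℤ) : IsFilt (tau deg p) := fun m f hf w hw => by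
  rw [tau_coeff, hf w hw, mul_zero]

theorem tau_mul (p : ℤ) (f g : NCSeries C) : tau deg p (f * g) = tau deg p f * tau deg p g := by
  funext w
  rw [tau_coeff, mul_coeff, mul_coeff, Finset.mul_sum]
  refine Finset.sum_congr rfl fun k _ => ?_
  rw [tau_coeff, tau_coeff, ← wdeg_take_add_drop deg w k, mul_add,
    zpow_add₀ (by norm_num : (-1 : ℚ) ≠ 0)]
  ring

theorem tau_tau (p : ℤ) (f : NCSeries C) : tau deg p (tau deg p f) = f := by
  funext w
  rw [tau_coeff, tau_coeff, ← mul_assoc, neg_one_zpow_mul_self, one_mul]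

theorem tau_zero (f : NCSeries C) : tau deg 0 f = f := by
  funext w
  rw [tau_coeff, zero_mul, zpow_zero, one_mul]

theorem tau_neg_one (f : NCSeries C) : tau deg (-1) f = tau deg 1 f := by
  funext w
  rw [tau_coeff, tau_coeff, neg_one_mul, one_mul, zpow_neg, ← inv_zpow]
  norm_num

theorem tau_of_mem_hom {p q : ℤ} {f : NCSeries C} (hf : f ∈ hom deg q) :
    tau deg p f = (-1 : ℚ) ^ (p * q) • f := by
  funext w
  rw [tau_coeff, smul_coeff]
  by_cases h : f w = 0
  · rw [h, mul_zero, mul_zero]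
  · rw [hf w h]

theorem tau_of_mem_hom_zero {p : ℤ} {f : NCSeries C} (hf : f ∈ hom deg 0) : tau deg p f = f := by
  rw [tau_of_mem_hom hf, mul_zero, zpow_zero, one_smul]

theorem one_mem_hom : (1 : NCSeries C) ∈ hom deg 0 := by
  intro w hw
  by_cases h : w = []
  · rw [h, wdeg_nil]
  · exact absurd (by simp [← one_eq, one, mono, h]) hw

theorem mono_mem_hom (u : List C) : mono u ∈ hom deg (wdeg deg u) := by
  intro w hw
  by_cases h : w = u
  · rw [h]
  · exact absurd (by simp [mono, h]) hw

theorem letter_mem_hom (c : C) : letter c ∈ hom deg (deg c) := by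
  have := mono_mem_hom (deg := deg) [c]
  rwa [wdeg_cons, wdeg_nil, add_zero] at this

theorem mul_mem_hom {p q : ℤ} {f g : NCSeries C} (hf : f ∈ hom deg p) (hg : g ∈ hom deg q) :
    f * g ∈ hom deg (p + q) := by
  intro w hw
  rw [mul_coeff] at hw
  obtain ⟨k, -, hk⟩ := Finset.exists_ne_zero_of_sum_ne_zero hw
  rw [← wdeg_take_add_drop deg w k, hf _ (left_ne_zero_of_mul hk), hg _ (right_ne_zero_of_mul hk)]

theorem pow_mem_hom {f : NCSeries C} (hf : f ∈ hom deg 0) (k : ℕ) : f ^ k ∈ hom deg 0 := by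
  induction k with
  | zero => exact one_mem_hom
  | succ k ih =>
    rw [pow_succ, ← add_zero (0 : ℤ)]
    exact mul_mem_hom ih hf

theorem lsum_mem_hom {n : ℤ} {F : ℕ → NCSeries C} (hF : ∀ k, F k ∈ hom deg n) :
    lsum F ∈ hom deg n := by
  intro w hw
  obtain ⟨k, -, hk⟩ := Finset.exists_ne_zero_of_sum_ne_zero hw
  exact hF k w hk

theorem ev_mem_hom {x : NCSeries C} (hx : x ∈ hom deg 0) (p : PowerSeries ℚ) :
    ev p x ∈ hom deg 0 :=
  lsum_mem_hom fun k => Submodule.smul_mem _ _ (pow_mem_hom hx k)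

theorem exp_mem_hom {x : NCSeries C} (hx : x ∈ hom deg 0) : exp x ∈ hom deg 0 := by
  rw [exp_eq_ev]
  exact ev_mem_hom hx _

theorem log_mem_hom {g : NCSeries C} (hg : g ∈ hom deg 0) : log g ∈ hom deg 0 := by
  rw [log_eq_ev]
  exact ev_mem_hom (sub_mem hg one_mem_hom) _

theorem bch_mem_hom {x y : NCSeries C} (hx : x ∈ hom deg 0) (hy : y ∈ hom deg 0) :
    bch x y ∈ hom deg 0 := by
  refine log_mem_hom ?_
  rw [mul_eq, ← add_zero (0 : ℤ)]
  exact mul_mem_hom (exp_mem_hom hx) (exp_mem_hom hy)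

/-- The homogeneous component of degree `n`. -/
noncomputable def component (deg : C → ℤ) (n : ℤ) : NCSeries C →ₗ[ℚ] NCSeries C where
  toFun f := fun w => if wdeg deg w = n then f w else 0
  map_add' f g := by
    funext w
    change (if wdeg deg w = n then f w + g w else 0)
      = (if wdeg deg w = n then f w else 0) + (if wdeg deg w = n then g w else 0)
    split_ifs
    · rfl
    · exact (add_zero 0).symm
  map_smul' r f := by
    funext w
    change (if wdeg deg w = n then r * f w else 0) = r * (if wdeg deg w = n then f w else 0)
    split_ifs
    · rfl
    · exact (mul_zero r).symm

theorem component_coeff (n : ℤ) (f : NCSeries C) (w : List C) :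
    component deg n f w = if wdeg deg w = n then f w else 0 := rfl

theorem component_mem_hom (n : ℤ) (f : NCSeries C) : component deg n f ∈ hom deg n := by
  intro w hw
  by_contra h
  exact hw (by rw [component_coeff, if_neg h])

theorem component_of_mem_hom {n : ℤ} {f : NCSeries C} (hf : f ∈ hom deg n) :
    component deg n f = f := by
  funext w
  rw [component_coeff]
  split_ifs with h
  · rfl
  · by_contra h'
    exact h (hf w (Ne.symm h'))

theorem component_of_mem_hom_ne {m n : ℤ} (h : m ≠ n) {f : NCSeries C} (hf : f ∈ hom deg m) :
    component deg n f = 0 := by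
  funext w
  rw [component_coeff, zero_coeff]
  split_ifs with h'
  · by_contra h''
    exact h ((hf w h'').symm.trans h')
  · rfl

/-- Word length is the grading in which every letter has weight `1`, so what holds for the
homogeneous components of an arbitrary grading applies to it. -/
theorem lenPart_eq_component (m : ℕ) (f : NCSeries C) :
    lenPart m f = component (fun _ => 1) m f := by
  funext w
  rw [component_coeff, lenPart, wdeg_const_one]
  simp only [Nat.cast_inj]

/-! The graded commutator. -/

/-- The graded commutator as a bilinear map. -/
noncomputable def brk (deg : C → ℤ) : NCSeries C →ₗ[ℚ] NCSeries C →ₗ[ℚ] NCSeries C :=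
  LinearMap.mk₂ ℚ (bracket deg)
    (fun f f' g => by
      funext w
      simp only [bracket, add_coeff]
      rw [← Finset.sum_add_distrib]
      exact Finset.sum_congr rfl fun k _ => by ring)
    (fun r f g => by
      funext w
      simp only [bracket, smul_coeff]
      rw [Finset.mul_sum]
      exact Finset.sum_congr rfl fun k _ => by ring)
    (fun f g g' => by
      funext w
      simp only [bracket, add_coeff]
      rw [← Finset.sum_add_distrib]
      exact Finset.sum_congr rfl fun k _ => by ring)
    (fun r f g => by
      funext w
      simp only [bracket, smul_coeff]
      rw [Finset.mul_sum]
      exact Finset.sum_congr rfl fun k _ => by ring)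

theorem brk_apply (f g : NCSeries C) : brk deg f g = bracket deg f g := rfl

theorem bracket_mem_fil {m n : ℕ} {f g : NCSeries C} (hf : f ∈ fil C m) (hg : g ∈ fil C n) :
    bracket deg f g ∈ fil C (m + n) := by
  intro w hw
  refine Finset.sum_eq_zero fun k hk => ?_
  rw [Finset.mem_range] at hk
  have h1 : f (w.take k) * g (w.drop k) = 0 := by
    by_cases h : k < m
    · rw [hf _ (by rw [List.length_take]; omega), zero_mul]
    · rw [hg _ (by rw [List.length_drop]; omega), mul_zero]
  have h2 : g (w.take k) * f (w.drop k) = 0 := by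
    by_cases h : k < n
    · rw [hg _ (by rw [List.length_take]; omega), zero_mul]
    · rw [hf _ (by rw [List.length_drop]; omega), mul_zero]
  rw [h1, h2, mul_zero, sub_zero]

theorem brk_isFilt (f : NCSeries C) : IsFilt (brk deg f) := fun m g hg => by
  simpa [brk_apply] using bracket_mem_fil (deg := deg) (fil_zero f) hg

theorem brk_flip_isFilt (g : NCSeries C) : IsFilt ((brk deg).flip g) := fun m f hf => by
  simpa [brk_apply] using bracket_mem_fil (deg := deg) hf (fil_zero g)

/-- With `f` homogeneous, the sign of each term depends on `g` alone and is absorbed by `tau`. This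
turns the coefficientwise bracket into ring operations. -/
theorem bracket_of_mem_hom {p : ℤ} {f : NCSeries C} (hf : f ∈ hom deg p) (g : NCSeries C) :
    bracket deg f g = f * g - tau deg p g * f := by
  funext w
  rw [sub_coeff, mul_coeff, mul_coeff, ← Finset.sum_sub_distrib]
  refine Finset.sum_congr rfl fun k _ => ?_
  rw [tau_coeff]
  by_cases h : f (w.drop k) = 0
  · rw [h]; ring
  · rw [hf _ h, mul_comm p]; ring

theorem bracket_hom_hom {p q : ℤ} {f g : NCSeries C} (hf : f ∈ hom deg p) (hg : g ∈ hom deg q) :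
    bracket deg f g = f * g - (-1 : ℚ) ^ (p * q) • (g * f) := by
  rw [bracket_of_mem_hom hf, tau_of_mem_hom hg, smul_mul_assoc]

theorem bracket_of_mem_hom_zero {f : NCSeries C} (hf : f ∈ hom deg 0) (g : NCSeries C) :
    bracket deg f g = comm f g := by
  rw [bracket_of_mem_hom hf, tau_zero, comm_apply]

theorem bracket_mem_hom {p q : ℤ} {f g : NCSeries C} (hf : f ∈ hom deg p)
    (hg : g ∈ hom deg q) : bracket deg f g ∈ hom deg (p + q) := by
  rw [bracket_hom_hom hf hg]
  refine sub_mem (mul_mem_hom hf hg) (Submodule.smul_mem _ _ ?_)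
  rw [add_comm]
  exact mul_mem_hom hg hf

/-- The graded commutator of series that are homogeneous for a second grading. -/
theorem bracket_mem_hom' {wt : C → ℤ} {p q : ℤ} {f g : NCSeries C} (hf : f ∈ hom wt p)
    (hg : g ∈ hom wt q) : bracket deg f g ∈ hom wt (p + q) := by
  intro w hw
  obtain ⟨k, -, hk⟩ := Finset.exists_ne_zero_of_sum_ne_zero hw
  rw [← wdeg_take_add_drop wt w k]
  by_cases h1 : f (w.take k) * g (w.drop k) = 0
  · have h2 : g (w.take k) * f (w.drop k) ≠ 0 := by
      intro h2
      exact hk (by rw [h1, h2, mul_zero, sub_zero])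
    rw [hg _ (left_ne_zero_of_mul h2), hf _ (right_ne_zero_of_mul h2), add_comm]
  · rw [hf _ (left_ne_zero_of_mul h1), hg _ (right_ne_zero_of_mul h1)]

theorem comm_mem_hom {n : ℤ} {e f : NCSeries C} (he : e ∈ hom deg 0) (hf : f ∈ hom deg n) :
    comm e f ∈ hom deg n := by
  rw [← bracket_of_mem_hom_zero he, ← zero_add n]
  exact bracket_mem_hom he hf

theorem comm_pow_mem_hom {n : ℤ} {e f : NCSeries C} (he : e ∈ hom deg 0) (hf : f ∈ hom deg n)
    (k : ℕ) : (comm e ^ k) f ∈ hom deg n := by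
  induction k with
  | zero => exact hf
  | succ k ih => rw [pow_succ', Module.End.mul_apply]; exact comm_mem_hom he ih

theorem opSeries_comm_mem_hom {n : ℤ} {e f : NCSeries C} (he : e ∈ hom deg 0)
    (hf : f ∈ hom deg n) (p : PowerSeries ℚ) : opSeries p (comm e) f ∈ hom deg n :=
  lsum_mem_hom fun k => Submodule.smul_mem _ _ (comm_pow_mem_hom he hf k)

theorem bracket_iterate {e : NCSeries C} (he : e ∈ hom deg 0) (k : ℕ) (f : NCSeries C) :
    (bracket deg e)^[k] f = (comm e ^ k) f := by
  induction k with
  | zero => rfl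
  | succ k ih =>
    rw [Function.iterate_succ_apply', ih, bracket_of_mem_hom_zero he, pow_succ',
      Module.End.mul_apply]

theorem expAd_eq_opSeries {e : NCSeries C} (he : e ∈ hom deg 0) (f : NCSeries C) :
    expAd deg e f = opSeries (PowerSeries.exp ℚ) (comm e) f := by
  funext w
  simp only [expAd, bracket_iterate he, opSeries_apply, lsum, smul_coeff, PowerSeries.coeff_exp]
  rfl

theorem expAd_eq {e : NCSeries C} (he : e ∈ hom deg 0) (he' : e ∈ fil C 1) (f : NCSeries C) :
    expAd deg e f = exp e * f * exp (-e) := by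
  rw [expAd_eq_opSeries he, opSeries_exp_comm he']

theorem edgeDiff_eq {e : NCSeries C} (he : e ∈ hom deg 0) (a b : NCSeries C) :
    edgeDiff deg e a b = comm e b + opSeries (bernoulliPowerSeries ℚ) (comm e) (b - a) := by
  funext w
  rw [add_coeff, ← bracket_of_mem_hom_zero he]
  simp only [edgeDiff, bracket_iterate he, opSeries_apply, lsum, smul_coeff, bernoulliPowerSeries,
    PowerSeries.coeff_mk]
  rfl

theorem flow_eq {d : lieAlg deg →ₗ[ℚ] lieAlg deg} {e : lieAlg deg}
    (he : (e : NCSeries C) ∈ hom deg 0) (he' : (e : NCSeries C) ∈ fil C 1) (a : lieAlg deg) :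
    flow d e a = exp (-(e : NCSeries C)) * a * exp (e : NCSeries C)
      + opSeries expQuot (comm (e : NCSeries C)) (d e) := by
  funext w
  have h := expAd_eq (neg_mem he) (neg_mem he') (a : NCSeries C)
  rw [neg_neg] at h
  rw [add_coeff, ← h]
  simp only [flow, bracket_iterate he, opSeries_apply, lsum, smul_coeff, expQuot,
    PowerSeries.coeff_mk]

/-! Lie series. -/

/-- Iterated brackets of letters. -/
inductive LieMono (deg : C → ℤ) (S : Set C) : NCSeries C → Prop
  | letter : ∀ c ∈ S, LieMono deg S (letter c)
  | bracket : ∀ f g, LieMono deg S f → LieMono deg S g → LieMono deg S (bracket deg f g)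

variable {S S' : Set C}

theorem LieMono.mem_freeLie {f : NCSeries C} (hf : LieMono deg S f) : f ∈ freeLie deg S := by
  induction hf with
  | letter c hc => exact letter_mem_freeLie deg hc
  | bracket f g _ _ ihf ihg => exact bracket_mem_freeLie deg ihf ihg

theorem LieMono.mem_hom {f : NCSeries C} (hf : LieMono deg S f) (wt : C → ℤ) :
    ∃ n, f ∈ hom wt n := by
  induction hf with
  | letter c _ => exact ⟨wt c, letter_mem_hom c⟩
  | bracket f g _ _ ihf ihg =>
    obtain ⟨p, hp⟩ := ihf
    obtain ⟨q, hq⟩ := ihg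
    exact ⟨p + q, bracket_mem_hom' hp hq⟩

theorem LieMono.mono {f : NCSeries C} (hf : LieMono deg S f) (h : S ⊆ S') : LieMono deg S' f := by
  induction hf with
  | letter c hc => exact .letter c (h hc)
  | bracket f g _ _ ihf ihg => exact .bracket f g ihf ihg

/-- By bilinearity the span of the iterated brackets is closed under the bracket. Linear statements
about Lie elements can therefore be proved by induction on iterated brackets, which are homogeneous.
-/
theorem freeLie_eq_span (deg : C → ℤ) (S : Set C) :
    freeLie deg S = Submodule.span ℚ {f | LieMono deg S f} := by
  apply le_antisymm
  · refine sInf_le ⟨fun c hc => Submodule.subset_span (.letter c hc), fun f hf g hg => ?_⟩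
    have h : ∀ g', LieMono deg S g' →
        bracket deg f g' ∈ Submodule.span ℚ {f | LieMono deg S f} := by
      intro g' hg'
      have : Submodule.span ℚ {f | LieMono deg S f}
          ≤ (Submodule.span ℚ {f | LieMono deg S f}).comap ((brk deg).flip g') :=
        Submodule.span_le.2 fun f' hf' => Submodule.subset_span (.bracket f' g' hf' hg')
      exact this hf
    have : Submodule.span ℚ {f | LieMono deg S f}
        ≤ (Submodule.span ℚ {f | LieMono deg S f}).comap (brk deg f) :=
      Submodule.span_le.2 h
    exact this hg
  · exact Submodule.span_le.2 fun f hf => hf.mem_freeLie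

theorem freeLie_le {L : Submodule ℚ (NCSeries C)} (h : ∀ f, LieMono deg S f → f ∈ L) :
    freeLie deg S ≤ L := by
  rw [freeLie_eq_span]
  exact Submodule.span_le.2 h

/-- The Lie series in the letters of `S`. -/
def lieSer (deg : C → ℤ) (S : Set C) : Submodule ℚ (NCSeries C) where
  carrier := {f | IsLieSeries deg S f}
  zero_mem' m := by rw [lenPart_zero]; exact zero_mem _
  add_mem' hf hg m := by rw [lenPart_add]; exact add_mem (hf m) (hg m)
  smul_mem' r f hf m := by rw [lenPart_smul]; exact Submodule.smul_mem _ _ (hf m)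

/-- Lie series form a closed subspace, because the part of length `m` is already visible modulo
longer words. -/
theorem lieSer_of_forall {f : NCSeries C} (h : ∀ m, ∃ g ∈ lieSer deg S, f - g ∈ fil C m) :
    f ∈ lieSer deg S := by
  intro m
  obtain ⟨g, hg, hfg⟩ := h (m + 1)
  have : lenPart m f = lenPart m g := by
    funext w
    simp only [lenPart]
    split_ifs with hw
    · exact coeff_eq_of_sub_mem_fil hfg (by omega)
    · rfl
  rw [this]
  exact hg m

/-- Iterated brackets of letters are homogeneous for every weight, so a component keeps or kills
each of them. -/
theorem component_mem_freeLie (wt : C → ℤ) (n : ℤ) {f : NCSeries C} (hf : f ∈ freeLie deg S) :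
    component wt n f ∈ freeLie deg S := by
  have : freeLie deg S ≤ (freeLie deg S).comap (component wt n) := by
    refine freeLie_le fun g hg => ?_
    obtain ⟨m, hm⟩ := hg.mem_hom wt
    rw [Submodule.mem_comap]
    by_cases h : m = n
    · rw [component_of_mem_hom (h ▸ hm)]
      exact hg.mem_freeLie
    · rw [component_of_mem_hom_ne h hm]
      exact zero_mem _
  exact this hf

theorem freeLie_le_lieSer : freeLie deg S ≤ lieSer deg S := fun f hf m => by
  rw [lenPart_eq_component]
  exact component_mem_freeLie _ _ hf

theorem LieMono.mem_lieSer {f : NCSeries C} (hf : LieMono deg S f) : f ∈ lieSer deg S :=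
  freeLie_le_lieSer hf.mem_freeLie

theorem letter_mem_lieSer {c : C} (hc : c ∈ S) : letter c ∈ lieSer deg S :=
  (LieMono.letter c hc).mem_lieSer

theorem component_mem_lieSer (wt : C → ℤ) (n : ℤ) {f : NCSeries C} (hf : f ∈ lieSer deg S) :
    component wt n f ∈ lieSer deg S := by
  intro m
  have : lenPart m (component wt n f) = component wt n (lenPart m f) := by
    funext w
    simp only [lenPart, component_coeff]
    split_ifs <;> rfl
  rw [this]
  exact component_mem_freeLie _ _ (hf m)

theorem bracket_mem_lieSer {f g : NCSeries C} (hf : f ∈ lieSer deg S) (hg : g ∈ lieSer deg S) :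
    bracket deg f g ∈ lieSer deg S := by
  intro m
  rw [lenPart_bracket]
  exact Submodule.sum_mem _ fun i _ => bracket_mem_freeLie deg (hf i) (hg _)

theorem freeLie_mono (h : S ⊆ S') : freeLie deg S ≤ freeLie deg S' :=
  freeLie_le fun _ hf => (hf.mono h).mem_freeLie

theorem lieSer_mono (h : S ⊆ S') : lieSer deg S ≤ lieSer deg S' :=
  fun _ hf m => freeLie_mono h (hf m)

theorem lieSer_le_fil : lieSer deg S ≤ fil C 1 := by
  have h : freeLie deg S ≤ fil C 1 := by
    refine freeLie_le fun f hf => ?_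
    induction hf with
    | letter c _ => exact letter_mem_fil c
    | bracket f g _ _ ihf ihg => exact fil_anti (by omega) (bracket_mem_fil ihf ihg)
  intro f hf
  rw [mem_fil_one]
  exact h (hf 0) [] (by simp)

theorem lsum_mem_lieSer {F : ℕ → NCSeries C} (hF : ∀ k, F k ∈ fil C k)
    (h : ∀ k, F k ∈ lieSer deg S) : lsum F ∈ lieSer deg S :=
  lieSer_of_forall fun m => ⟨_, sum_mem fun k _ => h k, lsum_sub_mem_fil hF m⟩

theorem map_mem_lieSer {deg' : C' → ℤ} {T : Set C'} {F : NCSeries C →ₗ[ℚ] NCSeries C'}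
    (hF : IsFilt F) (h : ∀ f, LieMono deg S f → F f ∈ lieSer deg' T) {f : NCSeries C}
    (hf : f ∈ lieSer deg S) : F f ∈ lieSer deg' T := by
  rw [← lsum_lenPart f, hF.map_lsum fun k => lenPart_mem_fil k f]
  refine lsum_mem_lieSer (fun k => hF _ _ (lenPart_mem_fil k f)) fun k => ?_
  have : freeLie deg S ≤ (lieSer deg' T).comap F := freeLie_le h
  exact this (hf k)

theorem eq_on_lieSer {F G : NCSeries C →ₗ[ℚ] NCSeries C'} (hF : IsFilt F) (hG : IsFilt G)
    (h : ∀ f, LieMono deg S f → F f = G f) {f : NCSeries C} (hf : f ∈ lieSer deg S) :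
    F f = G f := by
  rw [← lsum_lenPart f, hF.map_lsum fun k => lenPart_mem_fil k f,
    hG.map_lsum fun k => lenPart_mem_fil k f]
  congr 1
  funext k
  have : freeLie deg S ≤ LinearMap.eqLocus F G := freeLie_le h
  exact this (hf k)

theorem comm_pow_mem_lieSer {e f : NCSeries C} (he : e ∈ hom deg 0) (he' : e ∈ lieSer deg S)
    (hf : f ∈ lieSer deg S) (k : ℕ) : (comm e ^ k) f ∈ lieSer deg S := by
  induction k with
  | zero => exact hf
  | succ k ih =>
    rw [pow_succ', Module.End.mul_apply, ← bracket_of_mem_hom_zero he]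
    exact bracket_mem_lieSer he' ih

theorem opSeries_comm_mem_lieSer {e f : NCSeries C} (he : e ∈ hom deg 0) (he' : e ∈ lieSer deg S)
    (hf : f ∈ lieSer deg S) (p : PowerSeries ℚ) : opSeries p (comm e) f ∈ lieSer deg S :=
  lsum_mem_lieSer (opSeries_term_mem (comm_isRaise (lieSer_le_fil he')) p f) fun k =>
    Submodule.smul_mem _ _ (comm_pow_mem_lieSer he he' hf k)

theorem expAd_mem_lieSer {e f : NCSeries C} (he : e ∈ hom deg 0) (he' : e ∈ lieSer deg S)
    (hf : f ∈ lieSer deg S) : expAd deg e f ∈ lieSer deg S := by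
  rw [expAd_eq_opSeries he]
  exact opSeries_comm_mem_lieSer he he' hf _

theorem expAd_mem_hom {n : ℤ} {e f : NCSeries C} (he : e ∈ hom deg 0) (hf : f ∈ hom deg n) :
    expAd deg e f ∈ hom deg n := by
  rw [expAd_eq_opSeries he]
  exact opSeries_comm_mem_hom he hf _

theorem edgeDiff_mem_lieSer {e a b : NCSeries C} (he : e ∈ hom deg 0) (he' : e ∈ lieSer deg S)
    (ha : a ∈ lieSer deg S) (hb : b ∈ lieSer deg S) : edgeDiff deg e a b ∈ lieSer deg S := by
  rw [edgeDiff_eq he, ← bracket_of_mem_hom_zero he]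
  exact add_mem (bracket_mem_lieSer he' hb) (opSeries_comm_mem_lieSer he he' (sub_mem hb ha) _)

theorem edgeDiff_mem_hom {n : ℤ} {e a b : NCSeries C} (he : e ∈ hom deg 0) (ha : a ∈ hom deg n)
    (hb : b ∈ hom deg n) : edgeDiff deg e a b ∈ hom deg n := by
  rw [edgeDiff_eq he]
  exact add_mem (comm_mem_hom he hb) (opSeries_comm_mem_hom he (sub_mem hb ha) _)

/-- An element of the complete free graded Lie algebra from a homogeneous Lie series. -/
theorem mem_lieAlg {n : ℤ} {f : NCSeries C} (hf : f ∈ lieSer deg S) (hn : f ∈ hom deg n) :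
    f ∈ lieAlg deg :=
  ⟨lieSer_mono (Set.subset_univ S) hf, n.natAbs, fun w hw => by rw [hn w hw]; simp⟩

theorem lieAlg_le_lieSer {f : NCSeries C} (hf : f ∈ lieAlg deg) : f ∈ lieSer deg Set.univ := hf.1

theorem component_mem_lieAlg (n : ℤ) {f : NCSeries C} (hf : f ∈ lieAlg deg) :
    component deg n f ∈ lieAlg deg :=
  mem_lieAlg (component_mem_lieSer deg n (lieAlg_le_lieSer hf)) (component_mem_hom n f)

/-- The elements of the complete free graded Lie algebra are finite sums of homogeneous ones. -/
theorem exists_eq_sum_component {f : NCSeries C} (hf : f ∈ lieAlg deg) :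
    ∃ N : ℕ, f = ∑ n ∈ Finset.Icc (-(N : ℤ)) N, component deg n f := by
  obtain ⟨-, N, hN⟩ := hf
  refine ⟨N, ?_⟩
  funext w
  simp only [sum_coeff, component_coeff, Finset.sum_ite_eq]
  split_ifs with h
  · rfl
  · by_contra h'
    exact h (Finset.mem_Icc.2 (abs_le.1 (hN w h')))

/-- The projection to degree `n` kills all other degrees, which gives independence. The gradation
spans because elements of `lieAlg` have bounded degree and hence finitely many components. -/
theorem isInternal_gr (deg : C → ℤ) : DirectSum.IsInternal (gr deg) := by
  classical
  rw [DirectSum.isInternal_submodule_iff_iSupIndep_and_iSup_eq_top]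
  constructor
  · rw [iSupIndep_def]
    intro n
    rw [Submodule.disjoint_def]
    intro f hf hf'
    have key : (⨆ j, ⨆ (_ : j ≠ n), gr deg j)
        ≤ (LinearMap.ker (component deg n)).comap (lieAlg deg).subtype := by
      refine iSup_le fun j => iSup_le fun hj g hg => ?_
      exact component_of_mem_hom_ne hj hg
    have h := key hf'
    apply Subtype.ext
    rw [← component_of_mem_hom (f := (f : NCSeries C)) hf]
    exact h
  · rw [eq_top_iff]
    intro f _
    obtain ⟨N, hN⟩ := exists_eq_sum_component f.2
    have : f = ∑ n ∈ Finset.Icc (-(N : ℤ)) N,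
        (⟨component deg n f, component_mem_lieAlg n f.2⟩ : lieAlg deg) := by
      apply Subtype.ext
      rw [AddSubmonoidClass.coe_finsetSum]
      exact hN
    rw [this]
    exact sum_mem fun n _ => Submodule.mem_iSup_of_mem n (component_mem_hom n _)

end NCSeries

namespace NCSeries

open scoped NCSeries.Ring

variable {C C' C₂ ι : Type}

/-! Continuous algebra homomorphisms and substitution. -/

/-- The continuous algebra homomorphisms. -/
structure IsAlgHom (Φ : NCSeries C →ₗ[ℚ] NCSeries C') : Prop where
  filt : IsFilt Φ
  map_one : Φ 1 = 1
  map_mul : ∀ f g, Φ (f * g) = Φ f * Φ g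

namespace IsAlgHom

variable {Φ Ψ : NCSeries C →ₗ[ℚ] NCSeries C'} {x y : NCSeries C}

theorem comp {Φ' : NCSeries C' →ₗ[ℚ] NCSeries C₂} (hΦ' : IsAlgHom Φ') (hΦ : IsAlgHom Φ) :
    IsAlgHom (Φ'.comp Φ) where
  filt := hΦ'.filt.comp hΦ.filt
  map_one := by rw [LinearMap.comp_apply, hΦ.map_one, hΦ'.map_one]
  map_mul f g := by simp only [LinearMap.comp_apply, hΦ.map_mul, hΦ'.map_mul]

theorem id : IsAlgHom (LinearMap.id : NCSeries C →ₗ[ℚ] NCSeries C) where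
  filt := IsFilt.id
  map_one := rfl
  map_mul _ _ := rfl

theorem map_exp (hΦ : IsAlgHom Φ) (hx : x ∈ fil C 1) : Φ (exp x) = exp (Φ x) :=
  NCSeries.map_exp hΦ.filt hΦ.map_one hΦ.map_mul hx

theorem map_bch (hΦ : IsAlgHom Φ) (hx : x ∈ fil C 1) (hy : y ∈ fil C 1) :
    Φ (bch x y) = bch (Φ x) (Φ y) :=
  NCSeries.map_bch hΦ.filt hΦ.map_one hΦ.map_mul hx hy

theorem map_bchList (hΦ : IsAlgHom Φ) {l : List (NCSeries C)} (hl : ∀ x ∈ l, x ∈ fil C 1) :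
    Φ (bchList l) = bchList (l.map Φ) :=
  NCSeries.map_bchList hΦ.filt hΦ.map_one hΦ.map_mul hl

theorem map_mu2 (hΦ : IsAlgHom Φ) (hx : x ∈ fil C 1) (hy : y ∈ fil C 1) :
    Φ (mu2 x y) = mu2 (Φ x) (Φ y) := by
  rw [mu2, hΦ.map_bch hx (Submodule.smul_mem _ _ (bch_mem_fil _ _)), map_smul,
    hΦ.map_bch (neg_mem hx) hy, map_neg, mu2]

theorem map_prod (hΦ : IsAlgHom Φ) (l : List (NCSeries C)) : Φ l.prod = (l.map Φ).prod := by
  induction l with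
  | nil => exact hΦ.map_one
  | cons f l ih => rw [List.prod_cons, hΦ.map_mul, ih, List.map_cons, List.prod_cons]

theorem map_comm (hΦ : IsAlgHom Φ) (x f : NCSeries C) : Φ (comm x f) = comm (Φ x) (Φ f) := by
  rw [comm_apply, map_sub, hΦ.map_mul, hΦ.map_mul, comm_apply]

theorem mono_eq_prod (u : List C) : (mono u : NCSeries C) = (u.map letter).prod := by
  induction u with
  | nil => rfl
  | cons c u ih => rw [mono_cons, ih, List.map_cons, List.prod_cons]

theorem ext [Finite C] (hΦ : IsAlgHom Φ) (hΨ : IsAlgHom Ψ)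
    (h : ∀ c, Φ (letter c) = Ψ (letter c)) : Φ = Ψ := by
  refine hΦ.filt.ext hΨ.filt fun u => ?_
  rw [mono_eq_prod, hΦ.map_prod, hΨ.map_prod, List.map_map, List.map_map]
  congr 1
  exact List.map_congr_left fun c _ => h c

end IsAlgHom

theorem lin_mem_hom [Fintype ι] {deg : ι → ℤ} {deg' : C → ℤ} {K : List ι → NCSeries C} {s n : ℤ}
    (hK : ∀ u, K u ∈ hom deg' (wdeg deg u + s)) {f : NCSeries ι} (hf : f ∈ hom deg n) :
    lin K f ∈ hom deg' (n + s) := by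
  rw [lin_apply]
  refine lsum_mem_hom fun k => sum_mem fun u _ => ?_
  by_cases h : f (List.ofFn u) = 0
  · rw [h, zero_smul]
    exact zero_mem _
  · have := hK (List.ofFn u)
    rw [hf _ h] at this
    exact Submodule.smul_mem _ _ this

section Subst

variable [Fintype ι] {x : ι → NCSeries C}

/-- Substitution of the series `x i` for the letters `i`. -/
noncomputable def substHom (x : ι → NCSeries C) : NCSeries ι →ₗ[ℚ] NCSeries C :=
  lin fun u => (u.map x).prod

theorem subst_eq (P : NCSeries ι) (x : ι → NCSeries C) : subst P x = substHom x P := by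
  funext w
  rw [substHom, lin_coeff]
  simp only [subst, prod_eq]

omit [Fintype ι] in
theorem map_prod_mem_fil (hx : ∀ i, x i ∈ fil C 1) (u : List ι) :
    (u.map x).prod ∈ fil C u.length := by
  have := prod_mem_fil (l := u.map x) (by
    intro f hf
    obtain ⟨i, -, rfl⟩ := List.mem_map.1 hf
    exact hx i)
  rwa [List.length_map] at this

theorem substHom_mono (hx : ∀ i, x i ∈ fil C 1) (u : List ι) :
    substHom x (mono u) = (u.map x).prod :=
  lin_mono (map_prod_mem_fil hx) u

theorem substHom_letter (hx : ∀ i, x i ∈ fil C 1) (i : ι) : substHom x (letter i) = x i := by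
  have := substHom_mono hx [i]
  rwa [List.map_cons, List.map_nil, List.prod_singleton] at this

/-- By continuity in each factor, multiplicativity need only be checked on words, where it is
concatenation. -/
theorem substHom_isAlgHom (hx : ∀ i, x i ∈ fil C 1) : IsAlgHom (substHom x) := by
  have hF : IsFilt (substHom x) := lin_isFilt (map_prod_mem_fil hx)
  refine ⟨hF, substHom_mono hx [], fun f g => ?_⟩
  refine IsFilt.ext₂ (L := fun f => (substHom x).comp (LinearMap.mulLeft ℚ f))
    (L' := fun f => (LinearMap.mulLeft ℚ (substHom x f)).comp (substHom x))
    (R := fun g => (substHom x).comp (LinearMap.mulRight ℚ g))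
    (R' := fun g => (LinearMap.mulRight ℚ (substHom x g)).comp (substHom x))
    (fun f => hF.comp (IsFilt.mulLeft f)) (fun f => (IsFilt.mulLeft _).comp hF)
    (fun g => hF.comp (IsFilt.mulRight g)) (fun g => (IsFilt.mulRight _).comp hF)
    (fun _ _ => rfl) (fun _ _ => rfl) (fun u v => ?_) f g
  change substHom x (mono u * mono v) = substHom x (mono u) * substHom x (mono v)
  rw [mono_mul_mono, substHom_mono hx, substHom_mono hx, substHom_mono hx, List.map_append,
    List.prod_append]

theorem IsAlgHom.eq_substHom {Φ : NCSeries ι →ₗ[ℚ] NCSeries C} (hΦ : IsAlgHom Φ)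
    (hx : ∀ i, x i ∈ fil C 1) (h : ∀ i, Φ (letter i) = x i) : Φ = substHom x :=
  hΦ.ext (substHom_isAlgHom hx) fun i => by rw [h, substHom_letter hx]

theorem IsAlgHom.map_substHom {Φ : NCSeries C →ₗ[ℚ] NCSeries C'} (hΦ : IsAlgHom Φ)
    (hx : ∀ i, x i ∈ fil C 1) (P : NCSeries ι) :
    Φ (substHom x P) = substHom (fun i => Φ (x i)) P := by
  have hx' : ∀ i, Φ (x i) ∈ fil C' 1 := fun i => hΦ.filt _ _ (hx i)
  exact LinearMap.congr_fun ((hΦ.comp (substHom_isAlgHom hx)).eq_substHom hx' fun i => by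
    rw [LinearMap.comp_apply, substHom_letter hx]) P

theorem substHom_id (P : NCSeries ι) : substHom letter P = P :=
  (LinearMap.congr_fun (IsAlgHom.id.eq_substHom letter_mem_fil fun _ => rfl) P).symm

end Subst

/-! ### Graded homomorphisms. -/

/-- The continuous algebra homomorphisms that preserve degrees. -/
structure IsGradedHom (deg : C → ℤ) (deg' : C' → ℤ) (Φ : NCSeries C →ₗ[ℚ] NCSeries C') : Prop
    extends IsAlgHom Φ where
  map_hom : ∀ n f, f ∈ hom deg n → Φ f ∈ hom deg' n

namespace IsGradedHom

variable {deg : C → ℤ} {deg' : C' → ℤ} {Φ : NCSeries C →ₗ[ℚ] NCSeries C'} {S : Set C} {T : Set C'}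

theorem map_tau [Finite C] (hΦ : IsGradedHom deg deg' Φ) (p : ℤ) (f : NCSeries C) :
    Φ (tau deg p f) = tau deg' p (Φ f) := by
  have key : Φ.comp (tau deg p) = (tau deg' p).comp Φ := by
    refine (hΦ.filt.comp (tau_isFilt p)).ext ((tau_isFilt p).comp hΦ.filt) fun u => ?_
    rw [LinearMap.comp_apply, LinearMap.comp_apply, tau_of_mem_hom (mono_mem_hom u), map_smul,
      tau_of_mem_hom (hΦ.map_hom _ _ (mono_mem_hom u))]
  exact LinearMap.congr_fun key f

theorem map_bracket [Finite C] (hΦ : IsGradedHom deg deg' Φ) (f g : NCSeries C) :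
    Φ (bracket deg f g) = bracket deg' (Φ f) (Φ g) := by
  refine IsFilt.ext₂ (L := fun f => Φ.comp (brk deg f))
    (L' := fun f => (brk deg' (Φ f)).comp Φ)
    (R := fun g => Φ.comp ((brk deg).flip g))
    (R' := fun g => ((brk deg').flip (Φ g)).comp Φ)
    (fun f => hΦ.filt.comp (brk_isFilt f)) (fun f => (brk_isFilt _).comp hΦ.filt)
    (fun g => hΦ.filt.comp (brk_flip_isFilt g)) (fun g => (brk_flip_isFilt _).comp hΦ.filt)
    (fun _ _ => rfl) (fun _ _ => rfl) (fun u v => ?_) f g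
  change Φ (bracket deg (mono u) (mono v)) = bracket deg' (Φ (mono u)) (Φ (mono v))
  have hu := mono_mem_hom (deg := deg) u
  have hv := mono_mem_hom (deg := deg) v
  rw [bracket_hom_hom hu hv, bracket_hom_hom (hΦ.map_hom _ _ hu) (hΦ.map_hom _ _ hv), map_sub,
    map_smul, hΦ.map_mul, hΦ.map_mul]

theorem map_lieSer [Finite C] (hΦ : IsGradedHom deg deg' Φ)
    (h : ∀ c ∈ S, Φ (letter c) ∈ lieSer deg' T) {f : NCSeries C} (hf : f ∈ lieSer deg S) :
    Φ f ∈ lieSer deg' T := by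
  refine map_mem_lieSer hΦ.filt (fun g hg => ?_) hf
  induction hg with
  | letter c hc => exact h c hc
  | bracket f g _ _ ihf ihg =>
    rw [hΦ.map_bracket]
    exact bracket_mem_lieSer ihf ihg

theorem map_expAd (hΦ : IsGradedHom deg deg' Φ) {e : NCSeries C} (he : e ∈ hom deg 0)
    (he' : e ∈ fil C 1) (f : NCSeries C) : Φ (expAd deg e f) = expAd deg' (Φ e) (Φ f) := by
  rw [expAd_eq he he', expAd_eq (hΦ.map_hom _ _ he) (hΦ.filt _ _ he'), hΦ.map_mul, hΦ.map_mul,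
    hΦ.map_exp he', hΦ.map_exp (neg_mem he'), map_neg]

theorem map_opSeries (hΦ : IsGradedHom deg deg' Φ) {e : NCSeries C} (he' : e ∈ fil C 1)
    (p : PowerSeries ℚ) (f : NCSeries C) :
    Φ (opSeries p (comm e) f) = opSeries p (comm (Φ e)) (Φ f) :=
  opSeries_comm hΦ.filt (comm_isRaise he') (hΦ.map_comm e) p f

theorem map_edgeDiff (hΦ : IsGradedHom deg deg' Φ) {e : NCSeries C} (he : e ∈ hom deg 0)
    (he' : e ∈ fil C 1) (a b : NCSeries C) :
    Φ (edgeDiff deg e a b) = edgeDiff deg' (Φ e) (Φ a) (Φ b) := by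
  rw [edgeDiff_eq he, edgeDiff_eq (hΦ.map_hom _ _ he), map_add, hΦ.map_comm, hΦ.map_opSeries he',
    map_sub]

end IsGradedHom

theorem substHom_isGradedHom [Fintype ι] {deg : ι → ℤ} {deg' : C → ℤ} {x : ι → NCSeries C}
    (hx : ∀ i, x i ∈ fil C 1) (hx' : ∀ i, x i ∈ hom deg' (deg i)) :
    IsGradedHom deg deg' (substHom x) := by
  refine ⟨substHom_isAlgHom hx, fun n f hf => ?_⟩
  rw [← add_zero n]
  refine lin_mem_hom (fun u => ?_) hf
  rw [add_zero]
  induction u with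
  | nil => exact one_mem_hom
  | cons c u ih =>
    rw [List.map_cons, List.prod_cons, wdeg_cons]
    exact mul_mem_hom (hx' c) ih

/-! The action of noncommutative power series through adjoint operators. -/

section ActAd

variable [Fintype ι] {deg : C → ℤ} {y : ι → NCSeries C}

omit [Fintype ι] in
theorem foldr_bracket_mem_fil (hy : ∀ i, y i ∈ fil C 1) {m : ℕ} {z : NCSeries C}
    (hz : z ∈ fil C m) (u : List ι) :
    u.foldr (fun i g => bracket deg (y i) g) z ∈ fil C (u.length + m) := by
  induction u with
  | nil => simpa using hz
  | cons i u ih =>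
    rw [List.foldr_cons, List.length_cons]
    exact fil_anti (by omega) (bracket_mem_fil (hy i) ih)

omit [Fintype ι] in
theorem foldr_bracket_add (y : ι → NCSeries C) (z z' : NCSeries C) (u : List ι) :
    u.foldr (fun i g => bracket deg (y i) g) (z + z')
      = u.foldr (fun i g => bracket deg (y i) g) z
        + u.foldr (fun i g => bracket deg (y i) g) z' := by
  induction u with
  | nil => rfl
  | cons i u ih =>
    simp only [List.foldr_cons, ih]
    exact map_add (brk deg (y i)) _ _

omit [Fintype ι] in
theorem foldr_bracket_smul (y : ι → NCSeries C) (r : ℚ) (z : NCSeries C) (u : List ι) :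
    u.foldr (fun i g => bracket deg (y i) g) (r • z)
      = r • u.foldr (fun i g => bracket deg (y i) g) z := by
  induction u with
  | nil => rfl
  | cons i u ih =>
    simp only [List.foldr_cons, ih]
    exact map_smul (brk deg (y i)) _ _

/-- `P(ad y) z` as a bilinear map in `P` and `z`. -/
noncomputable def act (deg : C → ℤ) (y : ι → NCSeries C) :
    NCSeries ι →ₗ[ℚ] NCSeries C →ₗ[ℚ] NCSeries C :=
  LinearMap.mk₂ ℚ (fun P z => lin (fun u => u.foldr (fun i g => bracket deg (y i) g) z) P)
    (fun P P' z => map_add _ P P') (fun r P z => map_smul _ r P)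
    (fun P z z' => by
      simp only [lin_apply, foldr_bracket_add, smul_add, Finset.sum_add_distrib, lsum_add])
    (fun r P z => by
      simp only [lin_apply, foldr_bracket_smul, smul_comm _ r, ← Finset.smul_sum, lsum_smul])

theorem act_apply (y : ι → NCSeries C) (P : NCSeries ι) (z : NCSeries C) :
    act deg y P z = lin (fun u => u.foldr (fun i g => bracket deg (y i) g) z) P := rfl

theorem actAd_eq (P : NCSeries ι) (y : ι → NCSeries C) (z : NCSeries C) :
    actAd deg P y z = act deg y P z := by
  funext w
  rw [act_apply, lin_coeff]
  rfl

theorem act_mono (hy : ∀ i, y i ∈ fil C 1) (u : List ι) (z : NCSeries C) :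
    act deg y (mono u) z = u.foldr (fun i g => bracket deg (y i) g) z :=
  lin_mono (fun v => by simpa using foldr_bracket_mem_fil hy (fil_zero z) v) u

theorem act_letter (hy : ∀ i, y i ∈ fil C 1) (i : ι) (z : NCSeries C) :
    act deg y (letter i) z = bracket deg (y i) z :=
  act_mono hy [i] z

theorem act_one (hy : ∀ i, y i ∈ fil C 1) (z : NCSeries C) : act deg y 1 z = z :=
  act_mono hy [] z

theorem act_isFilt (hy : ∀ i, y i ∈ fil C 1) (P : NCSeries ι) : IsFilt (act deg y P) := by
  intro m z hz
  rw [act_apply, lin_apply]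
  exact lsum_mem_fil fun k => sum_mem fun u _ =>
    Submodule.smul_mem _ _ (fil_anti (by omega) (foldr_bracket_mem_fil hy hz _))

theorem act_flip_isFilt (hy : ∀ i, y i ∈ fil C 1) (z : NCSeries C) :
    IsFilt ((act deg y).flip z) :=
  lin_isFilt fun u => by simpa using foldr_bracket_mem_fil hy (fil_zero z) u

theorem act_mul (hy : ∀ i, y i ∈ fil C 1) (P Q : NCSeries ι) (z : NCSeries C) :
    act deg y (P * Q) z = act deg y P (act deg y Q z) := by
  refine IsFilt.ext₂ (L := fun P => ((act deg y).flip z).comp (LinearMap.mulLeft ℚ P))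
    (L' := fun P => (act deg y P).comp ((act deg y).flip z))
    (R := fun Q => ((act deg y).flip z).comp (LinearMap.mulRight ℚ Q))
    (R' := fun Q => (act deg y).flip (act deg y Q z))
    (fun f => (act_flip_isFilt hy z).comp (IsFilt.mulLeft f))
    (fun f => (act_isFilt hy f).comp (act_flip_isFilt hy z))
    (fun g => (act_flip_isFilt hy z).comp (IsFilt.mulRight g)) (fun g => act_flip_isFilt hy _)
    (fun _ _ => rfl) (fun _ _ => rfl) (fun u v => ?_) P Q
  change act deg y (mono u * mono v) z = act deg y (mono u) (act deg y (mono v) z)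
  rw [mono_mul_mono, act_mono hy, act_mono hy, act_mono hy, List.foldr_append]

theorem map_act {Φ : NCSeries C →ₗ[ℚ] NCSeries C'} (hΦ : IsFilt Φ) {deg' : C' → ℤ}
    {y' : ι → NCSeries C'} (hy : ∀ i, y i ∈ fil C 1) (hy' : ∀ i, y' i ∈ fil C' 1)
    (h : ∀ i g, Φ (bracket deg (y i) g) = bracket deg' (y' i) (Φ g)) (P : NCSeries ι)
    (z : NCSeries C) : Φ (act deg y P z) = act deg' y' P (Φ z) := by
  have key : Φ.comp ((act deg y).flip z) = (act deg' y').flip (Φ z) := by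
    refine (hΦ.comp (act_flip_isFilt hy z)).ext (act_flip_isFilt hy' _) fun u => ?_
    change Φ (act deg y (mono u) z) = act deg' y' (mono u) (Φ z)
    rw [act_mono hy, act_mono hy']
    induction u with
    | nil => rfl
    | cons i u ih => rw [List.foldr_cons, h, ih, List.foldr_cons]
  exact LinearMap.congr_fun key P

theorem IsGradedHom.map_act [Finite C] {deg' : C' → ℤ} {Φ : NCSeries C →ₗ[ℚ] NCSeries C'}
    (hΦ : IsGradedHom deg deg' Φ) (hy : ∀ i, y i ∈ fil C 1) (P : NCSeries ι) (z : NCSeries C) :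
    Φ (act deg y P z) = act deg' (fun i => Φ (y i)) P (Φ z) :=
  NCSeries.map_act hΦ.filt hy (fun i => hΦ.filt _ _ (hy i)) (fun i g => hΦ.map_bracket (y i) g) P z

theorem act_mem_lieSer {S : Set C} (hy : ∀ i, y i ∈ lieSer deg S) (P : NCSeries ι)
    {z : NCSeries C} (hz : z ∈ lieSer deg S) : act deg y P z ∈ lieSer deg S := by
  have hy' : ∀ i, y i ∈ fil C 1 := fun i => lieSer_le_fil (hy i)
  rw [act_apply, lin_apply]
  refine lsum_mem_lieSer (fun k => sum_mem fun u _ => Submodule.smul_mem _ _ ?_) fun k =>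
    sum_mem fun u _ => Submodule.smul_mem _ _ ?_
  · simpa using foldr_bracket_mem_fil hy' (fil_zero z) (List.ofFn u)
  · induction List.ofFn u with
    | nil => exact hz
    | cons i l ih => exact bracket_mem_lieSer (hy i) ih

theorem act_mem_hom {n : ℤ} (hy : ∀ i, y i ∈ hom deg 0) (P : NCSeries ι)
    {z : NCSeries C} (hz : z ∈ hom deg n) : act deg y P z ∈ hom deg n := by
  rw [act_apply, lin_apply]
  refine lsum_mem_hom fun k => sum_mem fun u _ => Submodule.smul_mem _ _ ?_
  induction List.ofFn u with
  | nil => exact hz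
  | cons i l ih =>
    rw [List.foldr_cons, ← zero_add n]
    exact bracket_mem_hom (hy i) ih

theorem mem_hom_zero (f : NCSeries C) : f ∈ hom (fun _ => 0) 0 := fun w _ => by
  simp [wdeg]

/-- A Lie series acts by the adjoint action of its substitution. -/
theorem act_of_mem_lieSer (hy : ∀ i, y i ∈ fil C 1) (hy' : ∀ i, y i ∈ hom deg 0) {S : Set ι}
    {P : NCSeries ι} (hP : P ∈ lieSer (fun _ => 0) S) (z : NCSeries C) :
    act deg y P z = bracket deg (substHom y P) z := by
  have hs := substHom_isAlgHom hy
  refine eq_on_lieSer (F := (act deg y).flip z) (G := ((brk deg).flip z).comp (substHom y))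
    (act_flip_isFilt hy z) ((brk_flip_isFilt z).comp hs.filt) (fun f hf => ?_) hP
  change act deg y f z = bracket deg (substHom y f) z
  have hgr : IsGradedHom (fun _ => 0) deg (substHom y) := substHom_isGradedHom hy hy'
  induction hf generalizing z with
  | letter i _ => rw [act_letter hy, substHom_letter hy]
  | bracket f g _ _ ihf ihg =>
    have hf0 := hgr.map_hom 0 f (mem_hom_zero f)
    have hg0 := hgr.map_hom 0 g (mem_hom_zero g)
    rw [bracket_of_mem_hom_zero (mem_hom_zero f), comm_apply, map_sub, LinearMap.sub_apply,
      act_mul hy, act_mul hy, ihf, ihg, ihg, ihf, map_sub, hs.map_mul, hs.map_mul]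
    have h0 : substHom y f * substHom y g - substHom y g * substHom y f ∈ hom deg 0 :=
      sub_mem (by simpa using mul_mem_hom hf0 hg0) (by simpa using mul_mem_hom hg0 hf0)
    rw [bracket_of_mem_hom_zero hf0, bracket_of_mem_hom_zero hg0, bracket_of_mem_hom_zero hg0,
      bracket_of_mem_hom_zero hf0, bracket_of_mem_hom_zero h0]
    simp only [comm_apply]
    noncomm_ring

/-- Each `x k` acts by the adjoint action of its value, by `act_of_mem_lieSer`. That the `x k` are
Lie series is essential: a general series, such as the square of a letter, does not act through the
bracket with its value. -/
theorem act_substHom {κ : Type} [Fintype κ] (hy : ∀ i, y i ∈ fil C 1)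
    (hy' : ∀ i, y i ∈ hom deg 0) {x : κ → NCSeries ι}
    (hx : ∀ k, x k ∈ lieSer (fun _ => 0) Set.univ) (P : NCSeries κ) (z : NCSeries C) :
    act deg y (substHom x P) z = act deg (fun k => substHom y (x k)) P z := by
  have hx' : ∀ k, x k ∈ fil ι 1 := fun k => lieSer_le_fil (hx k)
  have hs := substHom_isAlgHom hy
  have hyx : ∀ k, substHom y (x k) ∈ fil C 1 := fun k => hs.filt _ _ (hx' k)
  have key : ((act deg y).flip z).comp (substHom x)
      = (act deg fun k => substHom y (x k)).flip z := by
    refine ((act_flip_isFilt hy z).comp (substHom_isAlgHom hx').filt).ext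
      (act_flip_isFilt hyx z) fun u => ?_
    change act deg y (substHom x (mono u)) z = act deg (fun k => substHom y (x k)) (mono u) z
    rw [substHom_mono hx', act_mono hyx]
    induction u with
    | nil => exact act_one hy z
    | cons k u ih =>
      rw [List.map_cons, List.prod_cons, act_mul hy, ih, List.foldr_cons,
        act_of_mem_lieSer hy hy' (hx k)]
  exact LinearMap.congr_fun key P

end ActAd

/-! Derivations. -/

/-- The continuous derivations with the sign rule of an operator of odd degree. -/
structure IsDer (deg : C → ℤ) (D : NCSeries C →ₗ[ℚ] NCSeries C) : Prop where
  filt : IsFilt D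
  leibniz : ∀ f g, D (f * g) = D f * g + tau deg 1 f * D g

namespace IsDer

variable {deg : C → ℤ} {D D' : NCSeries C →ₗ[ℚ] NCSeries C} {x : NCSeries C}

theorem map_one (hD : IsDer deg D) : D 1 = 0 := by
  have h := hD.leibniz 1 1
  rw [tau_of_mem_hom_zero one_mem_hom, mul_one, one_mul, mul_one] at h
  simpa using h

theorem leibniz_zero (hD : IsDer deg D) {f : NCSeries C} (hf : f ∈ hom deg 0) (g : NCSeries C) :
    D (f * g) = D f * g + f * D g := by
  rw [hD.leibniz, tau_of_mem_hom_zero hf]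

theorem map_pow (hD : IsDer deg D) (h : D x = 0) (k : ℕ) : D (x ^ k) = 0 := by
  induction k with
  | zero => exact hD.map_one
  | succ k ih => rw [pow_succ, hD.leibniz, ih, h, zero_mul, mul_zero, add_zero]

theorem map_exp (hD : IsDer deg D) (hx : x ∈ hom deg 0) (hx' : x ∈ fil C 1) :
    D (exp x) = exp x * opSeries expQuot (comm x) (D x) :=
  map_exp_of_derivation hD.filt hx' hD.map_one fun k => hD.leibniz_zero (pow_mem_hom hx k) x

theorem map_exp_eq_zero (hD : IsDer deg D) (hx : x ∈ hom deg 0) (hx' : x ∈ fil C 1)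
    (h : D x = 0) : D (exp x) = 0 := by
  rw [hD.map_exp hx hx', h, map_zero, mul_zero]

theorem map_log_eq_zero (hD : IsDer deg D) {g : NCSeries C} (hg' : g [] = 1)
    (h : D g = 0) : D (log g) = 0 := by
  rw [log_eq_ev]
  refine map_ev_of_forall_pow hD.filt (sub_one_mem_fil hg') (fun k => ?_) _
  exact hD.map_pow (by rw [map_sub, h, hD.map_one, sub_zero]) k

theorem eq_zero_of_map_exp (hD : IsDer deg D) (hx' : x ∈ fil C 1)
    (h : D (exp x) = 0) : D x = 0 := by
  rw [← log_exp hx']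
  exact hD.map_log_eq_zero (exp_coeff_nil x) h

theorem ext [Finite C] (hD : IsDer deg D) (hD' : IsDer deg D')
    (h : ∀ c, D (letter c) = D' (letter c)) : D = D' := by
  refine hD.filt.ext hD'.filt fun u => ?_
  induction u with
  | nil => rw [mono_nil, hD.map_one, hD'.map_one]
  | cons c u ih => rw [mono_cons, hD.leibniz, hD'.leibniz, h, ih]

theorem zero : IsDer deg (0 : NCSeries C →ₗ[ℚ] NCSeries C) where
  filt := fun _ _ _ => zero_mem _
  leibniz f g := by simp

/-- The derivation `f ↦ D f + [a, f]`, for `a` of odd degree. -/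
noncomputable def tw (deg : C → ℤ) (D : NCSeries C →ₗ[ℚ] NCSeries C) (a : NCSeries C) :
    NCSeries C →ₗ[ℚ] NCSeries C :=
  D + LinearMap.mulLeft ℚ a - (LinearMap.mulRight ℚ a).comp (tau deg 1)

theorem tw_apply (a f : NCSeries C) : tw deg D a f = D f + a * f - tau deg 1 f * a := rfl

theorem tw_isDer (hD : IsDer deg D) (a : NCSeries C) : IsDer deg (tw deg D a) where
  filt := (hD.filt.add (IsFilt.mulLeft a)).sub ((IsFilt.mulRight a).comp (tau_isFilt 1))
  leibniz f g := by
    simp only [tw_apply, hD.leibniz, tau_mul]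
    noncomm_ring

end IsDer

section MkDer

variable [Fintype C] (deg : C → ℤ) (v : C → NCSeries C)

/-- The values on words of the derivation with the values `v c` on the letters `c`. -/
noncomputable def derWord : List C → NCSeries C
  | [] => 0
  | c :: u => v c * mono u + tau deg 1 (letter c) * derWord u

/-- The derivation with the values `v c` on the letters `c`. -/
noncomputable def mkDer : NCSeries C →ₗ[ℚ] NCSeries C := lin (derWord deg v)

variable {deg v}

omit [Fintype C] in
theorem derWord_mem_fil (hv : ∀ c, v c ∈ fil C 1) (u : List C) :
    derWord deg v u ∈ fil C u.length := by
  induction u with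
  | nil => exact zero_mem _
  | cons c u ih =>
    rw [derWord, List.length_cons, add_comm]
    exact add_mem (mul_mem_fil (hv c) (mono_mem_fil u))
      (mul_mem_fil (tau_isFilt 1 _ _ (letter_mem_fil c)) ih)

omit [Fintype C] in
theorem derWord_append (u w : List C) :
    derWord deg v (u ++ w) = derWord deg v u * mono w + tau deg 1 (mono u) * derWord deg v w := by
  induction u with
  | nil =>
    rw [List.nil_append, derWord, zero_mul, zero_add, mono_nil, tau_of_mem_hom_zero one_mem_hom,
      one_mul]
  | cons c u ih =>
    rw [List.cons_append, derWord, ih, derWord, mono_cons, tau_mul, ← mono_mul_mono]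
    noncomm_ring

theorem mkDer_mono (hv : ∀ c, v c ∈ fil C 1) (u : List C) :
    mkDer deg v (mono u) = derWord deg v u :=
  lin_mono (derWord_mem_fil hv) u

theorem mkDer_letter (hv : ∀ c, v c ∈ fil C 1) (c : C) : mkDer deg v (letter c) = v c := by
  have := mkDer_mono (deg := deg) hv [c]
  rw [derWord, derWord, mul_zero, add_zero, mono_nil, mul_one] at this
  exact this

theorem mkDer_isDer (hv : ∀ c, v c ∈ fil C 1) : IsDer deg (mkDer deg v) := by
  have hF : IsFilt (mkDer deg v) := lin_isFilt (derWord_mem_fil hv)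
  refine ⟨hF, fun f g => ?_⟩
  refine IsFilt.ext₂ (L := fun f => (mkDer deg v).comp (LinearMap.mulLeft ℚ f))
    (L' := fun f => LinearMap.mulLeft ℚ (mkDer deg v f)
      + (LinearMap.mulLeft ℚ (tau deg 1 f)).comp (mkDer deg v))
    (R := fun g => (mkDer deg v).comp (LinearMap.mulRight ℚ g))
    (R' := fun g => (LinearMap.mulRight ℚ g).comp (mkDer deg v)
      + (LinearMap.mulRight ℚ (mkDer deg v g)).comp (tau deg 1))
    (fun f => hF.comp (IsFilt.mulLeft f))
    (fun f => (IsFilt.mulLeft _).add ((IsFilt.mulLeft _).comp hF))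
    (fun g => hF.comp (IsFilt.mulRight g))
    (fun g => ((IsFilt.mulRight g).comp hF).add ((IsFilt.mulRight _).comp (tau_isFilt 1)))
    (fun _ _ => rfl) (fun _ _ => rfl) (fun u w => ?_) f g
  change mkDer deg v (mono u * mono w)
    = mkDer deg v (mono u) * mono w + tau deg 1 (mono u) * mkDer deg v (mono w)
  rw [mono_mul_mono, mkDer_mono hv, mkDer_mono hv, mkDer_mono hv, derWord_append]

theorem mkDer_mem_hom {s : ℤ} (hv : ∀ c, v c ∈ hom deg (deg c + s)) {n : ℤ} {f : NCSeries C}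
    (hf : f ∈ hom deg n) : mkDer deg v f ∈ hom deg (n + s) := by
  refine lin_mem_hom (fun u => ?_) hf
  induction u with
  | nil => exact zero_mem _
  | cons c u ih =>
    rw [derWord, wdeg_cons]
    refine add_mem ?_ ?_
    · rw [add_right_comm]
      exact mul_mem_hom (hv c) (mono_mem_hom u)
    · rw [tau_of_mem_hom (letter_mem_hom c), smul_mul_assoc, add_assoc]
      exact Submodule.smul_mem _ _ (mul_mem_hom (letter_mem_hom c) ih)

end MkDer

end NCSeries

namespace NCSeries

open scoped NCSeries.Ring

variable {C C' ι : Type}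

/-! The Baker-Campbell-Hausdorff theorem. -/

/-- The derivation that multiplies words by their length. -/
def lengthOp (C : Type) : NCSeries C →ₗ[ℚ] NCSeries C where
  toFun f := fun w => (w.length : ℚ) * f w
  map_add' f g := by
    funext w
    exact mul_add _ (f w) (g w)
  map_smul' r f := by
    funext w
    exact mul_left_comm _ r (f w)

theorem lengthOp_coeff (f : NCSeries C) (w : List C) : lengthOp C f w = (w.length : ℚ) * f w := rfl

theorem lengthOp_isDer : IsDer (fun _ => 0) (lengthOp C) where
  filt := fun m f hf w hw => by rw [lengthOp_coeff, hf w hw, mul_zero]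
  leibniz f g := by
    rw [tau_of_mem_hom_zero (mem_hom_zero f)]
    funext w
    rw [lengthOp_coeff, add_coeff, mul_coeff, mul_coeff, mul_coeff, Finset.mul_sum,
      ← Finset.sum_add_distrib]
    refine Finset.sum_congr rfl fun k hk => ?_
    rw [Finset.mem_range] at hk
    have h : (w.length : ℚ) = (w.take k).length + (w.drop k).length := by
      rw [← Nat.cast_add, ← List.length_append, List.take_append_drop]
    rw [lengthOp_coeff, lengthOp_coeff, h]
    ring

theorem lengthOp_letter (c : C) : lengthOp C (letter c) = letter c := by
  funext w
  rw [lengthOp_coeff]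
  by_cases h : w = [c] <;> simp [letter, mono, h]

theorem lenPart_lengthOp (m : ℕ) (f : NCSeries C) :
    lenPart m (lengthOp C f) = (m : ℚ) • lenPart m f := by
  funext w
  rw [smul_coeff]
  simp only [lenPart, lengthOp_coeff]
  split_ifs with h
  · rw [h]
  · rw [mul_zero]

/-- The power series `x / (1 - e⁻ˣ)`. -/
noncomputable def expQuotInv : PowerSeries ℚ := bernoulliPowerSeries ℚ * PowerSeries.exp ℚ

theorem expQuotInv_mul : expQuotInv * expQuot = 1 := by
  rw [expQuotInv, mul_comm, ← mul_assoc, expQuot_mul_bernoulli, mul_comm, exp_mul_expNeg]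

theorem opSeries_of_apply_eq_zero {T : NCSeries C →ₗ[ℚ] NCSeries C} (p : PowerSeries ℚ)
    {f : NCSeries C} (h : T f = 0) : opSeries p T f = PowerSeries.constantCoeff p • f := by
  rw [opSeries_apply, ← lsum_single (PowerSeries.constantCoeff p • f)]
  congr 1
  funext k
  split_ifs with hk
  · subst hk
    simp
  · obtain ⟨j, rfl⟩ := Nat.exists_eq_succ_of_ne_zero hk
    rw [pow_succ, Module.End.mul_apply, h, map_zero, smul_zero]

theorem constantCoeff_expQuot : PowerSeries.constantCoeff expQuot = 1 := by
  rw [← PowerSeries.coeff_zero_eq_constantCoeff_apply, expQuot, PowerSeries.coeff_mk]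
  simp

/-- An error of order `m` in `z` becomes one of order `m + 1`, because `z` only occurs bracketed
with series without constant term. -/
theorem comm_pow_sub_mem_fil {m : ℕ} {z z' f f' : NCSeries C}
    (hzz : z - z' ∈ fil C m) (hz : z ∈ fil C 1) (hf : f ∈ fil C 1) (hff : f - f' ∈ fil C (m + 1))
    (k : ℕ) : (comm z ^ k) f - (comm z' ^ k) f' ∈ fil C (m + 1) := by
  induction k with
  | zero => exact hff
  | succ k ih =>
    rw [pow_succ', pow_succ', Module.End.mul_apply, Module.End.mul_apply]
    set g := (comm z ^ k) f with hg
    set g' := (comm z' ^ k) f' with hg'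
    have hg1 : g ∈ fil C 1 := fil_anti (by omega) ((comm_isRaise hz).pow_mem hf k)
    have h : comm z g - comm z' g'
        = ((z - z') * g - g * (z - z')) + (z' * (g - g') - (g - g') * z') := by
      simp only [comm_apply]
      noncomm_ring
    rw [h]
    refine add_mem (sub_mem (mul_mem_fil hzz hg1) ?_)
      (sub_mem (mul_mem_fil_right _ ih) (mul_mem_fil_left ih _))
    rw [add_comm]
    exact mul_mem_fil hg1 hzz

theorem opSeries_comm_sub_mem_fil {m : ℕ} {z z' f f' : NCSeries C}
    (hzz : z - z' ∈ fil C m) (hz : z ∈ fil C 1) (hf : f ∈ fil C 1) (hff : f - f' ∈ fil C (m + 1))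
    (p : PowerSeries ℚ) : opSeries p (comm z) f - opSeries p (comm z') f' ∈ fil C (m + 1) := by
  rw [opSeries_apply, opSeries_apply, ← lsum_sub]
  refine lsum_mem_fil fun k => ?_
  rw [← smul_sub]
  exact Submodule.smul_mem _ _ (comm_pow_sub_mem_fil hzz hz hf hff k)

theorem exp_letter_derivative (c : C) :
    lengthOp C (exp (letter c)) = exp (letter c) * letter c := by
  rw [lengthOp_isDer.map_exp (mem_hom_zero _) (letter_mem_fil c), lengthOp_letter,
    opSeries_of_apply_eq_zero _ (by rw [comm_apply, sub_self]), constantCoeff_expQuot, one_smul]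

theorem exp_mul_self (x : NCSeries C) (hx : x ∈ fil C 1) : exp x * x = x * exp x := by
  rw [exp_eq_ev]
  conv_lhs => rw [← ev_X hx, ev_ev hx _ _ (by simp)]
  conv_rhs => rw [← ev_X hx, ev_ev hx _ _ (by simp)]
  rw [PowerSeries.X_subst, ← ev_mul hx, ← ev_mul hx, mul_comm]

/-- The Euler derivation `N`, applied to `exp z = exp a · exp b`, gives `N(exp z) = a · exp z + exp
z · b`. The derivative of the exponential turns this into `((1 - e^(-ad z)) / ad z) (N z) = e^(-ad
z) a + b`, and the operator on the left is invertible. The right-hand side then only involves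
brackets of `z` with letters. -/
theorem lengthOp_bch_letter (a b : C) :
    lengthOp C (bch (letter a) (letter b)) = opSeries expQuotInv (comm (bch (letter a) (letter b)))
      (opSeries expNeg (comm (bch (letter a) (letter b))) (letter a) + letter b) := by
  set z := bch (letter a) (letter b) with hz
  have hz1 : z ∈ fil C 1 := bch_mem_fil _ _
  have h1 := lengthOp_isDer.map_exp (mem_hom_zero z) hz1
  have h2 : lengthOp C (exp z) = letter a * exp z + exp z * letter b := by
    rw [exp_bch, lengthOp_isDer.leibniz_zero (mem_hom_zero _), exp_letter_derivative,
      exp_letter_derivative, exp_mul_self _ (letter_mem_fil a)]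
    noncomm_ring
  have h3 : opSeries expQuot (comm z) (lengthOp C z)
      = opSeries expNeg (comm z) (letter a) + letter b := by
    rw [opSeries_expNeg_comm hz1]
    calc _ = exp (-z) * (exp z * opSeries expQuot (comm z) (lengthOp C z)) := by
          rw [← mul_assoc, exp_neg_mul_exp hz1, one_mul]
      _ = exp (-z) * letter a * exp z + (exp (-z) * exp z) * letter b := by
          rw [← h1, h2]
          noncomm_ring
      _ = _ := by rw [exp_neg_mul_exp hz1, one_mul]
  rw [← h3, ← opSeries_mul (comm_isRaise hz1), expQuotInv_mul, opSeries_one]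
  rfl

/-- Strong induction on word length: in the differential equation `lengthOp_bch_letter`, the part of
length `m + 1` on the right only involves the parts of `z` of length at most `m`, and does so
through brackets. -/
theorem bch_letter_mem_lieSer (a b : C) :
    bch (letter a) (letter b) ∈ lieSer (fun _ => 0) Set.univ := by
  set z := bch (letter a) (letter b) with hz
  have hz1 : z ∈ fil C 1 := bch_mem_fil _ _
  intro m
  induction m using Nat.strong_induction_on with
  | _ m ih =>
    cases m with
    | zero =>
      have : lenPart 0 z = 0 := by
        funext w
        rw [lenPart, zero_coeff]
        split_ifs with h
        · exact hz1 w (by omega)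
        · rfl
      rw [this]
      exact zero_mem _
    | succ m =>
      -- The truncation `z'` is already known to be a Lie series, and with it the right-hand side of
      -- the equation is correct up to and including length `m + 1`.
      set z' := ∑ k ∈ Finset.range (m + 1), lenPart k z with hz'
      have hzz : z - z' ∈ fil C (m + 1) := by
        have := lsum_sub_mem_fil (fun k => lenPart_mem_fil k z) (m + 1)
        rwa [lsum_lenPart] at this
      have hz'L : z' ∈ lieSer (fun _ => 0) Set.univ :=
        sum_mem fun k hk => freeLie_le_lieSer (ih k (Finset.mem_range.1 hk))
      have ha := letter_mem_lieSer (deg := fun _ => 0) (Set.mem_univ a)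
      have hb := letter_mem_lieSer (deg := fun _ => 0) (Set.mem_univ b)
      set G := opSeries expQuotInv (comm z')
        (opSeries expNeg (comm z') (letter a) + letter b) with hG
      have hGL : G ∈ lieSer (fun _ => 0) Set.univ :=
        opSeries_comm_mem_lieSer (mem_hom_zero _) hz'L
          (add_mem (opSeries_comm_mem_lieSer (mem_hom_zero _) hz'L ha _) hb) _
      have hsub : lengthOp C z - G ∈ fil C (m + 1 + 1) := by
        rw [hz, lengthOp_bch_letter, ← hz]
        refine opSeries_comm_sub_mem_fil hzz hz1 ?_ ?_ _
        · exact add_mem (opSeries_isFilt (comm_isRaise hz1) _ _ (letter_mem_fil a))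
            (letter_mem_fil b)
        · rw [add_sub_add_right_eq_sub]
          exact opSeries_comm_sub_mem_fil hzz hz1 (letter_mem_fil a)
            (by rw [sub_self]; exact zero_mem _) _
      -- On words of length `m + 1` the Euler derivation is multiplication by `m + 1`, which is
      -- divided out.
      have h1 : lenPart (m + 1) z = (1 / ((m + 1 : ℕ) : ℚ)) • lenPart (m + 1) G := by
        have : lenPart (m + 1) G = lenPart (m + 1) (lengthOp C z) := by
          funext w
          simp only [lenPart]
          split_ifs with h
          · exact (coeff_eq_of_sub_mem_fil hsub (by omega)).symm
          · rfl
        rw [this, lenPart_lengthOp, smul_smul, one_div, inv_mul_cancel₀ (by positivity), one_smul]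
      rw [h1]
      exact Submodule.smul_mem _ _ (hGL (m + 1))

/-! ### Lie series of degree zero and their closure under BCH. -/

/-- The Lie series of degree `0` in the letters of `S`. -/
noncomputable def lieZero (deg : C → ℤ) (S : Set C) : Submodule ℚ (NCSeries C) := lieSer deg S ⊓ hom deg 0

section LieZero

variable {deg : C → ℤ} {S : Set C} {x y : NCSeries C}

theorem lieZero_mem_fil (hx : x ∈ lieZero deg S) : x ∈ fil C 1 := lieSer_le_fil hx.1

theorem letter_mem_lieZero {c : C} (hc : c ∈ S) (h : deg c = 0) : letter c ∈ lieZero deg S :=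
  ⟨letter_mem_lieSer hc, by rw [← h]; exact letter_mem_hom c⟩

theorem lieZero_mem_lieAlg (hx : x ∈ lieZero deg S) : x ∈ lieAlg deg := mem_lieAlg hx.1 hx.2

theorem substHom_mem_lieZero [Fintype ι] {x : ι → NCSeries C} (hx : ∀ i, x i ∈ lieZero deg S)
    {P : NCSeries ι} {T : Set ι} (hP : P ∈ lieSer (fun _ => 0) T) :
    substHom x P ∈ lieZero deg S := by
  have h : IsGradedHom (fun _ => 0) deg (substHom x) :=
    substHom_isGradedHom (fun i => lieZero_mem_fil (hx i)) fun i => (hx i).2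
  exact ⟨h.map_lieSer (fun i _ => by
    rw [substHom_letter fun i => lieZero_mem_fil (hx i)]
    exact (hx i).1) hP, h.map_hom 0 P (mem_hom_zero P)⟩

/-- Substitution into the universal case of two letters. -/
theorem bch_mem_lieZero (hx : x ∈ lieZero deg S) (hy : y ∈ lieZero deg S) :
    bch x y ∈ lieZero deg S := by
  have hv : ∀ i : Fin 2, (![x, y] : Fin 2 → NCSeries C) i ∈ lieZero deg S := by
    intro i
    fin_cases i
    · exact hx
    · exact hy
  have hf := fun i => lieZero_mem_fil (hv i)
  have h := substHom_mem_lieZero hv (bch_letter_mem_lieSer (0 : Fin 2) 1)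
  rwa [(substHom_isAlgHom hf).map_bch (letter_mem_fil _) (letter_mem_fil _), substHom_letter hf,
    substHom_letter hf] at h

theorem bchList_mem_lieZero {l : List (NCSeries C)} (hl : ∀ x ∈ l, x ∈ lieZero deg S) :
    bchList l ∈ lieZero deg S := by
  induction l with
  | nil => exact zero_mem _
  | cons x l ih => exact bch_mem_lieZero (hl x (by simp)) (ih fun y hy => hl y (by simp [hy]))

theorem mu2_mem_lieZero (hx : x ∈ lieZero deg S) (hy : y ∈ lieZero deg S) :
    mu2 x y ∈ lieZero deg S :=
  bch_mem_lieZero hx (Submodule.smul_mem _ _ (bch_mem_lieZero (neg_mem hx) hy))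

end LieZero

end NCSeries

namespace NCSeries

open scoped NCSeries.Ring

variable {C C' ι : Type} {deg : C → ℤ} {deg' : C' → ℤ}

/-! Differentials. -/

/-- The continuous derivations of degree `-1`. -/
structure IsOddDer (deg : C → ℤ) (D : NCSeries C →ₗ[ℚ] NCSeries C) : Prop extends IsDer deg D where
  map_hom : ∀ n f, f ∈ hom deg n → D f ∈ hom deg (n - 1)

/-- The continuous derivations of degree `-1` and square zero that preserve Lie series. -/
structure IsDiff (deg : C → ℤ) (D : NCSeries C →ₗ[ℚ] NCSeries C) : Prop extends
    IsOddDer deg D where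
  sq : ∀ f, D (D f) = 0
  lie : ∀ c, D (letter c) ∈ lieSer deg Set.univ

theorem neg_one_zpow_sub_one (p : ℤ) : (-1 : ℚ) ^ (p - 1) = -(-1 : ℚ) ^ p := by
  rw [zpow_sub₀ (by norm_num), zpow_one, div_neg, div_one]

theorem mkDer_isOddDer [Fintype C] {v : C → NCSeries C} (hv : ∀ c, v c ∈ fil C 1)
    (hv' : ∀ c, v c ∈ hom deg (deg c - 1)) : IsOddDer deg (mkDer deg v) where
  toIsDer := mkDer_isDer hv
  map_hom _ _ hf := mkDer_mem_hom (s := -1) hv' hf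

namespace IsOddDer

variable {D : NCSeries C →ₗ[ℚ] NCSeries C} {S T : Set C}

theorem map_tau [Finite C] (hD : IsOddDer deg D) (f : NCSeries C) :
    D (tau deg 1 f) = -tau deg 1 (D f) := by
  have key : D.comp (tau deg 1) = (-1 : ℚ) • (tau deg 1).comp D := by
    refine (hD.filt.comp (tau_isFilt 1)).ext (((tau_isFilt 1).comp hD.filt).smul _) fun u => ?_
    change D (tau deg 1 (mono u)) = (-1 : ℚ) • tau deg 1 (D (mono u))
    rw [tau_of_mem_hom (mono_mem_hom u), map_smul, tau_of_mem_hom (hD.map_hom _ _ (mono_mem_hom u)),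
      one_mul, one_mul, neg_one_zpow_sub_one, smul_smul]
    congr 1
    ring
  have := LinearMap.congr_fun key f
  rwa [LinearMap.comp_apply, LinearMap.smul_apply, LinearMap.comp_apply, neg_one_smul] at this

/-- The mixed terms cancel because `D` anticommutes with the sign automorphism. This is what reduces
`D² = 0` to a check on letters. -/
theorem sq_isDer [Finite C] (hD : IsOddDer deg D) : IsDer (fun _ => 0) (D.comp D) where
  filt := hD.filt.comp hD.filt
  leibniz f g := by
    rw [tau_of_mem_hom_zero (mem_hom_zero f)]
    simp only [LinearMap.comp_apply, hD.leibniz, map_add, hD.map_tau, tau_tau]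
    noncomm_ring

theorem isDiff [Finite C] (hD : IsOddDer deg D) (h : ∀ c, D (D (letter c)) = 0)
    (hL : ∀ c, D (letter c) ∈ lieSer deg Set.univ) : IsDiff deg D where
  toIsOddDer := hD
  sq f := LinearMap.congr_fun (hD.sq_isDer.ext IsDer.zero h) f
  lie := hL

theorem map_bracket (hD : IsOddDer deg D) {p q : ℤ} {f g : NCSeries C} (hf : f ∈ hom deg p)
    (hg : g ∈ hom deg q) : D (bracket deg f g)
      = bracket deg (D f) g + (-1 : ℚ) ^ p • bracket deg f (D g) := by
  have hs := neg_one_zpow_mul_self p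
  have hq := neg_one_zpow_mul_self q
  rw [bracket_hom_hom hf hg, bracket_hom_hom (hD.map_hom _ _ hf) hg,
    bracket_hom_hom hf (hD.map_hom _ _ hg), map_sub, map_smul, hD.leibniz, hD.leibniz,
    tau_of_mem_hom hf, tau_of_mem_hom hg, one_mul, one_mul, sub_mul, mul_sub, one_mul, mul_one,
    zpow_sub₀ (by norm_num : (-1 : ℚ) ≠ 0), zpow_sub₀ (by norm_num : (-1 : ℚ) ≠ 0)]
  have h1 : (-1 : ℚ) ^ (p * q) / (-1 : ℚ) ^ q = (-1 : ℚ) ^ (p * q) * (-1 : ℚ) ^ q := by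
    rw [div_eq_iff (by positivity), mul_assoc, hq, mul_one]
  have h2 : (-1 : ℚ) ^ (p * q) / (-1 : ℚ) ^ p = (-1 : ℚ) ^ (p * q) * (-1 : ℚ) ^ p := by
    rw [div_eq_iff (by positivity), mul_assoc, hs, mul_one]
  have h3 : (-1 : ℚ) ^ p * ((-1 : ℚ) ^ (p * q) * (-1 : ℚ) ^ p) = (-1 : ℚ) ^ (p * q) := by
    rw [mul_left_comm, hs, mul_one]
  rw [h1, h2]
  simp only [smul_sub, smul_add, smul_mul_assoc, smul_smul, h3]
  abel

theorem map_lieSer (hD : IsOddDer deg D) (hST : S ⊆ T)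
    (h : ∀ c ∈ S, D (letter c) ∈ lieSer deg T) {f : NCSeries C} (hf : f ∈ lieSer deg S) :
    D f ∈ lieSer deg T := by
  refine map_mem_lieSer hD.filt (fun g hg => ?_) hf
  induction hg with
  | letter c hc => exact h c hc
  | bracket f g hf hg ihf ihg =>
    obtain ⟨p, hp⟩ := hf.mem_hom deg
    obtain ⟨q, hq⟩ := hg.mem_hom deg
    rw [hD.map_bracket hp hq]
    exact add_mem (bracket_mem_lieSer ihf (lieSer_mono hST hg.mem_lieSer))
      (Submodule.smul_mem _ _ (bracket_mem_lieSer (lieSer_mono hST hf.mem_lieSer) ihg))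

theorem eq_on (hD : IsOddDer deg D) {D' : NCSeries C →ₗ[ℚ] NCSeries C} (hD' : IsOddDer deg D')
    (h : ∀ c ∈ S, D (letter c) = D' (letter c)) {f : NCSeries C} (hf : f ∈ lieSer deg S) :
    D f = D' f := by
  refine eq_on_lieSer hD.filt hD'.filt (fun g hg => ?_) hf
  induction hg with
  | letter c hc => exact h c hc
  | bracket f g hf hg ihf ihg =>
    obtain ⟨p, hp⟩ := hf.mem_hom deg
    obtain ⟨q, hq⟩ := hg.mem_hom deg
    rw [hD.map_bracket hp hq, hD'.map_bracket hp hq, ihf, ihg]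

end IsOddDer

theorem lieBr_coe (f g : lieAlg deg) :
    (lieBr deg f g : NCSeries C) = bracket deg (f : NCSeries C) (g : NCSeries C) := rfl

theorem gen_coe (c : C) : (gen deg c : NCSeries C) = letter c := rfl

theorem gen_mem_gr (c : C) : gen deg c ∈ gr deg (deg c) := letter_mem_hom c

theorem graded_symm {p q : ℤ} {x y : NCSeries C} (hx : x ∈ hom deg p) (hy : y ∈ hom deg q) :
    bracket deg y x = -((-1 : ℚ) ^ (p * q) • bracket deg x y) := by
  have hs := neg_one_zpow_mul_self (p * q)
  rw [bracket_hom_hom hx hy, bracket_hom_hom hy hx, mul_comm q p, smul_sub, smul_smul, hs, one_smul,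
    neg_sub]

theorem graded_jacobi {p q r : ℤ} {x y z : NCSeries C} (hx : x ∈ hom deg p) (hy : y ∈ hom deg q)
    (hz : z ∈ hom deg r) :
    (-1 : ℚ) ^ (p * q) • bracket deg (bracket deg y z) x
      + (-1 : ℚ) ^ (q * r) • bracket deg (bracket deg z x) y
      + (-1 : ℚ) ^ (r * p) • bracket deg (bracket deg x y) z = 0 := by
  rw [bracket_hom_hom (bracket_mem_hom hy hz) hx, bracket_hom_hom (bracket_mem_hom hz hx) hy,
    bracket_hom_hom (bracket_mem_hom hx hy) hz, bracket_hom_hom hy hz, bracket_hom_hom hz hx,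
    bracket_hom_hom hx hy, add_mul, add_mul, add_mul, mul_comm q p, mul_comm r q, mul_comm p r]
  have h0 : (-1 : ℚ) ≠ 0 := by norm_num
  rw [zpow_add₀ h0, zpow_add₀ h0, zpow_add₀ h0]
  have h : ∀ n : ℤ, (-1 : ℚ) ^ n = 1 ∨ (-1 : ℚ) ^ n = -1 := fun n => by
    rcases Int.even_or_odd n with h | h
    · exact Or.inl h.neg_one_zpow
    · exact Or.inr h.neg_one_zpow
  rcases h (p * q) with h1 | h1 <;> rcases h (q * r) with h2 | h2 <;>
    rcases h (r * p) with h3 | h3 <;> rw [h1, h2, h3] <;>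
    simp only [one_smul, neg_smul, mul_one, mul_neg, neg_neg] <;>
    noncomm_ring

theorem IsDiff.map_lieAlg {D : NCSeries C →ₗ[ℚ] NCSeries C} (hD : IsDiff deg D) {f : NCSeries C}
    (hf : f ∈ lieAlg deg) : D f ∈ lieAlg deg := by
  obtain ⟨N, hN⟩ := exists_eq_sum_component hf
  rw [hN, map_sum]
  refine sum_mem fun n _ => ?_
  refine mem_lieAlg (S := Set.univ) ?_ (hD.map_hom _ _ (component_mem_hom n f))
  exact hD.map_lieSer subset_rfl (fun c _ => hD.lie c)
    (component_mem_lieSer deg n (lieAlg_le_lieSer hf))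

/-- The restriction of a differential to the complete free Lie algebra. -/
noncomputable def IsDiff.restrict {D : NCSeries C →ₗ[ℚ] NCSeries C} (hD : IsDiff deg D) :
    lieAlg deg →ₗ[ℚ] lieAlg deg :=
  D.restrict fun _ hf => hD.map_lieAlg hf

theorem IsDiff.restrict_coe {D : NCSeries C →ₗ[ℚ] NCSeries C} (hD : IsDiff deg D)
    (f : lieAlg deg) : (hD.restrict f : NCSeries C) = D f := rfl

theorem IsDiff.isDifferential {D : NCSeries C →ₗ[ℚ] NCSeries C} (hD : IsDiff deg D) :
    IsDifferential hD.restrict where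
  dgla :=
    { internal := isInternal_gr deg
      br_mem := fun _ _ _ _ hx hy => bracket_mem_hom hx hy
      d_mem := fun p _ hx => hD.map_hom p _ hx
      d_sq := fun _ => Subtype.ext (hD.sq _)
      symm := fun _ _ _ _ hx hy => Subtype.ext (graded_symm (deg := deg) hx hy)
      jacobi := fun _ _ _ _ _ _ hx hy hz => Subtype.ext (graded_jacobi (deg := deg) hx hy hz)
      leibniz := fun _ _ _ _ hx hy => Subtype.ext (hD.map_bracket (deg := deg) hx hy) }
  cont := fun m _ hf => hD.filt m _ hf

theorem LieMono.mem_lieAlg {S : Set C} {f : NCSeries C} (hf : LieMono deg S f) :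
    f ∈ lieAlg deg := by
  obtain ⟨n, hn⟩ := hf.mem_hom deg
  exact NCSeries.mem_lieAlg hf.mem_lieSer hn

/-- An element of `lieAlg` is a limit of combinations of iterated brackets, its truncations, and
both maps respect the filtration. -/
theorem lieAlg_ext {d : lieAlg deg →ₗ[ℚ] lieAlg deg'} (hd : ∀ m f, InFil deg m f → InFil deg' m (d f))
    {F : NCSeries C →ₗ[ℚ] NCSeries C'} (hF : IsFilt F)
    (h : ∀ f (hf : LieMono deg Set.univ f), (d ⟨f, hf.mem_lieAlg⟩ : NCSeries C') = F f)
    (f : lieAlg deg) : (d f : NCSeries C') = F f := by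
  -- The locus where the two maps agree is pushed forward into the series, where it can be compared
  -- with `freeLie`.
  set L : Submodule ℚ (NCSeries C) := (LinearMap.eqLocus ((lieAlg deg').subtype.comp d)
    (F.comp (lieAlg deg).subtype)).map (lieAlg deg).subtype with hL
  have hle : freeLie deg Set.univ ≤ L := freeLie_le fun g hg => ⟨⟨g, hg.mem_lieAlg⟩, h g hg, rfl⟩
  refine eq_of_forall_sub_mem_fil fun m => ?_
  have hmem : ∑ k ∈ Finset.range m, lenPart k (f : NCSeries C) ∈ L :=
    sum_mem fun k _ => hle (f.2.1 k)
  obtain ⟨g, hg, hgf⟩ := hmem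
  have hg' : (d g : NCSeries C') = F g := hg
  have hfg : ((f - g : lieAlg deg) : NCSeries C) ∈ fil C m := by
    have h1 := lsum_sub_mem_fil (fun k => lenPart_mem_fil k (f : NCSeries C)) m
    rw [lsum_lenPart, ← hgf] at h1
    exact h1
  have h1 : ((d (f - g) : lieAlg deg') : NCSeries C') ∈ fil C' m := hd m _ hfg
  have h2 : F ((f - g : lieAlg deg) : NCSeries C) ∈ fil C' m := hF m _ hfg
  rw [map_sub, Submodule.coe_sub, hg'] at h1
  rw [Submodule.coe_sub, map_sub] at h2
  have := sub_mem h1 h2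
  rwa [sub_sub_sub_cancel_right] at this

/-- The values of `d` on generators extend to a derivation of the whole series algebra. It agrees
with `d` on iterated brackets by the graded Leibniz rule and elsewhere by continuity. From here on
all computations use products instead of brackets. -/
theorem IsDifferential.exists_isDiff [Finite C] {d : lieAlg deg →ₗ[ℚ] lieAlg deg}
    (hd : IsDifferential d) :
    ∃ D : NCSeries C →ₗ[ℚ] NCSeries C, IsDiff deg D ∧ ∀ f : lieAlg deg, (d f : NCSeries C) = D f := by
  have := Fintype.ofFinite C
  set v : C → NCSeries C := fun c => (d (gen deg c) : NCSeries C) with hv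
  have hvL : ∀ c, v c ∈ lieSer deg Set.univ := fun c => lieAlg_le_lieSer (d (gen deg c)).2
  have hv1 : ∀ c, v c ∈ fil C 1 := fun c => lieSer_le_fil (hvL c)
  have hvh : ∀ c, v c ∈ hom deg (deg c - 1) := fun c => hd.dgla.d_mem _ _ (gen_mem_gr c)
  have hD : IsOddDer deg (mkDer deg v) := mkDer_isOddDer hv1 hvh
  have hdD : ∀ f : lieAlg deg, (d f : NCSeries C) = mkDer deg v f := by
    refine lieAlg_ext hd.cont hD.filt fun f hf => ?_
    induction hf with
    | letter c _ => exact (mkDer_letter hv1 c).symm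
    | bracket f g hf hg ihf ihg =>
      obtain ⟨p, hp⟩ := hf.mem_hom deg
      obtain ⟨q, hq⟩ := hg.mem_hom deg
      have h := congrArg (Subtype.val) (hd.dgla.leibniz p q ⟨f, hf.mem_lieAlg⟩ ⟨g, hg.mem_lieAlg⟩
        hp hq)
      have h' : ((d ⟨bracket deg f g, (LieMono.bracket f g hf hg).mem_lieAlg⟩ : lieAlg deg) :
          NCSeries C) = bracket deg (d ⟨f, hf.mem_lieAlg⟩ : NCSeries C) g
            + (-1 : ℚ) ^ p • bracket deg f (d ⟨g, hg.mem_lieAlg⟩ : NCSeries C) := h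
      rw [h', ihf, ihg, hD.map_bracket hp hq]
  refine ⟨mkDer deg v, hD.isDiff (fun c => ?_) (fun c => ?_), hdD⟩
  · rw [← gen_coe (deg := deg), ← hdD, ← hdD, hd.dgla.d_sq]
    rfl
  · rw [mkDer_letter hv1]
    exact hvL c

theorem differential_ext [Finite C] {d d' : lieAlg deg →ₗ[ℚ] lieAlg deg} (hd : IsDifferential d)
    (hd' : IsDifferential d') (h : ∀ c, (d (gen deg c) : NCSeries C) = d' (gen deg c)) : d = d' := by
  obtain ⟨D, hD, hdD⟩ := hd.exists_isDiff
  obtain ⟨D', hD', hdD'⟩ := hd'.exists_isDiff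
  have : D = D' := hD.toIsDer.ext hD'.toIsDer fun c => by
    rw [← gen_coe (deg := deg), ← hdD, ← hdD', h]
  refine LinearMap.ext fun f => Subtype.ext ?_
  rw [hdD, hdD', this]

/-! Homomorphisms. -/

theorem IsGradedHom.map_lieAlg [Finite C] {Φ : NCSeries C →ₗ[ℚ] NCSeries C'}
    (hΦ : IsGradedHom deg deg' Φ) (h : ∀ c, Φ (letter c) ∈ lieSer deg' Set.univ) {f : NCSeries C}
    (hf : f ∈ lieAlg deg) : Φ f ∈ lieAlg deg' := by
  obtain ⟨N, hN⟩ := exists_eq_sum_component hf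
  rw [hN, map_sum]
  refine sum_mem fun n _ => ?_
  refine mem_lieAlg (S := Set.univ) ?_ (hΦ.map_hom _ _ (component_mem_hom n f))
  exact hΦ.map_lieSer (fun c _ => h c) (component_mem_lieSer deg n (lieAlg_le_lieSer hf))

theorem IsGradedHom.map_diff [Finite C] {Φ : NCSeries C →ₗ[ℚ] NCSeries C'}
    (hΦ : IsGradedHom deg deg' Φ) {D : NCSeries C →ₗ[ℚ] NCSeries C}
    {D' : NCSeries C' →ₗ[ℚ] NCSeries C'} (hD : IsDer deg D) (hD' : IsDer deg' D')
    (h : ∀ c, Φ (D (letter c)) = D' (Φ (letter c))) (f : NCSeries C) : Φ (D f) = D' (Φ f) := by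
  have key : Φ.comp D = D'.comp Φ := by
    refine (hΦ.filt.comp hD.filt).ext (hD'.filt.comp hΦ.filt) fun u => ?_
    change Φ (D (mono u)) = D' (Φ (mono u))
    induction u with
    | nil => rw [mono_nil, hD.map_one, hΦ.map_one, hD'.map_one, map_zero]
    | cons c u ih =>
      rw [mono_cons, hD.leibniz, map_add, hΦ.map_mul, hΦ.map_mul, hΦ.map_tau, ih, h, hΦ.map_mul,
        hD'.leibniz]
  exact LinearMap.congr_fun key f

/-- The values on the generators extend uniquely to a homomorphism of DGLAs if they are compatible
with the differentials. -/
theorem existsUnique_hom [Finite C] {d : lieAlg deg →ₗ[ℚ] lieAlg deg}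
    {d' : lieAlg deg' →ₗ[ℚ] lieAlg deg'} {D : NCSeries C →ₗ[ℚ] NCSeries C}
    {D' : NCSeries C' →ₗ[ℚ] NCSeries C'} (hD : IsDiff deg D) (hD' : IsDiff deg' D')
    (hdD : ∀ f : lieAlg deg, (d f : NCSeries C) = D f)
    (hdD' : ∀ f : lieAlg deg', (d' f : NCSeries C') = D' f) {x : C → NCSeries C'}
    (hx : ∀ c, x c ∈ lieSer deg' Set.univ) (hx' : ∀ c, x c ∈ hom deg' (deg c))
    (h : ∀ Φ : NCSeries C →ₗ[ℚ] NCSeries C', IsGradedHom deg deg' Φ → (∀ c, Φ (letter c) = x c) →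
      ∀ c, Φ (D (letter c)) = D' (x c)) :
    ∃! φ : lieAlg deg →ₗ[ℚ] lieAlg deg', IsDGLAHom d d' φ ∧
      ∀ c, (φ (gen deg c) : NCSeries C') = x c := by
  have := Fintype.ofFinite C
  have hx1 : ∀ c, x c ∈ fil C' 1 := fun c => lieSer_le_fil (hx c)
  have hΦ : IsGradedHom deg deg' (substHom x) := substHom_isGradedHom hx1 hx'
  have hΦl : ∀ c, substHom x (letter c) = x c := substHom_letter hx1
  have hΦD := hΦ.map_diff hD.toIsDer hD'.toIsDer fun c => by rw [h _ hΦ hΦl, hΦl]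
  have hmaps : ∀ f ∈ lieAlg deg, substHom x f ∈ lieAlg deg' := fun f hf =>
    hΦ.map_lieAlg (fun c => by rw [hΦl]; exact hx c) hf
  refine ⟨(substHom x).restrict hmaps, ⟨⟨fun n f hf => hΦ.map_hom n _ hf,
    fun f g => Subtype.ext (hΦ.map_bracket _ _), fun f => Subtype.ext ?_,
    fun m f hf => hΦ.filt m _ hf⟩, hΦl⟩, ?_⟩
  · change substHom x (d f : NCSeries C) = (d' _ : NCSeries C')
    rw [hdD, hΦD, hdD']
    rfl
  · rintro φ ⟨hφ, hφx⟩
    refine LinearMap.ext fun f => Subtype.ext ?_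
    change (φ f : NCSeries C') = substHom x f
    refine lieAlg_ext hφ.cont hΦ.filt (fun g hg => ?_) f
    induction hg with
    | letter c _ => rw [hΦl]; exact hφx c
    | bracket f g hf hg ihf ihg =>
      have h := congrArg Subtype.val (hφ.map_br ⟨f, hf.mem_lieAlg⟩ ⟨g, hg.mem_lieAlg⟩)
      have h' : ((φ ⟨bracket deg f g, (LieMono.bracket f g hf hg).mem_lieAlg⟩ : lieAlg deg') :
          NCSeries C') = bracket deg' (φ ⟨f, hf.mem_lieAlg⟩ : NCSeries C')
            (φ ⟨g, hg.mem_lieAlg⟩ : NCSeries C') := h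
      rw [h', ihf, ihg, hΦ.map_bracket]

/-! Points and flows. -/

section Points

variable {D : NCSeries C →ₗ[ℚ] NCSeries C} {a b c g h e : NCSeries C}

/-- The Maurer-Cartan equation. -/
def IsMC (deg : C → ℤ) (D : NCSeries C →ₗ[ℚ] NCSeries C) (a : NCSeries C) : Prop :=
  a ∈ hom deg (-1) ∧ D a = -(a * a)

/-- The series `g` of degree `0` transports the point `a` to `b`. -/
def Transports (D : NCSeries C →ₗ[ℚ] NCSeries C) (a b g : NCSeries C) : Prop :=
  D g = g * b - a * g

theorem bracket_self_of_odd (ha : a ∈ hom deg (-1)) :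
    (1 / 2 : ℚ) • bracket deg a a = a * a := by
  rw [bracket_hom_hom ha ha, neg_one_mul, neg_neg, zpow_one, neg_one_smul, sub_neg_eq_add,
    ← two_smul ℚ, smul_smul]
  norm_num

theorem tau_of_odd (ha : a ∈ hom deg (-1)) : tau deg 1 a = -a := by
  rw [tau_of_mem_hom ha, one_mul, zpow_neg_one, inv_neg, inv_one, neg_one_smul]

theorem bracket_of_odd (ha : a ∈ hom deg (-1)) (f : NCSeries C) :
    bracket deg a f = a * f - tau deg 1 f * a := by
  rw [bracket_of_mem_hom ha, tau_neg_one]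

theorem isPoint_iff {d : lieAlg deg →ₗ[ℚ] lieAlg deg}
    (hdD : ∀ f : lieAlg deg, (d f : NCSeries C) = D f) (a : lieAlg deg) :
    IsPoint d a ↔ IsMC deg D a := by
  refine and_congr_right fun ha => ?_
  have ha' : (a : NCSeries C) ∈ hom deg (-1) := ha
  rw [← hdD, Subtype.ext_iff, eq_neg_iff_add_eq_zero, ← bracket_self_of_odd ha']
  rfl

theorem twisted_coe {d : lieAlg deg →ₗ[ℚ] lieAlg deg}
    (hdD : ∀ f : lieAlg deg, (d f : NCSeries C) = D f) {a : lieAlg deg}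
    (ha : (a : NCSeries C) ∈ hom deg (-1)) (f : lieAlg deg) :
    (twisted d a f : NCSeries C) = IsDer.tw deg D a f := by
  rw [twisted, Submodule.coe_add, hdD, lieBr_coe, bracket_of_odd ha, IsDer.tw_apply, add_sub_assoc]

theorem Transports.one (hD : IsDer deg D) : Transports D a a 1 := by
  rw [Transports, hD.map_one, one_mul, mul_one, sub_self]

/-- The contributions of the intermediate point `b` cancel; this is composition of paths. -/
theorem Transports.mul (hD : IsDer deg D) (hg0 : g ∈ hom deg 0) (hg : Transports D a b g)
    (hh : Transports D b c h) : Transports D a c (g * h) := by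
  rw [Transports] at *
  rw [hD.leibniz_zero hg0, hg, hh]
  noncomm_ring

theorem Transports.inv (hD : IsDer deg D) (hh0 : h ∈ hom deg 0) (hgh : g * h = 1) (hhg : h * g = 1)
    (hg : Transports D a b g) : Transports D b a h := by
  rw [Transports] at *
  have h1 : D h * g + h * D g = 0 := by rw [← hD.leibniz_zero hh0, hhg, hD.map_one]
  calc D h = D h * (g * h) := by rw [hgh, mul_one]
    _ = (D h * g + h * D g) * h - h * D g * h := by noncomm_ring
    _ = (h * a) * (g * h) - (h * g) * b * h := by rw [h1, hg]; noncomm_ring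
    _ = h * a - b * h := by rw [hgh, hhg, one_mul, mul_one]

theorem Transports.exp_neg (hD : IsDer deg D) (he : e ∈ hom deg 0) (he' : e ∈ fil C 1)
    (h : Transports D a b (exp e)) : Transports D b a (exp (-e)) :=
  h.inv hD (exp_mem_hom (neg_mem he)) (exp_mul_exp_neg he') (exp_neg_mul_exp he')

theorem Transports.exp_bch (hD : IsDer deg D) {x y : NCSeries C} (hx : x ∈ hom deg 0)
    (h : Transports D a b (exp x)) (h' : Transports D b c (exp y)) :
    Transports D a c (exp (bch x y)) := by
  rw [NCSeries.exp_bch]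
  exact h.mul hD (exp_mem_hom hx) h'

/-- The flow along `e` from `a` arrives at `b`. -/
theorem transports_exp_iff (hD : IsDer deg D) (he : e ∈ hom deg 0) (he' : e ∈ fil C 1) :
    Transports D a b (exp e)
      ↔ exp (-e) * a * exp e + opSeries expQuot (comm e) (D e) = b := by
  rw [Transports, hD.map_exp he he', eq_sub_iff_add_eq]
  constructor
  · intro h
    calc _ = exp (-e) * (exp e * opSeries expQuot (comm e) (D e) + a * exp e) := by
          rw [mul_add, ← mul_assoc, exp_neg_mul_exp he', one_mul, mul_assoc, add_comm]
      _ = b := by rw [h, ← mul_assoc, exp_neg_mul_exp he', one_mul]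
  · intro h
    rw [← h, mul_add, ← mul_assoc, ← mul_assoc, exp_mul_exp_neg he', one_mul, add_comm]

/-- Under `(1 - e^(-ad e)) / ad e` the term `[e, b]` becomes `b - e^(-ad e) b`, and the Bernoulli
term becomes `e^(-ad e) (b - a)`. Their sum is `b - e^(-ad e) a`, as the flow requires. -/
theorem transports_of_edgeDiff (hD : IsDer deg D) (he : e ∈ hom deg 0) (he' : e ∈ fil C 1)
    (h : D e = edgeDiff deg e a b) : Transports D a b (exp e) := by
  rw [transports_exp_iff hD he he', h, edgeDiff_eq he, map_add, opSeries_expQuot_comm_comm he',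
    ← opSeries_mul (comm_isRaise he'), expQuot_mul_bernoulli, opSeries_expNeg_comm he']
  noncomm_ring

/-- The operator `(1 - e^(-ad e)) / ad e` is invertible, so the end points of a flow determine `D
e`. In particular the BCH series of an edge path has the standard differential. -/
theorem edgeDiff_of_transports (hD : IsDer deg D) (he : e ∈ hom deg 0) (he' : e ∈ fil C 1)
    (h : Transports D a b (exp e)) : D e = edgeDiff deg e a b := by
  have hr := comm_isRaise he'
  have h1 := (transports_exp_iff hD he he').1 h
  have h2 : opSeries expQuot (comm e) (edgeDiff deg e a b) = opSeries expQuot (comm e) (D e) := by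
    rw [← eq_sub_iff_add_eq'] at h1
    rw [h1, edgeDiff_eq he, map_add, opSeries_expQuot_comm_comm he',
      ← opSeries_mul (comm_isRaise he'), expQuot_mul_bernoulli, opSeries_expNeg_comm he']
    noncomm_ring
  have h3 := congrArg (opSeries expQuotInv (comm e)) h2
  rw [← opSeries_mul hr, ← opSeries_mul hr, expQuotInv_mul, opSeries_one] at h3
  exact h3.symm

theorem flow_eq_iff {d : lieAlg deg →ₗ[ℚ] lieAlg deg} (hD : IsDer deg D)
    (hdD : ∀ f : lieAlg deg, (d f : NCSeries C) = D f) {e : lieAlg deg}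
    (he : (e : NCSeries C) ∈ hom deg 0) (a : lieAlg deg) (b : NCSeries C) :
    flow d e a = b ↔ Transports D a b (exp (e : NCSeries C)) := by
  have he' : (e : NCSeries C) ∈ fil C 1 := lieSer_le_fil (lieAlg_le_lieSer e.2)
  rw [flow_eq he he', hdD, transports_exp_iff hD he he']

/-- Apply `D` to `g b = D g + a g` and cancel `g`. Only `D² g = 0` is assumed, so that this is
available while `D² = 0` is still being established on other cells. -/
theorem Transports.isMC [Finite C] (hD : IsOddDer deg D) (hsq : D (D g) = 0) (hg : g ∈ hom deg 0)
    (hh : h ∈ hom deg 0) (hhg : h * g = 1) (ha : IsMC deg D a) (hT : Transports D a b g) :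
    IsMC deg D b := by
  rw [Transports] at hT
  have h1 : g * b = D g + a * g := by rw [hT]; noncomm_ring
  have hb : b = h * (D g + a * g) := by rw [← h1, ← mul_assoc, hhg, one_mul]
  refine ⟨?_, ?_⟩
  · rw [hb, ← zero_add (-1 : ℤ)]
    refine mul_mem_hom hh (add_mem ?_ ?_)
    · have := hD.map_hom 0 g hg
      rwa [zero_sub] at this
    · have := mul_mem_hom ha.1 hg
      rwa [add_zero] at this
  · have h2 : D (g * b) = -(a * (g * b)) := by
      rw [h1, map_add, hsq, hD.leibniz, ha.2, tau_of_odd ha.1]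
      noncomm_ring
    rw [hD.leibniz_zero hg] at h2
    have h3 : g * D b = -(g * (b * b)) := by
      calc g * D b = (D g * b + g * D b) - D g * b := by noncomm_ring
        _ = -((D g + a * g) * b) := by rw [h2]; noncomm_ring
        _ = _ := by rw [← h1]; noncomm_ring
    calc D b = h * (g * D b) := by rw [← mul_assoc, hhg, one_mul]
      _ = -((h * g) * (b * b)) := by rw [h3]; noncomm_ring
      _ = _ := by rw [hhg, one_mul]

open IsDer

/-- Transport of the twisted differential. -/
theorem tw_conj (hD : IsDer deg D) (hg : g ∈ hom deg 0) (hh : h ∈ hom deg 0) (hgh : g * h = 1)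
    (hhg : h * g = 1) (hT : Transports D a b g) (f : NCSeries C) :
    tw deg D a (g * f * h) = g * tw deg D b f * h := by
  have hT' := hT.inv hD hh hgh hhg
  rw [Transports] at hT hT'
  simp only [tw_apply, tau_mul, tau_of_mem_hom_zero hg, tau_of_mem_hom_zero hh, hD.leibniz, hT, hT']
  noncomm_ring

theorem tw_expAd (hD : IsDer deg D) (he : e ∈ hom deg 0) (he' : e ∈ fil C 1)
    (hT : Transports D a b (exp e)) (f : NCSeries C) :
    tw deg D a (expAd deg e f) = expAd deg e (tw deg D b f) := by
  rw [expAd_eq he he', expAd_eq he he']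
  exact tw_conj hD (exp_mem_hom he) (exp_mem_hom (neg_mem he)) (exp_mul_exp_neg he')
    (exp_neg_mul_exp he') hT f

/-- The two squares differ by the commutator with `D a + a²`, which vanishes at a point. -/
theorem tw_tw [Finite C] (hD : IsOddDer deg D) (ha : IsMC deg D a) (f : NCSeries C) :
    tw deg D a (tw deg D a f) = D (D f) := by
  simp only [tw_apply, map_add, map_sub, hD.leibniz, hD.map_tau, tau_mul, tau_tau,
    tau_of_odd ha.1, ha.2]
  noncomm_ring

/-- The form in which `D² = 0` is checked on a cell localised at `a`: its twisted boundary has to be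
closed for the same twisted differential. -/
theorem sq_of_tw [Finite C] (hD : IsOddDer deg D) (ha : IsMC deg D a) {f r : NCSeries C}
    (h : tw deg D a f = r) (hr : tw deg D a r = 0) : D (D f) = 0 := by
  rw [← tw_tw hD ha, h, hr]

theorem IsMC.sq (hD : IsOddDer deg D) (ha : IsMC deg D a) : D (D a) = 0 := by
  rw [ha.2, map_neg, hD.leibniz, ha.2, tau_of_odd ha.1]
  noncomm_ring

theorem Transports.sq (hD : IsOddDer deg D) (ha : IsMC deg D a) (hb : IsMC deg D b)
    (hg : g ∈ hom deg 0) (hT : Transports D a b g) : D (D g) = 0 := by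
  rw [Transports] at hT
  rw [hT, map_sub, hD.leibniz_zero hg, hD.leibniz a, ha.2, hb.2, tau_of_odd ha.1, hT]
  noncomm_ring

/-- Since `D²` is an ordinary derivation, it kills the logarithm of whatever series with constant
term `1` it kills. -/
theorem Transports.exp_sq [Finite C] (hD : IsOddDer deg D) (ha : IsMC deg D a)
    (hb : IsMC deg D b) (he : e ∈ hom deg 0) (he' : e ∈ fil C 1)
    (hT : Transports D a b (exp e)) : D (D e) = 0 :=
  hD.sq_isDer.eq_zero_of_map_exp he' (hT.sq hD ha hb (exp_mem_hom he))

/-- A closed path is closed for the twisted differential. -/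
theorem tw_eq_zero_of_transports (hD : IsDer deg D) (he : e ∈ hom deg 0) (he' : e ∈ fil C 1)
    (hT : Transports D a a (exp e)) : tw deg D a e = 0 := by
  refine (tw_isDer hD a).eq_zero_of_map_exp he' ?_
  rw [tw_apply, tau_of_mem_hom_zero (exp_mem_hom he), hT]
  noncomm_ring

/-- Together with `tw_eq_zero_of_transports` this identifies logarithms of loops at `a` with closed
elements of degree `0`. The latter form a linear space, which makes averaging of loops possible. -/
theorem transports_of_tw_eq_zero (hD : IsDer deg D) (he : e ∈ hom deg 0) (he' : e ∈ fil C 1)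
    (h : tw deg D a e = 0) : Transports D a a (exp e) := by
  have := (tw_isDer hD a).map_exp_eq_zero he he' h
  rw [tw_apply, tau_of_mem_hom_zero (exp_mem_hom he)] at this
  rw [Transports]
  calc D (exp e) = (D (exp e) + a * exp e - exp e * a) + (exp e * a - a * exp e) := by noncomm_ring
    _ = _ := by rw [this, zero_add]

/-- Bracketing with a closed element of degree `0` commutes with the twisted differential; the rest
is continuity in `P`. -/
theorem tw_act [Fintype ι] (hD : IsDer deg D) {y : ι → NCSeries C} (hy : ∀ i, y i ∈ hom deg 0)
    (hy' : ∀ i, y i ∈ fil C 1) (h : ∀ i, tw deg D a (y i) = 0) (P : NCSeries ι) (z : NCSeries C) :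
    tw deg D a (act deg y P z) = act deg y P (tw deg D a z) := by
  have ht := tw_isDer hD a
  refine map_act ht.filt hy' hy' (fun i f => ?_) P z
  rw [bracket_of_mem_hom_zero (hy i), bracket_of_mem_hom_zero (hy i), comm_apply, comm_apply,
    map_sub, ht.leibniz_zero (hy i), ht.leibniz, h]
  noncomm_ring

end Points

end NCSeries

namespace NCSeries

open scoped NCSeries.Ring

variable {C C' ι : Type} {deg : C → ℤ}

/-! Linear parts. -/

section LinearPart

variable {x y : NCSeries C}

theorem one_coeff_singleton (c : C) : (1 : NCSeries C) [c] = 0 := by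
  simp [← one_eq, one, mono]

theorem mul_coeff_singleton (f g : NCSeries C) (c : C) :
    (f * g) [c] = f [] * g [c] + f [c] * g [] := by
  rw [← mul_eq, mul_cons, mul_nil]
  rfl

theorem exp_coeff_singleton (x : NCSeries C) (c : C) : exp x [c] = x [c] := by
  simp [exp_eq_ev, ev, lsum, Finset.sum_range_succ, smul_coeff, one_coeff_singleton,
    PowerSeries.coeff_exp]

theorem log_coeff_singleton (g : NCSeries C) (c : C) : log g [c] = g [c] := by
  simp [log_eq_ev, ev, lsum, Finset.sum_range_succ, smul_coeff, sub_coeff, one_coeff_singleton,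
    PowerSeries.coeff_log]

theorem bch_coeff_singleton (x y : NCSeries C) (c : C) : bch x y [c] = x [c] + y [c] := by
  rw [bch, log_coeff_singleton, mul_eq, mul_coeff_singleton, exp_coeff_nil, exp_coeff_nil,
    exp_coeff_singleton, exp_coeff_singleton, one_mul, mul_one, add_comm]

theorem bchList_coeff_singleton (l : List (NCSeries C)) (c : C) :
    bchList l [c] = (l.map fun x => x [c]).sum := by
  induction l with
  | nil => rfl
  | cons x l ih =>
    rw [List.map_cons, List.sum_cons, ← ih]
    exact bch_coeff_singleton x (bchList l) c

theorem coeff_singleton_of_mem_fil {f : NCSeries C} (hf : f ∈ fil C 2) (c : C) : f [c] = 0 :=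
  hf [c] (by simp)

theorem bracket_coeff_singleton (hx : x ∈ fil C 1) (hy : y ∈ fil C 1) (c : C) :
    bracket deg x y [c] = 0 :=
  coeff_singleton_of_mem_fil (bracket_mem_fil hx hy) c

theorem opSeries_coeff_singleton {T : NCSeries C →ₗ[ℚ] NCSeries C} (hT : IsRaise T)
    (hx : x ∈ fil C 1) (p : PowerSeries ℚ) (c : C) :
    opSeries p T x [c] = PowerSeries.constantCoeff p * x [c] := by
  simp [opSeries_apply, lsum, Finset.sum_range_succ, smul_coeff,
    coeff_singleton_of_mem_fil (hT 1 x hx)]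

theorem expAd_coeff_singleton {e : NCSeries C} (he : e ∈ hom deg 0) (he' : e ∈ fil C 1)
    (hx : x ∈ fil C 1) (c : C) : expAd deg e x [c] = x [c] := by
  rw [expAd_eq_opSeries he, opSeries_coeff_singleton (comm_isRaise he') hx]
  simp

theorem edgeDiff_coeff_singleton {e a b : NCSeries C} (he : e ∈ hom deg 0) (he' : e ∈ fil C 1)
    (ha : a ∈ fil C 1) (hb : b ∈ fil C 1) (c : C) : edgeDiff deg e a b [c] = b [c] - a [c] := by
  rw [edgeDiff_eq he, add_coeff, opSeries_coeff_singleton (comm_isRaise he') (sub_mem hb ha),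
    coeff_singleton_of_mem_fil (comm_isRaise he' 1 b hb), sub_coeff]
  simp [bernoulliPowerSeries, ← PowerSeries.coeff_zero_eq_constantCoeff_apply]

theorem act_mem_fil [Fintype ι] {y : ι → NCSeries C} (hy : ∀ i, y i ∈ fil C 1) {m n : ℕ}
    {P : NCSeries ι} (hP : P ∈ fil ι m) {z : NCSeries C} (hz : z ∈ fil C n) :
    act deg y P z ∈ fil C (m + n) := by
  rw [act_apply, lin_apply]
  refine lsum_mem_fil fun k => sum_mem fun u _ => ?_
  by_cases h : k < m
  · rw [hP _ (by rwa [List.length_ofFn]), zero_smul]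
    exact zero_mem _
  · refine Submodule.smul_mem _ _ (fil_anti ?_ (foldr_bracket_mem_fil hy hz _))
    rw [List.length_ofFn]
    omega

theorem act_coeff_singleton [Fintype ι] {y : ι → NCSeries C} (hy : ∀ i, y i ∈ fil C 1)
    (P : NCSeries ι) (hx : x ∈ fil C 1) (c : C) : act deg y P x [c] = P [] * x [c] := by
  have h : P - P [] • (1 : NCSeries ι) ∈ fil ι 1 := by
    rw [mem_fil_one, sub_coeff, smul_coeff, one_coeff_nil, mul_one, sub_self]
  have h' := coeff_singleton_of_mem_fil (act_mem_fil (deg := deg) hy h hx) c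
  rw [map_sub, map_smul, LinearMap.sub_apply, LinearMap.smul_apply, act_one hy, sub_coeff,
    smul_coeff, sub_eq_zero] at h'
  exact h'

theorem substHom_coeff_nil [Fintype ι] {y : ι → NCSeries C} (hy : ∀ i, y i ∈ fil C 1)
    (P : NCSeries ι) : substHom y P [] = P [] := by
  have h : P - P [] • (1 : NCSeries ι) ∈ fil ι 1 := by
    rw [mem_fil_one, sub_coeff, smul_coeff, one_coeff_nil, mul_one, sub_self]
  have hs := substHom_isAlgHom hy
  have h' := mem_fil_one.1 (hs.filt _ _ h)
  rw [map_sub, map_smul, hs.map_one, sub_coeff, smul_coeff, one_coeff_nil, mul_one,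
    sub_eq_zero] at h'
  exact h'

theorem letter_coeff_singleton [DecidableEq C] (c d : C) :
    (letter c : NCSeries C) [d] = if d = c then 1 else 0 := by
  rw [letter, mono_apply]
  simp

end LinearPart

/-! The Dynkin operator. -/

section Dynkin

variable [Fintype ι]

/-- The series `g` in the decomposition of a series as a sum of `g * letter i`. -/
def lastQuot (i : ι) : NCSeries ι →ₗ[ℚ] NCSeries ι where
  toFun f := fun w => f (w ++ [i])
  map_add' _ _ := rfl
  map_smul' _ _ := rfl

omit [Fintype ι] in
theorem lastQuot_coeff (i : ι) (f : NCSeries ι) (w : List ι) : lastQuot i f w = f (w ++ [i]) := rfl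

omit [Fintype ι] in
theorem lastQuot_mem_fil (i : ι) {m : ℕ} {f : NCSeries ι} (hf : f ∈ fil ι (m + 1)) :
    lastQuot i f ∈ fil ι m := fun w hw => by
  rw [lastQuot_coeff]
  exact hf _ (by simpa using hw)

omit [Fintype ι] in
theorem lastQuot_mul (i : ι) (f : NCSeries ι) {g : NCSeries ι} (hg : g ∈ fil ι 1) :
    lastQuot i (f * g) = f * lastQuot i g := by
  funext w
  rw [lastQuot_coeff, mul_coeff, mul_coeff, List.length_append, List.length_singleton,
    Finset.sum_range_succ]
  have h : (w ++ [i]).drop (w.length + 1) = [] := by simp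
  rw [h, mem_fil_one.1 hg, mul_zero, add_zero]
  refine Finset.sum_congr rfl fun k hk => ?_
  rw [Finset.mem_range] at hk
  rw [lastQuot_coeff, List.take_append_of_le_length (by omega),
    List.drop_append_of_le_length (by omega)]

/-- The Dynkin operator: it replaces words by right-nested brackets of their letters. -/
noncomputable def dynkin (ι : Type) [Fintype ι] : NCSeries ι →ₗ[ℚ] NCSeries ι :=
  ∑ i, ((act (fun _ => 0) letter).flip (letter i)).comp (lastQuot i)

theorem dynkin_apply (f : NCSeries ι) :
    dynkin ι f = ∑ i, act (fun _ => 0) letter (lastQuot i f) (letter i) := by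
  rw [dynkin, LinearMap.sum_apply]
  rfl

theorem dynkin_isFilt : IsFilt (dynkin ι) := by
  intro m f hf
  rw [dynkin_apply]
  cases m with
  | zero => exact fil_zero _
  | succ m =>
    exact sum_mem fun i _ => act_mem_fil letter_mem_fil (lastQuot_mem_fil i hf) (letter_mem_fil i)

/-- The operator treats only the last letter of a word as an argument, and that letter lies in `g`;
everything in front of it acts by `ad`. -/
theorem dynkin_mul (f : NCSeries ι) {g : NCSeries ι} (hg : g ∈ fil ι 1) :
    dynkin ι (f * g) = act (fun _ => 0) letter f (dynkin ι g) := by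
  rw [dynkin_apply, dynkin_apply, map_sum]
  refine Finset.sum_congr rfl fun i _ => ?_
  rw [lastQuot_mul i f hg, act_mul letter_mem_fil]

theorem dynkin_letter (i : ι) : dynkin ι (letter i) = letter i := by
  classical
  rw [dynkin_apply, Finset.sum_eq_single i]
  · have : lastQuot i (letter i) = (1 : NCSeries ι) := by
      funext w
      rw [lastQuot_coeff, ← one_eq, one, letter, mono_apply, mono_apply]
      cases w <;> simp
    rw [this, act_one letter_mem_fil]
  · intro j _ hj
    have : lastQuot j (letter i) = (0 : NCSeries ι) := by
      funext w
      rw [lastQuot_coeff, letter, mono_apply, zero_coeff]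
      cases w <;> simp [hj]
    rw [this, map_zero]
    rfl
  · intro h
    exact absurd (Finset.mem_univ i) h

/-- The Dynkin operator multiplies Lie series by their length. -/
theorem dynkin_of_mem_lieSer {f : NCSeries ι} (hf : f ∈ lieSer (fun _ => 0) Set.univ) :
    dynkin ι f = lengthOp ι f := by
  refine eq_on_lieSer dynkin_isFilt lengthOp_isDer.filt (fun g hg => ?_) hf
  induction hg with
  | letter c _ => rw [dynkin_letter, lengthOp_letter]
  | bracket f g hf hg ihf ihg =>
    have hf1 := lieSer_le_fil hf.mem_lieSer
    have hg1 := lieSer_le_fil hg.mem_lieSer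
    have hact : ∀ p : NCSeries ι, LieMono (fun _ => 0) Set.univ p → ∀ z,
        act (fun _ => 0) letter p z = comm p z := fun p hp z => by
      rw [act_of_mem_lieSer letter_mem_fil (fun _ => mem_hom_zero _) hp.mem_lieSer, substHom_id,
        bracket_of_mem_hom_zero (mem_hom_zero _)]
    -- Lie elements act by their bracket, so the operator sends `[f, g]` to `[f, N g] - [g, N f]`,
    -- where `N` is the length operator by induction; this is the Leibniz rule for `N`.
    rw [bracket_of_mem_hom_zero (mem_hom_zero f), comm_apply, map_sub, map_sub, dynkin_mul f hg1,
      dynkin_mul g hf1, ihf, ihg, hact f hf, hact g hg,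
      lengthOp_isDer.leibniz_zero (mem_hom_zero f), lengthOp_isDer.leibniz_zero (mem_hom_zero g)]
    simp only [comm_apply]
    noncomm_ring

/-- Lie series are combinations `∑ Q i (ad x) x i`. -/
theorem exists_eq_sum_act {f : NCSeries ι} (hf : f ∈ lieSer (fun _ => 0) Set.univ) :
    ∃ Q : ι → NCSeries ι, (∀ i, Q i [] = f [i]) ∧
      f = ∑ i, act (fun _ => 0) letter (Q i) (letter i) := by
  -- Division by the length undoes the factor in Dynkin's formula. On the empty word the quotient is
  -- `0` by convention, which is harmless because a Lie series has no constant term.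
  set f' : NCSeries ι := fun w => (1 / (w.length : ℚ)) * f w with hf'
  have hL : f' ∈ lieSer (fun _ => 0) Set.univ := by
    intro m
    have : lenPart m f' = (1 / (m : ℚ)) • lenPart m f := by
      funext w
      rw [smul_coeff]
      simp only [lenPart]
      split_ifs with h
      · rw [← h]
      · rw [mul_zero]
    rw [this]
    exact Submodule.smul_mem _ _ (hf m)
  have hN : lengthOp ι f' = f := by
    funext w
    rw [lengthOp_coeff]
    change (w.length : ℚ) * ((1 / (w.length : ℚ)) * f w) = f w
    by_cases h : w = []
    · rw [h, mem_fil_one.1 (lieSer_le_fil hf)]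
      simp
    · have : (w.length : ℚ) ≠ 0 := by
        rw [Nat.cast_ne_zero]
        exact fun h' => h (List.length_eq_zero_iff.1 h')
      field_simp
  refine ⟨fun i => lastQuot i f', fun i => ?_, ?_⟩
  · change (1 / (([] ++ [i] : List ι).length : ℚ)) * f ([] ++ [i]) = f [i]
    simp
  · rw [← dynkin_apply, dynkin_of_mem_lieSer hL, hN]

end Dynkin

/-- With last series `1`, the relation says that BCH is a combination `∑ Q i (ad x) x i`, which
holds for any Lie series. The constant terms of the `Q i` are the linear coefficients of BCH, all
equal to `1`. -/
theorem exists_isAdmissible (m : ℕ) : ∃ P, IsAdmissible m P := by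
  set B : NCSeries (Fin m) := bchList (List.ofFn fun j : Fin m => letter j) with hB
  have hBL : B ∈ lieSer (fun _ => 0) Set.univ := by
    refine (bchList_mem_lieZero (deg := fun _ => 0) fun x hx => ?_).1
    obtain ⟨j, rfl⟩ := List.mem_ofFn.1 hx
    exact letter_mem_lieZero (Set.mem_univ j) rfl
  obtain ⟨Q, hQ, hQB⟩ := exists_eq_sum_act hBL
  refine ⟨Fin.lastCases 1 Q, fun i => ?_, ?_⟩
  · refine Fin.lastCases ?_ (fun j => ?_) i
    · beta_reduce
      rw [Fin.lastCases_last, one_coeff_nil]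
    · beta_reduce
      rw [Fin.lastCases_castSucc, hQ, hB, bchList_coeff_singleton, List.map_ofFn, List.sum_ofFn]
      simp [letter_coeff_singleton]
  · rw [← hB]
    simp only [Fin.lastCases_castSucc, Fin.lastCases_last, actAd_eq]
    rw [act_one letter_mem_fil, ← hQB]

/-! Dihedral averages. -/

theorem neg_bchList {l : List (NCSeries C)} (hl : ∀ x ∈ l, x ∈ fil C 1) :
    -bchList l = bchList (l.map fun x => -x).reverse := by
  apply exp_injective (neg_mem (bchList_mem_fil l)) (bchList_mem_fil _)
  have h : exp (bchList l) * exp (bchList (l.map fun x => -x).reverse) = 1 := by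
    rw [exp_bchList, exp_bchList]
    induction l with
    | nil => simp
    | cons x l ih =>
      simp only [List.map_cons, List.prod_cons, List.reverse_cons, List.map_append,
        List.prod_append, List.map_nil, List.prod_nil, mul_one]
      have ih' := ih fun y hy => hl y (by simp [hy])
      calc _ = exp x * ((l.map exp).prod * ((l.map fun x => -x).reverse.map exp).prod)
            * exp (-x) := by noncomm_ring
        _ = 1 := by rw [ih', mul_one, exp_mul_exp_neg (hl x (by simp))]
  calc _ = exp (-bchList l) * (exp (bchList l) * exp (bchList (l.map fun x => -x).reverse)) := by
        rw [h, mul_one]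
    _ = _ := by rw [← mul_assoc, exp_neg_mul_exp (bchList_mem_fil l), one_mul]

section Dihedral

variable {m : ℕ}

/-- The letters `x₁, …, xₘ` and `-BCH(x₁, …, xₘ)`. -/
noncomputable def cyc (m : ℕ) (i : Fin (m + 1)) : NCSeries (Fin m) :=
  if h : (i : ℕ) < m then letter ⟨i, h⟩ else -bchList (List.ofFn fun k : Fin m => letter k)

theorem cyc_castSucc (j : Fin m) : cyc m j.castSucc = letter j := by
  simp [cyc]

theorem cyc_last : cyc m (Fin.last m) = -bchList (List.ofFn fun k : Fin m => letter k) := by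
  simp [cyc]

theorem cyc_mem_lieSer (i : Fin (m + 1)) : cyc m i ∈ lieSer (fun _ => 0) Set.univ := by
  refine Fin.lastCases ?_ (fun j => ?_) i
  · rw [cyc_last]
    refine neg_mem (bchList_mem_lieZero (deg := fun _ => 0) fun x hx => ?_).1
    obtain ⟨j, rfl⟩ := List.mem_ofFn.1 hx
    exact letter_mem_lieZero (Set.mem_univ j) rfl
  · rw [cyc_castSucc]
    exact letter_mem_lieSer (Set.mem_univ j)

theorem cyc_mem_fil (i : Fin (m + 1)) : cyc m i ∈ fil (Fin m) 1 := lieSer_le_fil (cyc_mem_lieSer i)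

theorem castSucc_add_one (j : Fin m) : j.castSucc + 1 = j.succ := Fin.coeSucc_eq_succ

theorem last_add_one : Fin.last m + 1 = 0 := Fin.last_add_one m

/-- Starting at the first letter the product is `exp B · exp (-B)`. Moving the first factor to the
end conjugates the product, which therefore stays `1`. -/
theorem prod_exp_cyc (k : Fin (m + 1)) :
    (List.ofFn fun j : Fin (m + 1) => exp (cyc m (j + k))).prod = 1 := by
  refine Fin.induction ?_ (fun k ih => ?_) k
  · rw [List.ofFn_succ', List.concat_eq_append, List.prod_append, List.prod_singleton]
    simp only [add_zero, cyc_castSucc, cyc_last]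
    have : (List.ofFn fun j : Fin m => exp (letter j))
        = (List.ofFn fun j : Fin m => (letter j : NCSeries (Fin m))).map exp := by
      rw [List.map_ofFn]
      rfl
    rw [this, ← exp_bchList, exp_mul_exp_neg (bchList_mem_fil _)]
  · rw [List.ofFn_succ, List.prod_cons] at ih
    rw [List.ofFn_succ', List.concat_eq_append, List.prod_append, List.prod_singleton,
      ← castSucc_add_one k]
    have h1 : ∀ j : Fin m, j.castSucc + (k.castSucc + 1) = j.succ + k.castSucc := by
      intro j
      rw [← castSucc_add_one]
      abel
    have h2 : Fin.last m + (k.castSucc + 1) = 0 + k.castSucc := by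
      rw [← last_add_one]
      abel
    simp only [h1, h2]
    set x := cyc m (0 + k.castSucc) with hx
    set L := (List.ofFn fun j : Fin m => exp (cyc m (j.succ + k.castSucc))).prod with hL
    have hx1 : x ∈ fil (Fin m) 1 := cyc_mem_fil _
    calc L * exp x = exp (-x) * (exp x * L) * exp x := by
          rw [← mul_assoc, exp_neg_mul_exp hx1, one_mul]
      _ = 1 := by rw [ih, mul_one, exp_neg_mul_exp hx1]

/-- The relation `prod_exp_cyc` is solved for its last factor. This makes the cyclic shift of `m +
1` elements a well-defined substitution in `m` letters, see `rot_cyc`. -/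
theorem cyc_last_add (k : Fin (m + 1)) :
    cyc m (Fin.last m + k) = -bchList (List.ofFn fun j : Fin m => cyc m (j.castSucc + k)) := by
  have h := prod_exp_cyc k
  rw [List.ofFn_succ', List.concat_eq_append, List.prod_append, List.prod_singleton] at h
  have h1 : (List.ofFn fun j : Fin m => exp (cyc m (j.castSucc + k)))
      = (List.ofFn fun j : Fin m => cyc m (j.castSucc + k)).map exp := by
    rw [List.map_ofFn]
    rfl
  rw [h1, ← exp_bchList] at h
  set b := bchList (List.ofFn fun j : Fin m => cyc m (j.castSucc + k)) with hb
  have hb1 : b ∈ fil (Fin m) 1 := bchList_mem_fil _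
  apply exp_injective (cyc_mem_fil _) (neg_mem hb1)
  calc _ = exp (-b) * exp b * exp (cyc m (Fin.last m + k)) := by
        rw [exp_neg_mul_exp hb1, one_mul]
    _ = exp (-b) := by rw [mul_assoc, h, mul_one]

/-- The automorphism `x i ↦ x (i + k)` of series, with cyclic indices. -/
noncomputable def rot (k : Fin (m + 1)) : NCSeries (Fin m) →ₗ[ℚ] NCSeries (Fin m) :=
  substHom fun j => cyc m (j.castSucc + k)

/-- The automorphism `x i ↦ -x (n - i)` of series. -/
noncomputable def flipHom (m : ℕ) : NCSeries (Fin m) →ₗ[ℚ] NCSeries (Fin m) :=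
  substHom fun j => -letter j.rev

theorem neg_letter_mem_fil (j : Fin m) : -letter j.rev ∈ fil (Fin m) 1 :=
  neg_mem (letter_mem_fil _)

theorem rot_isAlgHom (k : Fin (m + 1)) : IsAlgHom (rot k) :=
  substHom_isAlgHom fun _ => cyc_mem_fil _

theorem flipHom_isAlgHom : IsAlgHom (flipHom m) := substHom_isAlgHom neg_letter_mem_fil

theorem rot_letter (k : Fin (m + 1)) (j : Fin m) : rot k (letter j) = cyc m (j.castSucc + k) :=
  substHom_letter (fun _ => cyc_mem_fil _) j

theorem flipHom_letter (j : Fin m) : flipHom m (letter j) = -letter j.rev :=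
  substHom_letter neg_letter_mem_fil j

theorem map_bchList_letter {Φ : NCSeries (Fin m) →ₗ[ℚ] NCSeries C} (hΦ : IsAlgHom Φ) :
    Φ (bchList (List.ofFn fun k : Fin m => letter k))
      = bchList (List.ofFn fun k : Fin m => Φ (letter k)) := by
  rw [hΦ.map_bchList, List.map_ofFn]
  · rfl
  · intro x hx
    obtain ⟨j, rfl⟩ := List.mem_ofFn.1 hx
    exact letter_mem_fil j

theorem rot_cyc (k j : Fin (m + 1)) : rot k (cyc m j) = cyc m (j + k) := by
  refine Fin.lastCases ?_ (fun i => ?_) j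
  · rw [cyc_last, map_neg, map_bchList_letter (rot_isAlgHom k), cyc_last_add]
    simp only [rot_letter]
  · rw [cyc_castSucc, rot_letter]

/-- With indices counted from `0`, the reflection `i ↦ n - i` of indices counted from `1` reads `i ↦
-(i + 1) - 1` modulo `n`. It reverses the first `m` indices and, by `flip_last`, fixes the last one.
-/
theorem flip_castSucc (j : Fin m) : -(j.castSucc + 1) - 1 = j.rev.castSucc := by
  rw [sub_eq_iff_eq_add, castSucc_add_one, castSucc_add_one, neg_eq_iff_add_eq_zero]
  apply Fin.ext
  rw [Fin.val_add]
  simp only [Fin.val_succ, Fin.val_rev, Fin.val_zero]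
  have : (j : ℕ) + 1 + (m - (j + 1) + 1) = m + 1 := by omega
  rw [this, Nat.mod_self]

theorem flip_last : -(Fin.last m + 1) - 1 = Fin.last m := by
  rw [last_add_one, neg_zero, sub_eq_iff_eq_add, last_add_one]

theorem bchList_reverse_neg (x : Fin m → NCSeries C) (hx : ∀ j, x j ∈ fil C 1) :
    bchList (List.ofFn fun j => -x j.rev) = -bchList (List.ofFn x) := by
  rw [neg_bchList]
  · congr 1
    apply List.ext_getElem
    · simp
    · intro i h1 h2
      simp only [List.getElem_ofFn, List.getElem_reverse, List.getElem_map, List.length_map,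
        List.length_ofFn]
      congr 2
      apply Fin.ext
      simp only [Fin.val_rev]
      omega
  · intro y hy
    obtain ⟨j, rfl⟩ := List.mem_ofFn.1 hy
    exact hx j

theorem flipHom_cyc (j : Fin (m + 1)) : flipHom m (cyc m j) = -cyc m (-(j + 1) - 1) := by
  refine Fin.lastCases ?_ (fun i => ?_) j
  · rw [flip_last, cyc_last, map_neg, map_bchList_letter flipHom_isAlgHom]
    simp only [flipHom_letter]
    rw [bchList_reverse_neg _ letter_mem_fil]
  · rw [flip_castSucc, cyc_castSucc, cyc_castSucc, flipHom_letter]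

/-- Moving the last term to the other side makes the relation cyclic, a form on which the dihedral
group visibly acts. -/
theorem isAdmissible_iff {P : Fin (m + 1) → NCSeries (Fin m)} :
    IsAdmissible m P ↔ (∀ i, P i [] = 1) ∧ ∑ i, act (fun _ => 0) letter (P i) (cyc m i) = 0 := by
  rw [IsAdmissible, Fin.sum_univ_castSucc, cyc_last, map_neg, ← sub_eq_add_neg, sub_eq_zero]
  simp only [actAd_eq, cyc_castSucc]

theorem isDihedral_iff {P : Fin (m + 1) → NCSeries (Fin m)} :
    IsDihedral m P ↔ (∀ i, P (i + 1) = rot 1 (P i)) ∧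
      ∀ i, P (-(i + 1) - 1) = flipHom m (P i) := by
  have h : (fun j : Fin m => if hj : (j : ℕ) + 1 < m then (letter ⟨j + 1, hj⟩ : NCSeries (Fin m))
      else -bchList (List.ofFn fun k : Fin m => letter k)) = fun j => cyc m (j.castSucc + 1) := by
    funext j
    rw [castSucc_add_one]
    rfl
  rw [IsDihedral, h]
  simp only [subst_eq]
  rfl

theorem rot_rot (k l : Fin (m + 1)) (f : NCSeries (Fin m)) : rot k (rot l f) = rot (l + k) f := by
  refine LinearMap.congr_fun (IsAlgHom.ext ((rot_isAlgHom k).comp (rot_isAlgHom l))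
    (rot_isAlgHom _) fun j => ?_) f
  rw [LinearMap.comp_apply, rot_letter, rot_letter, rot_cyc, add_assoc]

theorem rot_zero (f : NCSeries (Fin m)) : rot 0 f = f := by
  simp only [rot, add_zero, cyc_castSucc]
  exact substHom_id f

theorem flipHom_rot (k : Fin (m + 1)) (f : NCSeries (Fin m)) :
    flipHom m (rot k f) = rot (-k) (flipHom m f) := by
  refine LinearMap.congr_fun (IsAlgHom.ext (flipHom_isAlgHom.comp (rot_isAlgHom k))
    ((rot_isAlgHom (-k)).comp flipHom_isAlgHom) fun j => ?_) f
  rw [LinearMap.comp_apply, LinearMap.comp_apply, rot_letter, flipHom_cyc, flipHom_letter,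
    map_neg, rot_letter, ← flip_castSucc]
  congr 2
  abel

theorem flipHom_flipHom (f : NCSeries (Fin m)) : flipHom m (flipHom m f) = f := by
  refine LinearMap.congr_fun (IsAlgHom.ext (flipHom_isAlgHom.comp flipHom_isAlgHom)
    IsAlgHom.id fun j => ?_) f
  rw [LinearMap.comp_apply, flipHom_letter, map_neg, flipHom_letter, neg_neg, Fin.rev_rev]
  rfl

/-- Substituting Lie series commutes with the adjoint action, so rotations and reflections can be
applied inside the admissibility relation. -/
theorem map_act_letter {x : Fin m → NCSeries (Fin m)}
    (hx : ∀ j, x j ∈ lieSer (fun _ => 0) Set.univ) (P z : NCSeries (Fin m)) :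
    substHom x (act (fun _ => 0) letter P z)
      = act (fun _ => 0) letter (substHom x P) (substHom x z) := by
  rw [(substHom_isGradedHom (fun j => lieSer_le_fil (hx j)) fun _ => mem_hom_zero _).map_act
    letter_mem_fil, act_substHom letter_mem_fil (fun _ => mem_hom_zero _) hx]
  simp only [substHom_letter (fun j => lieSer_le_fil (hx j)), substHom_id]

theorem rot_act (k : Fin (m + 1)) (P z : NCSeries (Fin m)) :
    rot k (act (fun _ => 0) letter P z) = act (fun _ => 0) letter (rot k P) (rot k z) :=
  map_act_letter (fun _ => cyc_mem_lieSer _) P z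

theorem flipHom_act (P z : NCSeries (Fin m)) :
    flipHom m (act (fun _ => 0) letter P z)
      = act (fun _ => 0) letter (flipHom m P) (flipHom m z) :=
  map_act_letter (fun _ => neg_mem (letter_mem_lieSer (Set.mem_univ _))) P z

/-- Rotations preserve the cyclic admissibility relation and the reflection preserves it up to sign,
while constant terms are unaffected. Hence an admissible family can be averaged over the dihedral
group. -/
theorem exists_isDihedral (m : ℕ) : ∃ P, IsAdmissible m P ∧ IsDihedral m P := by
  obtain ⟨P, hP⟩ := exists_isAdmissible m
  obtain ⟨hP1, hP⟩ := isAdmissible_iff.1 hP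
  let r : Fin (m + 1) → Fin (m + 1) := fun i => -(i + 1) - 1
  have hr : ∀ i, r (r i) = i := fun i => by simp only [r]; abel
  -- The average over rotations, with the index shifted back so that `A (i + 1)` is the rotation of
  -- `A i`.
  let A : Fin (m + 1) → NCSeries (Fin m) := fun i =>
    (1 / ((m : ℚ) + 1)) • ∑ k, rot k (P (i - k))
  have hA : ∀ i, A (i + 1) = rot 1 (A i) := fun i => by
    simp only [A, map_smul, map_sum, rot_rot]
    congr 1
    rw [← Equiv.sum_comp (Equiv.addRight (1 : Fin (m + 1)))]
    refine Finset.sum_congr rfl fun k _ => ?_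
    rw [Equiv.coe_addRight, add_sub_add_right_eq_sub]
  have hm : ((m : ℚ) + 1) ≠ 0 := by positivity
  have hA1 : ∀ i, A i [] = 1 := fun i => by
    simp only [A]
    rw [smul_coeff, sum_coeff]
    simp only [rot, substHom_coeff_nil fun j : Fin m => cyc_mem_fil (j.castSucc + _), hP1]
    simp [hm]
  have hA0 : ∑ i, act (fun _ => 0) letter (A i) (cyc m i) = 0 := by
    simp only [A, map_smul, map_sum, LinearMap.smul_apply, LinearMap.sum_apply]
    rw [← Finset.smul_sum, Finset.sum_comm]
    refine (congrArg _ (Finset.sum_eq_zero fun k _ => ?_)).trans (smul_zero _)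
    -- After the shift of `i` by `k`, the sum is the image of the original relation under `rot k`.
    rw [← Equiv.sum_comp (Equiv.addRight k)]
    simp only [Equiv.coe_addRight, add_sub_cancel_right, ← rot_cyc k, ← rot_act]
    rw [← map_sum, hP, map_zero]
  -- The average over the reflection. It keeps the rotation property because the reflection
  -- conjugates `rot k` to `rot (-k)` and reverses the cyclic order of the indices.
  let Q : Fin (m + 1) → NCSeries (Fin m) := fun i => (1 / 2 : ℚ) • (A i + flipHom m (A (r i)))
  refine ⟨Q, isAdmissible_iff.2 ⟨fun i => ?_, ?_⟩, isDihedral_iff.2 ⟨fun i => ?_, fun i => ?_⟩⟩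
  · simp only [Q]
    rw [smul_coeff, add_coeff, flipHom, substHom_coeff_nil neg_letter_mem_fil, hA1, hA1]
    norm_num
  · simp only [Q, map_smul, map_add, LinearMap.smul_apply, LinearMap.add_apply]
    rw [← Finset.smul_sum, Finset.sum_add_distrib, hA0, zero_add]
    refine (congrArg _ ?_).trans (smul_zero _)
    have hre : ∀ i, act (fun _ => 0) letter (flipHom m (A (r i))) (cyc m i)
        = -flipHom m (act (fun _ => 0) letter (A (r i)) (cyc m (r i))) := fun i => by
      rw [flipHom_act, flipHom_cyc, map_neg, neg_neg]
      change _ = act _ _ _ (cyc m (r (r i)))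
      rw [hr]
    simp only [hre]
    have hs : ∑ i, act (fun _ => 0) letter (A (r i)) (cyc m (r i)) = 0 :=
      (Equiv.sum_comp (Equiv.mk r r hr hr) fun i => act (fun _ => 0) letter (A i) (cyc m i)).trans
        hA0
    rw [Finset.sum_neg_distrib, ← map_sum, hs, map_zero, neg_zero]
  · have hr1 : r (i + 1) + 1 = r i := by simp only [r]; abel
    simp only [Q, map_smul, map_add]
    rw [hA, ← hr1, hA (r (i + 1)), flipHom_rot, rot_rot, neg_add_cancel, rot_zero]
  · change Q (r i) = _
    simp only [Q, map_smul, map_add, hr, flipHom_flipHom]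
    rw [add_comm]

end Dihedral

end NCSeries

namespace NCSeries

open scoped NCSeries.Ring

variable {C C' ι : Type} {deg : C → ℤ}

/-! Estimates for power series of nearby elements. -/

section Estimates

variable {x y z d w : NCSeries C} {k : ℕ}

theorem pow_succ_sub_mem_fil (hx : x ∈ fil C 1) (hy : y ∈ fil C 1) (h : x - y ∈ fil C k) (n : ℕ) :
    x ^ (n + 1) - y ^ (n + 1) ∈ fil C (k + n) := by
  induction n with
  | zero => simpa using h
  | succ n ih =>
    have : x ^ (n + 1 + 1) - y ^ (n + 1 + 1)
        = (x ^ (n + 1) - y ^ (n + 1)) * x + y ^ (n + 1) * (x - y) := by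
      rw [pow_succ x (n + 1), pow_succ y (n + 1)]
      noncomm_ring
    rw [this]
    have h1 := mul_mem_fil ih hx
    have h2 := mul_mem_fil (pow_mem_fil hy (n + 1)) h
    exact add_mem h1 (fil_anti (by omega) h2)

theorem ev_sub_linear_mem_fil (hx : x ∈ fil C 1) (hy : y ∈ fil C 1) (h : x - y ∈ fil C k)
    (p : PowerSeries ℚ) :
    ev p x - ev p y - PowerSeries.coeff 1 p • (x - y) ∈ fil C (k + 1) := by
  have hF : ∀ n, PowerSeries.coeff n p • x ^ n - PowerSeries.coeff n p • y ^ n ∈ fil C n :=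
    fun n => sub_mem (ev_term_mem hx p n) (ev_term_mem hy p n)
  rw [ev, ev, ← lsum_sub, lsum_succ hF, lsum_succ fun n => fil_anti (Nat.le_succ n) (hF (n + 1))]
  simp only [pow_zero, sub_self, zero_add, pow_one, ← smul_sub, add_sub_cancel_left]
  refine lsum_mem_fil fun n => Submodule.smul_mem _ _ (fil_anti ?_
    (pow_succ_sub_mem_fil hx hy h (n + 1)))
  omega

theorem ev_sub_mem_fil (hx : x ∈ fil C 1) (hy : y ∈ fil C 1) (h : x - y ∈ fil C k)
    (p : PowerSeries ℚ) : ev p x - ev p y ∈ fil C k := by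
  have := add_mem (fil_anti (Nat.le_succ k) (ev_sub_linear_mem_fil hx hy h p))
    (Submodule.smul_mem _ (PowerSeries.coeff 1 p) h)
  rwa [sub_add_cancel] at this

theorem exp_sub_mem_fil (hx : x ∈ fil C 1) (hy : y ∈ fil C 1) (h : x - y ∈ fil C k) :
    exp x - exp y ∈ fil C k := by
  rw [exp_eq_ev, exp_eq_ev]
  exact ev_sub_mem_fil hx hy h _

theorem log_sub_linear_mem_fil (hx : x [] = 1) (hy : y [] = 1) (h : x - y ∈ fil C k) :
    log x - log y - (x - y) ∈ fil C (k + 1) := by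
  have := ev_sub_linear_mem_fil (sub_one_mem_fil hx) (sub_one_mem_fil hy)
    (by rwa [sub_sub_sub_cancel_right]) (PowerSeries.log ℚ)
  rw [log_eq_ev, log_eq_ev]
  simpa [PowerSeries.coeff_log] using this

theorem log_sub_mem_fil (hx : x [] = 1) (hy : y [] = 1) (h : x - y ∈ fil C k) :
    log x - log y ∈ fil C k := by
  have := add_mem (fil_anti (Nat.le_succ k) (log_sub_linear_mem_fil hx hy h)) h
  rwa [sub_add_cancel] at this

theorem exp_mul_exp_coeff_nil (x y : NCSeries C) : (exp x * exp y) [] = 1 := by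
  rw [mul_coeff_nil, exp_coeff_nil, exp_coeff_nil, one_mul]

/-- To leading order in `d` the exponential and the logarithm are linear and multiplication by `exp
w` is trivial, so `BCH` is addition. -/
theorem bch_sub_add_mem_fil (hd : d ∈ fil C (k + 1)) (hw : w ∈ fil C 1) :
    bch d w - w - d ∈ fil C (k + 2) := by
  have hd1 : d ∈ fil C 1 := fil_anti (by omega) hd
  have h1 : exp d - 1 - d ∈ fil C (k + 2) := by
    have := ev_sub_linear_mem_fil hd1 (zero_mem (fil C 1)) (k := k + 1)
      (by rwa [sub_zero]) (PowerSeries.exp ℚ)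
    rw [← exp_eq_ev, ← exp_eq_ev, exp_zero, sub_zero] at this
    simpa [PowerSeries.coeff_exp] using this
  have h2 : exp d - 1 ∈ fil C (k + 1) := by
    have := add_mem (fil_anti (Nat.le_succ _) h1) hd
    rwa [sub_add_cancel] at this
  have h3 : exp d * exp w - exp w = (exp d - 1) * exp w := by noncomm_ring
  have h4 := log_sub_linear_mem_fil (exp_mul_exp_coeff_nil d w) (exp_coeff_nil w) (k := k + 1)
    (by rw [h3]; exact mul_mem_fil_left h2 _)
  have h5 := mul_mem_fil h2 (sub_one_mem_fil (exp_coeff_nil w))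
  rw [log_exp hw, h3] at h4
  rw [bch, mul_eq]
  have : log (exp d * exp w) - w - d = (log (exp d * exp w) - w - (exp d - 1) * exp w)
      + ((exp d - 1) * (exp w - 1) + (exp d - 1 - d)) := by noncomm_ring
  rw [this]
  exact add_mem h4 (add_mem h5 h1)

theorem bch_right_sub_mem_fil (hd : d ∈ fil C k) (hd1 : d ∈ fil C 1) (hw : w ∈ fil C 1) :
    bch w d - w ∈ fil C k := by
  have h : exp w * exp d - exp w ∈ fil C k := by
    have := exp_sub_mem_fil hd1 (zero_mem (fil C 1)) (k := k) (by rwa [sub_zero])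
    rw [exp_zero] at this
    have h3 : exp w * exp d - exp w = exp w * (exp d - 1) := by noncomm_ring
    rw [h3]
    exact mul_mem_fil_right _ this
  have := log_sub_mem_fil (exp_mul_exp_coeff_nil w d) (exp_coeff_nil w) h
  rwa [log_exp hw] at this

theorem bch_neg_sub_mem_fil (hx : x ∈ fil C 1) (hy : y ∈ fil C 1) (h : x - y ∈ fil C k)
    (w : NCSeries C) : bch (-x) w - bch (-y) w ∈ fil C k := by
  have h' : exp (-x) * exp w - exp (-y) * exp w ∈ fil C k := by
    rw [← sub_mul]
    refine mul_mem_fil_left (exp_sub_mem_fil (neg_mem hx) (neg_mem hy) ?_) _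
    rw [← neg_mem_iff]
    convert h using 1
    abel
  exact log_sub_mem_fil (exp_mul_exp_coeff_nil _ _) (exp_mul_exp_coeff_nil _ _) h'

theorem bch_neg_bch (hz : z ∈ fil C 1) (hd : d ∈ fil C 1) (x : NCSeries C) :
    bch (-bch z d) x = bch (-d) (bch (-z) x) := by
  apply exp_injective (bch_mem_fil _ _) (bch_mem_fil _ _)
  rw [neg_bch hz hd, exp_bch, exp_bch, exp_bch, exp_bch, mul_assoc]

theorem exists_limit {z : ℕ → NCSeries C} (h : ∀ k, z (k + 1) - z k ∈ fil C (k + 1)) :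
    ∃ l : NCSeries C, ∀ k, l - z k ∈ fil C (k + 1) := by
  have key : ∀ j k, z (j + k) - z j ∈ fil C (j + 1) := fun j k => by
    induction k with
    | zero =>
      rw [add_zero, sub_self]
      exact zero_mem _
    | succ k ih =>
      have := add_mem (fil_anti (by omega) (h (j + k))) ih
      rwa [sub_add_sub_cancel] at this
  -- The coefficient at a word no longer changes once the index reaches the length of the word.
  refine ⟨fun w => z w.length w, fun k w hw => ?_⟩
  obtain ⟨j, rfl⟩ := Nat.exists_eq_add_of_le (Nat.lt_succ_iff.1 hw)
  have := key w.length j w (Nat.lt_succ_self _)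
  rw [sub_coeff, sub_eq_zero] at this
  change z w.length w - z (w.length + j) w = 0
  rw [this, sub_self]

end Estimates

/-! Universal averages. -/

section Average

variable {n : ℕ}

/-- The mean of the elements `BCH(-z, x i)`. -/
noncomputable def deviation (x : Fin n → NCSeries C) (z : NCSeries C) : NCSeries C :=
  (1 / (n : ℚ)) • ∑ i, bch (-z) (x i)

theorem deviation_mem_fil_one (x : Fin n → NCSeries C) (z : NCSeries C) :
    deviation x z ∈ fil C 1 :=
  Submodule.smul_mem _ _ (sum_mem fun _ _ => bch_mem_fil _ _)

/-- By `bch_neg_bch` each summand becomes `BCH(-d, BCH(-z, x i))`, which is `BCH(-z, x i) - d` up to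
one further order. Thus moving `z` by its deviation cancels the leading term of the deviation. -/
theorem deviation_bch_sub_mem_fil (hn : n ≠ 0) (x : Fin n → NCSeries C) {z d : NCSeries C}
    (hz : z ∈ fil C 1) {k : ℕ} (hd : d ∈ fil C (k + 1)) :
    deviation x (bch z d) - (deviation x z - d) ∈ fil C (k + 2) := by
  have hd1 : d ∈ fil C 1 := fil_anti (by omega) hd
  have hn' : (n : ℚ) ≠ 0 := by exact_mod_cast hn
  -- Writing `d` as the mean of `n` copies of itself allows a comparison summand by summand; this is
  -- where `n ≠ 0` enters.
  have hdd : d = (1 / (n : ℚ)) • ∑ _i : Fin n, d := by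
    rw [Finset.sum_const, Finset.card_univ, Fintype.card_fin, ← Nat.cast_smul_eq_nsmul ℚ, smul_smul,
      one_div_mul_cancel hn', one_smul]
  have : deviation x (bch z d) - (deviation x z - d)
      = (1 / (n : ℚ)) • ∑ i, (bch (-d) (bch (-z) (x i)) - bch (-z) (x i) - -d) := by
    rw [deviation, deviation]
    conv_lhs => rw [hdd]
    rw [← hdd, Finset.sum_sub_distrib, Finset.sum_sub_distrib, Finset.sum_neg_distrib, smul_sub,
      smul_sub, smul_neg, ← hdd]
    simp only [bch_neg_bch hz hd1]
    abel
  rw [this]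
  exact Submodule.smul_mem _ _ (sum_mem fun i _ =>
    bch_sub_add_mem_fil (neg_mem hd) (bch_mem_fil _ _))

/-- The difference `d = BCH(-z, z')` equals the difference of two vanishing deviations up to one
further order, so its order grows without bound. -/
theorem eq_of_deviation_eq_zero (hn : n ≠ 0) {x : Fin n → NCSeries C} {z z' : NCSeries C}
    (hz : z ∈ fil C 1) (hz' : z' ∈ fil C 1) (h : deviation x z = 0) (h' : deviation x z' = 0) :
    z = z' := by
  set d := bch (-z) z' with hd
  have hzd : bch z d = z' := by
    apply exp_injective (bch_mem_fil _ _) hz'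
    rw [exp_bch, hd, exp_bch, ← mul_assoc, exp_mul_exp_neg hz, one_mul]
  have key : ∀ k, d ∈ fil C (k + 1) := fun k => by
    induction k with
    | zero => exact bch_mem_fil _ _
    | succ k ih =>
      have := deviation_bch_sub_mem_fil hn x hz ih
      rwa [hzd, h, h', zero_sub, zero_sub, neg_neg] at this
  have hd0 : d = 0 := eq_of_forall_sub_mem_fil fun m => by
    rw [sub_zero]
    exact fil_anti (Nat.le_succ m) (key m)
  rw [← hzd, hd0]
  apply exp_injective hz (bch_mem_fil _ _)
  rw [exp_bch, exp_zero, mul_one]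

/-- Successive approximations of the average of the `x i`. -/
noncomputable def approxAvg (x : Fin (n + 1) → NCSeries C) : ℕ → NCSeries C
  | 0 => x 0
  | k + 1 => bch (approxAvg x k) (deviation x (approxAvg x k))

theorem approxAvg_mem_fil {x : Fin (n + 1) → NCSeries C} (hx : ∀ i, x i ∈ fil C 1) (k : ℕ) :
    approxAvg x k ∈ fil C 1 := by
  cases k with
  | zero => exact hx 0
  | succ k => exact bch_mem_fil _ _

theorem deviation_approxAvg_mem_fil {x : Fin (n + 1) → NCSeries C} (hx : ∀ i, x i ∈ fil C 1)
    (k : ℕ) : deviation x (approxAvg x k) ∈ fil C (k + 1) := by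
  induction k with
  | zero => exact deviation_mem_fil_one _ _
  | succ k ih =>
    have := deviation_bch_sub_mem_fil (Nat.succ_ne_zero n) x (approxAvg_mem_fil hx k) ih
    rwa [sub_self, sub_zero] at this

/-- The corrections in `approxAvg` gain one order at each step, so the approximations converge, and
the deviation is continuous in `z`. -/
theorem exists_deviation_eq_zero {x : Fin (n + 1) → NCSeries C} (hx : ∀ i, x i ∈ fil C 1) :
    ∃ z ∈ fil C 1, deviation x z = 0 ∧ ∀ k, z - approxAvg x k ∈ fil C (k + 1) := by
  obtain ⟨z, hz⟩ := exists_limit (z := approxAvg x) fun k =>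
    bch_right_sub_mem_fil (deviation_approxAvg_mem_fil hx k) (deviation_mem_fil_one _ _)
      (approxAvg_mem_fil hx k)
  have hz1 : z ∈ fil C 1 := by
    have := add_mem (hz 0) (approxAvg_mem_fil hx 0)
    rwa [sub_add_cancel] at this
  refine ⟨z, hz1, eq_of_forall_sub_mem_fil fun k => ?_, hz⟩
  have h1 : deviation x z - deviation x (approxAvg x k) ∈ fil C (k + 1) := by
    rw [deviation, deviation, ← smul_sub, ← Finset.sum_sub_distrib]
    exact Submodule.smul_mem _ _ (sum_mem fun i _ =>
      bch_neg_sub_mem_fil hz1 (approxAvg_mem_fil hx k) (hz k) _)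
  have := add_mem h1 (deviation_approxAvg_mem_fil hx k)
  rw [sub_add_cancel] at this
  rw [sub_zero]
  exact fil_anti (Nat.le_succ k) this

theorem IsAlgHom.map_deviation {Φ : NCSeries C →ₗ[ℚ] NCSeries C'} (hΦ : IsAlgHom Φ)
    {x : Fin n → NCSeries C} (hx : ∀ i, x i ∈ fil C 1) {z : NCSeries C} (hz : z ∈ fil C 1) :
    Φ (deviation x z) = deviation (fun i => Φ (x i)) (Φ z) := by
  rw [deviation, deviation, map_smul, map_sum]
  refine congrArg _ (Finset.sum_congr rfl fun i _ => ?_)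
  rw [hΦ.map_bch (neg_mem hz) (hx i), map_neg]

theorem IsAlgHom.map_approxAvg {Φ : NCSeries C →ₗ[ℚ] NCSeries C'} (hΦ : IsAlgHom Φ)
    {x : Fin (n + 1) → NCSeries C} (hx : ∀ i, x i ∈ fil C 1) (k : ℕ) :
    Φ (approxAvg x k) = approxAvg (fun i => Φ (x i)) k := by
  induction k with
  | zero => rfl
  | succ k ih =>
    rw [approxAvg, approxAvg, hΦ.map_bch (approxAvg_mem_fil hx k) (deviation_mem_fil_one _ _),
      hΦ.map_deviation hx (approxAvg_mem_fil hx k), ih]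

theorem approxAvg_mem_lieZero {S : Set C} {x : Fin (n + 1) → NCSeries C}
    (hx : ∀ i, x i ∈ lieZero deg S) (k : ℕ) : approxAvg x k ∈ lieZero deg S := by
  induction k with
  | zero => exact hx 0
  | succ k ih => exact bch_mem_lieZero ih (Submodule.smul_mem _ _ (sum_mem fun i _ =>
      bch_mem_lieZero (neg_mem ih) (hx i)))

/-- If `z` and the `x i` flow from `a` to `b`, the elements `BCH(-z, x i)` are loops at `b` and
hence closed. Their mean is closed and so again a loop at `b`, and following `z` by it still ends at
`b`. -/
theorem transports_approxAvg {D : NCSeries C →ₗ[ℚ] NCSeries C} (hD : IsDer deg D)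
    {a b : NCSeries C} {x : Fin (n + 1) → NCSeries C} (hx : ∀ i, x i ∈ hom deg 0)
    (hx' : ∀ i, x i ∈ fil C 1) (h : ∀ i, Transports D a b (exp (x i))) (k : ℕ) :
    approxAvg x k ∈ hom deg 0 ∧ Transports D a b (exp (approxAvg x k)) := by
  induction k with
  | zero => exact ⟨hx 0, h 0⟩
  | succ k ih =>
    obtain ⟨ih0, ih⟩ := ih
    set z := approxAvg x k with hz
    have hz1 : z ∈ fil C 1 := approxAvg_mem_fil hx' k
    have hw : ∀ i, bch (-z) (x i) ∈ hom deg 0 := fun i => bch_mem_hom (neg_mem ih0) (hx i)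
    have hd : deviation x z ∈ hom deg 0 := Submodule.smul_mem _ _ (sum_mem fun i _ => hw i)
    have hT : IsDer.tw deg D b (deviation x z) = 0 := by
      rw [deviation, map_smul, map_sum, Finset.sum_eq_zero, smul_zero]
      intro i _
      exact tw_eq_zero_of_transports hD (hw i) (bch_mem_fil _ _)
        (Transports.exp_bch hD (neg_mem ih0) (Transports.exp_neg hD ih0 hz1 ih) (h i))
    exact ⟨bch_mem_hom ih0 hd, Transports.exp_bch hD ih0 ih
      (transports_of_tw_eq_zero hD hd (deviation_mem_fil_one _ _) hT)⟩

theorem transports_of_forall_fil {D : NCSeries C →ₗ[ℚ] NCSeries C} (hD : IsFilt D)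
    {a b g : NCSeries C} (h : ∀ k, ∃ g', Transports D a b g' ∧ g - g' ∈ fil C k) :
    Transports D a b g := by
  refine eq_of_forall_sub_mem_fil fun k => ?_
  obtain ⟨g', hT, hg⟩ := h k
  have : D g - (g * b - a * g) = D (g - g') - ((g - g') * b - a * (g - g')) := by
    rw [map_sub, hT, sub_mul, mul_sub]
    abel
  rw [this]
  exact sub_mem (hD _ _ hg) (sub_mem (mul_mem_fil_left hg _) (mul_mem_fil_right _ hg))

theorem substHom_perm_coeff [Fintype ι] (π : Equiv.Perm ι) (P : NCSeries ι) (w : List ι) :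
    substHom (fun i => letter (π i)) P (w.map π) = P w := by
  classical
  let R : NCSeries ι →ₗ[ℚ] NCSeries ι :=
    { toFun := fun P => fun w => P (w.map π.symm)
      map_add' := fun _ _ => rfl
      map_smul' := fun _ _ => rfl }
  have hR : IsFilt R := fun m f hf w hw => hf _ (by rwa [List.length_map])
  have hx : ∀ i, (letter (π i) : NCSeries ι) ∈ fil ι 1 := fun i => letter_mem_fil _
  have : substHom (fun i => letter (π i)) = R := by
    refine (substHom_isAlgHom hx).filt.ext hR fun u => ?_
    rw [substHom_mono hx]
    have h1 : u.map (fun i => (letter (π i) : NCSeries ι)) = (u.map π).map letter := by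
      rw [List.map_map]
      rfl
    rw [h1, ← IsAlgHom.mono_eq_prod]
    funext w
    change (mono (u.map π) : NCSeries ι) w = (mono u : NCSeries ι) (w.map π.symm)
    rw [mono_apply, mono_apply]
    refine if_congr ⟨?_, ?_⟩ rfl rfl
    · rintro rfl
      simp
    · rintro rfl
      simp
  rw [this]
  change P ((w.map π).map π.symm) = P w
  simp

/-- The zero of the deviation of the free letters. It is a Lie series as a limit of Lie series,
symmetric by uniqueness of the zero, and compatible with flows because its substitutions are limits
of the approximations treated in `transports_approxAvg`. -/
theorem exists_isUniversalAverage (n : ℕ) : ∃ μ, IsUniversalAverage (n + 1) μ := by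
  obtain ⟨μ, hμ1, hμ, hlim⟩ := exists_deviation_eq_zero (x := fun i : Fin (n + 1) => letter i)
    letter_mem_fil
  refine ⟨μ, ⟨?_, fun π w => ?_, ?_⟩⟩
  · refine lieSer_of_forall (deg := fun _ => 0) fun m => ⟨_, (approxAvg_mem_lieZero
      (deg := fun _ => 0) (S := Set.univ) (fun i => letter_mem_lieZero (Set.mem_univ i) rfl) m).1,
      fil_anti (Nat.le_succ m) (hlim m)⟩
  · have hx : ∀ i, (letter (π i) : NCSeries (Fin (n + 1))) ∈ fil _ 1 := fun i => letter_mem_fil _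
    have hΦ := substHom_isAlgHom hx
    have h1 := hΦ.map_deviation letter_mem_fil hμ1
    rw [hμ, map_zero] at h1
    -- Permuting the letters permutes the summands of the deviation, so the permuted series is a
    -- zero as well.
    have h2 : deviation letter (substHom (fun i => letter (π i)) μ) = 0 := by
      rw [h1, deviation, deviation]
      refine congrArg _ ?_
      simp only [substHom_letter hx]
      exact (Equiv.sum_comp π fun i => bch (-substHom (fun i => letter (π i)) μ) (letter i)).symm
    have h3 := eq_of_deviation_eq_zero (Nat.succ_ne_zero n)
      (mem_fil_one.2 (by rw [substHom_coeff_nil hx, mem_fil_one.1 hμ1])) hμ1 h2 hμ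
    conv_lhs => rw [← h3]
    exact substHom_perm_coeff π μ w
  · intro C _ deg d hd a b ha hb x hx hflow
    have := Fintype.ofFinite C
    obtain ⟨D, hD, hdD⟩ := hd.exists_isDiff
    set y : Fin (n + 1) → NCSeries C := fun i => (x i : NCSeries C) with hy
    have hy1 : ∀ i, y i ∈ fil C 1 := fun i => lieSer_le_fil (lieAlg_le_lieSer (x i).2)
    have hy0 : ∀ i, y i ∈ lieZero deg Set.univ := fun i => ⟨lieAlg_le_lieSer (x i).2, hx i⟩
    have hμL : μ ∈ lieSer (fun _ => 0) Set.univ :=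
      lieSer_of_forall (deg := fun _ => 0) fun m => ⟨_, (approxAvg_mem_lieZero
      (deg := fun _ => 0) (S := Set.univ) (fun i => letter_mem_lieZero (Set.mem_univ i) rfl) m).1,
      fil_anti (Nat.le_succ m) (hlim m)⟩
    have hz := substHom_mem_lieZero hy0 hμL
    refine ⟨⟨substHom y μ, lieZero_mem_lieAlg hz⟩, (subst_eq μ y).symm, ?_⟩
    rw [flow_eq_iff hD.toIsDer hdD hz.2]
    refine transports_of_forall_fil hD.filt fun k => ?_
    have hs := substHom_isAlgHom hy1
    refine ⟨exp (approxAvg y k), (transports_approxAvg hD.toIsDer hx hy1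
      (fun i => (flow_eq_iff hD.toIsDer hdD (hx i) a _).1 (hflow i)) k).2, ?_⟩
    refine exp_sub_mem_fil (lieZero_mem_fil hz) (approxAvg_mem_fil hy1 k) ?_
    have := hs.filt _ _ (hlim k)
    rw [map_sub, hs.map_approxAvg letter_mem_fil] at this
    simp only [substHom_letter hy1] at this
    exact fil_anti (Nat.le_succ k) this

end Average

end NCSeries

namespace NCSeries

open scoped NCSeries.Ring

variable {C C' ι : Type} {deg : C → ℤ}

/-! Conjugation. -/

section Conj

variable {g h e f : NCSeries C}

/-- Conjugation by an invertible series is an algebra homomorphism. -/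
theorem conj_isAlgHom (hgh : g * h = 1) (hhg : h * g = 1) :
    IsAlgHom ((LinearMap.mulLeft ℚ g).comp (LinearMap.mulRight ℚ h)) where
  filt := (IsFilt.mulLeft g).comp (IsFilt.mulRight h)
  map_one := by
    change g * (1 * h) = 1
    rw [one_mul, hgh]
  map_mul x y := by
    change g * (x * y * h) = g * (x * h) * (g * (y * h))
    calc g * (x * y * h) = g * x * 1 * y * h := by noncomm_ring
      _ = _ := by rw [← hhg]; noncomm_ring

theorem exp_conj (hgh : g * h = 1) (hhg : h * g = 1) (hf : f ∈ fil C 1) :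
    exp (g * f * h) = g * exp f * h := by
  have := (conj_isAlgHom hgh hhg).map_exp hf
  change g * (exp f * h) = exp (g * (f * h)) at this
  rw [mul_assoc, mul_assoc, this]

theorem exp_expAd (he : e ∈ hom deg 0) (he' : e ∈ fil C 1) (hf : f ∈ fil C 1) :
    exp (expAd deg e f) = exp e * exp f * exp (-e) := by
  rw [expAd_eq he he', exp_conj (exp_mul_exp_neg he') (exp_neg_mul_exp he') hf]

theorem expAd_mem_fil (he : e ∈ hom deg 0) (he' : e ∈ fil C 1) {k : ℕ} (hf : f ∈ fil C k) :
    expAd deg e f ∈ fil C k := by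
  rw [expAd_eq he he']
  exact mul_mem_fil_left (mul_mem_fil_right _ hf) _

end Conj

/-! Twisted differentials of generators. -/

section Twist

variable {D : NCSeries C →ₗ[ℚ] NCSeries C} {a b f r : NCSeries C}

theorem tw_eq_iff (ha : a ∈ hom deg (-1)) :
    IsDer.tw deg D a f = r ↔ D f = r - bracket deg a f := by
  rw [IsDer.tw_apply, bracket_of_odd ha, eq_sub_iff_add_eq, add_sub_assoc]

theorem sub_bracket_mem_hom {p : ℤ} (ha : a ∈ hom deg (-1)) (hf : f ∈ hom deg p)
    (hr : r ∈ hom deg (p - 1)) : r - bracket deg a f ∈ hom deg (p - 1) := by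
  refine sub_mem hr ?_
  have := bracket_mem_hom ha hf
  rwa [neg_add_eq_sub] at this

theorem sub_bracket_coeff_singleton (ha : a ∈ fil C 1) (hf : f ∈ fil C 1) (c : C) :
    (r - bracket deg a f) [c] = r [c] := by
  rw [sub_coeff, bracket_coeff_singleton ha hf, sub_zero]

theorem neg_mul_self_mem_lieSer {S : Set C} (ha : a ∈ hom deg (-1)) (ha' : a ∈ lieSer deg S) :
    -(a * a) ∈ lieSer deg S := by
  rw [← bracket_self_of_odd ha]
  exact neg_mem (Submodule.smul_mem _ _ (bracket_mem_lieSer ha' ha'))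

theorem neg_mul_self_mem_hom (ha : a ∈ hom deg (-1)) : -(a * a) ∈ hom deg (-1 - 1) :=
  neg_mem (mul_mem_hom ha ha)

theorem neg_mul_self_coeff_singleton (ha : a ∈ fil C 1) (c : C) : (-(a * a)) [c] = 0 :=
  coeff_singleton_of_mem_fil (neg_mem (mul_mem_fil ha ha)) c

end Twist

/-! Sums over paths from one point to another. -/

section Sector

variable {m : ℕ} {P : Fin (m + 1) → NCSeries (Fin m)} {γ z : Fin (m + 1) → NCSeries C}

theorem prod_exp_mul_exp_neg {m : ℕ} (γ : Fin (m + 1) → NCSeries C) (hγ : ∀ i, γ i ∈ fil C 1) :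
    (List.ofFn fun j : Fin m => exp (γ j.castSucc) * exp (-γ j.succ)).prod
      = exp (γ 0) * exp (-γ (Fin.last m)) := by
  induction m with
  | zero => simpa using (exp_mul_exp_neg (hγ 0)).symm
  | succ m ih =>
    rw [List.ofFn_succ', List.concat_eq_append, List.prod_append, List.prod_singleton]
    have := ih (fun i => γ i.castSucc) fun i => hγ _
    simp only [← Fin.succ_castSucc] at this ⊢
    rw [this, Fin.succ_last]
    calc exp (γ (Fin.castSucc 0)) * exp (-γ (Fin.castSucc (Fin.last m)))
          * (exp (γ (Fin.castSucc (Fin.last m))) * exp (-γ (Fin.last (m + 1))))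
        = exp (γ (Fin.castSucc 0)) * (exp (-γ (Fin.castSucc (Fin.last m)))
          * exp (γ (Fin.castSucc (Fin.last m)))) * exp (-γ (Fin.last (m + 1))) := by noncomm_ring
      _ = _ := by rw [exp_neg_mul_exp (hγ _), mul_one, Fin.castSucc_zero]

/-- The loops `BCH(γ j, -γ (j + 1))`. -/
noncomputable def loop (γ : Fin (m + 1) → NCSeries C) (j : Fin m) : NCSeries C :=
  bch (γ j.castSucc) (-γ j.succ)

theorem loop_mem_fil (j : Fin m) : loop γ j ∈ fil C 1 := bch_mem_fil _ _

theorem loop_mem_hom (hγ : ∀ i, γ i ∈ hom deg 0) (j : Fin m) : loop γ j ∈ hom deg 0 :=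
  bch_mem_hom (hγ _) (neg_mem (hγ _))

/-- The product of the loops between consecutive paths telescopes to the loop from the first path to
the last one. Its inverse, the closing loop, is therefore the value of the last cyclic element. -/
theorem substHom_loop_cyc (hγ : ∀ i, γ i ∈ fil C 1) (i : Fin (m + 1)) :
    substHom (loop γ) (cyc m i) = bch (γ i) (-γ (i + 1)) := by
  have hs := substHom_isAlgHom (x := loop γ) loop_mem_fil
  refine Fin.lastCases ?_ (fun j => ?_) i
  · have h1 : -bch (γ (Fin.last m)) (-γ 0) = bch (γ 0) (-γ (Fin.last m)) := by
      rw [neg_bch (hγ _) (neg_mem (hγ _)), neg_neg]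
    rw [cyc_last, map_neg, map_bchList_letter hs, last_add_one, neg_eq_iff_eq_neg, h1]
    apply exp_injective (bchList_mem_fil _) (bch_mem_fil _ _)
    rw [exp_bchList, exp_bch, ← prod_exp_mul_exp_neg γ hγ, List.map_ofFn]
    congr 2
    funext j
    rw [Function.comp_apply, substHom_letter loop_mem_fil, loop, exp_bch]
  · rw [cyc_castSucc, substHom_letter loop_mem_fil, castSucc_add_one]
    rfl

/-- The image of the cyclic admissibility relation under the substitution of loops for letters. -/
theorem sum_act_loop (hP : IsAdmissible m P) (hγ : ∀ i, γ i ∈ lieZero deg Set.univ) :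
    ∑ i, act deg (loop γ) (P i) (bch (γ i) (-γ (i + 1))) = 0 := by
  have hγ1 : ∀ i, γ i ∈ fil C 1 := fun i => lieZero_mem_fil (hγ i)
  have hs := substHom_isGradedHom (deg := fun _ => 0) (deg' := deg) (x := loop γ) loop_mem_fil
    (loop_mem_hom fun i => (hγ i).2)
  have h := congrArg (substHom (loop γ)) (isAdmissible_iff.1 hP).2
  rw [map_sum, map_zero] at h
  rw [← h]
  refine Finset.sum_congr rfl fun i _ => ?_
  rw [hs.map_act letter_mem_fil, substHom_loop_cyc hγ1]
  simp only [substHom_letter loop_mem_fil]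

theorem tw_loop {D : NCSeries C →ₗ[ℚ] NCSeries C} (hD : IsDer deg D) {a b : NCSeries C}
    (hγ : ∀ i, γ i ∈ lieZero deg Set.univ) (hT : ∀ i, Transports D a b (exp (γ i)))
    (i j : Fin (m + 1)) : IsDer.tw deg D a (bch (γ i) (-γ j)) = 0 :=
  tw_eq_zero_of_transports hD (bch_mem_hom (hγ _).2 (neg_mem (hγ _).2)) (bch_mem_fil _ _)
    (Transports.exp_bch hD (hγ _).2 (hT _)
      (Transports.exp_neg hD (hγ _).2 (lieZero_mem_fil (hγ _)) (hT _)))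

/-- The value of the twisted differential on the top cell is closed. -/
theorem tw_sum_act {D : NCSeries C →ₗ[ℚ] NCSeries C} (hD : IsDer deg D) {a b : NCSeries C}
    (hP : IsAdmissible m P) (hγ : ∀ i, γ i ∈ lieZero deg Set.univ)
    (hT : ∀ i, Transports D a b (exp (γ i)))
    (hz : ∀ i, IsDer.tw deg D a (z i) = bch (γ i) (-γ (i + 1))) :
    IsDer.tw deg D a (∑ i, act deg (loop γ) (P i) (z i)) = 0 := by
  rw [map_sum, ← sum_act_loop hP hγ]
  refine Finset.sum_congr rfl fun i _ => ?_
  rw [tw_act hD (loop_mem_hom fun i => (hγ i).2) loop_mem_fil (fun _ => tw_loop hD hγ hT _ _), hz]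

theorem sum_act_coeff_singleton (hP : IsAdmissible m P) (hz : ∀ i, z i ∈ fil C 1) (c : C) :
    (∑ i, act deg (loop γ) (P i) (z i)) [c] = ∑ i, z i [c] := by
  rw [sum_coeff]
  refine Finset.sum_congr rfl fun i _ => ?_
  rw [act_coeff_singleton loop_mem_fil _ (hz i), hP.1, one_mul]

theorem sum_act_mem_hom {n : ℤ} (hγ : ∀ i, γ i ∈ hom deg 0) (hz : ∀ i, z i ∈ hom deg n) :
    ∑ i, act deg (loop γ) (P i) (z i) ∈ hom deg n :=
  sum_mem fun i _ => act_mem_hom (loop_mem_hom hγ) _ (hz i)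

theorem sum_act_mem_lieSer {S : Set C} (hγ : ∀ i, γ i ∈ lieZero deg S)
    (hz : ∀ i, z i ∈ lieSer deg S) : ∑ i, act deg (loop γ) (P i) (z i) ∈ lieSer deg S :=
  sum_mem fun i _ => act_mem_lieSer
    (fun _ => (bch_mem_lieZero (hγ _) (neg_mem (hγ _))).1) _ (hz i)

end Sector

/-! Models. -/

section Model

variable {X : CellData}

/-- Values on the cells that extend to a derivation of square zero define a model. -/
theorem exists_isModel [Finite X.Cell] {v : X.Cell → NCSeries X.Cell}
    (hhom : ∀ c, v c ∈ hom X.deg (X.deg c - 1)) (hlie : ∀ c, v c ∈ lieSer X.deg (X.cl c))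
    (hlin : ∀ c c', v c [c'] = (X.inc c c' : ℚ))
    (hflat : ∀ c, X.dim c = 0 → v c = -(letter c * letter c))
    (hsq : ∀ D, IsOddDer X.deg D → (∀ c, D (letter c) = v c) → ∀ c, D (D (letter c)) = 0) :
    ∃ (d : X.Alg →ₗ[ℚ] X.Alg) (D : NCSeries X.Cell →ₗ[ℚ] NCSeries X.Cell), X.IsModel d ∧
      IsDiff X.deg D ∧ (∀ f : X.Alg, (d f : NCSeries X.Cell) = D f) ∧
        ∀ c, D (letter c) = v c := by
  have := Fintype.ofFinite X.Cell
  have hv1 : ∀ c, v c ∈ fil X.Cell 1 := fun c => lieSer_le_fil (hlie c)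
  have hD := mkDer_isOddDer hv1 hhom
  have hl := mkDer_letter (deg := X.deg) hv1
  have hdiff : IsDiff X.deg (mkDer X.deg v) := hD.isDiff (hsq _ hD hl) fun c => by
    rw [hl]
    exact lieSer_mono (Set.subset_univ _) (hlie c)
  refine ⟨hdiff.restrict, mkDer X.deg v, ⟨hdiff.isDifferential, fun c hc => ?_, fun c c' => ?_,
    fun c => ?_⟩, hdiff, hdiff.restrict_coe, hl⟩
  · rw [isPoint_iff hdiff.restrict_coe]
    refine ⟨?_, ?_⟩
    · have := letter_mem_hom (deg := X.deg) c
      rwa [CellData.deg, hc] at this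
    · rw [gen_coe, hl, hflat c hc]
  · rw [hdiff.restrict_coe, gen_coe, hl, hlin]
  · rw [hdiff.restrict_coe, gen_coe, hl]
    exact hlie c

theorem IsModel.map_vertex {d : X.Alg →ₗ[ℚ] X.Alg} (hd : X.IsModel d)
    {D : NCSeries X.Cell →ₗ[ℚ] NCSeries X.Cell}
    (hdD : ∀ f : X.Alg, (d f : NCSeries X.Cell) = D f) {c : X.Cell} (hc : X.dim c = 0) :
    D (letter c) = -(letter c * letter c) :=
  ((isPoint_iff hdD _).1 (hd.flat c hc)).2

end Model

end NCSeries

namespace NCSeries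

open scoped NCSeries.Ring

/-! The banana. -/

section Banana

variable {m : ℕ} {P : Fin (m + 1) → NCSeries (Fin m)}

instance banana_finite (m : ℕ) : Finite (banana m).Cell := by
  let F : BananaCell (m + 1) → Fin 5 × Fin (m + 1) := fun
    | .a => (0, 0)
    | .b => (1, 0)
    | .e i => (2, i)
    | .f i => (3, i)
    | .h => (4, 0)
  have hF : Function.Injective F := by
    intro x y h
    cases x <;> cases y <;> simp_all [F]
  exact Finite.of_injective F hF

theorem bSer_mem_fil (c : BananaCell (m + 1)) : bSer c ∈ fil (banana m).Cell 1 := letter_mem_fil _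

theorem bSer_mem_lieSer {S : Set (banana m).Cell} {c : BananaCell (m + 1)}
    (h : (c : (banana m).Cell) ∈ S) : bSer c ∈ lieSer (banana m).deg S :=
  letter_mem_lieSer h

theorem bSer_mem_hom {n : ℤ} (c : BananaCell (m + 1))
    (h : (banana m).deg (c : (banana m).Cell) = n) : bSer c ∈ hom (banana m).deg n :=
  h ▸ letter_mem_hom _

theorem bSer_a_mem_hom : bSer (m := m) .a ∈ hom (banana m).deg (-1) := bSer_mem_hom _ rfl

theorem bSer_b_mem_hom : bSer (m := m) .b ∈ hom (banana m).deg (-1) := bSer_mem_hom _ rfl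

theorem bSer_e_mem_hom (i : Fin (m + 1)) : bSer (.e i) ∈ hom (banana m).deg 0 := bSer_mem_hom _ rfl

theorem bSer_f_mem_hom (i : Fin (m + 1)) : bSer (.f i) ∈ hom (banana m).deg 1 := bSer_mem_hom _ rfl

theorem bSer_h_mem_hom : bSer (m := m) .h ∈ hom (banana m).deg 2 := bSer_mem_hom _ rfl

theorem bSer_e_mem_lieZero {S : Set (banana m).Cell} {i : Fin (m + 1)}
    (h : (BananaCell.e i : (banana m).Cell) ∈ S) : bSer (.e i) ∈ lieZero (banana m).deg S :=
  ⟨bSer_mem_lieSer h, bSer_e_mem_hom i⟩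

/-- A cell of the banana, as a letter. -/
def bCell (c : BananaCell (m + 1)) : (banana m).Cell := c

theorem bSer_coeff_singleton [DecidableEq (BananaCell (m + 1))] (c d : BananaCell (m + 1)) :
    bSer c [bCell d] = if d = c then 1 else 0 :=
  letter_coeff_singleton (C := BananaCell (m + 1)) c d

/-- The boundary of the 3-cell of the banana, based at `a`. -/
noncomputable def bananaTop (P : Fin (m + 1) → NCSeries (Fin m)) : NCSeries (banana m).Cell :=
  ∑ i, act (banana m).deg (loop fun i => bSer (.e i)) (P i) (bSer (.f i))

/-- The values of the differential of the banana on generators. -/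
noncomputable def bananaVal (P : Fin (m + 1) → NCSeries (Fin m)) :
    BananaCell (m + 1) → NCSeries (banana m).Cell
  | .a => -(bSer .a * bSer .a)
  | .b => -(bSer .b * bSer .b)
  | .e i => edgeDiff (banana m).deg (bSer (.e i)) (bSer .a) (bSer .b)
  | .f i => bch (bSer (.e i)) (-bSer (.e (i + 1))) - bracket (banana m).deg (bSer .a) (bSer (.f i))
  | .h => bananaTop P - bracket (banana m).deg (bSer .a) (bSer .h)

theorem bananaTop_eq (P : Fin (m + 1) → NCSeries (Fin m)) :
    ∑ i, actAd (banana m).deg (P i)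
        (fun j : Fin m => bch (bSer (.e j.castSucc)) (-bSer (.e j.succ))) (bSer (.f i))
      = bananaTop P := by
  simp only [actAd_eq]
  rfl

/-- Each prescribed formula determines `D` on one generator, the twisted ones after solving for `D`;
this is the uniqueness of the model. -/
theorem IsBananaModel.eq_val {d : (banana m).Alg →ₗ[ℚ] (banana m).Alg} (hd : IsBananaModel m P d)
    {D : NCSeries (banana m).Cell →ₗ[ℚ] NCSeries (banana m).Cell}
    (hdD : ∀ f : (banana m).Alg, (d f : NCSeries (banana m).Cell) = D f)
    (c : BananaCell (m + 1)) : D (bSer c) = bananaVal P c := by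
  have htw : ∀ f : (banana m).Alg, (twisted d (bGen .a) f : NCSeries (banana m).Cell)
      = IsDer.tw (banana m).deg D (bSer .a) f := fun f => twisted_coe hdD bSer_a_mem_hom f
  cases c with
  | a => exact IsModel.map_vertex hd.model hdD rfl
  | b => exact IsModel.map_vertex hd.model hdD rfl
  | e i => exact (hdD _).symm.trans (hd.d_edge i)
  | f i => exact (tw_eq_iff bSer_a_mem_hom).1 ((htw _).symm.trans (hd.d_face i))
  | h => exact (tw_eq_iff bSer_a_mem_hom).1 ((htw _).symm.trans (hd.d_top.trans (bananaTop_eq P)))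

section Values

variable {D : NCSeries (banana m).Cell →ₗ[ℚ] NCSeries (banana m).Cell}
  (hD : IsOddDer (banana m).deg D) (hv : ∀ c : BananaCell (m + 1), D (bSer c) = bananaVal P c)

include hv

theorem banana_isMC_a : IsMC (banana m).deg D (bSer .a) := ⟨bSer_a_mem_hom, hv .a⟩

theorem banana_isMC_b : IsMC (banana m).deg D (bSer .b) := ⟨bSer_b_mem_hom, hv .b⟩

theorem banana_tw_face (i : Fin (m + 1)) :
    IsDer.tw (banana m).deg D (bSer .a) (bSer (.f i)) = bch (bSer (.e i)) (-bSer (.e (i + 1))) :=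
  (tw_eq_iff bSer_a_mem_hom).2 (hv (.f i))

theorem banana_tw_top : IsDer.tw (banana m).deg D (bSer .a) (bSer .h) = bananaTop P :=
  (tw_eq_iff bSer_a_mem_hom).2 (hv .h)

include hD

theorem banana_transports (i : Fin (m + 1)) :
    Transports D (bSer .a) (bSer .b) (exp (bSer (.e i))) :=
  transports_of_edgeDiff hD.toIsDer (bSer_e_mem_hom i) (bSer_mem_fil _) (hv (.e i))

/-- Vertices are points, edges join points, and the twisted boundaries of the faces are loops.
Admissibility is needed only for the 3-cell, where it closes the sum over the faces. -/
theorem banana_sq (hP : IsAdmissible m P) (c : BananaCell (m + 1)) : D (D (bSer c)) = 0 := by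
  have hT := banana_transports hD hv
  have he : ∀ i : Fin (m + 1), bSer (.e i) ∈ lieZero (banana m).deg Set.univ :=
    fun i => bSer_e_mem_lieZero (Set.mem_univ _)
  cases c with
  | a => exact IsMC.sq hD (banana_isMC_a hv)
  | b => exact IsMC.sq hD (banana_isMC_b hv)
  | e i =>
    exact Transports.exp_sq hD (banana_isMC_a hv) (banana_isMC_b hv) (bSer_e_mem_hom i)
      (bSer_mem_fil _) (hT i)
  | f i =>
    exact sq_of_tw hD (banana_isMC_a hv) (banana_tw_face hv i)
      (tw_loop hD.toIsDer he hT i (i + 1))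
  | h =>
    exact sq_of_tw hD (banana_isMC_a hv) (banana_tw_top hv)
      (tw_sum_act hD.toIsDer hP he hT (banana_tw_face hv))

end Values

/-! ### Degree, locality and linear part for the banana; its model and the maps out of it. -/

theorem bananaVal_mem_hom (c : BananaCell (m + 1)) :
    bananaVal P c ∈ hom (banana m).deg ((banana m).deg (c : (banana m).Cell) - 1) := by
  cases c with
  | a => exact neg_mul_self_mem_hom bSer_a_mem_hom
  | b => exact neg_mul_self_mem_hom bSer_b_mem_hom
  | e i => exact edgeDiff_mem_hom (bSer_e_mem_hom i) bSer_a_mem_hom bSer_b_mem_hom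
  | f i =>
    exact sub_bracket_mem_hom (p := 1) bSer_a_mem_hom (bSer_f_mem_hom i)
      (bch_mem_hom (bSer_e_mem_hom _) (neg_mem (bSer_e_mem_hom _)))
  | h =>
    exact sub_bracket_mem_hom (p := 2) bSer_a_mem_hom bSer_h_mem_hom
      (sum_act_mem_hom bSer_e_mem_hom bSer_f_mem_hom)

theorem bananaVal_mem_lieSer (c : BananaCell (m + 1)) :
    bananaVal P c ∈ lieSer (banana m).deg ((banana m).cl (c : (banana m).Cell)) := by
  cases c with
  | a => exact neg_mul_self_mem_lieSer bSer_a_mem_hom (bSer_mem_lieSer (Set.mem_singleton _))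
  | b => exact neg_mul_self_mem_lieSer bSer_b_mem_hom (bSer_mem_lieSer (Set.mem_singleton _))
  | e i =>
    exact edgeDiff_mem_lieSer (bSer_e_mem_hom i) (bSer_mem_lieSer (Or.inl rfl))
      (bSer_mem_lieSer (Or.inr (Or.inl rfl))) (bSer_mem_lieSer (Or.inr (Or.inr rfl)))
  | f i =>
    exact sub_mem (bch_mem_lieZero (bSer_e_mem_lieZero (Or.inr (Or.inl rfl)))
      (neg_mem (bSer_e_mem_lieZero (Or.inr (Or.inr (Or.inl rfl)))))).1
      (bracket_mem_lieSer (bSer_mem_lieSer (Or.inr (Or.inr (Or.inr (Or.inl rfl)))))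
        (bSer_mem_lieSer (Or.inl rfl)))
  | h =>
    exact sub_mem (sum_act_mem_lieSer (fun i => bSer_e_mem_lieZero (Set.mem_univ _))
      fun i => bSer_mem_lieSer (Set.mem_univ _))
      (bracket_mem_lieSer (bSer_mem_lieSer (Set.mem_univ _)) (bSer_mem_lieSer (Set.mem_univ _)))

theorem bananaVal_coeff_singleton (hP : IsAdmissible m P) (c c' : BananaCell (m + 1)) :
    bananaVal P c [bCell c'] = ((banana m).inc (bCell c) (bCell c') : ℚ) := by
  classical
  cases c with
  | a =>
    rw [bananaVal, neg_mul_self_coeff_singleton (bSer_mem_fil _)]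
    simp [banana, bCell]
  | b =>
    rw [bananaVal, neg_mul_self_coeff_singleton (bSer_mem_fil _)]
    simp [banana, bCell]
  | e i =>
    rw [bananaVal, edgeDiff_coeff_singleton (bSer_e_mem_hom i) (bSer_mem_fil _) (bSer_mem_fil _)
      (bSer_mem_fil _), bSer_coeff_singleton, bSer_coeff_singleton]
    cases c' <;> simp [banana, bCell]
  | f i =>
    rw [bananaVal, sub_bracket_coeff_singleton (bSer_mem_fil _) (bSer_mem_fil _),
      bch_coeff_singleton, neg_coeff, bSer_coeff_singleton, bSer_coeff_singleton]
    cases c' <;> simp [banana, bCell, sub_eq_add_neg]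
  | h =>
    rw [bananaVal, sub_bracket_coeff_singleton (bSer_mem_fil _) (bSer_mem_fil _), bananaTop,
      sum_act_coeff_singleton hP fun i => bSer_mem_fil _]
    simp only [bSer_coeff_singleton]
    cases c' <;> simp [banana, bCell]

theorem existsUnique_isBananaModel (hP : IsAdmissible m P) : ∃! d, IsBananaModel m P d := by
  obtain ⟨d, D, hd, hD, hdD, hv⟩ := exists_isModel (X := banana m) (v := bananaVal P)
    bananaVal_mem_hom bananaVal_mem_lieSer (bananaVal_coeff_singleton hP)
    (fun c hc => by cases c <;> first | rfl | exact absurd hc (by simp [banana]))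
    fun D hD hv c => banana_sq hD hv hP c
  have htw : ∀ f : (banana m).Alg, (twisted d (bGen .a) f : NCSeries (banana m).Cell)
      = IsDer.tw (banana m).deg D (bSer .a) f := fun f => twisted_coe hdD bSer_a_mem_hom f
  refine ⟨d, ⟨hd, fun i => (hdD _).trans (hv (.e i)), fun i => (htw _).trans (banana_tw_face hv i),
    (htw _).trans ((banana_tw_top hv).trans (bananaTop_eq P).symm)⟩, fun d' hd' => ?_⟩
  obtain ⟨D', -, hdD'⟩ := hd'.model.differential.exists_isDiff
  refine differential_ext hd'.model.differential hd.differential fun c => ?_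
  rw [hdD, hdD']
  exact (hd'.eq_val hdD' c).trans (hv c).symm

/-- The values on generators of a map out of the banana. -/
def bananaMap {B : Type} (a b : B) (e f : Fin (m + 1) → B) (h : B) : BananaCell (m + 1) → B
  | .a => a
  | .b => b
  | .e i => e i
  | .f i => f i
  | .h => h

/-- Points `a`, `b`, paths `γ i` from `a` to `b`, fillings `z i` of consecutive paths, and a filling
of these define a unique map from the banana. -/
theorem existsUnique_bananaHom {C : Type} [Finite C] {deg : C → ℤ}
    {d₀ : (banana m).Alg →ₗ[ℚ] (banana m).Alg} (hd₀ : IsBananaModel m P d₀)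
    {d : lieAlg deg →ₗ[ℚ] lieAlg deg} {D : NCSeries C →ₗ[ℚ] NCSeries C} (hD : IsDiff deg D)
    (hdD : ∀ f : lieAlg deg, (d f : NCSeries C) = D f)
    {a b h : NCSeries C} {γ z : Fin (m + 1) → NCSeries C}
    (ha : IsMC deg D a) (hb : IsMC deg D b) (ha' : a ∈ lieSer deg Set.univ)
    (hb' : b ∈ lieSer deg Set.univ) (hγ : ∀ i, γ i ∈ lieZero deg Set.univ)
    (hT : ∀ i, Transports D a b (exp (γ i))) (hz : ∀ i, z i ∈ lieSer deg Set.univ)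
    (hz' : ∀ i, z i ∈ hom deg 1) (hh : h ∈ lieSer deg Set.univ) (hh' : h ∈ hom deg 2)
    (htz : ∀ i, IsDer.tw deg D a (z i) = bch (γ i) (-γ (i + 1)))
    (hth : IsDer.tw deg D a h = ∑ i, act deg (loop γ) (P i) (z i)) :
    ∃! φ, IsDGLAHom d₀ d φ ∧ ∀ c, (φ (bGen c) : NCSeries C) = bananaMap a b γ z h c := by
  obtain ⟨D₀, hD₀, hdD₀⟩ := hd₀.model.differential.exists_isDiff
  have hv := hd₀.eq_val hdD₀
  refine existsUnique_hom (deg := (banana m).deg) hD₀ hD hdD₀ hdD (x := bananaMap a b γ z h)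
    (fun c => ?_) (fun c => ?_) fun Φ hΦ hx c => ?_
  · cases c with
    | a => exact ha'
    | b => exact hb'
    | e i => exact (hγ i).1
    | f i => exact hz i
    | h => exact hh
  · cases c with
    | a => exact ha.1
    | b => exact hb.1
    | e i => exact (hγ i).2
    | f i => exact hz' i
    | h => exact hh'
  · have hx' : ∀ c : BananaCell (m + 1), Φ (bSer c) = bananaMap a b γ z h c := hx
    refine (congrArg Φ (hv c)).trans ?_
    cases c with
    | a =>
      rw [bananaVal, map_neg, hΦ.map_mul, hx']
      exact ha.2.symm
    | b =>
      rw [bananaVal, map_neg, hΦ.map_mul, hx']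
      exact hb.2.symm
    | e i =>
      rw [bananaVal, hΦ.map_edgeDiff (bSer_e_mem_hom i) (bSer_mem_fil _), hx', hx', hx']
      exact (edgeDiff_of_transports hD.toIsDer (hγ i).2 (lieZero_mem_fil (hγ i)) (hT i)).symm
    | f i =>
      rw [bananaVal, map_sub, hΦ.map_bracket, hΦ.map_bch (bSer_mem_fil _)
        (neg_mem (bSer_mem_fil _)), map_neg, hx', hx', hx', hx']
      exact ((tw_eq_iff ha.1).1 (htz i)).symm
    | h =>
      rw [bananaVal, map_sub, hΦ.map_bracket, bananaTop, map_sum, hx', hx']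
      refine Eq.trans ?_ ((tw_eq_iff ha.1).1 hth).symm
      congr 1
      refine Finset.sum_congr rfl fun i _ => ?_
      rw [hΦ.map_act loop_mem_fil, hx']
      congr 3
      funext j
      rw [loop, hΦ.map_bch (bSer_mem_fil _) (neg_mem (bSer_mem_fil _)), map_neg, hx', hx']
      rfl

end Banana

end NCSeries

namespace NCSeries

open scoped NCSeries.Ring

/-! Polyhedral 3-cells. -/

section Polyhedral

variable {X : PolyhedralCell}

open PolyhedralCell

instance cells_finite (X : PolyhedralCell) : Finite X.cells.Cell := by
  have := X.finV
  have := X.finE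
  have := X.finF
  let F : PolyhedralCell.Cell X → X.V ⊕ X.E ⊕ X.F ⊕ Unit := fun
    | .vert v => .inl v
    | .edge e => .inr (.inl e)
    | .face f => .inr (.inr (.inl f))
    | .top => .inr (.inr (.inr ()))
  have hF : Function.Injective F := by
    intro x y h
    cases x <;> cases y <;> simp_all [F]
  exact Finite.of_injective F hF

/-- A cell of a polyhedral 3-cell, as a letter. -/
def pCell (c : PolyhedralCell.Cell X) : X.cells.Cell := c

theorem ser_mem_fil (c : PolyhedralCell.Cell X) : X.ser c ∈ fil X.cells.Cell 1 := letter_mem_fil _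

theorem ser_mem_lieSer {S : Set X.cells.Cell} {c : PolyhedralCell.Cell X} (h : pCell c ∈ S) :
    X.ser c ∈ lieSer X.cells.deg S :=
  letter_mem_lieSer h

theorem ser_mem_hom {n : ℤ} (c : PolyhedralCell.Cell X) (h : X.cells.deg (pCell c) = n) :
    X.ser c ∈ hom X.cells.deg n :=
  h ▸ letter_mem_hom _

theorem ser_vert_mem_hom (v : X.V) : X.ser (.vert v) ∈ hom X.cells.deg (-1) := ser_mem_hom _ rfl

theorem ser_edge_mem_hom (e : X.E) : X.ser (.edge e) ∈ hom X.cells.deg 0 := ser_mem_hom _ rfl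

theorem ser_face_mem_hom (f : X.F) : X.ser (.face f) ∈ hom X.cells.deg 1 := ser_mem_hom _ rfl

theorem ser_top_mem_hom : X.ser .top ∈ hom X.cells.deg 2 := ser_mem_hom _ rfl

theorem ser_coeff_singleton [DecidableEq (PolyhedralCell.Cell X)] (c d : PolyhedralCell.Cell X) :
    X.ser c [pCell d] = if d = c then 1 else 0 :=
  letter_coeff_singleton (C := PolyhedralCell.Cell X) c d

/-! Edge paths. -/

theorem isWalk_append {u w : X.V} {l l' : List (X.E × Bool)} :
    X.IsWalk u (l ++ l') w ↔ ∃ v, X.IsWalk u l v ∧ X.IsWalk v l' w := by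
  induction l generalizing u with
  | nil =>
    constructor
    · exact fun h => ⟨u, rfl, h⟩
    · rintro ⟨v, rfl, h⟩
      exact h
  | cons x l ih =>
    constructor
    · rintro ⟨h, h'⟩
      obtain ⟨v, hv, hv'⟩ := ih.1 h'
      exact ⟨v, ⟨h, hv⟩, hv'⟩
    · rintro ⟨v, ⟨h, hv⟩, hv'⟩
      exact ⟨h, ih.2 ⟨v, hv, hv'⟩⟩

theorem IsWalk.end_unique {u v v' : X.V} {l : List (X.E × Bool)} (h : X.IsWalk u l v)
    (h' : X.IsWalk u l v') : v = v' := by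
  induction l generalizing u with
  | nil => exact (h : u = v).symm.trans h'
  | cons x l ih => exact ih h.2 h'.2

theorem IsWalk.start_unique {u u' v : X.V} {l : List (X.E × Bool)} (h : X.IsWalk u l v)
    (h' : X.IsWalk u' l v) : u = u' := by
  cases l with
  | nil => exact (h : u = v).trans (h' : u' = v).symm
  | cons x l => exact h.1.symm.trans h'.1

theorem dartFlip_dartFlip (x : X.E × Bool) : dartFlip (dartFlip x) = x := by
  obtain ⟨e, s⟩ := x
  simp [dartFlip]

theorem IsWalk.reverse {u v : X.V} {l : List (X.E × Bool)} (h : X.IsWalk u l v) :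
    X.IsWalk v (X.reverse l) u := by
  induction l generalizing u with
  | nil => exact (h : u = v).symm
  | cons x l ih =>
    have h1 : X.reverse (x :: l) = X.reverse l ++ [dartFlip x] := by
      simp [PolyhedralCell.reverse]
    rw [h1, isWalk_append]
    refine ⟨X.fin x, ih h.2, rfl, ?_⟩
    rw [← h.1]
    change dartStart X.src X.tgt (dartFlip (dartFlip x)) = dartStart X.src X.tgt x
    rw [dartFlip_dartFlip]

/-- A dart as a series. -/
noncomputable def dartSer (x : X.E × Bool) : NCSeries X.cells.Cell :=
  if x.2 then X.ser (.edge x.1) else -X.ser (.edge x.1)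

theorem pathBCH_eq (l : List (X.E × Bool)) : X.pathBCH l = bchList (l.map dartSer) := rfl

theorem dartSer_flip (x : X.E × Bool) : dartSer (dartFlip x) = -dartSer x := by
  obtain ⟨e, s⟩ := x
  cases s <;> simp [dartSer, dartFlip]

theorem dartSer_mem_fil (x : X.E × Bool) : dartSer x ∈ fil X.cells.Cell 1 := by
  unfold dartSer
  split_ifs
  · exact ser_mem_fil _
  · exact neg_mem (ser_mem_fil _)

theorem dartSer_mem_lieZero {S : Set X.cells.Cell} {x : X.E × Bool} (h : pCell (.edge x.1) ∈ S) :
    dartSer x ∈ lieZero X.cells.deg S := by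
  have h' : X.ser (.edge x.1) ∈ lieZero X.cells.deg S := ⟨ser_mem_lieSer h, ser_edge_mem_hom _⟩
  unfold dartSer
  split_ifs
  · exact h'
  · exact neg_mem h'

theorem pathBCH_mem_fil (l : List (X.E × Bool)) : X.pathBCH l ∈ fil X.cells.Cell 1 :=
  bchList_mem_fil _

theorem pathBCH_mem_lieZero {S : Set X.cells.Cell} {l : List (X.E × Bool)}
    (h : ∀ x ∈ l, pCell (.edge x.1) ∈ S) : X.pathBCH l ∈ lieZero X.cells.deg S := by
  refine bchList_mem_lieZero fun y hy => ?_
  obtain ⟨x, hx, rfl⟩ := List.mem_map.1 hy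
  exact dartSer_mem_lieZero (h x hx)

theorem pathBCH_mem_hom (l : List (X.E × Bool)) : X.pathBCH l ∈ hom X.cells.deg 0 :=
  (pathBCH_mem_lieZero (S := Set.univ) fun _ _ => Set.mem_univ _).2

theorem exp_pathBCH_append (l l' : List (X.E × Bool)) :
    exp (X.pathBCH (l ++ l')) = exp (X.pathBCH l) * exp (X.pathBCH l') := by
  rw [pathBCH_eq, pathBCH_eq, pathBCH_eq, exp_bchList, exp_bchList, exp_bchList, List.map_append,
    List.map_append, List.prod_append]

theorem pathBCH_reverse (l : List (X.E × Bool)) : X.pathBCH (X.reverse l) = -X.pathBCH l := by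
  rw [pathBCH_eq, pathBCH_eq, neg_bchList]
  · rw [PolyhedralCell.reverse, List.map_reverse, List.map_map, List.map_map]
    congr 3
    funext x
    exact dartSer_flip x
  · intro y hy
    obtain ⟨x, -, rfl⟩ := List.mem_map.1 hy
    exact dartSer_mem_fil x

/-- Transports compose along the path; an edge traversed backwards contributes the inverse
transport. -/
theorem transports_pathBCH {D : NCSeries X.cells.Cell →ₗ[ℚ] NCSeries X.cells.Cell}
    (hD : IsDer X.cells.deg D)
    (h : ∀ e, Transports D (X.ser (.vert (X.src e))) (X.ser (.vert (X.tgt e)))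
      (exp (X.ser (.edge e)))) {u v : X.V} {l : List (X.E × Bool)} (hl : X.IsWalk u l v) :
    Transports D (X.ser (.vert u)) (X.ser (.vert v)) (exp (X.pathBCH l)) := by
  induction l generalizing u with
  | nil =>
    obtain rfl : u = v := hl
    have : X.pathBCH [] = 0 := rfl
    rw [this, exp_zero]
    exact Transports.one hD
  | cons x l ih =>
    have h1 : Transports D (X.ser (.vert (X.start x))) (X.ser (.vert (X.fin x)))
        (exp (dartSer x)) := by
      obtain ⟨e, s⟩ := x
      cases s
      · exact Transports.exp_neg hD (ser_edge_mem_hom e) (ser_mem_fil _) (h e)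
      · exact h e
    have h2 := Transports.exp_bch hD (dartSer_mem_lieZero (Set.mem_univ (pCell (.edge x.1)))).2 h1
      (ih hl.2)
    rw [hl.1] at h2
    exact h2

theorem dartSer_coeff_singleton [DecidableEq X.E] (x : X.E × Bool) (e : X.E) :
    dartSer x [pCell (.edge e)]
      = (if x = (e, true) then 1 else 0) - (if x = (e, false) then 1 else 0) := by
  classical
  obtain ⟨e', s⟩ := x
  cases s
  · change (-X.ser (.edge e')) [pCell (.edge e)] = _
    rw [neg_coeff, ser_coeff_singleton]
    simp [eq_comm]
  · change X.ser (.edge e') [pCell (.edge e)] = _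
    rw [ser_coeff_singleton]
    simp [eq_comm]

theorem dartSer_coeff_singleton_of_ne (x : X.E × Bool) (c : PolyhedralCell.Cell X)
    (hc : ∀ e, c ≠ .edge e) : dartSer x [pCell c] = 0 := by
  classical
  have : X.ser (.edge x.1) [pCell c] = 0 := by
    rw [ser_coeff_singleton, if_neg (hc _)]
  unfold dartSer
  split_ifs
  · exact this
  · rw [neg_coeff, this, neg_zero]

/-- Modulo brackets BCH is addition, so all that remains of a path is its cellular 1-chain. -/
theorem pathBCH_coeff_singleton [DecidableEq X.E] (l : List (X.E × Bool)) (e : X.E) :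
    X.pathBCH l [pCell (.edge e)] = (l.count (e, true) : ℚ) - l.count (e, false) := by
  rw [pathBCH_eq, bchList_coeff_singleton, List.map_map]
  induction l with
  | nil => simp
  | cons x l ih =>
    rw [List.map_cons, List.sum_cons, ih, Function.comp_apply, dartSer_coeff_singleton,
      List.count_cons, List.count_cons]
    push_cast
    simp only [beq_iff_eq]
    ring

theorem pathBCH_coeff_singleton_of_ne (l : List (X.E × Bool)) (c : PolyhedralCell.Cell X)
    (hc : ∀ e, c ≠ .edge e) : X.pathBCH l [pCell c] = 0 := by
  rw [pathBCH_eq, bchList_coeff_singleton, List.map_map]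
  refine List.sum_eq_zero fun q hq => ?_
  obtain ⟨x, -, rfl⟩ := List.mem_map.1 hq
  exact dartSer_coeff_singleton_of_ne x c hc

/-! Shellings. -/

section Shelling

variable {m : ℕ} {a b : X.V} (S : X.Shelling m a b) {P : Fin (m + 1) → NCSeries (Fin m)}

/-- The boundary of the `i`-th face. -/
noncomputable def faceLoop (i : Fin (m + 1)) : List (X.E × Bool) := S.δ i ++ X.reverse (S.δ' i)

/-- The paths `γ i` and `γ (i + 1)` share their initial and final segments, so both middle pieces
start where `α i` ends and end where `β i` starts. -/
theorem exists_isWalk_δ (i : Fin (m + 1)) :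
    ∃ q, X.IsWalk (S.p i) (S.δ i) q ∧ X.IsWalk (S.p i) (S.δ' i) q := by
  have h1 := S.walk i
  have h2 := S.walk (i + 1)
  rw [S.γ_eq, isWalk_append] at h1
  rw [S.γ_succ_eq, isWalk_append] at h2
  obtain ⟨q, hq, hβ⟩ := h1
  obtain ⟨q', hq', hβ'⟩ := h2
  obtain rfl := IsWalk.start_unique hβ hβ'
  obtain ⟨p, hp, hδ⟩ := isWalk_append.1 hq
  obtain ⟨p', hp', hδ'⟩ := isWalk_append.1 hq'
  obtain rfl := IsWalk.end_unique hp (S.walk_α i)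
  obtain rfl := IsWalk.end_unique hp' (S.walk_α i)
  exact ⟨q, hδ, hδ'⟩

theorem isWalk_faceLoop (i : Fin (m + 1)) : X.IsWalk (S.p i) (faceLoop S i) (S.p i) := by
  obtain ⟨q, h, h'⟩ := exists_isWalk_δ S i
  exact isWalk_append.2 ⟨q, h, IsWalk.reverse h'⟩

theorem mem_faceLoop (i : Fin (m + 1)) (x : X.E × Bool) :
    x ∈ faceLoop S i ↔ X.left x = S.face i := S.boundary i x

/-- The two darts of an edge lie on different faces, so the two contributions to the incidence
number cannot cancel. -/
theorem edge_mem_boundary_face {x : X.E × Bool} {f : X.F} (h : X.left x = f) :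
    X.cells.inc (pCell (.face f)) (pCell (.edge x.1)) ≠ 0 := by
  classical
  obtain ⟨e, s⟩ := x
  have hne := X.left_flip (e, s)
  rw [h] at hne
  cases s
  · have h' : X.left (e, true) ≠ f := hne
    simp [PolyhedralCell.cells, pCell, h, h']
  · have h' : X.left (e, false) ≠ f := hne
    simp [PolyhedralCell.cells, pCell, h, h']

theorem edge_mem_cl_face {x : X.E × Bool} {f : X.F} (h : X.left x = f) :
    pCell (.edge x.1) ∈ X.cells.cl (pCell (.face f)) :=
  Or.inr ⟨x, h, Or.inl rfl⟩

/-- The face loop is nonempty, as every face is the left face of some dart, and its first dart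
starts at `p i`. -/
theorem p_mem_cl_face (i : Fin (m + 1)) :
    pCell (.vert (S.p i)) ∈ X.cells.cl (pCell (.face (S.face i))) := by
  obtain ⟨x, hx⟩ := X.left_surjective (S.face i)
  have h := (mem_faceLoop S i x).2 hx
  have hw := isWalk_faceLoop S i
  have hm := mem_faceLoop S i
  cases hl : faceLoop S i with
  | nil =>
    rw [hl] at h
    exact absurd h List.not_mem_nil
  | cons y l =>
    rw [hl] at hw hm
    exact Or.inr ⟨y, (hm y).1 List.mem_cons_self, Or.inr (congrArg Cell.vert hw.1.symm)⟩

theorem edge_mem_cl_boundary (e : X.E) :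
    pCell (.edge e) ∈ {z | ∃ y, X.cells.inc (pCell .top) y ≠ 0 ∧ z ∈ X.cells.cl y} :=
  ⟨pCell (.face (X.left (e, true))), one_ne_zero, edge_mem_cl_face rfl⟩

theorem face_mem_cl_boundary (f : X.F) :
    pCell (.face f) ∈ {z | ∃ y, X.cells.inc (pCell .top) y ≠ 0 ∧ z ∈ X.cells.cl y} :=
  ⟨pCell (.face f), one_ne_zero, Or.inl rfl⟩

theorem pathBCH_γ_mem_lieZero (i : Fin (m + 1)) :
    X.pathBCH (S.γ i) ∈ lieZero X.cells.deg Set.univ :=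
  pathBCH_mem_lieZero fun _ _ => Set.mem_univ _

/-- The faces, moved so that they are localised at `a`. -/
noncomputable def shellFace (i : Fin (m + 1)) : NCSeries X.cells.Cell :=
  expAd X.cells.deg (X.pathBCH (S.α i)) (X.ser (.face (S.face i)))

theorem shellFace_mem_fil (i : Fin (m + 1)) : shellFace S i ∈ fil X.cells.Cell 1 :=
  expAd_mem_fil (pathBCH_mem_hom _) (pathBCH_mem_fil _) (ser_mem_fil _)

theorem shellFace_mem_hom (i : Fin (m + 1)) : shellFace S i ∈ hom X.cells.deg 1 :=
  expAd_mem_hom (pathBCH_mem_hom _) (ser_face_mem_hom _)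

theorem shellFace_mem_lieSer {T : Set X.cells.Cell} (hT : ∀ e, pCell (.edge e) ∈ T)
    (hT' : ∀ f, pCell (.face f) ∈ T) (i : Fin (m + 1)) :
    shellFace S i ∈ lieSer X.cells.deg T :=
  expAd_mem_lieSer (pathBCH_mem_hom _) (pathBCH_mem_lieZero fun _ _ => hT _).1
    (ser_mem_lieSer (hT' _))

/-- The boundary of the 3-cell, based at `a`. -/
noncomputable def shellTop (P : Fin (m + 1) → NCSeries (Fin m)) : NCSeries X.cells.Cell :=
  ∑ i, act X.cells.deg (loop fun i => X.pathBCH (S.γ i)) (P i) (shellFace S i)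

theorem shellTop_mem_lieSer {T : Set X.cells.Cell} (hT : ∀ e, pCell (.edge e) ∈ T)
    (hT' : ∀ f, pCell (.face f) ∈ T) : shellTop S P ∈ lieSer X.cells.deg T :=
  sum_act_mem_lieSer (fun _ => pathBCH_mem_lieZero fun _ _ => hT _)
    (shellFace_mem_lieSer S hT hT')

theorem shellTop_eq (P : Fin (m + 1) → NCSeries (Fin m)) :
    ∑ i, actAd X.cells.deg (P i)
        (fun j : Fin m => bch (X.pathBCH (S.γ j.castSucc)) (-X.pathBCH (S.γ j.succ)))
        (expAd X.cells.deg (X.pathBCH (S.α i)) (X.ser (.face (S.face i)))) = shellTop S P := by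
  simp only [actAd_eq]
  rfl

/-- The values of the differential on generators. -/
noncomputable def shellVal (P : Fin (m + 1) → NCSeries (Fin m)) :
    PolyhedralCell.Cell X → NCSeries X.cells.Cell
  | .vert v => -(X.ser (.vert v) * X.ser (.vert v))
  | .edge e => edgeDiff X.cells.deg (X.ser (.edge e)) (X.ser (.vert (X.src e)))
      (X.ser (.vert (X.tgt e)))
  | .face f => X.pathBCH (faceLoop S (S.face.symm f))
      - bracket X.cells.deg (X.ser (.vert (S.p (S.face.symm f)))) (X.ser (.face f))
  | .top => shellTop S P - bracket X.cells.deg (X.ser (.vert a)) (X.ser .top)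

theorem shellVal_face (i : Fin (m + 1)) : shellVal S P (.face (S.face i))
    = X.pathBCH (faceLoop S i)
      - bracket X.cells.deg (X.ser (.vert (S.p i))) (X.ser (.face (S.face i))) := by
  rw [shellVal, Equiv.symm_apply_apply]

variable {S}

theorem Shelling.IsInducedModel.eq_val {d : X.cells.Alg →ₗ[ℚ] X.cells.Alg}
    (hd : S.IsInducedModel P d) {D : NCSeries X.cells.Cell →ₗ[ℚ] NCSeries X.cells.Cell}
    (hdD : ∀ f : X.cells.Alg, (d f : NCSeries X.cells.Cell) = D f) (c : PolyhedralCell.Cell X) :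
    D (X.ser c) = shellVal S P c := by
  have htw : ∀ v (f : X.cells.Alg), (twisted d (X.cellGen (.vert v)) f : NCSeries X.cells.Cell)
      = IsDer.tw X.cells.deg D (X.ser (.vert v)) f :=
    fun v f => twisted_coe hdD (ser_vert_mem_hom v) f
  cases c with
  | vert v => exact IsModel.map_vertex hd.model hdD rfl
  | edge e => exact (hdD _).symm.trans (hd.d_edge e)
  | face f =>
    obtain ⟨i, rfl⟩ := S.face.surjective f
    rw [shellVal_face]
    exact (tw_eq_iff (ser_vert_mem_hom _)).1 ((htw _ _).symm.trans (hd.d_face i))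
  | top =>
    exact (tw_eq_iff (ser_vert_mem_hom _)).1
      ((htw _ _).symm.trans (hd.d_top.trans (shellTop_eq S P)))

section Values

variable {D : NCSeries X.cells.Cell →ₗ[ℚ] NCSeries X.cells.Cell}
  (hD : IsOddDer X.cells.deg D)
  (hv : ∀ c : PolyhedralCell.Cell X, D (X.ser c) = shellVal S P c)

include hv

theorem shell_isMC (v : X.V) : IsMC X.cells.deg D (X.ser (.vert v)) :=
  ⟨ser_vert_mem_hom v, hv (.vert v)⟩

theorem shell_tw_face (i : Fin (m + 1)) :
    IsDer.tw X.cells.deg D (X.ser (.vert (S.p i))) (X.ser (.face (S.face i)))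
      = X.pathBCH (faceLoop S i) :=
  (tw_eq_iff (ser_vert_mem_hom _)).2 ((hv _).trans (shellVal_face S i))

theorem shell_tw_top :
    IsDer.tw X.cells.deg D (X.ser (.vert a)) (X.ser .top) = shellTop S P :=
  (tw_eq_iff (ser_vert_mem_hom _)).2 (hv .top)

include hD

theorem shell_transports_edge (e : X.E) : Transports D (X.ser (.vert (X.src e)))
    (X.ser (.vert (X.tgt e))) (exp (X.ser (.edge e))) :=
  transports_of_edgeDiff hD.toIsDer (ser_edge_mem_hom e) (ser_mem_fil _) (hv (.edge e))

theorem shell_transports {u v : X.V} {l : List (X.E × Bool)} (hl : X.IsWalk u l v) :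
    Transports D (X.ser (.vert u)) (X.ser (.vert v)) (exp (X.pathBCH l)) :=
  transports_pathBCH hD.toIsDer (shell_transports_edge hD hv) hl

/-- Transport along `α i` conjugates the loop `δ i ∪ -δ' i` by `α i`. Inserting `β i` followed by
its inverse between `δ i` and the reverse of `δ' i` turns the conjugate into `γ i` followed by the
inverse of `γ (i + 1)`. -/
theorem shell_tw_shellFace (i : Fin (m + 1)) :
    IsDer.tw X.cells.deg D (X.ser (.vert a)) (shellFace S i)
      = bch (X.pathBCH (S.γ i)) (-X.pathBCH (S.γ (i + 1))) := by
  rw [shellFace, tw_expAd hD.toIsDer (pathBCH_mem_hom _) (pathBCH_mem_fil _)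
    (shell_transports hD hv (S.walk_α i)), shell_tw_face hv]
  apply exp_injective (expAd_mem_fil (pathBCH_mem_hom _) (pathBCH_mem_fil _) (pathBCH_mem_fil _))
    (bch_mem_fil _ _)
  rw [exp_expAd (pathBCH_mem_hom _) (pathBCH_mem_fil _) (pathBCH_mem_fil _), exp_bch,
    ← pathBCH_reverse, ← pathBCH_reverse, ← exp_pathBCH_append, ← exp_pathBCH_append,
    ← exp_pathBCH_append, S.γ_eq, S.γ_succ_eq]
  have hr : ∀ l l' : List (X.E × Bool), X.reverse (l ++ l') = X.reverse l' ++ X.reverse l := by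
    intro l l'
    simp [PolyhedralCell.reverse]
  rw [faceLoop, hr, hr]
  simp only [exp_pathBCH_append, pathBCH_reverse]
  set A := exp (X.pathBCH (S.α i))
  set A' := exp (-X.pathBCH (S.α i))
  set E := exp (X.pathBCH (S.δ i))
  set E' := exp (-X.pathBCH (S.δ' i))
  calc A * (E * E') * A' = A * E * 1 * E' * A' := by noncomm_ring
    _ = _ := by
      rw [← exp_mul_exp_neg (pathBCH_mem_fil (S.β i))]
      noncomm_ring

theorem shell_sq (hP : IsAdmissible m P) (c : PolyhedralCell.Cell X) : D (D (X.ser c)) = 0 := by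
  cases c with
  | vert v => exact IsMC.sq hD (shell_isMC hv v)
  | edge e =>
    exact Transports.exp_sq hD (shell_isMC hv _) (shell_isMC hv _) (ser_edge_mem_hom e)
      (ser_mem_fil _) (shell_transports_edge hD hv e)
  | face f =>
    obtain ⟨i, rfl⟩ := S.face.surjective f
    exact sq_of_tw hD (shell_isMC hv _) (shell_tw_face hv i)
      (tw_eq_zero_of_transports hD.toIsDer (pathBCH_mem_hom _) (pathBCH_mem_fil _)
        (shell_transports hD hv (isWalk_faceLoop S i)))
  | top =>
    exact sq_of_tw hD (shell_isMC hv _) (shell_tw_top hv)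
      (tw_sum_act hD.toIsDer hP (pathBCH_γ_mem_lieZero S)
        (fun i => shell_transports hD hv (S.walk i)) (shell_tw_shellFace hD hv))

end Values

/-! ### Degree, locality and linear part for a polyhedral cell; its model and the map from the
banana. -/

theorem shellVal_mem_hom (c : PolyhedralCell.Cell X) :
    shellVal S P c ∈ hom X.cells.deg (X.cells.deg (pCell c) - 1) := by
  cases c with
  | vert v => exact neg_mul_self_mem_hom (ser_vert_mem_hom v)
  | edge e =>
    exact edgeDiff_mem_hom (ser_edge_mem_hom e) (ser_vert_mem_hom _) (ser_vert_mem_hom _)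
  | face f =>
    exact sub_bracket_mem_hom (p := 1) (ser_vert_mem_hom _) (ser_face_mem_hom f)
      (pathBCH_mem_hom _)
  | top =>
    exact sub_bracket_mem_hom (p := 2) (ser_vert_mem_hom _) ser_top_mem_hom
      (sum_act_mem_hom (fun i => (pathBCH_γ_mem_lieZero S i).2) (shellFace_mem_hom S))

theorem shellVal_mem_lieSer (c : PolyhedralCell.Cell X) :
    shellVal S P c ∈ lieSer X.cells.deg (X.cells.cl (pCell c)) := by
  cases c with
  | vert v =>
    exact neg_mul_self_mem_lieSer (ser_vert_mem_hom v) (ser_mem_lieSer (Set.mem_singleton _))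
  | edge e =>
    exact edgeDiff_mem_lieSer (ser_edge_mem_hom e) (ser_mem_lieSer (Or.inl rfl))
      (ser_mem_lieSer (Or.inr (Or.inl rfl))) (ser_mem_lieSer (Or.inr (Or.inr rfl)))
  | face f =>
    obtain ⟨i, rfl⟩ := S.face.surjective f
    rw [shellVal_face]
    exact sub_mem (pathBCH_mem_lieZero fun x hx => edge_mem_cl_face ((mem_faceLoop S i x).1 hx)).1
      (bracket_mem_lieSer (ser_mem_lieSer (p_mem_cl_face S i)) (ser_mem_lieSer (Or.inl rfl)))
  | top =>
    exact sub_mem (shellTop_mem_lieSer S (fun _ => Set.mem_univ _) fun _ => Set.mem_univ _)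
      (bracket_mem_lieSer (ser_mem_lieSer (Set.mem_univ _)) (ser_mem_lieSer (Set.mem_univ _)))

theorem shellVal_coeff_singleton (hP : IsAdmissible m P) (c c' : PolyhedralCell.Cell X) :
    shellVal S P c [pCell c'] = (X.cells.inc (pCell c) (pCell c') : ℚ) := by
  classical
  cases c with
  | vert v =>
    rw [shellVal, neg_mul_self_coeff_singleton (ser_mem_fil _)]
    simp [PolyhedralCell.cells, pCell]
  | edge e =>
    rw [shellVal, edgeDiff_coeff_singleton (ser_edge_mem_hom e) (ser_mem_fil _) (ser_mem_fil _)
      (ser_mem_fil _), ser_coeff_singleton, ser_coeff_singleton]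
    cases c' <;> simp [PolyhedralCell.cells, pCell, eq_comm]
  | face f =>
    obtain ⟨i, rfl⟩ := S.face.surjective f
    rw [shellVal_face, sub_bracket_coeff_singleton (ser_mem_fil _) (ser_mem_fil _)]
    -- The boundary loop has no repeated darts and runs exactly through those with this face on
    -- their left, so its 1-chain is the geometric boundary.
    have hcount : ∀ x, ((faceLoop S i).count x : ℚ) = if X.left x = S.face i then 1 else 0 := by
      intro x
      have hn : (faceLoop S i).Nodup := S.boundary_nodup i
      rw [hn.count]
      simp only [mem_faceLoop]
      push_cast
      rfl
    cases c' with
    | edge e =>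
      rw [pathBCH_coeff_singleton, hcount, hcount]
      simp [PolyhedralCell.cells, pCell]
    | _ =>
      rw [pathBCH_coeff_singleton_of_ne _ _ (by simp)]
      simp [PolyhedralCell.cells, pCell]
  | top =>
    rw [shellVal, sub_bracket_coeff_singleton (ser_mem_fil _) (ser_mem_fil _), shellTop,
      sum_act_coeff_singleton hP (shellFace_mem_fil S)]
    simp only [shellFace, expAd_coeff_singleton (pathBCH_mem_hom _) (pathBCH_mem_fil _)
      (ser_mem_fil _), ser_coeff_singleton]
    cases c' with
    | face f =>
      obtain ⟨j, rfl⟩ := S.face.surjective f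
      simp [PolyhedralCell.cells, pCell]
    | _ => simp [PolyhedralCell.cells, pCell]

theorem existsUnique_isInducedModel (S : X.Shelling m a b) (hP : IsAdmissible m P) :
    ∃! d, S.IsInducedModel P d := by
  obtain ⟨d, D, hd, hD, hdD, hv⟩ := exists_isModel (X := X.cells) (v := shellVal S P)
    shellVal_mem_hom shellVal_mem_lieSer (shellVal_coeff_singleton hP)
    (fun c hc => by cases c <;> first | rfl | exact absurd hc (by simp [PolyhedralCell.cells]))
    fun D hD hv c => shell_sq hD hv hP c
  have htw : ∀ v (f : X.cells.Alg), (twisted d (X.cellGen (.vert v)) f : NCSeries X.cells.Cell)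
      = IsDer.tw X.cells.deg D (X.ser (.vert v)) f :=
    fun v f => twisted_coe hdD (ser_vert_mem_hom v) f
  have hface : ∀ i, (twisted d (X.cellGen (.vert (S.p i))) (X.cellGen (.face (S.face i))) :
      NCSeries X.cells.Cell) = X.pathBCH (faceLoop S i) :=
    fun i => (htw _ _).trans (shell_tw_face hv i)
  have htop : (twisted d (X.cellGen (.vert a)) (X.cellGen .top) : NCSeries X.cells.Cell)
      = shellTop S P := (htw _ _).trans (shell_tw_top hv)
  refine ⟨d, ⟨hd, fun e => (hdD _).trans (hv (.edge e)), fun e => ?_, hface,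
    fun i => ⟨hd.flat _ rfl, ?_⟩, htop.trans (shellTop_eq S P).symm, hd.flat _ rfl, ?_⟩,
    fun d' hd' => ?_⟩
  · exact (flow_eq_iff hD.toIsDer hdD (ser_edge_mem_hom e) _ _).2
      (shell_transports_edge hD.toIsOddDer hv e)
  · refine (hface i).symm ▸ (pathBCH_mem_lieZero fun x hx => ?_).1
    exact ⟨_, edge_mem_boundary_face ((mem_faceLoop S i x).1 hx), Or.inl rfl⟩
  · exact htop.symm ▸ shellTop_mem_lieSer S edge_mem_cl_boundary face_mem_cl_boundary
  · obtain ⟨D', -, hdD'⟩ := hd'.model.differential.exists_isDiff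
    refine differential_ext hd'.model.differential hd.differential fun c => ?_
    rw [hdD, hdD']
    exact (Shelling.IsInducedModel.eq_val hd' hdD' c).trans (hv c).symm

theorem existsUnique_isInducedMap (S : X.Shelling m a b)
    {d₀ : (banana m).Alg →ₗ[ℚ] (banana m).Alg} (hd₀ : IsBananaModel m P d₀)
    {d : X.cells.Alg →ₗ[ℚ] X.cells.Alg} (hd : S.IsInducedModel P d) :
    ∃! φ, IsDGLAHom d₀ d φ ∧ S.IsInducedMap φ := by
  obtain ⟨D, hD, hdD⟩ := hd.model.differential.exists_isDiff
  have hv := Shelling.IsInducedModel.eq_val hd hdD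
  have h := existsUnique_bananaHom hd₀ hD hdD (shell_isMC hv a) (shell_isMC hv b)
    (ser_mem_lieSer (Set.mem_univ _)) (ser_mem_lieSer (Set.mem_univ _))
    (pathBCH_γ_mem_lieZero S) (fun i => shell_transports hD.toIsOddDer hv (S.walk i))
    (shellFace_mem_lieSer S (fun _ => Set.mem_univ _) fun _ => Set.mem_univ _)
    (shellFace_mem_hom S) (ser_mem_lieSer (Set.mem_univ _)) ser_top_mem_hom
    (shell_tw_shellFace hD.toIsOddDer hv) (shell_tw_top hv)
  refine (existsUnique_congr fun φ => and_congr_right fun _ => ?_).1 h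
  constructor
  · exact fun hφ => ⟨Subtype.ext (hφ .a), Subtype.ext (hφ .b), fun i => hφ (.e i),
      fun i => hφ (.f i), Subtype.ext (hφ .h)⟩
  · intro hφ c
    cases c with
    | a => exact congrArg Subtype.val hφ.map_a
    | b => exact congrArg Subtype.val hφ.map_b
    | e i => exact hφ.map_e i
    | f i => exact hφ.map_f i
    | h => exact congrArg Subtype.val hφ.map_h

end Shelling

end Polyhedral

end NCSeries

namespace NCSeries

open scoped NCSeries.Ring

variable {C : Type} {deg : C → ℤ}

/-! Half-way points. -/

section HalfWay

variable {D D' : NCSeries C →ₗ[ℚ] NCSeries C} {a b e f x y v : NCSeries C} {S : Set C}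

/-- The result of flowing by `e` from `a`. -/
noncomputable def flowPt (D : NCSeries C →ₗ[ℚ] NCSeries C) (e a : NCSeries C) : NCSeries C :=
  exp (-e) * a * exp e + opSeries expQuot (comm e) (D e)

theorem transports_iff_flowPt (hD : IsDer deg D) (he : e ∈ hom deg 0) (he' : e ∈ fil C 1) :
    Transports D a b (exp e) ↔ flowPt D e a = b :=
  transports_exp_iff hD he he'

/-- The derivation enters only through its value at `e`, so a flow can be computed with any
derivation that agrees there. -/
theorem flowPt_congr (h : D e = D' e) : flowPt D e a = flowPt D' e a := by
  rw [flowPt, flowPt, h]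

theorem flowPt_mem_hom (hD : IsOddDer deg D) (he : e ∈ hom deg 0) (he' : e ∈ fil C 1)
    (ha : a ∈ hom deg (-1)) : flowPt D e a ∈ hom deg (-1) := by
  have h := expAd_eq (neg_mem he) (neg_mem he') a
  rw [neg_neg] at h
  rw [flowPt, ← h]
  exact add_mem (expAd_mem_hom (neg_mem he) ha) (opSeries_comm_mem_hom he (hD.map_hom 0 e he) _)

theorem flowPt_mem_lieSer (he : e ∈ hom deg 0) (he' : e ∈ lieSer deg S) (ha : a ∈ lieSer deg S)
    (hDe : D e ∈ lieSer deg S) : flowPt D e a ∈ lieSer deg S := by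
  have h := expAd_eq (neg_mem he) (neg_mem (lieSer_le_fil he')) a
  rw [neg_neg] at h
  rw [flowPt, ← h]
  exact add_mem (expAd_mem_lieSer (neg_mem he) (neg_mem he') ha)
    (opSeries_comm_mem_lieSer he he' hDe _)

/-- A relative version of the check on letters, for use while `D² = 0` is known only on part of the
complex. -/
theorem sq_eq_zero_of_mem_lieSer [Finite C] (hD : IsOddDer deg D)
    (h : ∀ c ∈ S, D (D (letter c)) = 0) (hf : f ∈ lieSer deg S) : D (D f) = 0 := by
  have hE := hD.sq_isDer
  refine eq_on_lieSer (F := D.comp D) (G := 0) hE.filt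
    (IsDer.zero (deg := deg)).filt (fun g hg => ?_) hf
  induction hg with
  | letter c hc => exact h c hc
  | bracket g g' hg hg' ih ih' =>
    obtain ⟨p, hp⟩ := hg.mem_hom deg
    obtain ⟨q, hq⟩ := hg'.mem_hom deg
    rw [LinearMap.zero_apply] at ih ih' ⊢
    rw [bracket_hom_hom hp hq, map_sub, map_smul, hE.leibniz_zero (mem_hom_zero _),
      hE.leibniz_zero (mem_hom_zero _), ih, ih']
    simp

theorem flowPt_isMC [Finite C] (hD : IsOddDer deg D) (ha : IsMC deg D a)
    (h : ∀ c ∈ S, D (D (letter c)) = 0) (he : e ∈ lieZero deg S) : IsMC deg D (flowPt D e a) := by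
  have he1 := lieZero_mem_fil he
  refine Transports.isMC hD (g := exp e) (h := exp (-e)) ?_ (exp_mem_hom he.2)
    (exp_mem_hom (neg_mem he.2)) (exp_neg_mul_exp he1) ha
    ((transports_iff_flowPt hD.toIsDer he.2 he1).2 rfl)
  exact hD.sq_isDer.map_exp_eq_zero (mem_hom_zero _) he1 (sq_eq_zero_of_mem_lieSer hD h he.1)

/-- The average of two elements is symmetric. -/
theorem mu2_comm (hx : x ∈ fil C 1) (hy : y ∈ fil C 1) : mu2 x y = mu2 y x := by
  have hxy : bch (-x) y ∈ fil C 1 := bch_mem_fil _ _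
  have hw : (1 / 2 : ℚ) • bch (-x) y ∈ fil C 1 := Submodule.smul_mem _ _ hxy
  apply exp_injective (bch_mem_fil _ _) (bch_mem_fil _ _)
  rw [exp_bch, exp_bch]
  have h1 : bch (-y) x = -bch (-x) y := by
    rw [neg_bch (neg_mem hx) hy, neg_neg]
  rw [h1, smul_neg]
  -- Half of `BCH(-x, y)`, taken twice, leads from `exp x` to `exp y`; going back by one half from
  -- `exp y` reaches the same middle as going forward from `exp x`.
  have h2 : exp y = exp x * exp ((1 / 2 : ℚ) • bch (-x) y) * exp ((1 / 2 : ℚ) • bch (-x) y) := by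
    rw [mul_assoc, exp_half_mul_exp_half hxy, exp_bch, ← mul_assoc, exp_mul_exp_neg hx, one_mul]
  rw [h2, mul_assoc, exp_mul_exp_neg hw, mul_one]

theorem tw_expAd_neg (hD : IsDer deg D) (hv : v ∈ hom deg 0) (hv' : v ∈ fil C 1)
    (hT : Transports D a x (exp v)) (f : NCSeries C) :
    IsDer.tw deg D x (expAd deg (-v) f) = expAd deg (-v) (IsDer.tw deg D a f) :=
  tw_expAd hD (neg_mem hv) (neg_mem hv') (Transports.exp_neg hD hv hv' hT) f

theorem expAd_expAd_neg (hv : v ∈ hom deg 0) (hv' : v ∈ fil C 1) (f : NCSeries C) :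
    expAd deg v (expAd deg (-v) f) = f := by
  rw [expAd_eq hv hv', expAd_eq (neg_mem hv) (neg_mem hv'), neg_neg]
  calc _ = (exp v * exp (-v)) * f * (exp v * exp (-v)) := by noncomm_ring
    _ = f := by rw [exp_mul_exp_neg hv', one_mul, mul_one]

theorem expAd_smul (hv : v ∈ hom deg 0) (hv' : v ∈ fil C 1) (r : ℚ) (f : NCSeries C) :
    expAd deg v (r • f) = r • expAd deg v f := by
  rw [expAd_eq hv hv', expAd_eq hv hv', mul_smul_comm, smul_mul_assoc]

end HalfWay

/-! The combinatorics of the cube. -/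

section Combinatorics

open Cube

/-- The minimal vertex of a cell. -/
def lo (c : CubeCell) : CubeCell := fun i => some ((c i).getD false)

/-- The maximal vertex of a cell. -/
def hi (c : CubeCell) : CubeCell := fun i => some ((c i).getD true)

/-- The first direction of a square. -/
def fstDir (g : CubeCell) : Fin 3 := if g 0 = none then 0 else 1

/-- The second direction of a square. -/
def sndDir (g : CubeCell) : Fin 3 := if g 2 = none then 2 else 1

/-- The dimension of a cell. -/
def cdim (c : CubeCell) : ℕ := cube.dim c

/-- Incidence numbers. -/
def cinc (c c' : CubeCell) : ℤ := cube.inc c c'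

/-- The faces of the cube that are oriented outwards. -/
def facePos : Fin 6 → Bool := ![false, false, false, true, true, true]

set_option maxRecDepth 10000

/-- The pair of directions is forced by the square, so that diagonal, loop and centre can be indexed
by the square alone. Like the other combinatorial facts in this part it is a finite check. -/
theorem square_dirs : ∀ (g : CubeCell) (j k : Fin 3), cdim g = 2 → j < k → g j = none →
    g k = none → j = fstDir g ∧ k = sndDir g ∧ squareMin g j k = lo g := by decide +kernel

theorem fstDir_lt_sndDir : ∀ g : CubeCell, cdim g = 2 →
    fstDir g < sndDir g ∧ g (fstDir g) = none ∧ g (sndDir g) = none := by decide +kernel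

theorem edge_ends : ∀ (c : CubeCell) (j : Fin 3), cdim c = 1 → c j = none →
    c.set j false = lo c ∧ c.set j true = hi c := by decide +kernel

theorem edge_exists_dir : ∀ c : CubeCell, cdim c = 1 → ∃ j, c j = none := by decide +kernel

theorem cdim_lo : ∀ c : CubeCell, cdim (lo c) = 0 := by decide +kernel

theorem cdim_hi : ∀ c : CubeCell, cdim (hi c) = 0 := by decide +kernel

theorem cdim_set : ∀ (g : CubeCell) (j : Fin 3) (s : Bool), cdim g = 2 → g j = none →
    cdim (g.set j s) = 1 := by decide +kernel

theorem square_path_ends : ∀ (g : CubeCell) (j k : Fin 3), j ≠ k → cdim g = 2 → g j = none →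
    g k = none → lo (g.set k false) = lo g ∧ hi (g.set k false) = lo (g.set j true) ∧
      hi (g.set j true) = hi g := by decide +kernel

theorem cinc_set_ne_zero : ∀ (g : CubeCell) (i : Fin 3) (s : Bool), g i = none →
    cinc g (g.set i s) ≠ 0 := by decide +kernel

theorem cinc_vertex : ∀ c c' : CubeCell, cdim c = 0 → cinc c c' = 0 := by decide +kernel

theorem cinc_edge : ∀ c c' : CubeCell, cdim c = 1 →
    cinc c c' = (if c' = hi c then 1 else 0) - (if c' = lo c then 1 else 0) := by decide +kernel

theorem cinc_square : ∀ g c' : CubeCell, cdim g = 2 →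
    cinc g c' = (if c' = g.set (sndDir g) false then 1 else 0)
      + (if c' = g.set (fstDir g) true then 1 else 0)
      - (if c' = g.set (sndDir g) true then 1 else 0)
      - (if c' = g.set (fstDir g) false then 1 else 0) := by decide +kernel

theorem cinc_top : ∀ c' : CubeCell, cinc top c'
    = ∑ i, (if facePos i then 1 else -1) * (if c' = chainFace i then 1 else 0) := by decide +kernel

theorem eq_top_of_cdim : ∀ c : CubeCell, cdim c ≠ 0 → cdim c ≠ 1 → cdim c ≠ 2 → c = top := by
  decide +kernel

theorem cdim_top : cdim top = 3 := by decide +kernel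

theorem cdim_vertA : cdim vertA = 0 := by decide +kernel

theorem cdim_vertB : cdim vertB = 0 := by decide +kernel

theorem edge_exists_face : ∀ c : CubeCell, cdim c = 1 → ∃ y : CubeCell, cinc top y ≠ 0 ∧
    ∀ i, y i = none ∨ c i = y i := by decide +kernel

theorem cinc_top_ne_zero : ∀ c : CubeCell, cdim c = 2 → cinc top c ≠ 0 := by decide +kernel

theorem cdim_chainEdge : ∀ i t, cdim (chainEdge i t) = 1 := by decide +kernel

theorem cdim_chainFace : ∀ i, cdim (chainFace i) = 2 := by decide +kernel

theorem chain_ends : ∀ i, lo (chainEdge i 0) = vertA ∧ hi (chainEdge i 0) = lo (chainEdge i 1) ∧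
    hi (chainEdge i 1) = lo (chainEdge i 2) ∧ hi (chainEdge i 2) = vertB := by decide +kernel

theorem faceFst_eq : ∀ i, faceFst i = fstDir (chainFace i) := by decide +kernel

theorem faceSnd_eq : ∀ i, faceSnd i = sndDir (chainFace i) := by decide +kernel

theorem lo_chainFace : ∀ i, lo (chainFace i)
    = if faceEnd i then hi (chainEdge i 0) else vertA := by decide +kernel

/-- The path on the boundary of the `i`-th face that is part of the `i`-th chain. -/
def firstPath (i : Fin 6) : CubeCell × CubeCell :=
  if facePos i then ((chainFace i).set (faceSnd i) false, (chainFace i).set (faceFst i) true)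
  else ((chainFace i).set (faceFst i) false, (chainFace i).set (faceSnd i) true)

/-- The path on the boundary of the `i`-th face that is part of the next chain. -/
def secondPath (i : Fin 6) : CubeCell × CubeCell :=
  if facePos i then ((chainFace i).set (faceFst i) false, (chainFace i).set (faceSnd i) true)
  else ((chainFace i).set (faceSnd i) false, (chainFace i).set (faceFst i) true)

/-- A face that contains the end point `b`: the two adjacent chains share their first edge and
differ in the last two. -/
theorem chain_of_faceEnd : ∀ i, faceEnd i = true →
    chainEdge i 1 = (firstPath i).1 ∧ chainEdge i 2 = (firstPath i).2 ∧
    chainEdge (i + 1) 1 = (secondPath i).1 ∧ chainEdge (i + 1) 2 = (secondPath i).2 ∧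
    chainEdge (i + 1) 0 = chainEdge i 0 := by decide +kernel

/-- A face that contains the initial point `a`: the two adjacent chains differ in the first two
edges and share the last one. -/
theorem chain_of_not_faceEnd : ∀ i, faceEnd i = false →
    chainEdge i 0 = (firstPath i).1 ∧ chainEdge i 1 = (firstPath i).2 ∧
    chainEdge (i + 1) 0 = (secondPath i).1 ∧ chainEdge (i + 1) 1 = (secondPath i).2 ∧
    chainEdge (i + 1) 2 = chainEdge i 2 := by decide +kernel

theorem faceSign_eq : ∀ i, faceSign i = ((if facePos i then 1 else -1 : ℤ) : ℚ) := by
  decide +kernel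

theorem permSign_of_cdim_le : ∀ (π : Equiv.Perm (Fin 3)) (c : CubeCell), cdim c ≤ 1 →
    permSign π c = 1 := by decide +kernel

theorem cdim_permCell : ∀ (π : Equiv.Perm (Fin 3)) (c : CubeCell),
    cdim (permCell π c) = cdim c := by decide +kernel

theorem permCell_set : ∀ (π : Equiv.Perm (Fin 3)) (c : CubeCell) (i : Fin 3) (s : Bool),
    permCell π (c.set i s) = (permCell π c).set (π i) s := by decide +kernel

/-- A permutation keeps or exchanges the order of the two directions of a square, and the sign
records which. -/
theorem permCell_square : ∀ (π : Equiv.Perm (Fin 3)) (g : CubeCell), cdim g = 2 →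
    (permSign π g = 1 ∧ fstDir (permCell π g) = π (fstDir g) ∧
      sndDir (permCell π g) = π (sndDir g)) ∨
    (permSign π g = -1 ∧ fstDir (permCell π g) = π (sndDir g) ∧
      sndDir (permCell π g) = π (fstDir g)) := by decide +kernel

theorem permCell_top : ∀ π : Equiv.Perm (Fin 3), permCell π top = top := fun _ => rfl

theorem permCell_vertA : ∀ π : Equiv.Perm (Fin 3), permCell π vertA = vertA := fun _ => rfl

/-- The permutations of the directions act on the six chains by rotations and reflections. -/
theorem permCell_chain : ∀ π : Equiv.Perm (Fin 3),
    (permSign π top = 1 ∧ ∃ k : Fin 6, ∀ i,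
      (∀ t, permCell π (chainEdge i t) = chainEdge (i + k) t) ∧
      permCell π (chainFace i) = chainFace (i + k) ∧ faceEnd (i + k) = faceEnd i ∧
      faceSign i * permSign π (chainFace i) = faceSign (i + k)) ∨
    (permSign π top = -1 ∧ ∃ k : Fin 6, ∀ i,
      (∀ t, permCell π (chainEdge i t) = chainEdge (k - i) t) ∧
      permCell π (chainFace i) = chainFace (k - 1 - i) ∧ faceEnd (k - 1 - i) = faceEnd i ∧
      (faceEnd i = true → chainEdge (k - i) 0 = chainEdge (k - 1 - i) 0) ∧
      faceSign i * permSign π (chainFace i) = -faceSign (k - 1 - i)) := by decide +kernel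

end Combinatorics

end NCSeries

namespace NCSeries

open scoped NCSeries.Ring

theorem exists_isOddDer {C : Type} [Finite C] {deg : C → ℤ} {v : C → NCSeries C}
    (hv : ∀ c, v c ∈ fil C 1) (hv' : ∀ c, v c ∈ hom deg (deg c - 1)) :
    ∃ D : NCSeries C →ₗ[ℚ] NCSeries C, IsOddDer deg D ∧ ∀ c, D (letter c) = v c := by
  have := Fintype.ofFinite C
  exact ⟨mkDer deg v, mkDer_isOddDer hv hv', mkDer_letter hv⟩

/-! The model of the cube. -/

section Cube

open Cube

variable {μ : NCSeries (Fin 6)} {P : Fin 6 → NCSeries (Fin 5)}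

instance cube_finite : Finite cube.Cell := inferInstanceAs (Finite CubeCell)

/-- A cell of the cube, as a letter. -/
def cCell (c : CubeCell) : cube.Cell := c

theorem cSer_mem_fil (c : CubeCell) : cSer c ∈ fil cube.Cell 1 := letter_mem_fil _

theorem cSer_mem_lieSer {S : Set cube.Cell} {c : CubeCell} (h : cCell c ∈ S) :
    cSer c ∈ lieSer cube.deg S :=
  letter_mem_lieSer h

theorem cSer_mem_hom {n : ℤ} {c : CubeCell} (h : (cdim c : ℤ) - 1 = n) :
    cSer c ∈ hom cube.deg n :=
  h ▸ letter_mem_hom (deg := cube.deg) (cCell c)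

theorem vert_mem_hom {c : CubeCell} (h : cdim c = 0) : cSer c ∈ hom cube.deg (-1) :=
  cSer_mem_hom (by rw [h]; rfl)

theorem edge_mem_hom {c : CubeCell} (h : cdim c = 1) : cSer c ∈ hom cube.deg 0 :=
  cSer_mem_hom (by rw [h]; rfl)

theorem square_mem_hom {c : CubeCell} (h : cdim c = 2) : cSer c ∈ hom cube.deg 1 :=
  cSer_mem_hom (by rw [h]; rfl)

theorem top_mem_hom : cSer top ∈ hom cube.deg 2 :=
  cSer_mem_hom (by rw [cdim_top]; rfl)

theorem edge_mem_lieZero' {S : Set cube.Cell} {c : CubeCell} (h : cdim c = 1) (hc : cCell c ∈ S) :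
    cSer c ∈ lieZero cube.deg S :=
  ⟨cSer_mem_lieSer hc, edge_mem_hom h⟩

theorem cSer_coeff_singleton (c d : CubeCell) : cSer c [cCell d] = if d = c then 1 else 0 :=
  letter_coeff_singleton (C := CubeCell) c d

/-- The vertices and edges. -/
def skel : Set cube.Cell := {c | cdim c ≤ 1}

/-- The differential on vertices and edges. -/
noncomputable def skelVal (c : CubeCell) : NCSeries cube.Cell :=
  if cdim c = 0 then -(cSer c * cSer c)
  else if cdim c = 1 then edgeDiff cube.deg (cSer c) (cSer (lo c)) (cSer (hi c)) else 0

theorem skelVal_vert {c : CubeCell} (h : cdim c = 0) : skelVal c = -(cSer c * cSer c) := by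
  rw [skelVal, if_pos h]

theorem skelVal_edge {c : CubeCell} (h : cdim c = 1) :
    skelVal c = edgeDiff cube.deg (cSer c) (cSer (lo c)) (cSer (hi c)) := by
  rw [skelVal, if_neg (by omega), if_pos h]

theorem skelVal_mem_hom (c : CubeCell) : skelVal c ∈ hom cube.deg ((cdim c : ℤ) - 1 - 1) := by
  unfold skelVal
  split_ifs with h h
  · rw [h]
    exact neg_mul_self_mem_hom (vert_mem_hom h)
  · rw [h]
    exact edgeDiff_mem_hom (edge_mem_hom h) (vert_mem_hom (cdim_lo c)) (vert_mem_hom (cdim_hi c))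
  · exact zero_mem _

theorem skelVal_mem_lieSer {S : Set cube.Cell} {c : CubeCell} (hc : cCell c ∈ S)
    (hl : cCell (lo c) ∈ S) (hh : cCell (hi c) ∈ S) : skelVal c ∈ lieSer cube.deg S := by
  unfold skelVal
  split_ifs with h h
  · exact neg_mul_self_mem_lieSer (vert_mem_hom h) (cSer_mem_lieSer hc)
  · exact edgeDiff_mem_lieSer (edge_mem_hom h) (cSer_mem_lieSer hc) (cSer_mem_lieSer hl)
      (cSer_mem_lieSer hh)
  · exact zero_mem _

theorem skelVal_mem_fil (c : CubeCell) : skelVal c ∈ fil cube.Cell 1 :=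
  lieSer_le_fil (skelVal_mem_lieSer (Set.mem_univ _) (Set.mem_univ _) (Set.mem_univ _))

/-- The differential of a square or of the 3-cell involves its centre, while the centre is defined
by a flow for that differential. The circle is broken by a derivation prescribed on vertices and
edges and zero on all other cells: the diagonals lie in the Lie algebra of the skeleton, so the
resulting flows are the right ones. -/
theorem exists_skelDer : ∃ D : NCSeries cube.Cell →ₗ[ℚ] NCSeries cube.Cell,
    IsOddDer cube.deg D ∧ ∀ c, D (cSer c) = skelVal c :=
  exists_isOddDer (deg := cube.deg) skelVal_mem_fil skelVal_mem_hom

/-- A derivation with the given values on vertices and edges. -/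
noncomputable def skelDer : NCSeries cube.Cell →ₗ[ℚ] NCSeries cube.Cell :=
  exists_skelDer.choose

theorem skelDer_isOddDer : IsOddDer cube.deg skelDer := exists_skelDer.choose_spec.1

theorem skelDer_cSer (c : CubeCell) : skelDer (cSer c) = skelVal c :=
  exists_skelDer.choose_spec.2 c

/-! Diagonals and loops. -/

theorem squarePath_mem_lieZero {S : Set cube.Cell} {g : CubeCell} {j k : Fin 3} (hg : cdim g = 2)
    (hj : g j = none) (hk : g k = none) (h1 : cCell (g.set k false) ∈ S)
    (h2 : cCell (g.set j true) ∈ S) : squarePath g j k ∈ lieZero cube.deg S :=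
  bch_mem_lieZero (edge_mem_lieZero' (cdim_set g k false hg hk) h1)
    (edge_mem_lieZero' (cdim_set g j true hg hj) h2)

/-- The diagonal of a square. -/
noncomputable def gDiag (g : CubeCell) : NCSeries cube.Cell := squareDiag g (fstDir g) (sndDir g)

/-- The boundary of a square, based at its minimal vertex. -/
noncomputable def gLoop (g : CubeCell) : NCSeries cube.Cell :=
  bchList [cSer (g.set (sndDir g) false), cSer (g.set (fstDir g) true),
    -cSer (g.set (sndDir g) true), -cSer (g.set (fstDir g) false)]

theorem gLoop_eq (g : CubeCell) : gLoop g
    = bch (squarePath g (fstDir g) (sndDir g)) (-squarePath g (sndDir g) (fstDir g)) := by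
  apply exp_injective (bchList_mem_fil _) (bch_mem_fil _ _)
  rw [exp_bchList, exp_bch, squarePath, squarePath,
    neg_bch (cSer_mem_fil _) (cSer_mem_fil _), exp_bch, exp_bch]
  simp [mul_assoc]

variable {S : Set cube.Cell}

/-- The edges of a square lie in `S`. -/
def HasEdges (S : Set cube.Cell) (g : CubeCell) : Prop :=
  ∀ i s, g i = none → cCell (g.set i s) ∈ S

theorem gPath_mem_lieZero {g : CubeCell} (hg : cdim g = 2) (hS : HasEdges S g) :
    squarePath g (fstDir g) (sndDir g) ∈ lieZero cube.deg S ∧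
      squarePath g (sndDir g) (fstDir g) ∈ lieZero cube.deg S := by
  obtain ⟨-, hj, hk⟩ := fstDir_lt_sndDir g hg
  exact ⟨squarePath_mem_lieZero hg hj hk (hS _ _ hk) (hS _ _ hj),
    squarePath_mem_lieZero hg hk hj (hS _ _ hj) (hS _ _ hk)⟩

theorem gDiag_mem_lieZero {g : CubeCell} (hg : cdim g = 2) (hS : HasEdges S g) :
    gDiag g ∈ lieZero cube.deg S :=
  mu2_mem_lieZero (gPath_mem_lieZero hg hS).1 (gPath_mem_lieZero hg hS).2

theorem gLoop_mem_lieZero {g : CubeCell} (hg : cdim g = 2) (hS : HasEdges S g) :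
    gLoop g ∈ lieZero cube.deg S := by
  rw [gLoop_eq]
  exact bch_mem_lieZero (gPath_mem_lieZero hg hS).1 (neg_mem (gPath_mem_lieZero hg hS).2)

theorem hasEdges_skel {g : CubeCell} (hg : cdim g = 2) : HasEdges skel g :=
  fun i s hi => (cdim_set g i s hg hi).le

theorem hasEdges_univ (g : CubeCell) : HasEdges Set.univ g := fun _ _ _ => Set.mem_univ _

theorem set_mem_cl (g : CubeCell) (i : Fin 3) (s : Bool) (hi : g i = none) :
    cCell (g.set i s) ∈ cube.cl (cCell g) := by
  intro j
  by_cases h : j = i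
  · exact Or.inl (h ▸ hi)
  · exact Or.inr (Function.update_of_ne h _ _)

theorem lo_mem_cl {c g : CubeCell} (h : cCell c ∈ cube.cl (cCell g)) :
    cCell (lo c) ∈ cube.cl (cCell g) := by
  intro i
  rcases h i with h | h
  · exact Or.inl h
  · rcases hg : g i with _ | b
    · exact Or.inl hg
    · refine Or.inr ?_
      have h' : c i = some b := h.trans hg
      change some ((c i).getD false) = g i
      rw [h', hg]
      rfl

theorem hi_mem_cl {c g : CubeCell} (h : cCell c ∈ cube.cl (cCell g)) :
    cCell (hi c) ∈ cube.cl (cCell g) := by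
  intro i
  rcases h i with h | h
  · exact Or.inl h
  · rcases hg : g i with _ | b
    · exact Or.inl hg
    · refine Or.inr ?_
      have h' : c i = some b := h.trans hg
      change some ((c i).getD true) = g i
      rw [h', hg]
      rfl

theorem self_mem_cl (g : CubeCell) : cCell g ∈ cube.cl (cCell g) := fun _ => Or.inr rfl

theorem chainBCH_mem_lieZero (hS : ∀ c, cdim c = 1 → cCell c ∈ S) (i : Fin 6) :
    chainBCH i ∈ lieZero cube.deg S := by
  refine bchList_mem_lieZero fun x hx => ?_
  simp only [List.mem_cons, List.not_mem_nil, or_false] at hx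
  rcases hx with rfl | rfl | rfl <;>
    exact edge_mem_lieZero' (cdim_chainEdge _ _) (hS _ (cdim_chainEdge _ _))

theorem mainDiag_mem_lieZero (hμ : μ ∈ lieSer (fun _ => 0) Set.univ)
    (hS : ∀ c, cdim c = 1 → cCell c ∈ S) : mainDiag μ ∈ lieZero cube.deg S := by
  rw [mainDiag, subst_eq]
  exact substHom_mem_lieZero (chainBCH_mem_lieZero hS) hμ

theorem initialBCH_mem_lieZero (hS : ∀ c, cdim c = 1 → cCell c ∈ S) (i : Fin 6) :
    initialBCH i ∈ lieZero cube.deg S := by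
  unfold initialBCH
  split_ifs
  · exact edge_mem_lieZero' (cdim_chainEdge _ _) (hS _ (cdim_chainEdge _ _))
  · exact zero_mem _

theorem mem_skel_of_edge (c : CubeCell) (hc : cdim c = 1) : cCell c ∈ skel := hc.le

theorem movedFace_eq (i : Fin 6) : movedFace i = faceSign i • expAd cube.deg (initialBCH i)
    (expAd cube.deg ((1 / 2 : ℚ) • gDiag (chainFace i)) (cSer (chainFace i))) := by
  rw [movedFace, gDiag, ← faceFst_eq, ← faceSnd_eq]

theorem half_mem_lieZero {v : NCSeries cube.Cell} (hv : v ∈ lieZero cube.deg S) :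
    (1 / 2 : ℚ) • v ∈ lieZero cube.deg S := Submodule.smul_mem _ _ hv

theorem movedFace_mem_lieSer (hS : ∀ c, cdim c = 1 → cCell c ∈ S)
    (hS' : ∀ c, cdim c = 2 → cCell c ∈ S) (i : Fin 6) : movedFace i ∈ lieSer cube.deg S := by
  have h1 := half_mem_lieZero (gDiag_mem_lieZero (S := S) (cdim_chainFace i)
    fun j s hj => hS _ (cdim_set _ j s (cdim_chainFace i) hj))
  have h2 := initialBCH_mem_lieZero hS i
  rw [movedFace_eq]
  exact Submodule.smul_mem _ _ (expAd_mem_lieSer h2.2 h2.1 (expAd_mem_lieSer h1.2 h1.1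
    (cSer_mem_lieSer (hS' _ (cdim_chainFace i)))))

theorem movedFace_mem_hom (i : Fin 6) : movedFace i ∈ hom cube.deg 1 := by
  have h1 := half_mem_lieZero (gDiag_mem_lieZero (cdim_chainFace i) (hasEdges_univ _))
  have h2 := initialBCH_mem_lieZero (S := Set.univ) (fun _ _ => Set.mem_univ _) i
  rw [movedFace_eq]
  exact Submodule.smul_mem _ _ (expAd_mem_hom h2.2 (expAd_mem_hom h1.2
    (square_mem_hom (cdim_chainFace i))))

theorem movedFace_mem_fil (i : Fin 6) : movedFace i ∈ fil cube.Cell 1 :=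
  lieSer_le_fil (movedFace_mem_lieSer (fun _ _ => Set.mem_univ _) (fun _ _ => Set.mem_univ _) i)

theorem movedFace_coeff_singleton (i : Fin 6) (c : cube.Cell) :
    movedFace i [c] = faceSign i * cSer (chainFace i) [c] := by
  have h1 := half_mem_lieZero (gDiag_mem_lieZero (cdim_chainFace i) (hasEdges_univ _))
  have h2 := initialBCH_mem_lieZero (S := Set.univ) (fun _ _ => Set.mem_univ _) i
  rw [movedFace_eq, smul_coeff, expAd_coeff_singleton h2.2 (lieZero_mem_fil h2)
    (expAd_mem_fil h1.2 (lieZero_mem_fil h1) (cSer_mem_fil _)),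
    expAd_coeff_singleton h1.2 (lieZero_mem_fil h1) (cSer_mem_fil _)]

/-- The boundary of the cube, based at its minimal vertex. -/
noncomputable def cTop (P : Fin 6 → NCSeries (Fin 5)) : NCSeries cube.Cell :=
  ∑ i, act cube.deg (loop chainBCH) (P i) (movedFace i)

theorem cTop_eq (P : Fin 6 → NCSeries (Fin 5)) :
    ∑ i : Fin 6, actAd cube.deg (P i)
      (fun j : Fin 5 => bch (chainBCH j.castSucc) (-chainBCH j.succ)) (movedFace i) = cTop P := by
  simp only [actAd_eq]
  rfl

theorem cTop_mem_lieSer (hS : ∀ c, cdim c = 1 → cCell c ∈ S)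
    (hS' : ∀ c, cdim c = 2 → cCell c ∈ S) : cTop P ∈ lieSer cube.deg S :=
  sum_act_mem_lieSer (m := 5) (chainBCH_mem_lieZero hS) (movedFace_mem_lieSer hS hS')

theorem cTop_mem_hom : cTop P ∈ hom cube.deg 1 :=
  sum_act_mem_hom (m := 5)
    (fun i => (chainBCH_mem_lieZero (S := Set.univ) (fun _ _ => Set.mem_univ _) i).2)
    movedFace_mem_hom

/-! Centres and the values of the differential. -/

/-- The centre of a square. -/
noncomputable def gCentre (g : CubeCell) : NCSeries cube.Cell :=
  flowPt skelDer ((1 / 2 : ℚ) • gDiag g) (cSer (lo g))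

/-- The centre of the cube. -/
noncomputable def cCentre (μ : NCSeries (Fin 6)) : NCSeries cube.Cell :=
  flowPt skelDer ((1 / 2 : ℚ) • mainDiag μ) (cSer vertA)

/-- The boundary of a square, based at its centre. -/
noncomputable def gBoundary (g : CubeCell) : NCSeries cube.Cell :=
  expAd cube.deg (-((1 / 2 : ℚ) • gDiag g)) (gLoop g)

/-- The boundary of the cube, based at its centre. -/
noncomputable def cBoundary (μ : NCSeries (Fin 6)) (P : Fin 6 → NCSeries (Fin 5)) :
    NCSeries cube.Cell :=
  expAd cube.deg (-((1 / 2 : ℚ) • mainDiag μ)) (cTop P)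

/-- The differential on generators. -/
noncomputable def cubeVal (μ : NCSeries (Fin 6)) (P : Fin 6 → NCSeries (Fin 5)) (c : CubeCell) :
    NCSeries cube.Cell :=
  if cdim c ≤ 1 then skelVal c
  else if cdim c = 2 then gBoundary c - bracket cube.deg (gCentre c) (cSer c)
  else cBoundary μ P - bracket cube.deg (cCentre μ) (cSer c)

theorem cubeVal_skel {c : CubeCell} (h : cdim c ≤ 1) : cubeVal μ P c = skelVal c := by
  rw [cubeVal, if_pos h]

theorem cubeVal_square {c : CubeCell} (h : cdim c = 2) :
    cubeVal μ P c = gBoundary c - bracket cube.deg (gCentre c) (cSer c) := by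
  rw [cubeVal, if_neg (by omega), if_pos h]

theorem cubeVal_top :
    cubeVal μ P top = cBoundary μ P - bracket cube.deg (cCentre μ) (cSer top) := by
  rw [cubeVal, cdim_top, if_neg (by omega), if_neg (by omega)]

theorem gCentre_mem_hom {g : CubeCell} (hg : cdim g = 2) : gCentre g ∈ hom cube.deg (-1) := by
  have h := half_mem_lieZero (gDiag_mem_lieZero hg (hasEdges_univ g))
  exact flowPt_mem_hom skelDer_isOddDer h.2 (lieZero_mem_fil h) (vert_mem_hom (cdim_lo g))

theorem cCentre_mem_hom (hμ : μ ∈ lieSer (fun _ => 0) Set.univ) :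
    cCentre μ ∈ hom cube.deg (-1) := by
  have h := half_mem_lieZero (mainDiag_mem_lieZero (S := Set.univ) hμ fun _ _ => Set.mem_univ _)
  exact flowPt_mem_hom skelDer_isOddDer h.2 (lieZero_mem_fil h) (vert_mem_hom cdim_vertA)

theorem gCentre_mem_lieSer {g : CubeCell} (hg : cdim g = 2) :
    gCentre g ∈ lieSer cube.deg (cube.cl (cCell g)) := by
  have h := half_mem_lieZero (gDiag_mem_lieZero hg (set_mem_cl g))
  refine flowPt_mem_lieSer h.2 h.1 (cSer_mem_lieSer (lo_mem_cl (self_mem_cl g))) ?_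
  refine skelDer_isOddDer.map_lieSer subset_rfl (fun c hc => ?_) h.1
  exact (skelDer_cSer c).symm ▸ skelVal_mem_lieSer hc (lo_mem_cl hc) (hi_mem_cl hc)

theorem cCentre_mem_lieSer (hμ : μ ∈ lieSer (fun _ => 0) Set.univ) :
    cCentre μ ∈ lieSer cube.deg Set.univ := by
  have h := half_mem_lieZero (mainDiag_mem_lieZero (S := Set.univ) hμ fun _ _ => Set.mem_univ _)
  refine flowPt_mem_lieSer h.2 h.1 (cSer_mem_lieSer (Set.mem_univ _)) ?_
  refine skelDer_isOddDer.map_lieSer subset_rfl (fun c hc => ?_) h.1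
  exact (skelDer_cSer c).symm ▸
    skelVal_mem_lieSer (Set.mem_univ _) (Set.mem_univ _) (Set.mem_univ _)

theorem gBoundary_mem_lieZero {g : CubeCell} (hg : cdim g = 2) (hS : HasEdges S g) :
    gBoundary g ∈ lieZero cube.deg S := by
  have h := neg_mem (half_mem_lieZero (gDiag_mem_lieZero hg hS))
  have h' := gLoop_mem_lieZero hg hS
  exact ⟨expAd_mem_lieSer h.2 h.1 h'.1, expAd_mem_hom h.2 h'.2⟩

theorem cBoundary_mem_hom (hμ : μ ∈ lieSer (fun _ => 0) Set.univ) :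
    cBoundary μ P ∈ hom cube.deg 1 := by
  have h := neg_mem (half_mem_lieZero
    (mainDiag_mem_lieZero (S := Set.univ) hμ fun _ _ => Set.mem_univ _))
  exact expAd_mem_hom h.2 cTop_mem_hom

theorem cBoundary_mem_lieSer (hμ : μ ∈ lieSer (fun _ => 0) Set.univ)
    (hS : ∀ c, cdim c = 1 → cCell c ∈ S) (hS' : ∀ c, cdim c = 2 → cCell c ∈ S) :
    cBoundary μ P ∈ lieSer cube.deg S := by
  have h := neg_mem (half_mem_lieZero (mainDiag_mem_lieZero hμ hS))
  exact expAd_mem_lieSer h.2 h.1 (cTop_mem_lieSer hS hS')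

theorem cubeVal_mem_hom (hμ : μ ∈ lieSer (fun _ => 0) Set.univ) (c : CubeCell) :
    cubeVal μ P c ∈ hom cube.deg ((cdim c : ℤ) - 1 - 1) := by
  by_cases h1 : cdim c ≤ 1
  · rw [cubeVal_skel h1]
    exact skelVal_mem_hom c
  by_cases h2 : cdim c = 2
  · rw [cubeVal_square h2, h2]
    exact sub_bracket_mem_hom (p := 1) (gCentre_mem_hom h2) (square_mem_hom h2)
      (gBoundary_mem_lieZero h2 (hasEdges_univ c)).2
  · obtain rfl := eq_top_of_cdim c (by omega) (by omega) h2
    rw [cubeVal_top, cdim_top]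
    exact sub_bracket_mem_hom (p := 2) (cCentre_mem_hom hμ) top_mem_hom (cBoundary_mem_hom hμ)

theorem cubeVal_mem_lieSer (hμ : μ ∈ lieSer (fun _ => 0) Set.univ) (c : CubeCell) :
    cubeVal μ P c ∈ lieSer cube.deg (cube.cl (cCell c)) := by
  by_cases h1 : cdim c ≤ 1
  · rw [cubeVal_skel h1]
    exact skelVal_mem_lieSer (self_mem_cl c) (lo_mem_cl (self_mem_cl c))
      (hi_mem_cl (self_mem_cl c))
  by_cases h2 : cdim c = 2
  · rw [cubeVal_square h2]
    exact sub_mem (gBoundary_mem_lieZero h2 (set_mem_cl c)).1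
      (bracket_mem_lieSer (gCentre_mem_lieSer h2) (cSer_mem_lieSer (self_mem_cl c)))
  · obtain rfl := eq_top_of_cdim c (by omega) (by omega) h2
    have hcl : cube.cl (cCell top) = Set.univ := Set.eq_univ_of_forall fun _ _ => Or.inl rfl
    rw [cubeVal_top, hcl]
    exact sub_mem (cBoundary_mem_lieSer hμ (fun _ _ => Set.mem_univ _) fun _ _ => Set.mem_univ _)
      (bracket_mem_lieSer (cCentre_mem_lieSer hμ) (cSer_mem_lieSer (Set.mem_univ _)))

theorem cubeVal_coeff_singleton (hμ : μ ∈ lieSer (fun _ => 0) Set.univ) (hP : IsAdmissible 5 P)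
    (c c' : CubeCell) : cubeVal μ P c [cCell c'] = (cinc c c' : ℚ) := by
  by_cases h0 : cdim c = 0
  · rw [cubeVal_skel (by omega), skelVal_vert h0, neg_mul_self_coeff_singleton (cSer_mem_fil _),
      cinc_vertex c c' h0, Int.cast_zero]
  by_cases h1 : cdim c = 1
  · rw [cubeVal_skel (by omega), skelVal_edge h1, edgeDiff_coeff_singleton (edge_mem_hom h1)
      (cSer_mem_fil _) (cSer_mem_fil _) (cSer_mem_fil _), cSer_coeff_singleton,
      cSer_coeff_singleton, cinc_edge c c' h1]
    push_cast
    rfl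
  by_cases h2 : cdim c = 2
  · have hv := neg_mem (half_mem_lieZero (gDiag_mem_lieZero h2 (hasEdges_univ c)))
    rw [cubeVal_square h2, sub_bracket_coeff_singleton (lieSer_le_fil (gCentre_mem_lieSer h2))
      (cSer_mem_fil _), gBoundary, expAd_coeff_singleton hv.2 (lieZero_mem_fil hv)
      (lieZero_mem_fil (gLoop_mem_lieZero h2 (hasEdges_univ c)))]
    unfold gLoop
    rw [bchList_coeff_singleton, cinc_square c c' h2]
    simp only [List.map_cons, List.map_nil, List.sum_cons, List.sum_nil, neg_coeff,
      cSer_coeff_singleton]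
    push_cast
    ring
  · obtain rfl := eq_top_of_cdim c (by omega) (by omega) h2
    have hv := neg_mem (half_mem_lieZero
      (mainDiag_mem_lieZero (S := Set.univ) hμ fun _ _ => Set.mem_univ _))
    rw [cubeVal_top, sub_bracket_coeff_singleton (lieSer_le_fil (cCentre_mem_lieSer hμ))
      (cSer_mem_fil _), cBoundary, expAd_coeff_singleton hv.2 (lieZero_mem_fil hv)
      (lieSer_le_fil (cTop_mem_lieSer (fun _ _ => Set.mem_univ _) fun _ _ => Set.mem_univ _)),
      cTop, sum_act_coeff_singleton (m := 5) hP movedFace_mem_fil, cinc_top]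
    simp only [movedFace_coeff_singleton, faceSign_eq, cSer_coeff_singleton]
    push_cast
    rfl

end Cube

end NCSeries

namespace NCSeries

open scoped NCSeries.Ring

section Cube

open Cube

variable {μ : NCSeries (Fin 6)} {P : Fin 6 → NCSeries (Fin 5)} {S : Set cube.Cell}
  {D : NCSeries cube.Cell →ₗ[ℚ] NCSeries cube.Cell}

/-! Transport along the paths of the cube. -/

section Transport

variable (hD : IsOddDer cube.deg D) (hs : ∀ c, cdim c ≤ 1 → D (cSer c) = skelVal c)

include hs

theorem vert_isMC {c : CubeCell} (h : cdim c = 0) : IsMC cube.deg D (cSer c) :=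
  ⟨vert_mem_hom h, (hs c (by omega)).trans (skelVal_vert h)⟩

include hD

theorem skelDer_eq_on {f : NCSeries cube.Cell} (hf : f ∈ lieSer cube.deg skel) :
    D f = skelDer f :=
  hD.eq_on skelDer_isOddDer (fun c hc => (hs c hc).trans (skelDer_cSer c).symm) hf

theorem edge_transports {c : CubeCell} (h : cdim c = 1) :
    Transports D (cSer (lo c)) (cSer (hi c)) (exp (cSer c)) :=
  transports_of_edgeDiff hD.toIsDer (edge_mem_hom h) (cSer_mem_fil c)
    ((hs c h.le).trans (skelVal_edge h))

theorem skel_sq (c : cube.Cell) (hc : c ∈ skel) : D (D (letter c)) = 0 := by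
  have hc : cdim c ≤ 1 := hc
  change D (D (cSer c)) = 0
  by_cases h : cdim c = 0
  · exact IsMC.sq hD (vert_isMC hs h)
  · have h1 : cdim c = 1 := by omega
    exact Transports.exp_sq hD (vert_isMC hs (cdim_lo c)) (vert_isMC hs (cdim_hi c))
      (edge_mem_hom h1) (cSer_mem_fil c) (edge_transports hD hs h1)

theorem squarePath_transports {g : CubeCell} (hg : cdim g = 2) {j k : Fin 3} (hjk : j ≠ k)
    (hj : g j = none) (hk : g k = none) :
    Transports D (cSer (lo g)) (cSer (hi g)) (exp (squarePath g j k)) := by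
  obtain ⟨h1, h2, h3⟩ := square_path_ends g j k hjk hg hj hk
  have t1 := edge_transports hD hs (cdim_set g k false hg hk)
  have t2 := edge_transports hD hs (cdim_set g j true hg hj)
  rw [h1, h2] at t1
  rw [h3] at t2
  exact Transports.exp_bch hD.toIsDer (edge_mem_hom (cdim_set g k false hg hk)) t1 t2

theorem gLoop_transports {g : CubeCell} (hg : cdim g = 2) :
    Transports D (cSer (lo g)) (cSer (lo g)) (exp (gLoop g)) := by
  obtain ⟨hlt, hj, hk⟩ := fstDir_lt_sndDir g hg
  obtain ⟨h1, h2⟩ := gPath_mem_lieZero hg (hasEdges_univ g)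
  rw [gLoop_eq]
  exact Transports.exp_bch hD.toIsDer h1.2 (squarePath_transports hD hs hg hlt.ne hj hk)
    (Transports.exp_neg hD.toIsDer h2.2 (lieZero_mem_fil h2)
      (squarePath_transports hD hs hg hlt.ne' hk hj))

theorem chainBCH_transports (i : Fin 6) :
    Transports D (cSer vertA) (cSer vertB) (exp (chainBCH i)) := by
  obtain ⟨h1, h2, h3, h4⟩ := chain_ends i
  have t := fun t => edge_transports hD hs (cdim_chainEdge i t)
  have t0 := t 0
  have t1 := t 1
  have t2 := t 2
  rw [h1, h2] at t0
  rw [h3] at t1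
  rw [h4] at t2
  have h : exp (chainBCH i) = exp (cSer (chainEdge i 0)) *
      (exp (cSer (chainEdge i 1)) * exp (cSer (chainEdge i 2))) := by
    rw [chainBCH, exp_bchList]
    simp
  have hm := fun t => exp_mem_hom (edge_mem_hom (cdim_chainEdge i t))
  rw [h]
  exact t0.mul hD.toIsDer (hm 0) (t1.mul hD.toIsDer (hm 1) t2)

theorem initialBCH_transports (i : Fin 6) :
    Transports D (cSer vertA) (cSer (lo (chainFace i))) (exp (initialBCH i)) := by
  have h := lo_chainFace i
  unfold initialBCH
  split_ifs at h ⊢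
  · rw [h, ← (chain_ends i).1]
    exact edge_transports hD hs (cdim_chainEdge i 0)
  · rw [h, exp_zero]
    exact Transports.one hD.toIsDer

theorem flowPt_skel {v : NCSeries cube.Cell} (hv : v ∈ lieZero cube.deg skel)
    (a : NCSeries cube.Cell) : flowPt D v a = flowPt skelDer v a :=
  flowPt_congr (skelDer_eq_on hD hs hv.1)

theorem gCentre_transports {g : CubeCell} (hg : cdim g = 2) :
    Transports D (cSer (lo g)) (gCentre g) (exp ((1 / 2 : ℚ) • gDiag g)) := by
  have h := half_mem_lieZero (gDiag_mem_lieZero hg (hasEdges_skel hg))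
  exact (transports_iff_flowPt hD.toIsDer h.2 (lieZero_mem_fil h)).2 (flowPt_skel hD hs h _)

theorem cCentre_transports (hμ : μ ∈ lieSer (fun _ => 0) Set.univ) :
    Transports D (cSer vertA) (cCentre μ) (exp ((1 / 2 : ℚ) • mainDiag μ)) := by
  have h := half_mem_lieZero (mainDiag_mem_lieZero hμ mem_skel_of_edge)
  exact (transports_iff_flowPt hD.toIsDer h.2 (lieZero_mem_fil h)).2 (flowPt_skel hD hs h _)

theorem gCentre_isMC {g : CubeCell} (hg : cdim g = 2) : IsMC cube.deg D (gCentre g) := by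
  have h := half_mem_lieZero (gDiag_mem_lieZero hg (hasEdges_skel hg))
  have := flowPt_isMC hD (vert_isMC hs (cdim_lo g)) (skel_sq hD hs) h
  rwa [flowPt_skel hD hs h] at this

theorem cCentre_isMC (hμ : μ ∈ lieSer (fun _ => 0) Set.univ) :
    IsMC cube.deg D (cCentre μ) := by
  have h := half_mem_lieZero (mainDiag_mem_lieZero hμ mem_skel_of_edge)
  have := flowPt_isMC hD (vert_isMC hs cdim_vertA) (skel_sq hD hs) h
  rwa [flowPt_skel hD hs h] at this

/-- The boundary loop is closed at the minimal vertex, and transport along half the diagonal carries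
closed elements to elements closed at the centre. -/
theorem tw_gBoundary {g : CubeCell} (hg : cdim g = 2) :
    IsDer.tw cube.deg D (gCentre g) (gBoundary g) = 0 := by
  have h := half_mem_lieZero (gDiag_mem_lieZero hg (hasEdges_skel hg))
  have hl := gLoop_mem_lieZero hg (hasEdges_univ g)
  rw [gBoundary, tw_expAd_neg hD.toIsDer h.2 (lieZero_mem_fil h) (gCentre_transports hD hs hg),
    tw_eq_zero_of_transports hD.toIsDer hl.2 (lieZero_mem_fil hl) (gLoop_transports hD hs hg),
    expAd_eq (neg_mem h.2) (neg_mem (lieZero_mem_fil h)), mul_zero, zero_mul]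

end Transport

/-! The boundary of a moved face. -/

/-- The series of a path with two edges. -/
noncomputable def pairBCH (p : CubeCell × CubeCell) : NCSeries cube.Cell :=
  bch (cSer p.1) (cSer p.2)

/-- For a face with inward orientation the sign reverses the loop, which exchanges its two paths; in
either case the part of the `i`-th chain is traversed first. -/
theorem faceSign_smul_gLoop (i : Fin 6) : faceSign i • gLoop (chainFace i)
    = bch (pairBCH (firstPath i)) (-pairBCH (secondPath i)) := by
  have hn : ∀ x y : NCSeries cube.Cell, x ∈ fil cube.Cell 1 → y ∈ fil cube.Cell 1 →
      -bch x (-y) = bch y (-x) := fun x y hx hy => by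
    rw [neg_bch hx (neg_mem hy), neg_neg]
  rw [gLoop_eq, faceSign_eq, ← faceFst_eq, ← faceSnd_eq, firstPath, secondPath]
  cases facePos i
  · simp only [Bool.false_eq_true, if_false, Int.reduceNeg, Int.cast_neg, Int.cast_one, neg_smul,
      one_smul]
    exact hn _ _ (bch_mem_fil _ _) (bch_mem_fil _ _)
  · simp only [if_true, Int.cast_one, one_smul]
    rfl

/-- If the face contains `b`, conjugation supplies the common first edge of the two chains. If it
contains `a`, nothing is conjugated and the common last edge cancels against its inverse. -/
theorem expAd_pair (i : Fin 6) : expAd cube.deg (initialBCH i)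
    (bch (pairBCH (firstPath i)) (-pairBCH (secondPath i)))
      = bch (chainBCH i) (-chainBCH (i + 1)) := by
  have hi := initialBCH_mem_lieZero (S := Set.univ) (fun _ _ => Set.mem_univ _) i
  have hp : ∀ p, pairBCH p ∈ fil cube.Cell 1 := fun p => bch_mem_fil _ _
  apply exp_injective (expAd_mem_fil hi.2 (lieZero_mem_fil hi) (bch_mem_fil _ _)) (bch_mem_fil _ _)
  have hc : ∀ i, -chainBCH i = bchList [-cSer (chainEdge i 2), -cSer (chainEdge i 1),
      -cSer (chainEdge i 0)] := fun i => by
    rw [chainBCH, neg_bchList fun x hx => ?_]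
    · rfl
    · simp only [List.mem_cons, List.not_mem_nil, or_false] at hx
      rcases hx with rfl | rfl | rfl <;> exact cSer_mem_fil _
  rw [exp_expAd hi.2 (lieZero_mem_fil hi) (bch_mem_fil _ _), exp_bch, exp_bch, hc, chainBCH,
    exp_bchList, exp_bchList, pairBCH, pairBCH, neg_bch (cSer_mem_fil _) (cSer_mem_fil _),
    exp_bch, exp_bch, initialBCH]
  rcases h : faceEnd i
  · obtain ⟨h1, h2, h3, h4, h5⟩ := chain_of_not_faceEnd i h
    rw [h1, h2, h3, h4, h5]
    simp only [Bool.false_eq_true, if_false, neg_zero, exp_zero, one_mul, mul_one, List.map_cons,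
      List.map_nil, List.prod_cons, List.prod_nil]
    rw [mul_assoc, mul_assoc, mul_assoc, ← mul_assoc (exp (cSer (chainEdge i 2))),
      exp_mul_exp_neg (cSer_mem_fil _), one_mul]
  · obtain ⟨h1, h2, h3, h4, h5⟩ := chain_of_faceEnd i h
    rw [h1, h2, h3, h4, h5]
    simp only [if_true, List.map_cons, mul_one, List.map_nil, List.prod_cons, List.prod_nil,
      mul_assoc]

section Values

variable (hD : IsOddDer cube.deg D) (hv : ∀ c, D (cSer c) = cubeVal μ P c)

include hv

theorem cube_skel (c : CubeCell) (hc : cdim c ≤ 1) : D (cSer c) = skelVal c :=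
  (hv c).trans (cubeVal_skel hc)

theorem tw_square {g : CubeCell} (hg : cdim g = 2) :
    IsDer.tw cube.deg D (gCentre g) (cSer g) = gBoundary g :=
  (tw_eq_iff (gCentre_mem_hom hg)).2 ((hv g).trans (cubeVal_square hg))

theorem tw_top (hμ : μ ∈ lieSer (fun _ => 0) Set.univ) :
    IsDer.tw cube.deg D (cCentre μ) (cSer top) = cBoundary μ P :=
  (tw_eq_iff (cCentre_mem_hom hμ)).2 ((hv top).trans cubeVal_top)

include hD

/-- Transport from `a` to the minimal vertex and on to the centre turns the twisted differential at
`a` into the one at the centre. Conjugation by half the diagonal undoes the one in `gBoundary`, and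
the signed loop remains. -/
theorem tw_movedFace (i : Fin 6) : IsDer.tw cube.deg D (cSer vertA) (movedFace i)
    = bch (chainBCH i) (-chainBCH (i + 1)) := by
  have hs := cube_skel hv
  have hi := initialBCH_mem_lieZero (S := Set.univ) (fun _ _ => Set.mem_univ _) i
  have hg := cdim_chainFace i
  have h := half_mem_lieZero (gDiag_mem_lieZero hg (hasEdges_univ _))
  rw [movedFace_eq, map_smul, tw_expAd hD.toIsDer hi.2 (lieZero_mem_fil hi)
    (initialBCH_transports hD hs i), tw_expAd hD.toIsDer h.2 (lieZero_mem_fil h)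
    (gCentre_transports hD hs hg), tw_square hv hg, gBoundary,
    expAd_expAd_neg h.2 (lieZero_mem_fil h), ← expAd_smul hi.2 (lieZero_mem_fil hi),
    faceSign_smul_gLoop, expAd_pair]

theorem tw_cTop (hP : IsAdmissible 5 P) : IsDer.tw cube.deg D (cSer vertA) (cTop P) = 0 :=
  tw_sum_act hD.toIsDer hP (chainBCH_mem_lieZero fun _ _ => Set.mem_univ _)
    (chainBCH_transports hD (cube_skel hv)) (tw_movedFace hD hv)

theorem tw_cBoundary (hμ : μ ∈ lieSer (fun _ => 0) Set.univ) (hP : IsAdmissible 5 P) :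
    IsDer.tw cube.deg D (cCentre μ) (cBoundary μ P) = 0 := by
  have h := half_mem_lieZero (mainDiag_mem_lieZero hμ mem_skel_of_edge)
  rw [cBoundary, tw_expAd_neg hD.toIsDer h.2 (lieZero_mem_fil h)
    (cCentre_transports hD (cube_skel hv) hμ), tw_cTop hD hv hP,
    expAd_eq (neg_mem h.2) (neg_mem (lieZero_mem_fil h)), mul_zero, zero_mul]

/-- The 3-cell moved to the initial vertex. -/
theorem tw_movedTop (hμ : μ ∈ lieSer (fun _ => 0) Set.univ) :
    IsDer.tw cube.deg D (cSer vertA) (expAd cube.deg ((1 / 2 : ℚ) • mainDiag μ) (cSer top))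
      = cTop P := by
  have h := half_mem_lieZero (mainDiag_mem_lieZero hμ mem_skel_of_edge)
  rw [tw_expAd hD.toIsDer h.2 (lieZero_mem_fil h) (cCentre_transports hD (cube_skel hv) hμ),
    tw_top hv hμ, cBoundary, expAd_expAd_neg h.2 (lieZero_mem_fil h)]

theorem cube_sq (hμ : μ ∈ lieSer (fun _ => 0) Set.univ) (hP : IsAdmissible 5 P) (c : CubeCell) :
    D (D (cSer c)) = 0 := by
  have hs := cube_skel hv
  by_cases h1 : cdim c ≤ 1
  · exact skel_sq hD hs c h1
  by_cases h2 : cdim c = 2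
  · exact sq_of_tw hD (gCentre_isMC hD hs h2) (tw_square hv h2) (tw_gBoundary hD hs h2)
  · obtain rfl := eq_top_of_cdim c (by omega) (by omega) h2
    exact sq_of_tw hD (cCentre_isMC hD hs hμ) (tw_top hv hμ) (tw_cBoundary hD hv hμ hP)

end Values

/-! Existence and uniqueness of the model. -/

theorem isLie_gBoundary {g : CubeCell} (hg : cdim g = 2) :
    gBoundary g ∈ lieSer cube.deg {z | ∃ y, cube.inc (cCell g) y ≠ 0 ∧ z ∈ cube.cl y} :=
  (gBoundary_mem_lieZero hg
    (S := {z | ∃ y, cube.inc (cCell g) y ≠ 0 ∧ z ∈ cube.cl y}) fun i s hi =>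
      ⟨cCell (g.set i s), cinc_set_ne_zero g i s hi, self_mem_cl _⟩).1

theorem isLie_cBoundary (hμ : μ ∈ lieSer (fun _ => 0) Set.univ) :
    cBoundary μ P ∈ lieSer cube.deg {z | ∃ y, cube.inc (cCell top) y ≠ 0 ∧ z ∈ cube.cl y} :=
  cBoundary_mem_lieSer hμ (fun c hc => edge_exists_face c hc)
    fun c hc => ⟨cCell c, cinc_top_ne_zero c hc, self_mem_cl c⟩

/-- The values on vertices and edges are forced first. They determine the flows along the diagonals
and hence the centres, after which the formulas at the centres determine the remaining values. -/
theorem IsCubeModel.eq_val {d : cube.Alg →ₗ[ℚ] cube.Alg}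
    (hμ : μ ∈ lieSer (fun _ => 0) Set.univ) (hd : IsCubeModel μ P d)
    (hD : IsOddDer cube.deg D) (hdD : ∀ f : cube.Alg, (d f : NCSeries cube.Cell) = D f)
    (c : CubeCell) : D (cSer c) = cubeVal μ P c := by
  have hs : ∀ c, cdim c ≤ 1 → D (cSer c) = skelVal c := by
    intro c hc
    by_cases h0 : cdim c = 0
    · rw [skelVal_vert h0]
      exact IsModel.map_vertex hd.model hdD h0
    · have h1 : cdim c = 1 := by omega
      obtain ⟨j, hj⟩ := edge_exists_dir c h1
      obtain ⟨hl, hh⟩ := edge_ends c j h1 hj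
      have := hd.d_edge c j h1 hj
      rw [hl, hh] at this
      rw [skelVal_edge h1]
      exact (hdD _).symm.trans this
  -- A half-way point given as a flow for `d` coincides with the one computed by `skelDer`, because
  -- the diagonal is a Lie series in vertices and edges.
  have hflow : ∀ (v x : cube.Alg) (v' : NCSeries cube.Cell) (p : CubeCell),
      v' ∈ lieZero cube.deg skel → (v : NCSeries cube.Cell) = v' →
      (x : NCSeries cube.Cell) = flow d ((1 / 2 : ℚ) • v) (cGen p) →
      (x : NCSeries cube.Cell) = flowPt skelDer ((1 / 2 : ℚ) • v') (cSer p) := by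
    intro v x v' p hv' hv hx
    have h := half_mem_lieZero hv'
    have he : (((1 / 2 : ℚ) • v : cube.Alg) : NCSeries cube.Cell) = (1 / 2 : ℚ) • v' :=
      congrArg (fun f => (1 / 2 : ℚ) • f) hv
    have h1 := (flow_eq_iff hD.toIsDer hdD (he.symm ▸ h.2) (cGen p) (x : NCSeries cube.Cell)).1
      hx.symm
    rw [he] at h1
    rw [← flowPt_skel hD hs h]
    exact ((transports_iff_flowPt hD.toIsDer h.2 (lieZero_mem_fil h)).1 h1).symm
  by_cases h1 : cdim c ≤ 1
  · rw [hs c h1, cubeVal_skel h1]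
  by_cases h2 : cdim c = 2
  · obtain ⟨hlt, hj, hk⟩ := fstDir_lt_sndDir c h2
    obtain ⟨v, x, hv, hx, ht, -⟩ := hd.d_face c _ _ h2 hlt hj hk
    rw [(square_dirs c _ _ h2 hlt hj hk).2.2] at hx
    have hx' : (x : NCSeries cube.Cell) = gCentre c :=
      hflow v x _ _ (gDiag_mem_lieZero h2 (hasEdges_skel h2)) hv hx
    have hx1 : (x : NCSeries cube.Cell) ∈ hom cube.deg (-1) := hx'.symm ▸ gCentre_mem_hom h2
    have h3 := (twisted_coe hdD hx1 (cGen c)).symm.trans ht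
    rw [hx', neg_smul] at h3
    rw [cubeVal_square h2]
    exact (tw_eq_iff (gCentre_mem_hom h2)).1 h3
  · obtain rfl := eq_top_of_cdim c (by omega) (by omega) h2
    obtain ⟨v, x, hv, hx, ht, -⟩ := hd.d_top
    have hx' : (x : NCSeries cube.Cell) = cCentre μ :=
      hflow v x _ _ (mainDiag_mem_lieZero hμ mem_skel_of_edge) hv hx
    have hx1 : (x : NCSeries cube.Cell) ∈ hom cube.deg (-1) := hx'.symm ▸ cCentre_mem_hom hμ
    have h3 := (twisted_coe hdD hx1 (cGen top)).symm.trans ht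
    rw [hx', neg_smul, cTop_eq] at h3
    rw [cubeVal_top]
    exact (tw_eq_iff (cCentre_mem_hom hμ)).1 h3

theorem existsUnique_isCubeModel (hμ : μ ∈ lieSer (fun _ => 0) Set.univ)
    (hP : IsAdmissible 5 P) : ∃! d, IsCubeModel μ P d := by
  obtain ⟨d, D, hd, hD, hdD, hv⟩ := exists_isModel (X := cube) (v := cubeVal μ P)
    (cubeVal_mem_hom hμ) (cubeVal_mem_lieSer hμ) (cubeVal_coeff_singleton hμ hP)
    (fun c hc => (cubeVal_skel (hc.trans_le zero_le_one)).trans (skelVal_vert hc))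
    fun D hD hv c => cube_sq hD hv hμ hP c
  have hv : ∀ c, D (cSer c) = cubeVal μ P c := hv
  have hO := hD.toIsOddDer
  have hs := cube_skel hv
  refine ⟨d, ⟨hd, fun c i hc hi => ?_, fun c i hc hi => ?_, fun g j k hg hjk hj hk => ?_, ?_⟩,
    fun d' hd' => ?_⟩
  · obtain ⟨hl, hh⟩ := edge_ends c i hc hi
    rw [hl, hh, ← skelVal_edge hc]
    exact (hdD _).trans (hs c (le_of_eq hc))
  · obtain ⟨hl, hh⟩ := edge_ends c i hc hi
    rw [hl, hh]
    exact (flow_eq_iff hD.toIsDer hdD (edge_mem_hom hc) _ _).2 (edge_transports hO hs hc)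
  · obtain ⟨rfl, rfl, hlo⟩ := square_dirs g j k hg hjk hj hk
    have h := gDiag_mem_lieZero hg (hasEdges_univ g)
    have h' := half_mem_lieZero h
    have hx := lieSer_mono (Set.subset_univ _) (gCentre_mem_lieSer hg)
    have ht : (twisted d ⟨gCentre g, mem_lieAlg hx (gCentre_mem_hom hg)⟩ (cGen g) :
        NCSeries cube.Cell) = gBoundary g :=
      (twisted_coe hdD (gCentre_mem_hom hg) _).trans (tw_square hv hg)
    refine ⟨⟨gDiag g, lieZero_mem_lieAlg h⟩, ⟨gCentre g, mem_lieAlg hx (gCentre_mem_hom hg)⟩,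
      rfl, ?_, ?_, (isPoint_iff hdD _).2 (gCentre_isMC hO hs hg), ht.symm ▸ isLie_gBoundary hg⟩
    · rw [hlo]
      exact ((flow_eq_iff hD.toIsDer hdD h'.2 _ _).2 (gCentre_transports hO hs hg)).symm
    · rw [neg_smul]
      exact ht
  · have h := mainDiag_mem_lieZero (S := Set.univ) hμ fun _ _ => Set.mem_univ _
    have h' := half_mem_lieZero h
    have hx := cCentre_mem_lieSer hμ
    have ht : (twisted d ⟨cCentre μ, mem_lieAlg hx (cCentre_mem_hom hμ)⟩ (cGen top) :
        NCSeries cube.Cell) = cBoundary μ P :=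
      (twisted_coe hdD (cCentre_mem_hom hμ) _).trans (tw_top hv hμ)
    refine ⟨⟨mainDiag μ, lieZero_mem_lieAlg h⟩, ⟨cCentre μ, mem_lieAlg hx (cCentre_mem_hom hμ)⟩,
      rfl, ?_, ?_, (isPoint_iff hdD _).2 (cCentre_isMC hO hs hμ), ht.symm ▸ isLie_cBoundary hμ⟩
    · exact ((flow_eq_iff hD.toIsDer hdD h'.2 _ _).2 (cCentre_transports hO hs hμ)).symm
    · rw [neg_smul, cTop_eq]
      exact ht
  · obtain ⟨D', hD', hdD'⟩ := hd'.model.differential.exists_isDiff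
    refine differential_ext hd'.model.differential hd.differential fun c => ?_
    rw [hdD, hdD']
    exact (IsCubeModel.eq_val hμ hd' hD'.toIsOddDer hdD' c).trans (hv c).symm

theorem existsUnique_cube_isInducedMap (hμ : μ ∈ lieSer (fun _ => 0) Set.univ)
    {d₀ : (banana 5).Alg →ₗ[ℚ] (banana 5).Alg} (hd₀ : IsBananaModel 5 P d₀)
    {d : cube.Alg →ₗ[ℚ] cube.Alg} (hd : IsCubeModel μ P d) :
    ∃! φ, IsDGLAHom d₀ d φ ∧ IsInducedMap μ φ := by
  obtain ⟨D, hD, hdD⟩ := hd.model.differential.exists_isDiff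
  have hO := hD.toIsOddDer
  have hv := IsCubeModel.eq_val hμ hd hO hdD
  have hs := cube_skel hv
  have h' := half_mem_lieZero
    (mainDiag_mem_lieZero (S := Set.univ) hμ fun _ _ => Set.mem_univ _)
  have h := existsUnique_bananaHom hd₀ hD hdD (vert_isMC hs cdim_vertA) (vert_isMC hs cdim_vertB)
    (cSer_mem_lieSer (Set.mem_univ _)) (cSer_mem_lieSer (Set.mem_univ _))
    (chainBCH_mem_lieZero fun _ _ => Set.mem_univ _) (chainBCH_transports hO hs)
    (movedFace_mem_lieSer (fun _ _ => Set.mem_univ _) fun _ _ => Set.mem_univ _)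
    movedFace_mem_hom (expAd_mem_lieSer h'.2 h'.1 (cSer_mem_lieSer (Set.mem_univ _)))
    (expAd_mem_hom h'.2 top_mem_hom) (tw_movedFace hO hv) (tw_movedTop hO hv hμ)
  refine (existsUnique_congr fun φ => and_congr_right fun _ => ?_).1 h
  constructor
  · exact fun hφ => ⟨Subtype.ext (hφ .a), Subtype.ext (hφ .b), fun i => hφ (.e i),
      fun i => hφ (.f i), hφ .h⟩
  · intro hφ c
    cases c with
    | a => exact congrArg Subtype.val hφ.map_a
    | b => exact congrArg Subtype.val hφ.map_b
    | e i => exact hφ.map_e i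
    | f i => exact hφ.map_f i
    | h => exact hφ.map_h

end Cube

end NCSeries

namespace NCSeries

open scoped NCSeries.Ring

theorem bracket_smul_right {C : Type} (deg : C → ℤ) (f : NCSeries C) (r : ℚ) (g : NCSeries C) :
    bracket deg f (r • g) = r • bracket deg f g :=
  map_smul (brk deg f) r g

/-! Symmetries of sums over cyclic sequences of paths. -/

section Dihedral

variable {C : Type} {deg : C → ℤ} {m : ℕ} {P : Fin (m + 1) → NCSeries (Fin m)}
  {γ : Fin (m + 1) → NCSeries C}

theorem IsDihedral.add_eq_rot (hP : IsDihedral m P) (i k : Fin (m + 1)) :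
    P (i + k) = rot k (P i) := by
  refine Fin.induction ?_ (fun k ih => ?_) k
  · rw [add_zero, rot_zero]
  · rw [← castSucc_add_one, ← add_assoc, (isDihedral_iff.1 hP).1, ih, rot_rot]

/-- Rotating the letters and then substituting the loops amounts to substituting the loops of the
rotated sequence of paths, also across the last index, by `substHom_loop_cyc`. -/
theorem act_loop_rot (hγ : ∀ i, γ i ∈ lieZero deg Set.univ) (k : Fin (m + 1))
    (Q : NCSeries (Fin m)) (z : NCSeries C) :
    act deg (loop γ) (rot k Q) z = act deg (loop fun i => γ (i + k)) Q z := by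
  have h : (fun j : Fin m => substHom (loop γ) (cyc m (j.castSucc + k)))
      = loop fun i => γ (i + k) := by
    funext j
    rw [substHom_loop_cyc (fun i => lieZero_mem_fil (hγ i)), loop, ← castSucc_add_one,
      add_right_comm]
  rw [rot, act_substHom loop_mem_fil (loop_mem_hom fun i => (hγ i).2) (fun _ => cyc_mem_lieSer _),
    h]

/-- Minus the loop between two consecutive paths is the loop between the same paths in the opposite
order, so reflecting the letters reverses the sequence of paths. -/
theorem act_loop_flipHom (hγ : ∀ i, γ i ∈ lieZero deg Set.univ) (Q : NCSeries (Fin m))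
    (z : NCSeries C) :
    act deg (loop γ) (flipHom m Q) z = act deg (loop fun i => γ (-(i + 1))) Q z := by
  have hγ' := fun i => lieZero_mem_fil (hγ i)
  have hs := substHom_isAlgHom (x := loop γ) loop_mem_fil
  have h : (fun j : Fin m => substHom (loop γ) (-letter j.rev))
      = loop fun i => γ (-(i + 1)) := by
    funext j
    rw [map_neg, ← cyc_castSucc, substHom_loop_cyc hγ', neg_bch (hγ' _) (neg_mem (hγ' _)), neg_neg,
      loop, ← flip_castSucc, sub_add_cancel, ← castSucc_add_one, neg_add (j.castSucc + 1),
      ← sub_eq_add_neg]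
  rw [flipHom, act_substHom loop_mem_fil (loop_mem_hom fun i => (hγ i).2)
    (fun _ => neg_mem (letter_mem_lieSer (Set.mem_univ _))), h]

/-- Rotating the paths does not change the sum. -/
theorem sum_act_rot (hP : IsDihedral m P) (hγ : ∀ i, γ i ∈ lieZero deg Set.univ)
    (z : Fin (m + 1) → NCSeries C) (k : Fin (m + 1)) :
    ∑ i, act deg (loop fun i => γ (i + k)) (P i) (z (i + k))
      = ∑ i, act deg (loop γ) (P i) (z i) := by
  rw [← Equiv.sum_comp (Equiv.addRight k) fun i => act deg (loop γ) (P i) (z i)]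
  refine Finset.sum_congr rfl fun i _ => ?_
  rw [Equiv.coe_addRight, IsDihedral.add_eq_rot hP, act_loop_rot hγ]

/-- Reflecting the paths does not change the sum. -/
theorem sum_act_flip (hP : IsDihedral m P) (hγ : ∀ i, γ i ∈ lieZero deg Set.univ)
    (z : Fin (m + 1) → NCSeries C) (k : Fin (m + 1)) :
    ∑ i, act deg (loop fun i => γ (k - i)) (P i) (z (k - 1 - i))
      = ∑ i, act deg (loop γ) (P i) (z i) := by
  rw [← Equiv.sum_comp (Equiv.subLeft (k - 1)) fun i => act deg (loop γ) (P i) (z i)]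
  refine Finset.sum_congr rfl fun i _ => ?_
  -- The reflection of the face indices is the basic reflection followed by the rotation by `k + 1`.
  have h1 : k - 1 - i = (-(i + 1) - 1) + (k + 1) := by abel
  have h2 : P (k - 1 - i) = rot (k + 1) (flipHom m (P i)) := by
    rw [h1, IsDihedral.add_eq_rot hP, (isDihedral_iff.1 hP).2]
  have h3 : (fun i => γ (-(i + 1) + (k + 1))) = fun i => γ (k - i) :=
    funext fun i => congrArg γ (by abel)
  rw [Equiv.subLeft_apply, h2, act_loop_rot hγ, act_loop_flipHom fun i => hγ _, h3]

end Dihedral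

/-- Substitution into a symmetric series does not depend on the order. -/
theorem substHom_perm {C : Type} {ι : Type} [Fintype ι] {μ : NCSeries ι} {ρ : Equiv.Perm ι}
    (hμ : ∀ w : List ι, μ (w.map ρ) = μ w) {x : ι → NCSeries C} (hx : ∀ i, x i ∈ fil C 1) :
    substHom (fun i => x (ρ i)) μ = substHom x μ := by
  have h : substHom (fun i => letter (ρ i)) μ = μ := by
    funext w
    have := substHom_perm_coeff ρ μ (w.map ρ.symm)
    rw [← hμ, List.map_map, Equiv.self_comp_symm, List.map_id] at this
    exact this
  conv_rhs => rw [← h]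
  rw [(substHom_isAlgHom hx).map_substHom fun _ => letter_mem_fil _]
  simp only [substHom_letter hx]

section Cube

open Cube

/-! The symmetries of the cube. -/

variable {μ : NCSeries (Fin 6)} {P : Fin 6 → NCSeries (Fin 5)} {π : Equiv.Perm (Fin 3)}
  {Φ : NCSeries cube.Cell →ₗ[ℚ] NCSeries cube.Cell}

section Symmetry

variable (hΦ : IsGradedHom cube.deg cube.deg Φ)
  (hx : ∀ c, Φ (cSer c) = permSign π c • cSer (permCell π c))

include hx

theorem symm_skel {c : CubeCell} (hc : cdim c ≤ 1) : Φ (cSer c) = cSer (permCell π c) := by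
  rw [hx, permSign_of_cdim_le π c hc, one_smul]

include hΦ

theorem symm_skelVal {c : CubeCell} (hc : cdim c ≤ 1) :
    Φ (skelVal c) = skelVal (permCell π c) := by
  by_cases h0 : cdim c = 0
  · rw [skelVal_vert h0, skelVal_vert ((cdim_permCell π c).trans h0), map_neg, hΦ.map_mul,
      symm_skel hx hc]
  · have h1 : cdim c = 1 := by omega
    rw [skelVal_edge h1, skelVal_edge ((cdim_permCell π c).trans h1),
      hΦ.map_edgeDiff (edge_mem_hom h1) (cSer_mem_fil c), symm_skel hx hc,
      symm_skel hx ((cdim_lo c).trans_le zero_le_one),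
      symm_skel hx ((cdim_hi c).trans_le zero_le_one)]
    -- Permuting coordinates commutes with `lo` and `hi` by definition.
    rfl

/-- Commutation with a derivation can be checked on letters, and the symmetry carries vertices and
edges to vertices and edges. It makes the centres equivariant. -/
theorem symm_skelDer (f : NCSeries cube.Cell) : Φ (skelDer f) = skelDer (Φ f) := by
  refine hΦ.map_diff skelDer_isOddDer.toIsDer skelDer_isOddDer.toIsDer ?_ f
  suffices h : ∀ c : CubeCell, Φ (skelDer (cSer c)) = skelDer (Φ (cSer c)) from h
  intro c
  rw [skelDer_cSer]
  by_cases hc : cdim c ≤ 1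
  · rw [symm_skelVal hΦ hx hc, symm_skel hx hc, skelDer_cSer]
  · have hz : ∀ c, ¬cdim c ≤ 1 → skelVal c = 0 := fun c hc => by
      rw [skelVal, if_neg (by omega), if_neg (by omega)]
    rw [hx, map_smul, skelDer_cSer, hz c hc, hz _ (by rwa [cdim_permCell]), smul_zero, map_zero]

theorem symm_flowPt {e a : NCSeries cube.Cell} (he : e ∈ lieZero cube.deg Set.univ) :
    Φ (flowPt skelDer e a) = flowPt skelDer (Φ e) (Φ a) := by
  have he' := lieZero_mem_fil he
  rw [flowPt, flowPt, map_add, hΦ.map_mul, hΦ.map_mul, hΦ.map_exp he', hΦ.map_exp (neg_mem he'),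
    map_neg, hΦ.map_opSeries he', symm_skelDer hΦ hx]

theorem symm_squarePath {g : CubeCell} (hg : cdim g = 2) {j k : Fin 3} (hj : g j = none)
    (hk : g k = none) :
    Φ (squarePath g j k) = squarePath (permCell π g) (π j) (π k) := by
  rw [squarePath, hΦ.map_bch (cSer_mem_fil _) (cSer_mem_fil _),
    symm_skel hx (cdim_set g k false hg hk).le, symm_skel hx (cdim_set g j true hg hj).le,
    permCell_set, permCell_set, squarePath]

/-- If the two directions are exchanged, so are the two paths around the square; the average `mu2`
is symmetric by `mu2_comm`. -/
theorem symm_gDiag {g : CubeCell} (hg : cdim g = 2) : Φ (gDiag g) = gDiag (permCell π g) := by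
  obtain ⟨-, hj, hk⟩ := fstDir_lt_sndDir g hg
  have hp : ∀ j k, squarePath g j k ∈ fil cube.Cell 1 := fun _ _ => bch_mem_fil _ _
  rw [gDiag, squareDiag, hΦ.map_mu2 (hp _ _) (hp _ _),
    symm_squarePath hΦ hx hg hj hk, symm_squarePath hΦ hx hg hk hj, gDiag, squareDiag]
  rcases permCell_square π g hg with ⟨-, h1, h2⟩ | ⟨-, h1, h2⟩
  · rw [h1, h2]
  · rw [h1, h2]
    exact mu2_comm (bch_mem_fil _ _) (bch_mem_fil _ _)

/-- Exchanging the two directions of the square reverses the loop, and a reversed loop has the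
negative logarithm. -/
theorem symm_gLoop {g : CubeCell} (hg : cdim g = 2) :
    Φ (gLoop g) = permSign π g • gLoop (permCell π g) := by
  obtain ⟨-, hj, hk⟩ := fstDir_lt_sndDir g hg
  have hp : ∀ g j k, squarePath g j k ∈ fil cube.Cell 1 := fun _ _ _ => bch_mem_fil _ _
  rw [gLoop_eq, hΦ.map_bch (hp _ _ _) (neg_mem (hp _ _ _)), map_neg,
    symm_squarePath hΦ hx hg hj hk, symm_squarePath hΦ hx hg hk hj, gLoop_eq]
  rcases permCell_square π g hg with ⟨h, h1, h2⟩ | ⟨h, h1, h2⟩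
  · rw [h, h1, h2, one_smul]
  · rw [h, h1, h2, neg_one_smul, neg_bch (hp _ _ _) (neg_mem (hp _ _ _)), neg_neg]

theorem symm_gCentre {g : CubeCell} (hg : cdim g = 2) :
    Φ (gCentre g) = gCentre (permCell π g) := by
  rw [gCentre, symm_flowPt hΦ hx (half_mem_lieZero (gDiag_mem_lieZero hg (hasEdges_univ g))),
    map_smul, symm_gDiag hΦ hx hg, symm_skel hx ((cdim_lo g).trans_le zero_le_one)]
  rfl

theorem symm_gBoundary {g : CubeCell} (hg : cdim g = 2) :
    Φ (gBoundary g) = permSign π g • gBoundary (permCell π g) := by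
  have hg' := (cdim_permCell π g).trans hg
  have h := neg_mem (half_mem_lieZero (gDiag_mem_lieZero hg (hasEdges_univ g)))
  have h' := neg_mem (half_mem_lieZero (gDiag_mem_lieZero hg' (hasEdges_univ _)))
  rw [gBoundary, hΦ.map_expAd h.2 (lieZero_mem_fil h), map_neg, map_smul, symm_gDiag hΦ hx hg,
    symm_gLoop hΦ hx hg, expAd_smul h'.2 (lieZero_mem_fil h'), gBoundary]

theorem symm_chainBCH {i j : Fin 6} (h : ∀ t, permCell π (chainEdge i t) = chainEdge j t) :
    Φ (chainBCH i) = chainBCH j := by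
  rw [chainBCH, hΦ.map_bchList]
  · simp only [List.map_cons, List.map_nil, symm_skel hx (cdim_chainEdge i _).le, h]
    rfl
  · intro x hx
    simp only [List.mem_cons, List.not_mem_nil, or_false] at hx
    rcases hx with rfl | rfl | rfl <;> exact cSer_mem_fil _

omit hΦ in
theorem symm_initialBCH {i j : Fin 6} (hf : faceEnd j = faceEnd i)
    (h : faceEnd i = true → permCell π (chainEdge i 0) = chainEdge j 0) :
    Φ (initialBCH i) = initialBCH j := by
  rw [initialBCH, initialBCH, hf]
  split_ifs with hi
  · rw [symm_skel hx (cdim_chainEdge i 0).le, h hi]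
  · exact map_zero Φ

theorem symm_movedFace {i j : Fin 6} (hf : faceEnd j = faceEnd i)
    (h : faceEnd i = true → permCell π (chainEdge i 0) = chainEdge j 0)
    (hc : permCell π (chainFace i) = chainFace j) {s : ℚ}
    (hs : faceSign i * permSign π (chainFace i) = s * faceSign j) :
    Φ (movedFace i) = s • movedFace j := by
  have hi := fun i => initialBCH_mem_lieZero (S := Set.univ) (fun _ _ => Set.mem_univ _) i
  have hg := fun i => half_mem_lieZero (gDiag_mem_lieZero (cdim_chainFace i) (hasEdges_univ _))
  rw [movedFace_eq, map_smul, hΦ.map_expAd (hi i).2 (lieZero_mem_fil (hi i)),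
    hΦ.map_expAd (hg i).2 (lieZero_mem_fil (hg i)), symm_initialBCH hx hf h, map_smul,
    symm_gDiag hΦ hx (cdim_chainFace i), hx, hc, expAd_smul (hg j).2 (lieZero_mem_fil (hg j)),
    expAd_smul (hi j).2 (lieZero_mem_fil (hi j)), smul_smul, hs, mul_smul, ← movedFace_eq]

/-- The six chains are permuted among themselves, by a rotation or a reflection, and `μ` is totally
symmetric. -/
theorem symm_mainDiag (hμ : ∀ (ρ : Equiv.Perm (Fin 6)) (w : List (Fin 6)), μ (w.map ρ) = μ w) :
    Φ (mainDiag μ) = mainDiag μ := by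
  have hc : ∀ i, chainBCH i ∈ fil cube.Cell 1 := fun i => bchList_mem_fil _
  have key : ∃ ρ : Equiv.Perm (Fin 6), ∀ i, Φ (chainBCH i) = chainBCH (ρ i) := by
    rcases permCell_chain π with ⟨-, k, hk⟩ | ⟨-, k, hk⟩
    · exact ⟨Equiv.addRight k, fun i => symm_chainBCH hΦ hx (hk i).1⟩
    · exact ⟨Equiv.subLeft k, fun i => symm_chainBCH hΦ hx (hk i).1⟩
  obtain ⟨ρ, hρ⟩ := key
  rw [mainDiag, subst_eq, hΦ.map_substHom hc, ← substHom_perm (hμ ρ) hc]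
  simp only [hρ]

/-- An even permutation rotates chains and faces with their outward orientations. An odd one
reflects them and reverses all outward orientations, which is the source of the sign. Dihedral
invariance of `P` absorbs the change of the sequence in both cases. -/
theorem symm_cTop (hP : IsDihedral 5 P) : Φ (cTop P) = permSign π top • cTop P := by
  have hγ := fun i => chainBCH_mem_lieZero (S := Set.univ) (fun _ _ => Set.mem_univ _) i
  have hγ' := fun i => lieZero_mem_fil (hγ i)
  have hl : ∀ j : Fin 5, Φ (loop chainBCH j) = loop (fun i => Φ (chainBCH i)) j := fun j => by
    rw [loop, hΦ.map_bch (hγ' _) (neg_mem (hγ' _)), map_neg, loop]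
  rw [cTop, map_sum]
  simp only [hΦ.map_act loop_mem_fil, hl]
  rcases permCell_chain π with ⟨hs, k, hk⟩ | ⟨hs, k, hk⟩
  · have h1 : ∀ i, Φ (chainBCH i) = chainBCH (i + k) := fun i => symm_chainBCH hΦ hx (hk i).1
    have h2 : ∀ i, Φ (movedFace i) = (1 : ℚ) • movedFace (i + k) := fun i =>
      symm_movedFace hΦ hx (hk i).2.2.1 (fun _ => (hk i).1 0) (hk i).2.1
        (by rw [one_mul, (hk i).2.2.2])
    simp only [h1, h2, hs, one_smul]
    exact sum_act_rot (m := 5) hP hγ movedFace k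
  · have h1 : ∀ i, Φ (chainBCH i) = chainBCH (k - i) := fun i => symm_chainBCH hΦ hx (hk i).1
    -- The face between the chains `i` and `i + 1` goes to the one between `k - i` and `k - 1 - i`,
    -- whose index is the latter. If the initial segment is nonempty, it is an edge common to both
    -- chains, so it does not matter from which of them it is taken.
    have h2 : ∀ i, Φ (movedFace i) = (-1 : ℚ) • movedFace (k - 1 - i) := fun i =>
      symm_movedFace hΦ hx (hk i).2.2.1 (fun h => ((hk i).1 0).trans ((hk i).2.2.2.1 h)) (hk i).2.1
        (by rw [neg_one_mul, (hk i).2.2.2.2])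
    simp only [h1, h2, hs, map_smul, ← Finset.smul_sum]
    exact congrArg _ (sum_act_flip (m := 5) hP hγ movedFace k)

/-- All ingredients are equivariant, and in dimensions `2` and `3` boundary and cell change by the
same sign, which factors out by linearity. -/
theorem symm_cubeVal (hμ : IsUniversalAverage 6 μ) (hP : IsDihedral 5 P) (c : CubeCell) :
    Φ (cubeVal μ P c) = permSign π c • cubeVal μ P (permCell π c) := by
  by_cases h1 : cdim c ≤ 1
  · rw [cubeVal_skel h1, cubeVal_skel ((cdim_permCell π c).trans_le h1), symm_skelVal hΦ hx h1,
      permSign_of_cdim_le π c h1, one_smul]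
  by_cases h2 : cdim c = 2
  · rw [cubeVal_square h2, cubeVal_square ((cdim_permCell π c).trans h2), map_sub, hΦ.map_bracket,
      symm_gBoundary hΦ hx h2, symm_gCentre hΦ hx h2, hx, bracket_smul_right, smul_sub]
  · obtain rfl := eq_top_of_cdim c (by omega) (by omega) h2
    have hm := symm_mainDiag hΦ hx hμ.symm
    have h := half_mem_lieZero
      (mainDiag_mem_lieZero (S := Set.univ) hμ.lie fun _ _ => Set.mem_univ _)
    have hn := neg_mem h
    rw [permCell_top, cubeVal_top, map_sub, hΦ.map_bracket, hx, permCell_top, cBoundary,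
      hΦ.map_expAd hn.2 (lieZero_mem_fil hn), map_neg, map_smul, hm, symm_cTop hΦ hx hP,
      expAd_smul hn.2 (lieZero_mem_fil hn), bracket_smul_right, smul_sub, cCentre,
      symm_flowPt hΦ hx h, map_smul, hm, symm_skel hx (cdim_vertA.trans_le zero_le_one),
      permCell_vertA]

end Symmetry

theorem existsUnique_symmetry (hμ : IsUniversalAverage 6 μ) (hP : IsDihedral 5 P)
    {d : cube.Alg →ₗ[ℚ] cube.Alg} (hd : IsCubeModel μ P d) (π : Equiv.Perm (Fin 3)) :
    ∃! σ : cube.Alg →ₗ[ℚ] cube.Alg, IsDGLAHom d d σ ∧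
      ∀ c, (σ (cGen c) : NCSeries cube.Cell) = permSign π c • cSer (permCell π c) := by
  obtain ⟨D, hD, hdD⟩ := hd.model.differential.exists_isDiff
  have hv := IsCubeModel.eq_val hμ.lie hd hD.toIsOddDer hdD
  have hdim : ∀ c : CubeCell, (cdim (permCell π c) : ℤ) - 1 = cube.deg (cCell c) := fun c => by
    rw [cdim_permCell]
    rfl
  refine existsUnique_hom (deg := cube.deg) hD hD hdD hdD
    (x := fun c => permSign π c • cSer (permCell π c))
    (fun c => Submodule.smul_mem _ _ (cSer_mem_lieSer (Set.mem_univ _)))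
    (fun c => Submodule.smul_mem _ _ (cSer_mem_hom (hdim c))) fun Φ hΦ hx c => ?_
  refine (congrArg Φ (hv c)).trans ((symm_cubeVal hΦ hx hμ hP c).trans ?_)
  rw [map_smul, hv]

end Cube

end NCSeries

/-! ### The main theorem. -/

open NCSeries

theorem mainTheorem4 :
    (∀ (X : PolyhedralCell) (m : ℕ) (a b : X.V) (S : X.Shelling m a b),
      (∃ P, IsAdmissible m P) ∧
      ∀ P, IsAdmissible m P →
        (∃! d, IsBananaModel m P d) ∧
        (∃! d, S.IsInducedModel P d) ∧
        ∀ d d', IsBananaModel m P d → S.IsInducedModel P d' →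
          ∃! φ, IsDGLAHom d d' φ ∧ S.IsInducedMap φ) ∧
    (∃ μ, IsUniversalAverage 6 μ) ∧
    (∃ P, IsAdmissible 5 P ∧ IsDihedral 5 P) ∧
    ∀ μ P, IsUniversalAverage 6 μ → IsAdmissible 5 P → IsDihedral 5 P →
      (∃! d, Cube.IsCubeModel μ P d) ∧
      ∀ d, Cube.IsCubeModel μ P d →
        (∀ d₀, IsBananaModel 5 P d₀ → ∃! φ, IsDGLAHom d₀ d φ ∧ Cube.IsInducedMap μ φ) ∧
        ∀ π : Equiv.Perm (Fin 3), ∃! σ : cube.Alg →ₗ[ℚ] cube.Alg, IsDGLAHom d d σ ∧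
          ∀ c, (σ (Cube.cGen c) : NCSeries _) = Cube.permSign π c • Cube.cSer (Cube.permCell π c) := by
  refine ⟨fun X m a b S => ⟨exists_isAdmissible m, fun P hP => ⟨existsUnique_isBananaModel hP,
    existsUnique_isInducedModel S hP, fun d d' hd hd' => existsUnique_isInducedMap S hd hd'⟩⟩,
    exists_isUniversalAverage 5, exists_isDihedral 5, fun μ P hμ hP hP' =>
      ⟨existsUnique_isCubeModel hμ.lie hP, fun d hd =>
        ⟨fun d₀ hd₀ => existsUnique_cube_isInducedMap hμ.lie hd₀ hd,
          existsUnique_symmetry hμ hP' hd⟩⟩⟩
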